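/- **Setting.** Let $\Sigma=\{(z,y)\in\mathbb C^2 : y^2=z^8-1,\ e^{-1}\le|z|\le e\}$, with its complex orientation; it is a compact surface of genus $3$ with four boundary components. Let $U\subset\partial\Sigma$ be the set of the four points with $z\in\{e^{-1},e\}$ (one on each component), $\mathrm{Diff}^+(\Sigma;U)$ the group of orientation-preserving diffeomorphisms of $\Sigma$ that preserve $U$, and $\mathrm{Mod}(\Sigma;U)=\pi_0\mathrm{Diff}^+(\Sigma;U)$. For a simple closed curve $a\subset\mathrm{Int}\,\Sigma$ let $t_a$ be the right-handed Dehn twist along $a$; products of mapping classes are compositions. Two words of Dehn twists are *Hurwitz equivalent* if one is obtained from the other by successive moves of the following two kinds, curves being taken up to isotopy: * elementary transformation: $\cdots t_a t_b\cdots\ \to\ \cdots t_{t_a(b)}\,t_a\cdots$; * simultaneous conjugation: $t_{a_1}\cdots t_{a_n}\to t_{\varphi(a_1)}\cdots t_{\varphi(a_n)}$ with $\varphi\in\mathrm{Mod}(\Sigma;U)$. **The curves.** Write $(\rho,a)$ for the point $z=e^{\rho+ia\pi/4}$; the branch points of $(z,y)\mapsto z$ are $(0,k)$, $k\in\mathbb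 Z$. A closed path in the $z$-plane is described by its vertices, joined by segments that are straight in the coordinates $(\rho,a)$. Its lift to $\Sigma$ with sign $+$ (respectively $-$) is the one whose starting point has $\mathrm{Im}\,y>0$ (respectively $<0$). For $h_0,h_1,h_2,h_3\in\{\pm\frac12\}$ let $w(h_0,h_1,h_2,h_3)$ be the path through $(\frac{h_0+h_1}2,\frac12),(h_1,1),(h_2,2),(h_3,3),(h_0,4),(h_1,5),(h_2,6),(h_3,7),(h_0,8),(\frac{h_0+h_1}2,\frac{17}2)$. Let $\iota(z,y)=(z,-y)$. *Geometric curves.* Abbreviating the arguments $\pm\frac12$ by their signs, $\tilde c_1,\dots,\tilde c_6$ are the lifts of $w(+,-,+,-)$, $w(+,-,-,+)$, $w(-,+,+,-)$, $w(-,+,-,+)$, $w(+,+,-,-)$, $w(-,-,+,+)$ with signs $+,+,-,-,-,-$, and $\tilde c_{i+6}=\iota(\tilde c_i)$. ($\Sigma$ is a regular fibre of Smith's genus-$3$ pencil on the four-torus with neighbourhoods of the four base points removed, and the $\tilde c_i$ are its vanishing cycles.) *Combinatorial curves.* $d_1$ is the lift with sign $+$ of the path through $(0,\frac32),(\frac14,2),(0,\frac94),(-\frac14,2),(0,\frac32),(\frac14,1),(0,\frac12),(-\frac14,0),(0,-\frac14),(\frac14,0),(0,\frac12),(\frac14,1),(\frac12,2),(\frac12,3),(-\frac12,4),(-\frac12,5),(0,\frac{11}2)$,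 followed by the same path with $4$ added to all the angles $a$; $d_2$ is the lift with sign $+$ of the path through $(0,\frac{11}2),(-\frac12,5),(-\frac12,4),(\frac12,3),(\frac12,2),(\frac14,1),(0,\frac34),(-\frac14,1),(0,\frac32),(-\frac14,2),(0,\frac94),(\frac14,2),(0,\frac32)$, followed by the same path with $4$ subtracted from all the angles $a$; $d_3,d_4,d_5,d_6$ are the lifts of $w(-,-,+,+)$, $w(-,+,+,-)$, $w(+,-,+,-)$, $w(+,+,-,-)$ with signs $+,+,-,-$; and $d_{i+6}=\iota(d_i)$. (The curves $d_1,\dots,d_6$ and $d_7,\dots,d_{12}$ are the two copies of the symmetric lift of Matsumoto's relation from which the combinatorial factorization of the boundary multitwist is built.) **Lemma.** All these lifts are closed curves, and the monodromy factorization of Smith's pencil $$t_{\tilde c_{12}}t_{\tilde c_{11}}\cdots t_{\tilde c_1}\ (=t_{\delta_1}t_{\delta_2}t_{\delta_3}t_{\delta_4})$$ is Hurwitz equivalent to the combinatorial factorization $$t_{d_1}t_{d_2}\cdots t_{d_{12}}\ (=t_{\delta_1}t_{\delta_2}t_{\delta_3}t_{\delta_4}),$$ where $\delta_1,\dots,\delta_4$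 are parallel to the boundary components (that both words multiply to the boundary multitwist is part of the earlier construction of the two factorizations, not of the claim). -/

import Mathlib

open scoped ContDiff

namespace SmithPencil

/-! ### The surface of genus three with four boundary components -/

/-- The compact surface `Σ`: the part of the affine curve `y ^ 2 = z ^ 8 - 1` lying over the closed
annulus `e⁻¹ ≤ |z| ≤ e`.  It is a double cover of the annulus branched at the eight eighth roots of
unity; it has genus three, and two boundary circles over each boundary circle of the annulus. -/
def Surf : Set (ℂ × ℂ) :=
  {p | p.2 ^ 2 = p.1 ^ 8 - 1 ∧ Real.exp (-1) ≤ ‖p.1‖ ∧ ‖p.1‖ ≤ Real.exp 1}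

/-- The interior of `Σ`. -/
def SurfInt : Set (ℂ × ℂ) :=
  {p | p.2 ^ 2 = p.1 ^ 8 - 1 ∧ Real.exp (-1) < ‖p.1‖ ∧ ‖p.1‖ < Real.exp 1}

/-- The marked set `U`: one point on each of the four boundary components of `Σ`. -/
def Marked : Set (ℂ × ℂ) :=
  {p ∈ Surf | p.1 = (Real.exp (-1) : ℂ) ∨ p.1 = (Real.exp 1 : ℂ)}

/-- The standard symplectic form of `ℂ ^ 2`.  Restricted to a complex line it is the area form of
the complex orientation. -/
noncomputable def areaForm (a b : ℂ × ℂ) : ℝ :=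
  (starRingEnd ℂ a.1 * b.1).im + (starRingEnd ℂ a.2 * b.2).im

/-- The tangent line of the curve `y ^ 2 = z ^ 8 - 1` at its point `p`. -/
def IsTangent (p v : ℂ × ℂ) : Prop := p.2 * v.2 = 4 * p.1 ^ 7 * v.1

/-- An element of `Diff⁺(Σ; U)`: an orientation-preserving diffeomorphism of `Σ` that preserves the
set `U`.  (It is recorded by maps of the ambient `ℂ ^ 2` whose values off `Σ` are irrelevant.) -/
structure SurfDiffeo where
  toFun : ℂ × ℂ → ℂ × ℂ
  invFun : ℂ × ℂ → ℂ × ℂ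
  mapsTo : Set.MapsTo toFun Surf Surf
  mapsTo_inv : Set.MapsTo invFun Surf Surf
  left_inv : Set.LeftInvOn invFun toFun Surf
  right_inv : Set.RightInvOn invFun toFun Surf
  smooth : ContDiffOn ℝ ∞ toFun Surf
  smooth_inv : ContDiffOn ℝ ∞ invFun Surf
  orientation : ∀ p ∈ Surf, ∃ L : ℂ × ℂ →L[ℝ] ℂ × ℂ, HasFDerivWithinAt toFun L Surf p ∧
    ∀ v : ℂ × ℂ, IsTangent p v → v ≠ 0 → 0 < areaForm (L v) (L (Complex.I • v))
  marked : Set.MapsTo toFun Marked Marked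

/-! ### Simple closed curves, isotopy, Dehn twists -/

/-- A parametrized closed curve is a `1`-periodic map from the reals. -/
abbrev Curve := ℝ → ℂ × ℂ

/-- Simple closed curves in the interior of `Σ`. -/
structure IsSimpleClosed (γ : Curve) : Prop where
  continuous : Continuous γ
  periodic : Function.Periodic γ 1
  injOn : Set.InjOn γ (Set.Ico 0 1)
  mem : ∀ t, γ t ∈ SurfInt

/-- Isotopy of unoriented simple closed curves in the interior of `Σ`. -/
def Isotopic (γ δ : Curve) : Prop :=
  ∃ H : ℝ → ℝ → ℂ × ℂ,
    ContinuousOn (fun q : ℝ × ℝ => H q.1 q.2) (Set.Icc 0 1 ×ˢ Set.univ) ∧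
    (∀ s ∈ Set.Icc (0 : ℝ) 1, IsSimpleClosed (H s)) ∧
    H 0 = γ ∧ (H 1 = δ ∨ H 1 = fun t => δ (-t))

/-- The strip `ℝ × [-1, 1]`, the universal cover of the standard annulus. -/
def Strip : Set (ℝ × ℝ) := Set.univ ×ˢ Set.Icc (-1) 1

/-- An orientation-preserving smooth embedding of the annulus `(ℝ / ℤ) × [-1, 1]` into the interior
of `Σ`, with core `γ`. -/
structure IsAnnulus (γ : Curve) (φ : ℝ × ℝ → ℂ × ℂ) : Prop where
  smooth : ContDiffOn ℝ ∞ φ Strip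
  periodic : ∀ s t, φ (s + 1, t) = φ (s, t)
  injOn : Set.InjOn φ (Set.Ico 0 1 ×ˢ Set.Icc (-1) 1)
  mapsTo : Set.MapsTo φ Strip SurfInt
  orientation : ∀ q ∈ Strip,
    0 < areaForm (fderivWithin ℝ φ Strip q (1, 0)) (fderivWithin ℝ φ Strip q (0, 1))
  core : ∀ s, φ (s, 0) = γ s

/-- `T` is a right-handed Dehn twist along `γ`: it is supported in an annular neighbourhood of `γ`,
where it is `(s, t) ↦ (s + χ t, t)` with `χ` rising from `0` to `1`.  (An arc that crosses `γ` is
turned to the right.) -/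
def IsDehnTwist (γ : Curve) (T : SurfDiffeo) : Prop :=
  ∃ (φ : ℝ × ℝ → ℂ × ℂ) (χ : ℝ → ℝ), IsAnnulus γ φ ∧ ContDiff ℝ ∞ χ ∧
    (∀ t ≤ -(1 / 2), χ t = 0) ∧ (∀ t ≥ 1 / 2, χ t = 1) ∧
    (∀ s, ∀ t ∈ Set.Icc (-1 : ℝ) 1, T.toFun (φ (s, t)) = φ (s + χ t, t)) ∧
    ∀ p ∈ Surf \ φ '' Strip, T.toFun p = p

/-! ### Hurwitz equivalence -/

/-- The moves between words of Dehn twists.  The list `[a₁, …, aₙ]` of simple closed curves stands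
for the word `t_{a₁} ⋯ t_{aₙ}` (products are compositions of maps), and a twist `t_a` depends on the
isotopy class of `a` only.
* `isotopy`: every curve is replaced by an isotopic one (the word does not change);
* `elementary`: `⋯ t_a t_b ⋯` becomes `⋯ t_{t_a(b)} t_a ⋯`;
* `conj`: every `t_a` becomes `t_{φ(a)}`, for one `φ` in `Diff⁺(Σ; U)`. -/
inductive HurwitzMove : List Curve → List Curve → Prop
  | isotopy (l l' : List Curve) (h : List.Forall₂ Isotopic l l') : HurwitzMove l l'
  | elementary (l r : List Curve) (a b : Curve) (T : SurfDiffeo) (hT : IsDehnTwist a T) :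
      HurwitzMove (l ++ a :: b :: r) (l ++ (T.toFun ∘ b) :: a :: r)
  | conj (l : List Curve) (φ : SurfDiffeo) : HurwitzMove l (l.map fun a => φ.toFun ∘ a)

/-- Hurwitz equivalence: one word is obtained from the other by successive moves. -/
def HurwitzEquivalent : List Curve → List Curve → Prop := Relation.ReflTransGen HurwitzMove

/-! ### The curves -/

/-- The point of the `z`-plane with logarithmic polar coordinates `(ρ, a)`, the angle being measured
in units of `π / 4`; the branch points are `(0, k)` with `k` an integer. -/
noncomputable def polar (w : ℝ × ℝ) : ℂ :=
  Complex.exp ((w.1 : ℂ) + (w.2 : ℂ) * (Real.pi / 4) * Complex.I)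

/-- `γ` is the closed curve in `Σ` that lifts the closed path in the `z`-plane which runs, at
constant speed and linearly in logarithmic polar coordinates, through the vertices in `D.1`.  The
lift is selected by its starting point: there `y` has positive imaginary part if `D.2 = 1` and
negative imaginary part if `D.2 = -1`. -/
structure IsLift (D : List (ℝ × ℝ) × ℝ) (γ : Curve) : Prop where
  continuous : Continuous γ
  periodic : Function.Periodic γ 1
  mem : ∀ t, γ t ∈ SurfInt
  ne_zero : ∀ t, (γ t).2 ≠ 0
  path : ∀ (j : ℕ) (h : j + 1 < D.1.length), ∀ u ∈ Set.Icc (0 : ℝ) 1,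
    (γ ((j + u) / (D.1.length - 1 : ℕ))).1 = polar ((1 - u) • D.1[j] + u • D.1[j + 1])
  start : 0 < D.2 * (γ 0).2.im

/-- A lift is determined by its data. -/
theorem IsLift.unique {D : List (ℝ × ℝ) × ℝ} (hD : 2 ≤ D.1.length) {γ δ : Curve}
    (hγ : IsLift D γ) (hδ : IsLift D δ) : γ = δ := by
  have hz : ∀ t, (γ t).1 = (δ t).1 := by
    have key : ∀ t ∈ Set.Ico (0 : ℝ) 1, (γ t).1 = (δ t).1 := by
      intro t ht
      set n : ℕ := D.1.length - 1 with hn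
      have hn1 : 1 ≤ n := by omega
      have hnpos : (0 : ℝ) < n := by exact_mod_cast hn1
      have h0 : 0 ≤ t * n := mul_nonneg ht.1 hnpos.le
      have hlt : t * n < n := by nlinarith [ht.2]
      have hj : ⌊t * n⌋₊ < n := (Nat.floor_lt h0).2 hlt
      have hu : t * n - ⌊t * n⌋₊ ∈ Set.Icc (0 : ℝ) 1 :=
        ⟨by linarith [Nat.floor_le h0], by linarith [Nat.lt_floor_add_one (t * n)]⟩
      have e : ((⌊t * n⌋₊ : ℝ) + (t * n - ⌊t * n⌋₊)) / (n : ℝ) = t := by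
        field_simp
        ring
      have a := hγ.path ⌊t * n⌋₊ (by omega) _ hu
      have b := hδ.path ⌊t * n⌋₊ (by omega) _ hu
      rw [← hn, e] at a b
      rw [a, b]
    intro t
    have h := key (Int.fract t) ⟨Int.fract_nonneg t, Int.fract_lt_one t⟩
    have p1 : γ (Int.fract t) = γ t := by
      have := hγ.periodic.sub_int_mul_eq (x := t) ⌊t⌋
      rwa [mul_one] at this
    have p2 : δ (Int.fract t) = δ t := by
      have := hδ.periodic.sub_int_mul_eq (x := t) ⌊t⌋
      rwa [mul_one] at this
    rwa [p1, p2] at h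
  have hsq : ∀ t, (γ t).2 ^ 2 = (δ t).2 ^ 2 := fun t => by
    rw [(hγ.mem t).1, (hδ.mem t).1, hz t]
  have h0 : (γ 0).2 = (δ 0).2 := by
    rcases sq_eq_sq_iff_eq_or_eq_neg.1 (hsq 0) with h | h
    · exact h
    · have a := hγ.start
      have b := hδ.start
      rw [h, Complex.neg_im] at a
      nlinarith
  have hy : Set.EqOn (fun t => (γ t).2) (fun t => (δ t).2) Set.univ :=
    isPreconnected_univ.eq_of_sq_eq (continuous_snd.comp hγ.continuous).continuousOn
      (continuous_snd.comp hδ.continuous).continuousOn (fun t _ => hsq t)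
      (fun {t} _ => hδ.ne_zero t) (Set.mem_univ 0) h0
  funext t
  exact Prod.ext (hz t) (hy (Set.mem_univ t))

/-- The path once around the annulus that passes the branch points with angle `k` and `k + 4` at
logarithmic radius `hₖ`, for `k = 0, 1, 2, 3`. -/
noncomputable def wave (h₀ h₁ h₂ h₃ : ℝ) : List (ℝ × ℝ) :=
  [((h₀ + h₁) / 2, 1 / 2), (h₁, 1), (h₂, 2), (h₃, 3), (h₀, 4), (h₁, 5), (h₂, 6), (h₃, 7), (h₀, 8),
    ((h₀ + h₁) / 2, 17 / 2)]

/-- The path whose lifts are `d₁` and `d₇`.  Its second half is the first half turned by `π`. -/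
noncomputable def pathOne : List (ℝ × ℝ) :=
  [(0, 3 / 2),
    (1 / 4, 2), (0, 9 / 4), (-1 / 4, 2), (0, 3 / 2), (1 / 4, 1), (0, 1 / 2), (-1 / 4, 0),
    (0, -1 / 4), (1 / 4, 0), (0, 1 / 2), (1 / 4, 1), (1 / 2, 2), (1 / 2, 3), (-1 / 2, 4),
    (-1 / 2, 5), (0, 11 / 2),
    (1 / 4, 6), (0, 25 / 4), (-1 / 4, 6), (0, 11 / 2), (1 / 4, 5), (0, 9 / 2), (-1 / 4, 4),
    (0, 15 / 4), (1 / 4, 4), (0, 9 / 2), (1 / 4, 5), (1 / 2, 6), (1 / 2, 7), (-1 / 2, 8),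
    (-1 / 2, 9), (0, 19 / 2)]

/-- The path whose lifts are `d₂` and `d₈`.  Its second half is the first half turned by `-π`. -/
noncomputable def pathTwo : List (ℝ × ℝ) :=
  [(0, 11 / 2),
    (-1 / 2, 5), (-1 / 2, 4), (1 / 2, 3), (1 / 2, 2), (1 / 4, 1), (0, 3 / 4), (-1 / 4, 1),
    (0, 3 / 2), (-1 / 4, 2), (0, 9 / 4), (1 / 4, 2), (0, 3 / 2),
    (-1 / 2, 1), (-1 / 2, 0), (1 / 2, -1), (1 / 2, -2), (1 / 4, -3), (0, -13 / 4), (-1 / 4, -3),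
    (0, -5 / 2), (-1 / 4, -2), (0, -7 / 4), (1 / 4, -2), (0, -5 / 2)]

/-- The vanishing cycles `c₁, …, c₁₂` of the geometric factorization (entry `i` gives `cᵢ₊₁`).  The
curve `cᵢ₊₆` is the image of `cᵢ` under the hyperelliptic involution `(z, y) ↦ (z, -y)`. -/
noncomputable def smithData : Fin 12 → List (ℝ × ℝ) × ℝ :=
  ![(wave (1 / 2) (-1 / 2) (1 / 2) (-1 / 2), 1),
    (wave (1 / 2) (-1 / 2) (-1 / 2) (1 / 2), 1),
    (wave (-1 / 2) (1 / 2) (1 / 2) (-1 / 2), -1),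
    (wave (-1 / 2) (1 / 2) (-1 / 2) (1 / 2), -1),
    (wave (1 / 2) (1 / 2) (-1 / 2) (-1 / 2), -1),
    (wave (-1 / 2) (-1 / 2) (1 / 2) (1 / 2), -1),
    (wave (1 / 2) (-1 / 2) (1 / 2) (-1 / 2), -1),
    (wave (1 / 2) (-1 / 2) (-1 / 2) (1 / 2), -1),
    (wave (-1 / 2) (1 / 2) (1 / 2) (-1 / 2), 1),
    (wave (-1 / 2) (1 / 2) (-1 / 2) (1 / 2), 1),
    (wave (1 / 2) (1 / 2) (-1 / 2) (-1 / 2), 1),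
    (wave (-1 / 2) (-1 / 2) (1 / 2) (1 / 2), 1)]

/-- The curves `d₁, …, d₁₂` of the combinatorial factorization (entry `i` gives `dᵢ₊₁`).  The first
six and the last six are the two copies of the symmetric lift of Matsumoto's relation; the
hyperelliptic involution takes `dᵢ` to `dᵢ₊₆`. -/
noncomputable def combData : Fin 12 → List (ℝ × ℝ) × ℝ :=
  ![(pathOne, 1),
    (pathTwo, 1),
    (wave (-1 / 2) (-1 / 2) (1 / 2) (1 / 2), 1),
    (wave (-1 / 2) (1 / 2) (1 / 2) (-1 / 2), 1),
    (wave (1 / 2) (-1 / 2) (1 / 2) (-1 / 2), -1),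
    (wave (1 / 2) (1 / 2) (-1 / 2) (-1 / 2), -1),
    (pathOne, -1),
    (pathTwo, -1),
    (wave (-1 / 2) (-1 / 2) (1 / 2) (1 / 2), -1),
    (wave (-1 / 2) (1 / 2) (1 / 2) (-1 / 2), -1),
    (wave (1 / 2) (-1 / 2) (1 / 2) (-1 / 2), 1),
    (wave (1 / 2) (1 / 2) (-1 / 2) (-1 / 2), 1)]

end SmithPencil

open scoped Topology

namespace SmithPencil

/-! ### Points of the surface in logarithmic polar coordinates -/

/-- The label of an arc: the side of the unit circle on which it lies, and its sheet. -/
abbrev Label := Bool × Bool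

/-- The real sign of a Boolean. -/
def sg (b : Bool) : ℝ := if b then 1 else -1

lemma sg_ne (b : Bool) : sg b ≠ 0 := by cases b <;> simp [sg]

lemma sg_sq (b : Bool) : sg b ^ 2 = 1 := by cases b <;> simp [sg]

lemma sg_mul_self (b : Bool) : sg b * sg b = 1 := by cases b <;> simp [sg]

lemma sg_inj {b c : Bool} (h : sg b = sg c) : b = c := by
  cases b <;> cases c <;> simp [sg] at h ⊢ <;> norm_num at h

lemma sg_not (b : Bool) : sg (!b) = - sg b := by cases b <;> simp [sg]

/-- Parity of an integer. -/
def odd (k : ℤ) : Bool := decide (k % 2 = 1)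

lemma sg_odd (k : ℤ) : ((-1 : ℝ)) ^ k = sg (!odd k) := by
  unfold sg odd
  rcases Int.even_or_odd k with h | h
  · rw [h.neg_one_zpow]; grind
  · rw [h.neg_one_zpow]; grind

lemma sg_xor (b c : Bool) : sg (b ^^ c) = sg b * sg (!c) := by cases b <;> cases c <;> simp [sg]

/-- A square root of `1 - exp (-8 r + 2 π i a)`. -/
noncomputable def slitRoot (r a : ℝ) : ℂ :=
  (1 - Complex.exp ((-8 * max r 0 : ℝ) + (2 * Real.pi * a : ℝ) * Complex.I)) ^ (2⁻¹ : ℂ)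

lemma slitRoot_sq (r a : ℝ) : slitRoot r a ^ 2 =
    1 - Complex.exp ((-8 * max r 0 : ℝ) + (2 * Real.pi * a : ℝ) * Complex.I) := by
  unfold slitRoot
  exact Complex.cpow_ofNat_inv_pow _ 2

lemma slitRoot_add_int (r a : ℝ) (k : ℤ) : slitRoot r (a + k) = slitRoot r a := by
  unfold slitRoot
  congr 2
  rw [Complex.exp_eq_exp_iff_exists_int]
  exact ⟨k, by push_cast; ring⟩

lemma base_re_nonneg (r a : ℝ) :
    0 ≤ (1 - Complex.exp ((-8 * max r 0 : ℝ) + (2 * Real.pi * a : ℝ) * Complex.I)).re := by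
  have h : (Complex.exp ((-8 * max r 0 : ℝ) + (2 * Real.pi * a : ℝ) * Complex.I)).re ≤ 1 := by
    refine (Complex.re_le_norm _).trans ?_
    rw [Complex.norm_exp, Real.exp_le_one_iff]
    simp [-Complex.ofReal_mul]
  simpa using h

lemma continuous_slitRoot : Continuous fun q : ℝ × ℝ => slitRoot q.1 q.2 := by
  rw [continuous_iff_continuousAt]
  intro q
  unfold slitRoot
  have hb : ContinuousAt (fun q : ℝ × ℝ =>
      1 - Complex.exp ((-8 * max q.1 0 : ℝ) + (2 * Real.pi * q.2 : ℝ) * Complex.I)) q := by fun_prop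
  have h0 := base_re_nonneg q.1 q.2
  by_cases hz : 1 - Complex.exp ((-8 * max q.1 0 : ℝ) + (2 * Real.pi * q.2 : ℝ) * Complex.I) = 0
  · have hc : ContinuousAt (fun x : ℂ × ℂ => x.1 ^ x.2) (0, (2⁻¹ : ℂ)) :=
      Complex.continuousAt_cpow_zero_of_re_pos (by norm_num)
    have hp : ContinuousAt (fun q : ℝ × ℝ =>
      (1 - Complex.exp ((-8 * max q.1 0 : ℝ) + (2 * Real.pi * q.2 : ℝ) * Complex.I),
        (2⁻¹ : ℂ))) q := hb.prodMk continuousAt_const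
    rw [← hz] at hc
    exact ContinuousAt.comp (f := fun q : ℝ × ℝ =>
      (1 - Complex.exp ((-8 * max q.1 0 : ℝ) + (2 * Real.pi * q.2 : ℝ) * Complex.I),
        (2⁻¹ : ℂ))) (g := fun x : ℂ × ℂ => x.1 ^ x.2) hc hp
  · refine hb.cpow continuousAt_const ?_
    rw [Complex.mem_slitPlane_iff]
    rcases h0.lt_or_eq with h | h
    · exact Or.inl h
    · refine Or.inr fun him => hz (Complex.ext h.symm him)

/-- The branch of `y` over the half-plane `ρ ≥ 0` (`u = true`) or `ρ ≤ 0` (`u = false`). -/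
noncomputable def branch (u : Bool) (r a : ℝ) : ℂ :=
  if u then Complex.exp ((4 * max r 0 : ℝ) + (Real.pi * a : ℝ) * Complex.I) * slitRoot r (-a)
  else Complex.I * slitRoot r a

/-- The point of the surface at distance `r` from the unit circle (in logarithmic coordinates),
outside (`u = true`) or inside (`u = false`) of it, at angle `a`, on the sheet `σ`. -/
noncomputable def pt (u σ : Bool) (r a : ℝ) : ℂ × ℂ :=
  (polar (sg u * max r 0, a), (sg σ : ℂ) * branch u r a)

lemma continuous_polar : Continuous polar := by unfold polar; fun_prop

lemma continuous_branch (u : Bool) : Continuous fun q : ℝ × ℝ => branch u q.1 q.2 := by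
  unfold branch
  cases u
  · simp only [Bool.false_eq_true, if_false]
    exact continuous_const.mul continuous_slitRoot
  · simp only [if_true]
    refine Continuous.mul (by fun_prop) ?_
    exact continuous_slitRoot.comp (f := fun q : ℝ × ℝ => (q.1, -q.2)) (by fun_prop)

lemma continuous_pt (u σ : Bool) : Continuous fun q : ℝ × ℝ => pt u σ q.1 q.2 := by
  unfold pt
  refine Continuous.prodMk ?_ (continuous_const.mul (continuous_branch u))
  exact continuous_polar.comp (f := fun q : ℝ × ℝ => (sg u * max q.1 0, q.2)) (by fun_prop)

lemma polar_pow (w : ℝ × ℝ) : polar w ^ 8 =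
    Complex.exp ((8 * w.1 : ℝ) + (2 * Real.pi * w.2 : ℝ) * Complex.I) := by
  unfold polar
  rw [← Complex.exp_nat_mul]
  congr 1
  push_cast
  ring

lemma norm_polar (w : ℝ × ℝ) : ‖polar w‖ = Real.exp w.1 := by
  unfold polar
  rw [Complex.norm_exp]
  congr 1
  have : ((w.2 : ℂ) * (Real.pi / 4) * Complex.I) = ((w.2 * (Real.pi / 4) : ℝ) : ℂ) * Complex.I := by
    push_cast; ring
  rw [this]
  simp [-Complex.ofReal_mul]

lemma polar_eq_iff {v w : ℝ × ℝ} : polar v = polar w ↔ v.1 = w.1 ∧ ∃ m : ℤ, w.2 = v.2 + 8 * m := by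
  constructor
  · intro h
    have h1 : v.1 = w.1 := by
      have := congrArg norm h
      rwa [norm_polar, norm_polar, Real.exp_eq_exp] at this
    refine ⟨h1, ?_⟩
    unfold polar at h
    rw [eq_comm, Complex.exp_eq_exp_iff_exists_int] at h
    obtain ⟨n, hn⟩ := h
    refine ⟨n, ?_⟩
    have := congrArg Complex.im hn
    simp at this
    have hp := Real.pi_pos
    have e : (w.2 - v.2 - 8 * n) * Real.pi = 0 := by linarith
    grind
  · rintro ⟨h1, m, h2⟩
    unfold polar
    rw [h1, h2, eq_comm, Complex.exp_eq_exp_iff_exists_int]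
    exact ⟨m, by push_cast; ring⟩

lemma branch_sq (u : Bool) (r a : ℝ) :
    branch u r a ^ 2 = polar (sg u * max r 0, a) ^ 8 - 1 := by
  rw [polar_pow]
  unfold branch
  cases u
  · simp only [Bool.false_eq_true, if_false, mul_pow, slitRoot_sq, Complex.I_sq]
    simp only [sg, Bool.false_eq_true, if_false]
    grind
  · simp only [if_true, mul_pow, slitRoot_sq]
    rw [← Complex.exp_nat_mul, mul_sub, ← Complex.exp_add]
    simp only [sg, if_true]
    push_cast
    ring_nf
    simp
    ring

lemma pt_snd_sq (u σ : Bool) (r a : ℝ) : (pt u σ r a).2 ^ 2 = (pt u σ r a).1 ^ 8 - 1 := by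
  have : ((sg σ : ℂ)) ^ 2 = 1 := by rw [← Complex.ofReal_pow, sg_sq]; simp
  simp only [pt, mul_pow, branch_sq, this, one_mul]

lemma pt_mem {u σ : Bool} {r a : ℝ} (h : r < 1) : pt u σ r a ∈ SurfInt := by
  refine ⟨pt_snd_sq _ _ _ _, ?_, ?_⟩ <;>
  · simp only [pt, norm_polar, Real.exp_lt_exp]
    have : max r 0 < 1 := max_lt h one_pos
    have := le_max_right r 0
    cases u <;> simp only [sg, if_true, Bool.false_eq_true, if_false] <;> linarith

lemma pt_snd_eq_zero {u σ : Bool} {r a : ℝ} (h : (pt u σ r a).2 = 0) :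
    r ≤ 0 ∧ ∃ k : ℤ, a = k := by
  have h1 := pt_snd_sq u σ r a
  rw [h] at h1
  have h2 : polar (sg u * max r 0, a) ^ 8 = 1 := by
    simp only [pt] at h1
    grind
  have h3 := congrArg norm h2
  rw [norm_pow, norm_polar, norm_one, ← Real.exp_nat_mul, Real.exp_eq_one_iff] at h3
  have h4 : max r 0 = 0 := by
    have := sg_ne u
    grind
  refine ⟨by grind, ?_⟩
  rw [polar_pow, Complex.exp_eq_one_iff] at h2
  obtain ⟨n, hn⟩ := h2
  refine ⟨n, ?_⟩
  have := congrArg Complex.im hn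
  simp at this
  have hp := Real.pi_pos
  grind

lemma branch_add (u : Bool) (r a : ℝ) (m : ℤ) : branch u r (a + 8 * m) = branch u r a := by
  unfold branch
  cases u
  · have := slitRoot_add_int r a (8 * m)
    grind
  · have := slitRoot_add_int r (-a) (-(8 * m))
    push_cast at this
    simp only [if_true, neg_add, this]
    congr 1
    rw [Complex.exp_eq_exp_iff_exists_int]
    exact ⟨4 * m, by push_cast; ring⟩

lemma pt_add (u σ : Bool) (r a : ℝ) (m : ℤ) : pt u σ r (a + 8 * m) = pt u σ r a := by
  unfold pt
  rw [branch_add]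
  congr 1
  rw [eq_comm, polar_eq_iff]
  grind

lemma slitRoot_half (r : ℝ) (k : ℤ) : slitRoot r (1 / 2 + k) =
    ((1 + Real.exp (-8 * max r 0)) ^ (2⁻¹ : ℝ) : ℝ) := by
  rw [slitRoot_add_int]
  unfold slitRoot
  rw [Complex.ofReal_cpow (by positivity)]
  congr 1
  · rw [Complex.exp_add]
    have : ((2 * Real.pi * (1 / 2) : ℝ) : ℂ) * Complex.I = Real.pi * Complex.I := by grind
    rw [this, Complex.exp_pi_mul_I]
    push_cast; ring
  · simp

lemma slitRoot_half_pos (r : ℝ) : 0 < ((1 + Real.exp (-8 * max r 0)) ^ (2⁻¹ : ℝ) : ℝ) := by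
  positivity

lemma exp_pi_half (r : ℝ) (k : ℤ) :
    Complex.exp ((4 * max r 0 : ℝ) + (Real.pi * (1 / 2 + k) : ℝ) * Complex.I) =
      (sg (!odd k) * Real.exp (4 * max r 0) : ℝ) * Complex.I := by
  rw [← sg_odd]
  have : ((Real.pi * (1 / 2 + k) : ℝ) : ℂ) * Complex.I
      = Real.pi / 2 * Complex.I + k * (Real.pi * Complex.I) := by push_cast; ring
  rw [Complex.exp_add, this, Complex.exp_add, Complex.exp_pi_div_two_mul_I, Complex.exp_int_mul,
    Complex.exp_pi_mul_I]
  push_cast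
  ring

lemma branch_half (u : Bool) (r : ℝ) (k : ℤ) : branch u r (1 / 2 + k) =
    (sg (!(u && odd k)) * (if u then Real.exp (4 * max r 0) else 1) *
      (1 + Real.exp (-8 * max r 0)) ^ (2⁻¹ : ℝ) : ℝ) * Complex.I := by
  unfold branch
  cases u
  · simp only [Bool.false_eq_true, if_false, slitRoot_half]
    simp [sg]; ring
  · have h := slitRoot_half r (-k - 1)
    have e : (1 / 2 + ((-k - 1 : ℤ) : ℝ)) = -(1 / 2 + k) := by grind
    rw [e] at h
    simp only [if_true, h, exp_pi_half, Bool.true_and]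
    push_cast; ring

lemma branch_zero_int (u : Bool) (k : ℤ) : branch u 0 k = 0 := by
  have h : branch u 0 k ^ 2 = 0 := by
    rw [branch_sq, polar_pow, sub_eq_zero, Complex.exp_eq_one_iff]
    exact ⟨k, by simp; ring⟩
  grind

lemma branch_axis (k : ℤ) {a : ℝ} (ha : a ∈ Set.Icc (k : ℝ) (k + 1)) :
    branch true 0 a = (sg (!odd k) : ℂ) * branch false 0 a := by
  rcases ha.1.eq_or_lt with h | h
  · rw [← h, branch_zero_int, branch_zero_int, mul_zero]
  rcases ha.2.eq_or_lt with h' | h'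
  · have : a = ((k + 1 : ℤ) : ℝ) := by grind
    rw [this, branch_zero_int, branch_zero_int, mul_zero]
  have hc (u : Bool) : Continuous fun a => branch u 0 a :=
    (continuous_branch u).comp (f := fun a : ℝ => ((0 : ℝ), a)) (by fun_prop)
  have hne : ∀ x ∈ Set.Ioo (k : ℝ) (k + 1), branch false 0 x ≠ 0 := by
    intro x hx h0
    have : (pt false true 0 x).2 = 0 := by simp [pt, h0]
    obtain ⟨-, j, hj⟩ := pt_snd_eq_zero this
    rw [hj] at hx
    have h1 : k < j := by exact_mod_cast hx.1
    have h2 : j < k + 1 := by exact_mod_cast hx.2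
    omega
  have key := (isPreconnected_Ioo (a := (k : ℝ)) (b := k + 1)).eq_of_sq_eq
    (f := fun a => branch true 0 a) (g := fun a => (sg (!odd k) : ℂ) * branch false 0 a)
    (hc true).continuousOn (continuous_const.mul (hc false)).continuousOn
    (fun x _ => by
      have : ((sg (!odd k) : ℂ)) ^ 2 = 1 := by rw [← Complex.ofReal_pow, sg_sq]; simp
      simp only [Pi.pow_apply, mul_pow, this, branch_sq, one_mul]
      simp)
    (fun {x} hx => mul_ne_zero (by exact_mod_cast sg_ne _) (hne x hx))
    (y := 1 / 2 + k) ⟨by linarith, by linarith⟩ (by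
      simp only [branch_half]
      cases odd k <;> simp [sg])
  grind

/-- The sheet, seen from the inner half-plane, of an axis point in the unit interval from `k`. -/
def lower (u σ : Bool) (k : ℤ) : Bool := σ ^^ (u && odd k)

lemma pt_axis (u σ : Bool) (k : ℤ) {a : ℝ} (ha : a ∈ Set.Icc (k : ℝ) (k + 1)) :
    pt u σ 0 a = pt false (lower u σ k) 0 a := by
  unfold pt lower
  cases u
  · simp
  · rw [branch_axis k ha]
    simp only [max_self, mul_zero, Bool.true_and, sg_xor]
    push_cast
    rw [mul_assoc]

lemma pt_axis_eq {u σ u' σ' : Bool} {k : ℤ} {a : ℝ} (ha : a ∈ Set.Icc (k : ℝ) (k + 1))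
    (h : lower u σ k = lower u' σ' k) : pt u σ 0 a = pt u' σ' 0 a := by
  rw [pt_axis u σ k ha, pt_axis u' σ' k ha, h]

lemma pt_int (u σ u' σ' : Bool) (k : ℤ) : pt u σ 0 k = pt u' σ' 0 k := by
  unfold pt
  simp [branch_zero_int]

lemma pt_inj {u σ u' σ' : Bool} {r r' a a' : ℝ} (hr : 0 ≤ r) (hr' : 0 ≤ r')
    (h : pt u σ r a = pt u' σ' r' a') :
    r = r' ∧ (∃ m : ℤ, a' = a + 8 * m) ∧ (0 < r → u = u' ∧ σ = σ') ∧
      (r = 0 → ∀ k : ℤ, a ∈ Set.Ioo (k : ℝ) (k + 1) → lower u σ k = lower u' σ' k) := by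
  have h1 := congrArg Prod.fst h
  simp only [pt, max_eq_left hr, max_eq_left hr'] at h1
  obtain ⟨h2, m, h3⟩ := polar_eq_iff.1 h1
  simp only at h2 h3
  have hrr : r = r' := by
    have := congrArg (· ^ 2) h2
    simp only [mul_pow, sg_sq, one_mul] at this
    exact (sq_eq_sq₀ hr hr').1 this
  subst hrr
  rw [h3, pt_add] at h
  refine ⟨rfl, ⟨m, h3⟩, ?_, ?_⟩
  · intro hpos
    have hu : u = u' := sg_inj (mul_right_cancel₀ hpos.ne' h2)
    subst hu
    refine ⟨rfl, ?_⟩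
    have h4 := congrArg Prod.snd h
    simp only [pt] at h4
    have hb : branch u r a ≠ 0 := by
      intro h0
      have : (pt u true r a).2 = 0 := by simp [pt, h0]
      have := (pt_snd_eq_zero this).1
      linarith
    exact sg_inj (by exact_mod_cast mul_right_cancel₀ hb h4)
  · intro h0 k hk
    subst h0
    rw [pt_axis u σ k ⟨hk.1.le, hk.2.le⟩, pt_axis u' σ' k ⟨hk.1.le, hk.2.le⟩] at h
    have h4 := congrArg Prod.snd h
    simp only [pt] at h4
    have hb : branch false 0 a ≠ 0 := by
      intro h0
      have : (pt false true 0 a).2 = 0 := by simp [pt, h0]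
      obtain ⟨-, j, hj⟩ := pt_snd_eq_zero this
      rw [hj] at hk
      have h1 : k < j := by exact_mod_cast hk.1
      have h2 : j < k + 1 := by exact_mod_cast hk.2
      omega
    exact sg_inj (by exact_mod_cast mul_right_cancel₀ hb h4)

/-- The hyperelliptic involution. -/
def hyp (p : ℂ × ℂ) : ℂ × ℂ := (p.1, -p.2)

/-! ### Piecewise linear interpolation and gluing -/

/-- The piecewise linear interpolation of a function on the integers. -/
noncomputable def lin (f : ℤ → ℝ) (x : ℝ) : ℝ := f ⌊x⌋ + Int.fract x * (f (⌊x⌋ + 1) - f ⌊x⌋)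

lemma lin_on (f : ℤ → ℝ) (i : ℤ) {x : ℝ} (h0 : i ≤ x) (h1 : x ≤ i + 1) :
    lin f x = f i + (x - i) * (f (i + 1) - f i) := by
  rcases h1.eq_or_lt with h | h
  · simp [lin, h]
  · have : ⌊x⌋ = i := Int.floor_eq_iff.2 ⟨h0, h⟩
    simp [lin, this, Int.fract]

@[simp] lemma lin_int (f : ℤ → ℝ) (i : ℤ) : lin f i = f i := by
  rw [lin_on f i le_rfl (by linarith)]; simp

lemma locallyFinite_unit : LocallyFinite fun i : ℤ => Set.Icc (i : ℝ) (i + 1) := by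
  intro x
  refine ⟨Set.Ioo (x - 1) (x + 1), Ioo_mem_nhds (by linarith) (by linarith), ?_⟩
  refine (Set.finite_Icc (⌊x⌋ - 2) (⌊x⌋ + 2)).subset ?_
  rintro i ⟨y, ⟨h1, h2⟩, h3, h4⟩
  have := Int.floor_le x
  have := Int.lt_floor_add_one x
  constructor
  · have : ((⌊x⌋ - 2 : ℤ) : ℝ) < i + 1 := by grind
    have : ⌊x⌋ - 2 < i + 1 := by exact_mod_cast this
    omega
  · have : (i : ℝ) < ((⌊x⌋ + 2 : ℤ) : ℝ) := by grind
    have : i < ⌊x⌋ + 2 := by exact_mod_cast this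
    omega

lemma continuous_glue {X E : Type*} [TopologicalSpace X] [TopologicalSpace E] {F : X × ℝ → E}
    (G : ℤ → X × ℝ → E) (hG : ∀ i, Continuous (G i))
    (h : ∀ (i : ℤ) (q : X × ℝ), i ≤ q.2 → q.2 ≤ i + 1 → F q = G i q) : Continuous F := by
  have hl : LocallyFinite fun i : ℤ => (Prod.snd ⁻¹' Set.Icc (i : ℝ) (i + 1) : Set (X × ℝ)) :=
    locallyFinite_unit.preimage_continuous continuous_snd
  refine hl.continuous ?_ (fun i => isClosed_Icc.preimage continuous_snd) fun i => ?_
  · ext q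
    simp only [Set.mem_iUnion, Set.mem_preimage, Set.mem_Icc, Set.mem_univ, iff_true]
    exact ⟨⌊q.2⌋, Int.floor_le _, (Int.lt_floor_add_one _).le⟩
  · exact (hG i).continuousOn.congr fun q hq => h i q hq.1 hq.2

lemma continuous_glue_real {E : Type*} [TopologicalSpace E] {F : ℝ → E}
    (G : ℤ → ℝ → E) (hG : ∀ i, Continuous (G i))
    (h : ∀ (i : ℤ) (x : ℝ), i ≤ x → x ≤ i + 1 → F x = G i x) : Continuous F :=
  (continuous_glue (X := Unit) (F := fun q => F q.2) (fun i q => G i q.2)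
    (fun i => (hG i).comp continuous_snd) fun i q => h i q.2).comp
      (f := fun x : ℝ => ((), x)) (by fun_prop)

lemma continuous_lin_family {X : Type*} [TopologicalSpace X] {f : X → ℤ → ℝ}
    (hf : ∀ i, Continuous fun s => f s i) : Continuous fun q : X × ℝ => lin (f q.1) q.2 := by
  refine continuous_glue (fun i q => f q.1 i + (q.2 - i) * (f q.1 (i + 1) - f q.1 i)) ?_ ?_
  · intro i
    have h1 := (hf i).comp (continuous_fst (X := X) (Y := ℝ))
    have h2 := (hf (i + 1)).comp (continuous_fst (X := X) (Y := ℝ))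
    simp only [Function.comp_def] at h1 h2
    fun_prop
  · intro i q h0 h1
    exact lin_on _ i h0 h1

lemma continuous_lin (f : ℤ → ℝ) : Continuous (lin f) :=
  (continuous_lin_family (X := Unit) (f := fun _ => f) fun _ => continuous_const).comp
    (f := fun x : ℝ => ((), x)) (by fun_prop)

lemma lin_add_int {f : ℤ → ℝ} {n : ℤ} {c : ℝ} (h : ∀ i, f (i + n) = f i + c) (x : ℝ) :
    lin f (x + n) = lin f x + c := by
  have h1 : ⌊x + n⌋ = ⌊x⌋ + n := Int.floor_add_intCast x n
  have h2 : Int.fract (x + n) = Int.fract x := Int.fract_add_intCast x n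
  have h3 := h (⌊x⌋ + 1)
  unfold lin
  grind

lemma monotone_of_unit {g : ℝ → ℝ} (h : ∀ (i : ℤ) (x y : ℝ), i ≤ x → x ≤ y → y ≤ i + 1 → g x ≤ g y) :
    Monotone g := by
  have key : ∀ (n : ℕ) (x y : ℝ), x ≤ y → y ≤ ⌊x⌋ + 1 + n → g x ≤ g y := by
    intro n
    induction n with
    | zero => intro x y hxy hy; exact h ⌊x⌋ x y (Int.floor_le x) hxy (by simpa using hy)
    | succ n ih =>
      intro x y hxy hy
      by_cases hc : y ≤ ⌊x⌋ + 1 + n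
      · grind
      · push Not at hc
        push_cast at hy
        refine (ih x (⌊x⌋ + 1 + n) ?_ le_rfl).trans (h (⌊x⌋ + 1 + n) _ y ?_ hc.le ?_)
        · have := Int.lt_floor_add_one x
          grind
        · push_cast; rfl
        · push_cast; linarith
  intro x y hxy
  obtain ⟨n, hn⟩ := exists_nat_ge (y - (⌊x⌋ + 1))
  exact key n x y hxy (by linarith)

lemma lin_monotone {f : ℤ → ℝ} (h : ∀ i, f i ≤ f (i + 1)) : Monotone (lin f) := by
  refine monotone_of_unit fun i x y hx hxy hy => ?_
  rw [lin_on f i hx (hxy.trans hy), lin_on f i (hx.trans hxy) hy]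
  have := h i
  nlinarith

lemma lin_strictMono {f : ℤ → ℝ} (h : ∀ i, f i < f (i + 1)) : StrictMono (lin f) := by
  refine (lin_monotone fun i => (h i).le).strictMono_of_injective ?_
  have key : ∀ x y, x < y → lin f x ≠ lin f y := by
    intro x y hxy he
    have hm := lin_monotone fun i => (h i).le
    set z := min y (⌊x⌋ + 1) with hz
    have hxz : x < z := lt_min hxy (Int.lt_floor_add_one x)
    have h1 : lin f x = lin f z :=
      le_antisymm (hm hxz.le) (by rw [he]; exact hm (min_le_left _ _))
    rw [lin_on f ⌊x⌋ (Int.floor_le x) (Int.lt_floor_add_one x).le,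
      lin_on f ⌊x⌋ ((Int.floor_le x).trans hxz.le) (min_le_right _ _)] at h1
    have := h ⌊x⌋
    nlinarith
  intro x y he
  grind

/-- Interpolation of a reindexed sequence, for an index map with steps `0` and `1`. -/
lemma lin_reindex (f : ℤ → ℝ) {φ : ℤ → ℤ} (h : ∀ i, φ (i + 1) = φ i ∨ φ (i + 1) = φ i + 1)
    (x : ℝ) : lin f (lin (fun i => φ i) x) = lin (fun i => f (φ i)) x := by
  have h0 := Int.floor_le x
  have h1 := (Int.lt_floor_add_one x).le
  rw [lin_on _ ⌊x⌋ h0 h1, lin_on (fun i => f (φ i)) ⌊x⌋ h0 h1]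
  rcases h ⌊x⌋ with h | h
  · rw [h]; simp
  · rw [h, lin_on f (φ ⌊x⌋)]
    · grind
    · grind
    grind

lemma exists_floor_eq {φ : ℤ → ℤ} {x : ℝ}
    (h : φ (⌊x⌋ + 1) = φ ⌊x⌋ ∨ φ (⌊x⌋ + 1) = φ ⌊x⌋ + 1) :
    ⌊lin (fun i => φ i) x⌋ = φ ⌊x⌋ := by
  have h0 := Int.floor_le x
  have h1 := Int.lt_floor_add_one x
  rw [Int.floor_eq_iff, lin_on _ ⌊x⌋ h0 h1.le]
  rcases h with h | h <;> rw [h] <;> push_cast <;> constructor <;> linarith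

/-! ### Isotopies -/

lemma IsSimpleClosed.neg {γ : Curve} (h : IsSimpleClosed γ) : IsSimpleClosed fun t => γ (-t) where
  continuous := h.continuous.comp continuous_neg
  periodic := fun t => by
    have := h.periodic (-(t + 1))
    simp only at this ⊢
    rw [← this]; congr 1; ring
  injOn := by
    intro s hs t ht e
    have key : ∀ x ∈ Set.Ico (0 : ℝ) 1, γ (-x) = γ (Int.fract (-x)) := by
      intro x _
      have := h.periodic.sub_int_mul_eq (x := -x) ⌊-x⌋
      rw [mul_one] at this
      exact this.symm
    simp only at e
    rw [key s hs, key t ht] at e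
    have := h.injOn ⟨Int.fract_nonneg _, Int.fract_lt_one _⟩
      ⟨Int.fract_nonneg _, Int.fract_lt_one _⟩ e
    obtain ⟨k, hk⟩ := Int.fract_eq_fract.1 this
    have h1 : ((k : ℤ) : ℝ) < 1 := by grind
    have h2 : (-1 : ℝ) < (k : ℤ) := by grind
    have h3 : k < 1 := by exact_mod_cast h1
    have h4 : -1 < k := by exact_mod_cast h2
    have : k = 0 := by omega
    subst this
    grind
  mem := fun t => h.mem _

lemma IsSimpleClosed.eq_iff {γ : Curve} (h : IsSimpleClosed γ) {s t : ℝ} :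
    γ s = γ t ↔ ∃ m : ℤ, t = s + m := by
  have key : ∀ x, γ x = γ (Int.fract x) := by
    intro x
    have := h.periodic.sub_int_mul_eq (x := x) ⌊x⌋
    rw [mul_one] at this
    exact this.symm
  constructor
  · intro e
    rw [key s, key t] at e
    have := h.injOn ⟨Int.fract_nonneg _, Int.fract_lt_one _⟩
      ⟨Int.fract_nonneg _, Int.fract_lt_one _⟩ e
    obtain ⟨k, hk⟩ := Int.fract_eq_fract.1 this.symm
    grind
  · rintro ⟨m, rfl⟩
    have := h.periodic.int_mul m s
    grind

lemma Isotopic.symm {γ δ : Curve} (h : Isotopic γ δ) : Isotopic δ γ := by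
  obtain ⟨H, hc, hs, h0, h1⟩ := h
  have maps : Set.MapsTo (fun q : ℝ × ℝ => (1 - q.1, q.2)) (Set.Icc 0 1 ×ˢ Set.univ)
      (Set.Icc 0 1 ×ˢ Set.univ) := by
    rintro ⟨s, t⟩ ⟨hs, -⟩
    grind
  have maps' : Set.MapsTo (fun q : ℝ × ℝ => (1 - q.1, -q.2)) (Set.Icc 0 1 ×ˢ Set.univ)
      (Set.Icc 0 1 ×ˢ Set.univ) := by
    rintro ⟨s, t⟩ ⟨hs, -⟩
    grind
  have mem : ∀ s ∈ Set.Icc (0 : ℝ) 1, 1 - s ∈ Set.Icc (0 : ℝ) 1 := fun s hs =>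
    ⟨by grind, by grind⟩
  rcases h1 with h1 | h1
  · exact ⟨fun s => H (1 - s), hc.comp (by fun_prop) maps, fun s hs' => hs _ (mem s hs'),
      by simpa using h1, Or.inl (by simpa using h0)⟩
  · refine ⟨fun s t => H (1 - s) (-t), hc.comp (f := fun q : ℝ × ℝ => (1 - q.1, -q.2))
      (by fun_prop) maps', fun s hs' => (hs _ (mem s hs')).neg, ?_, Or.inr ?_⟩
    · funext t; simp [h1]
    grind

lemma Isotopic.simple_left {γ δ : Curve} (h : Isotopic γ δ) : IsSimpleClosed γ := by
  obtain ⟨H, hc, hs, h0, h1⟩ := h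
  grind

lemma IsSimpleClosed.isotopic_refl {γ : Curve} (h : IsSimpleClosed γ) : Isotopic γ γ :=
  ⟨fun _ => γ, (h.continuous.comp continuous_snd).continuousOn, fun _ _ => h, rfl, Or.inl rfl⟩

/-- The transitive closure of isotopy. -/
def Iso : Curve → Curve → Prop := Relation.TransGen Isotopic

lemma Iso.trans {γ δ ε : Curve} (h : Iso γ δ) (h' : Iso δ ε) : Iso γ ε :=
  Relation.TransGen.trans h h'

lemma Isotopic.iso {γ δ : Curve} (h : Isotopic γ δ) : Iso γ δ := Relation.TransGen.single h

lemma Iso.symm {γ δ : Curve} (h : Iso γ δ) : Iso δ γ := by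
  induction h with
  | single h => exact h.symm.iso
  | tail _ h ih => exact h.symm.iso.trans ih

lemma Iso.simple_left {γ δ : Curve} (h : Iso γ δ) : IsSimpleClosed γ := by
  induction h with
  | single h => exact h.simple_left
  | tail _ _ ih => exact ih

lemma Iso.simple_right {γ δ : Curve} (h : Iso γ δ) : IsSimpleClosed δ := h.symm.simple_left

lemma IsSimpleClosed.iso_refl {γ : Curve} (h : IsSimpleClosed γ) : Iso γ γ := h.isotopic_refl.iso

/-- A family of periodic maps of the line that become simple closed curves after collapsing the
fibres of monotone maps. -/
structure CurveFamily (G : ℝ → ℝ → ℂ × ℂ) (τ : ℝ → ℝ → ℝ) (P : ℝ) : Prop where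
  pos : 0 < P
  cont : ContinuousOn (fun q : ℝ × ℝ => G q.1 q.2) (Set.Icc 0 1 ×ˢ Set.univ)
  contTime : ContinuousOn (fun q : ℝ × ℝ => τ q.1 q.2) (Set.Icc 0 1 ×ˢ Set.univ)
  mono : ∀ s ∈ Set.Icc (0 : ℝ) 1, Monotone (τ s)
  shift : ∀ s ∈ Set.Icc (0 : ℝ) 1, ∀ x, τ s (x + P) = τ s x + 1
  mem : ∀ s ∈ Set.Icc (0 : ℝ) 1, ∀ x, G s x ∈ SurfInt
  eq_iff : ∀ s ∈ Set.Icc (0 : ℝ) 1, ∀ x x', G s x = G s x' ↔ ∃ m : ℤ, τ s x' = τ s x + m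

lemma shift_int {τ : ℝ → ℝ} {P : ℝ} (h : ∀ x, τ (x + P) = τ x + 1) (x : ℝ) (k : ℤ) :
    τ (x + k * P) = τ x + k := by
  induction k with
  | zero => simp
  | succ k ih =>
    grind
  | pred k ih =>
    grind

lemma shift_bound {τ : ℝ → ℝ} {P : ℝ} (hP : 0 < P) (h : ∀ x, τ (x + P) = τ x + 1)
    (hm : Monotone τ) (x : ℝ) : |τ x - x / P| ≤ |τ 0| + 1 := by
  set k := ⌊x / P⌋
  have h0 : (k : ℝ) * P ≤ x := by rw [← le_div_iff₀ hP]; exact Int.floor_le _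
  have h1 : x ≤ (k + 1 : ℝ) * P := by rw [← div_le_iff₀ hP]; exact (Int.lt_floor_add_one _).le
  have e0 := shift_int h 0 k
  have e1 := shift_int h 0 (k + 1)
  have m0 := hm h0
  have m1 := hm h1
  push_cast at e0 e1
  rw [zero_add] at e0 e1
  have f0 := Int.floor_le (x / P)
  have f1 := Int.lt_floor_add_one (x / P)
  grind

lemma surjective_of_shift {τ : ℝ → ℝ} {P : ℝ} (hP : 0 < P) (h : ∀ x, τ (x + P) = τ x + 1)
    (hm : Monotone τ) (hc : Continuous τ) : Function.Surjective τ := by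
  intro t
  have b := shift_bound hP h hm
  have hlo := b (P * (t - (|τ 0| + 1)))
  have hhi := b (P * (t + (|τ 0| + 1)))
  rw [mul_div_cancel_left₀ _ hP.ne', abs_le] at hlo hhi
  have hab : P * (t - (|τ 0| + 1)) ≤ P * (t + (|τ 0| + 1)) := by
    have := abs_nonneg (τ 0)
    nlinarith
  obtain ⟨x, -, hx⟩ := intermediate_value_Icc hab hc.continuousOn
    (show t ∈ Set.Icc _ _ from ⟨by linarith, by linarith⟩)
  grind

theorem CurveFamily.exists_isotopy {G : ℝ → ℝ → ℂ × ℂ} {τ : ℝ → ℝ → ℝ} {P : ℝ}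
    (h : CurveFamily G τ P) :
    ∃ H : ℝ → ℝ → ℂ × ℂ,
      ContinuousOn (fun q : ℝ × ℝ => H q.1 q.2) (Set.Icc 0 1 ×ˢ Set.univ) ∧
      (∀ s ∈ Set.Icc (0 : ℝ) 1, IsSimpleClosed (H s)) ∧
      ∀ s ∈ Set.Icc (0 : ℝ) 1, ∀ x, H s (τ s x) = G s x := by
  set c : ℝ → ℝ := fun s => max 0 (min 1 s) with hcdef
  have hcc : Continuous c := by fun_prop
  have hcm : ∀ s, c s ∈ Set.Icc (0 : ℝ) 1 := fun s =>
    ⟨le_max_left _ _, max_le zero_le_one (min_le_left _ _)⟩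
  have hce : ∀ s ∈ Set.Icc (0 : ℝ) 1, c s = s := fun s hs => by grind
  have clamp : Continuous fun q : ℝ × ℝ => (c q.1, q.2) := by fun_prop
  have hGc : Continuous fun q : ℝ × ℝ => G (c q.1) q.2 :=
    h.cont.comp_continuous clamp fun q => ⟨hcm _, trivial⟩
  have hτc : Continuous fun q : ℝ × ℝ => τ (c q.1) q.2 :=
    h.contTime.comp_continuous clamp fun q => ⟨hcm _, trivial⟩
  have hτs : ∀ s, Continuous (τ (c s)) := fun s =>
    hτc.comp (f := fun x : ℝ => (s, x)) (by fun_prop)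
  have hsurj : ∀ s t, ∃ x, τ (c s) x = t := fun s =>
    surjective_of_shift h.pos (h.shift _ (hcm s)) (h.mono _ (hcm s)) (hτs s)
  choose g hg using hsurj
  set Q : ℝ × ℝ → ℝ × ℝ := fun q => (q.1, τ (c q.1) q.2) with hQ
  have hQc : Continuous Q := continuous_fst.prodMk hτc
  have hQs : Function.Surjective Q := fun q => ⟨(q.1, g q.1 q.2), by simp [hQ, hg]⟩
  obtain ⟨M, hM⟩ := isCompact_Icc.exists_bound_of_continuousOn (s := Set.Icc (0 : ℝ) 1)
    (f := fun s => τ (c s) 0)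
    (hτc.comp (f := fun s : ℝ => (s, (0 : ℝ))) (by fun_prop)).continuousOn
  have hM' : ∀ s, |τ (c s) 0| ≤ M := fun s => by
    have := hM (c s) (hcm s)
    rwa [hce _ (hcm s)] at this
  have hQp : IsProperMap Q := by
    rw [isProperMap_iff_isCompact_preimage]
    refine ⟨hQc, fun K hK => ?_⟩
    obtain ⟨R, hR⟩ := hK.isBounded.exists_norm_le
    refine IsCompact.of_isClosed_subset (isCompact_Icc.prod isCompact_Icc :
      IsCompact (Set.Icc (-R) R ×ˢ Set.Icc (-(P * (R + M + 1))) (P * (R + M + 1))))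
      (hK.isClosed.preimage hQc) ?_
    rintro ⟨s, x⟩ hsx
    have hn := hR _ hsx
    simp only [hQ, Prod.norm_def, sup_le_iff, Real.norm_eq_abs] at hn
    have hb := shift_bound h.pos (h.shift _ (hcm s)) (h.mono _ (hcm s)) x
    have h3 := hM' s
    have h4 : |x / P| ≤ R + M + 1 := by
      have := abs_sub_abs_le_abs_sub (x / P) (τ (c s) x)
      grind
    rw [abs_div, abs_of_pos h.pos, div_le_iff₀ h.pos, abs_le] at h4
    grind
  have hquot : Topology.IsQuotientMap Q := hQp.isClosedMap.isQuotientMap hQc hQs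
  set H : ℝ → ℝ → ℂ × ℂ := fun s t => G (c s) (g s t) with hH
  have hHG : ∀ s x, H s (τ (c s) x) = G (c s) x := fun s x =>
    (h.eq_iff _ (hcm s) _ _).2 ⟨0, by simp [hg]⟩
  have hHc : Continuous fun q : ℝ × ℝ => H q.1 q.2 := by
    rw [hquot.continuous_iff]
    exact hGc.congr fun q => (hHG q.1 q.2).symm
  refine ⟨H, hHc.continuousOn, fun s hs => ⟨?_, ?_, ?_, ?_⟩, fun s hs x => ?_⟩
  · exact hHc.comp (f := fun t : ℝ => (s, t)) (by fun_prop)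
  · intro t
    exact (h.eq_iff _ (hcm s) _ _).2 ⟨-1, by simp [hg]⟩
  · intro t ht t' ht' e
    obtain ⟨m, hm⟩ := (h.eq_iff _ (hcm s) _ _).1 e
    rw [hg, hg] at hm
    have h1 : ((m : ℤ) : ℝ) < 1 := by grind
    have h2 : (-1 : ℝ) < (m : ℤ) := by grind
    have h3 : m < 1 := by exact_mod_cast h1
    have h4 : -1 < m := by exact_mod_cast h2
    have : m = 0 := by omega
    subst this
    grind
  · intro t
    exact h.mem _ (hcm s) _
  grind

/-- The periodic map `c` of the line traverses the simple closed curve `γ` monotonically. -/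
def Rep (P : ℝ) (c : ℝ → ℂ × ℂ) (γ : Curve) : Prop :=
  0 < P ∧ IsSimpleClosed γ ∧ ∃ τ : ℝ → ℝ, Continuous τ ∧ Monotone τ ∧ (∀ x, τ (x + P) = τ x + 1) ∧
    ∀ x, c x = γ (τ x)

lemma CurveFamily.isotopic {G : ℝ → ℝ → ℂ × ℂ} {τ : ℝ → ℝ → ℝ} {P : ℝ}
    (h : CurveFamily G τ P) {γ δ : Curve} (hγ : ∀ x, G 0 x = γ (τ 0 x))
    (hδ : ∀ x, G 1 x = δ (τ 1 x)) : Isotopic γ δ := by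
  obtain ⟨H, hc, hs, he⟩ := h.exists_isotopy
  have m0 : (0 : ℝ) ∈ Set.Icc (0 : ℝ) 1 := ⟨le_rfl, zero_le_one⟩
  have m1 : (1 : ℝ) ∈ Set.Icc (0 : ℝ) 1 := ⟨zero_le_one, le_rfl⟩
  have cτ : ∀ s ∈ Set.Icc (0 : ℝ) 1, Continuous (τ s) := fun s hs =>
    h.contTime.comp_continuous (f := fun x : ℝ => (s, x)) (by fun_prop) fun x => ⟨hs, trivial⟩
  have s0 := surjective_of_shift h.pos (h.shift 0 m0) (h.mono 0 m0) (cτ 0 m0)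
  have s1 := surjective_of_shift h.pos (h.shift 1 m1) (h.mono 1 m1) (cτ 1 m1)
  refine ⟨H, hc, hs, ?_, Or.inl ?_⟩
  · funext t
    obtain ⟨x, rfl⟩ := s0 t
    grind
  · funext t
    obtain ⟨x, rfl⟩ := s1 t
    grind

lemma CurveFamily.rep {G : ℝ → ℝ → ℂ × ℂ} {τ : ℝ → ℝ → ℝ} {P : ℝ} (h : CurveFamily G τ P) :
    ∃ γ δ : Curve, Rep P (G 0) γ ∧ Rep P (G 1) δ ∧ Isotopic γ δ := by
  obtain ⟨H, hc, hs, he⟩ := h.exists_isotopy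
  have m0 : (0 : ℝ) ∈ Set.Icc (0 : ℝ) 1 := ⟨le_rfl, zero_le_one⟩
  have m1 : (1 : ℝ) ∈ Set.Icc (0 : ℝ) 1 := ⟨zero_le_one, le_rfl⟩
  have cτ : ∀ s ∈ Set.Icc (0 : ℝ) 1, Continuous (τ s) := fun s hs =>
    h.contTime.comp_continuous (f := fun x : ℝ => (s, x)) (by fun_prop) fun x => ⟨hs, trivial⟩
  exact ⟨H 0, H 1, ⟨h.pos, hs 0 m0, τ 0, cτ 0 m0, h.mono 0 m0, h.shift 0 m0,
    fun x => (he 0 m0 x).symm⟩, ⟨h.pos, hs 1 m1, τ 1, cτ 1 m1, h.mono 1 m1, h.shift 1 m1,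
    fun x => (he 1 m1 x).symm⟩, H, hc, hs, rfl, Or.inl rfl⟩

lemma Rep.same_int {P : ℝ} {c : ℝ → ℂ × ℂ} {γ' : Curve} {τ τ' : ℝ → ℝ}
    (hs' : IsSimpleClosed γ') (hm : Monotone τ)
    (hc' : Continuous τ') (hm' : Monotone τ')
    (hp : ∀ x, τ (x + P) = τ x + 1) (hp' : ∀ x, τ' (x + P) = τ' x + 1)
    (hconst : ∀ x y, τ x = τ y → c x = c y) (he' : ∀ x, c x = γ' (τ' x)) {x x' : ℝ} {m : ℤ}
    (h : τ x' = τ x + m) : τ' x' = τ' x + m := by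
  have key : ∀ y z, y ≤ z → τ y = τ z → τ' y = τ' z := by
    intro y z hyz e
    by_contra hne
    have hlt : τ' y < τ' z := lt_of_le_of_ne (hm' hyz) hne
    obtain ⟨w, hw, hw'⟩ := intermediate_value_Icc hyz hc'.continuousOn
      (show min (τ' z) (τ' y + 1 / 2) ∈ Set.Icc _ _ from
        ⟨le_min hlt.le (by linarith), min_le_left _ _⟩)
    have e1 : τ y = τ w := le_antisymm (hm hw.1) (by rw [e]; exact hm hw.2)
    have e2 := hconst y w e1
    rw [he', he', hs'.eq_iff] at e2
    obtain ⟨k, hk⟩ := e2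
    rw [hw'] at hk
    have h1 : (0 : ℝ) < k := by grind
    have h2 : (k : ℝ) < 1 := by grind
    have h3 : 0 < k := by exact_mod_cast h1
    have h4 : k < 1 := by exact_mod_cast h2
    omega
  have e1 := shift_int hp x m
  have e2 := shift_int hp' x m
  grind

/-- The curve traversed by a periodic map is unique up to isotopy. -/
lemma Rep.isotopic {P : ℝ} {c : ℝ → ℂ × ℂ} {γ γ' : Curve} (h : Rep P c γ) (h' : Rep P c γ') :
    Isotopic γ γ' := by
  obtain ⟨hP, hs, τ, hc, hm, hp, he⟩ := h
  obtain ⟨-, hs', τ', hc', hm', hp', he'⟩ := h'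
  have fwd := @Rep.same_int P c γ' τ τ' hs' hm hc' hm' hp hp'
    (fun x y e => by rw [he, he, e]) he'
  have bwd := @Rep.same_int P c γ τ' τ hs hm' hc hm hp' hp
    (fun x y e => by grind) he
  have cf : CurveFamily (fun _ => c) (fun s x => (1 - s) * τ x + s * τ' x) P := by
    refine ⟨hP, ?_, ?_, ?_, ?_, ?_, ?_⟩
    · have : Continuous c := (hs.continuous.comp hc).congr fun x => (he x).symm
      exact (this.comp continuous_snd).continuousOn
    · have h1 := hc.comp (continuous_snd (X := ℝ) (Y := ℝ))
      have h2 := hc'.comp (continuous_snd (X := ℝ) (Y := ℝ))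
      simp only [Function.comp_def] at h1 h2
      exact Continuous.continuousOn (by fun_prop)
    · intro s hs x y hxy
      have := hm hxy
      have := hm' hxy
      have := hs.1
      have : 0 ≤ 1 - s := by grind
      simp only
      gcongr
    · grind
    · intro s _ x
      rw [he]; exact hs.mem _
    · intro s hs01 x x'
      constructor
      · intro e
        rw [he, he, hs.eq_iff] at e
        grind
      · rintro ⟨m, hm1⟩
        have e1 := shift_int hp x m
        have e2 := shift_int hp' x m
        have hz : ∀ y z, y ≤ z → (1 - s) * τ y + s * τ' y = (1 - s) * τ z + s * τ' z →
            c y = c z := by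
          intro y z hyz e
          have a1 := hm hyz
          have a2 := hm' hyz
          rcases hs01.1.eq_or_lt with h0 | h0
          · grind
          · rw [he', he']; congr 1
            have : 0 ≤ 1 - s := by grind
            nlinarith
        have hcp : c (x + m * P) = c x := by rw [he, he, e1]; exact (hs.eq_iff.2 ⟨m, rfl⟩).symm
        grind
  exact cf.isotopic (fun x => by simp [he]) (fun x => by simp [he'])

/-- Two periodic maps of the line traverse isotopic simple closed curves. -/
def LineIso (P P' : ℝ) (c c' : ℝ → ℂ × ℂ) : Prop :=
  ∃ γ γ' : Curve, Rep P c γ ∧ Rep P' c' γ' ∧ Iso γ γ'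

lemma LineIso.trans {P P' P'' : ℝ} {c c' c'' : ℝ → ℂ × ℂ} (h : LineIso P P' c c')
    (h' : LineIso P' P'' c' c'') : LineIso P P'' c c'' := by
  obtain ⟨γ, γ', h1, h2, h3⟩ := h
  obtain ⟨δ, δ', k1, k2, k3⟩ := h'
  exact ⟨γ, δ', h1, k2, h3.trans ((h2.isotopic k1).iso.trans k3)⟩

/-- Reparametrization of the line. -/
lemma Rep.comp {P P' : ℝ} {c : ℝ → ℂ × ℂ} {γ : Curve} (h : Rep P c γ) (hP' : 0 < P') {ψ : ℝ → ℝ}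
    (hc : Continuous ψ) (hm : Monotone ψ) (hp : ∀ x, ψ (x + P') = ψ x + P) :
    Rep P' (fun x => c (ψ x)) γ := by
  obtain ⟨hP, hs, τ, hc', hm', hp', he⟩ := h
  exact ⟨hP', hs, fun x => τ (ψ x), hc'.comp hc, hm'.comp hm, fun x => by grind,
    fun x => he _⟩

lemma IsSimpleClosed.rep {γ : Curve} (h : IsSimpleClosed γ) {P : ℝ} (hP : 0 < P) :
    Rep P (fun x => γ (x / P)) γ :=
  ⟨hP, h, fun x => x / P, by fun_prop, fun x y hxy => by simp only; gcongr,
    fun x => by field_simp, fun _ => rfl⟩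

/-- A family of periodic maps of the line that are injective modulo the period. -/
structure InjFamily (G : ℝ → ℝ → ℂ × ℂ) (P : ℝ) : Prop where
  pos : 0 < P
  cont : ContinuousOn (fun q : ℝ × ℝ => G q.1 q.2) (Set.Icc 0 1 ×ˢ Set.univ)
  mem : ∀ s ∈ Set.Icc (0 : ℝ) 1, ∀ x, G s x ∈ SurfInt
  eq_iff : ∀ s ∈ Set.Icc (0 : ℝ) 1, ∀ x x', G s x = G s x' ↔ ∃ m : ℤ, x' = x + m * P

lemma InjFamily.curveFamily {G : ℝ → ℝ → ℂ × ℂ} {P : ℝ} (h : InjFamily G P) :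
    CurveFamily G (fun _ x => x / P) P := by
  refine ⟨h.pos, h.cont, ?_, ?_, ?_, h.mem, ?_⟩
  · exact Continuous.continuousOn (by fun_prop)
  · intro s _ x y hxy
    have := h.pos
    simp only; gcongr
  · intro s _ x
    have := h.pos.ne'
    field_simp
  · intro s hs x x'
    rw [h.eq_iff s hs]
    have := h.pos.ne'
    grind

lemma InjFamily.lineIso {G : ℝ → ℝ → ℂ × ℂ} {P : ℝ} (h : InjFamily G P) :
    LineIso P P (G 0) (G 1) := by
  obtain ⟨γ, δ, h1, h2, h3⟩ := h.curveFamily.rep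
  exact ⟨γ, δ, h1, h2, h3.iso⟩

lemma CurveFamily.lineIso {G : ℝ → ℝ → ℂ × ℂ} {τ : ℝ → ℝ → ℝ} {P : ℝ} (h : CurveFamily G τ P) :
    LineIso P P (G 0) (G 1) := by
  obtain ⟨γ, δ, h1, h2, h3⟩ := h.rep
  exact ⟨γ, δ, h1, h2, h3.iso⟩

/-! ### Chains of arcs -/

/-- Partial sums of a function on the integers. -/
noncomputable def cumul (v : ℤ → ℝ) (i : ℤ) : ℝ :=
  ∑ k ∈ Finset.range i.toNat, v k - ∑ k ∈ Finset.range (-i).toNat, v (-k - 1)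

lemma cumul_succ (v : ℤ → ℝ) (i : ℤ) : cumul v (i + 1) = cumul v i + v i := by
  rcases le_or_gt 0 i with h | h
  · obtain ⟨n, rfl⟩ := Int.eq_ofNat_of_zero_le h
    have e1 : ((n : ℤ) + 1).toNat = n + 1 := by omega
    have e2 : (-((n : ℤ) + 1)).toNat = 0 := by omega
    have e3 : (-(n : ℤ)).toNat = 0 := by omega
    simp only [cumul, e1, e2, e3, Finset.sum_range_succ, Int.toNat_natCast]
    simp
  · obtain ⟨n, hn⟩ := Int.eq_ofNat_of_zero_le (show 0 ≤ -i - 1 by omega)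
    have hi : i = -(n : ℤ) - 1 := by omega
    have e1 : (i + 1).toNat = 0 := by omega
    have e2 : (-(i + 1)).toNat = n := by omega
    have e3 : i.toNat = 0 := by omega
    have e4 : (-i).toNat = n + 1 := by omega
    simp only [cumul, e1, e2, e3, e4, Finset.sum_range_succ]
    rw [hi]; ring

lemma int_const {E : Type*} {f : ℤ → E} (h : ∀ i, f (i + 1) = f i) (i : ℤ) : f i = f 0 := by
  induction i with
  | zero => rfl
  | succ n ih => rw [h, ih]
  | pred n ih => grind

lemma cumul_add {v : ℤ → ℝ} {N : ℤ} (h : ∀ i, v (i + N) = v i) (i : ℤ) :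
    cumul v (i + N) = cumul v i + cumul v N := by
  have := int_const (f := fun i => cumul v (i + N) - cumul v i) (fun i => by
    rw [show i + 1 + N = i + N + 1 by ring, cumul_succ, cumul_succ, h]; ring) i
  have h0 : cumul v 0 = 0 := by simp [cumul]
  grind

/-- The curvature of the arcs. -/
noncomputable def curv : ℝ := 1 / 100

/-- The piecewise map of the line with vertices at angles `a i` and distances `ρ i` from the unit
circle.  The arc between two vertices lies on the half-plane and sheet given by the label, and is a
chord in the coordinates `(a, r + curv * a ^ 2)`. -/
noncomputable def chain (lab : ℤ → Label) (ρ a : ℤ → ℝ) (x : ℝ) : ℂ × ℂ :=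
  pt (lab ⌊x⌋).1 (lab ⌊x⌋).2
    (lin ρ x + curv * (Int.fract x * (1 - Int.fract x)) * (a (⌊x⌋ + 1) - a ⌊x⌋) ^ 2) (lin a x)

/-- The distance of a point of an arc from the unit circle. -/
noncomputable def height (ρ a : ℤ → ℝ) (i : ℤ) (u : ℝ) : ℝ :=
  ρ i + u * (ρ (i + 1) - ρ i) + curv * (u * (1 - u)) * (a (i + 1) - a i) ^ 2

lemma chain_eq (lab : ℤ → Label) (ρ a : ℤ → ℝ) (x : ℝ) :
    chain lab ρ a x = pt (lab ⌊x⌋).1 (lab ⌊x⌋).2 (height ρ a ⌊x⌋ (Int.fract x)) (lin a x) := rfl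

lemma chain_on {lab : ℤ → Label} {ρ a : ℤ → ℝ}
    (hg : ∀ i, pt (lab (i - 1)).1 (lab (i - 1)).2 (ρ i) (a i) = pt (lab i).1 (lab i).2 (ρ i) (a i))
    (i : ℤ) {x : ℝ} (h0 : i ≤ x) (h1 : x ≤ i + 1) :
    chain lab ρ a x = pt (lab i).1 (lab i).2 (height ρ a i (x - i)) (a i + (x - i) * (a (i + 1) - a i)) := by
  rcases h1.eq_or_lt with h | h
  · subst h
    have := hg (i + 1)
    simp only [add_sub_cancel_right] at this
    have e : ((i : ℝ) + 1) = ((i + 1 : ℤ) : ℝ) := by grind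
    rw [e, chain_eq]
    simp only [Int.floor_intCast, Int.fract_intCast, lin_int, height]
    grind
  · have hf : ⌊x⌋ = i := Int.floor_eq_iff.2 ⟨h0, h⟩
    rw [chain_eq, hf, lin_on a i h0 h1, Int.fract, hf]

lemma eq_of_unit {E : Type*} {g : ℝ → E} {m : ℝ → ℝ} (hm : Monotone m)
    (h : ∀ (i : ℤ) (x y : ℝ), i ≤ x → x ≤ y → y ≤ i + 1 → m x = m y → g x = g y) {x y : ℝ}
    (hxy : x ≤ y) (e : m x = m y) : g x = g y := by
  have key : ∀ (n : ℕ) (x y : ℝ), x ≤ y → m x = m y → y ≤ ⌊x⌋ + 1 + n → g x = g y := by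
    intro n
    induction n with
    | zero => intro x y hxy e hy; exact h ⌊x⌋ x y (Int.floor_le x) hxy (by simpa using hy) e
    | succ n ih =>
      intro x y hxy e hy
      by_cases hc : y ≤ ⌊x⌋ + 1 + n
      · grind
      · push Not at hc
        push_cast at hy
        have hx : x ≤ ⌊x⌋ + 1 + n := by
          have := Int.lt_floor_add_one x
          grind
        have e1 : m x = m (⌊x⌋ + 1 + n) :=
          le_antisymm (hm hx) (by rw [e]; exact hm hc.le)
        refine (ih x (⌊x⌋ + 1 + n) hx e1 le_rfl).trans (h (⌊x⌋ + 1 + n) _ y ?_ hc.le ?_ ?_)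
        · push_cast; rfl
        · push_cast; linarith
        grind
  obtain ⟨n, hn⟩ := exists_nat_ge (y - (⌊x⌋ + 1))
  exact key n x y hxy e (by linarith)

/-- Arc length measured by the angle. -/
noncomputable def travel (a : ℤ → ℝ) : ℤ → ℝ := cumul fun i => |a (i + 1) - a i|

lemma travel_succ (a : ℤ → ℝ) (i : ℤ) : travel a (i + 1) = travel a i + |a (i + 1) - a i| :=
  cumul_succ _ i

/-- Points of different arcs of the chain coincide only where everything between them is
degenerate. -/
def ChainInj (lab : ℤ → Label) (ρ a : ℤ → ℝ) : Prop :=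
  ∀ x x' : ℝ, ⌊x⌋ < ⌊x'⌋ → chain lab ρ a x = chain lab ρ a x' → lin a x = lin a x' →
    lin (travel a) x = lin (travel a) x'

/-- The data of a periodic chain. -/
structure IsChain (lab : ℤ → Label) (ρ a : ℤ → ℝ) (N w : ℤ) : Prop where
  period : ∀ i, a (i + N) = a i + 8 * w
  period_ρ : ∀ i, ρ (i + N) = ρ i
  period_lab : ∀ i, lab (i + N) = lab i
  glue : ∀ i, pt (lab (i - 1)).1 (lab (i - 1)).2 (ρ i) (a i) = pt (lab i).1 (lab i).2 (ρ i) (a i)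
  degenerate : ∀ i, a (i + 1) = a i → ρ (i + 1) = ρ i
  nonneg : ∀ i, 0 ≤ ρ i
  small : ∀ i, ρ i ≤ 1 / 4
  short : ∀ i, |a (i + 1) - a i| ≤ 10
  inj : ChainInj lab ρ a

lemma height_nonneg {ρ a : ℤ → ℝ} (h : ∀ i, 0 ≤ ρ i) (i : ℤ) {u : ℝ} (h0 : 0 ≤ u) (h1 : u ≤ 1) :
    0 ≤ height ρ a i u := by
  have e : height ρ a i u =
      (1 - u) * ρ i + u * ρ (i + 1) + curv * (u * (1 - u)) * (a (i + 1) - a i) ^ 2 := by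
    unfold height; ring
  rw [e]
  have := h i
  have := h (i + 1)
  have : 0 ≤ 1 - u := by linarith
  have : 0 < curv := by norm_num [curv]
  positivity

lemma height_lt_one {ρ a : ℤ → ℝ} (h : ∀ i, ρ i ≤ 1 / 4) (h' : ∀ i, |a (i + 1) - a i| ≤ 10) (i : ℤ)
    {u : ℝ} (h0 : 0 ≤ u) (h1 : u ≤ 1) : height ρ a i u < 1 := by
  have h2 := h i
  have h3 := h (i + 1)
  have h4 : (a (i + 1) - a i) ^ 2 ≤ 100 := by
    have := sq_le_sq' (by grind) (h' i)
    rw [sq_abs] at this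
    linarith
  have h5 : u * (1 - u) ≤ 1 / 4 := by nlinarith [sq_nonneg (u - 1 / 2)]
  have h6 : u * (1 - u) * (a (i + 1) - a i) ^ 2 ≤ 1 / 4 * 100 := by
    refine mul_le_mul h5 h4 (sq_nonneg _) (by norm_num)
  unfold height curv
  nlinarith

section
variable {lab : ℤ → Label} {N w : ℤ}

lemma IsChain.travel_mono (a : ℤ → ℝ) : Monotone (lin (travel a)) :=
  lin_monotone fun i => by rw [travel_succ]; grind

lemma IsChain.travel_add {ρ a : ℤ → ℝ} (h : IsChain lab ρ a N w) (i : ℤ) :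
    travel a (i + N) = travel a i + travel a N :=
  cumul_add (fun i => by
    have h1 := h.period i
    have h2 := h.period (i + 1)
    rw [show i + 1 + N = i + N + 1 by ring] at h2
    simp only [h1, h2]
    congr 1; ring) i

lemma IsChain.travel_pos {ρ a : ℤ → ℝ} (h : IsChain lab ρ a N w) (hN : 0 < N) (hw : w * w = 1) :
    0 < travel a N := by
  have m1 : Monotone fun i => travel a i - a i :=
    monotone_int_of_le_succ fun i => by simp only [travel_succ]; grind
  have m2 : Monotone fun i => travel a i + a i :=
    monotone_int_of_le_succ fun i => by simp only [travel_succ]; grind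
  have h0 : travel a 0 = 0 := by simp [travel, cumul]
  have h1 := m1 hN.le
  have h2 := m2 hN.le
  have h3 := h.period 0
  simp only [h0, zero_add] at h1 h2 h3
  have hw' : w = 1 ∨ w = -1 := by
    rcases Int.mul_eq_one_iff_eq_one_or_neg_one.1 hw with h | h
    · grind
    grind
  rcases hw' with rfl | rfl <;> grind

lemma IsChain.eq_of_travel {ρ a : ℤ → ℝ} (h : IsChain lab ρ a N w) {x x' : ℝ} (hx : x ≤ x')
    (e : lin (travel a) x = lin (travel a) x') : chain lab ρ a x = chain lab ρ a x' := by
  refine eq_of_unit (IsChain.travel_mono a) (fun i x y h0 hxy h1 e => ?_) hx e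
  rw [chain_on h.glue i h0 (hxy.trans h1), chain_on h.glue i (h0.trans hxy) h1]
  rw [lin_on _ i h0 (hxy.trans h1), lin_on _ i (h0.trans hxy) h1, travel_succ] at e
  have e' : (x - y) * |a (i + 1) - a i| = 0 := by grind
  rcases mul_eq_zero.1 e' with e' | e'
  · grind
  · have e1 : a (i + 1) = a i := sub_eq_zero.1 (abs_eq_zero.1 e')
    have e2 := h.degenerate i e1
    simp [height, e1, e2]

lemma IsChain.chain_add {ρ a : ℤ → ℝ} (h : IsChain lab ρ a N w) (x : ℝ) (m : ℤ) :
    chain lab ρ a (x + (m * N : ℤ)) = chain lab ρ a x := by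
  have p (i : ℤ) : a (i + m * N) = a i + 8 * (m * w : ℤ) ∧ ρ (i + m * N) = ρ i ∧
      lab (i + m * N) = lab i := by
    induction m with
    | zero => simp
    | succ m ih =>
      have h1 := h.period (i + m * N)
      have h2 := h.period_ρ (i + m * N)
      have h3 := h.period_lab (i + m * N)
      grind
    | pred m ih =>
      have h1 := h.period (i + (-m - 1) * N)
      have h2 := h.period_ρ (i + (-m - 1) * N)
      have h3 := h.period_lab (i + (-m - 1) * N)
      grind
  have e1 : lin a (x + (m * N : ℤ)) = lin a x + 8 * (m * w : ℤ) := lin_add_int (fun i => (p i).1) x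
  have e2 : lin ρ (x + (m * N : ℤ)) = lin ρ x + 0 :=
    lin_add_int (fun i => by grind) x
  have q1 := p ⌊x⌋
  have q2 := p (⌊x⌋ + 1)
  unfold chain
  rw [Int.floor_add_intCast, Int.fract_add_intCast, e1, e2, q1.2.2, q1.1,
    show ⌊x⌋ + m * N + 1 = ⌊x⌋ + 1 + m * N by ring, q2.1, pt_add]
  congr 1
  ring

lemma lin_add_mul {a : ℤ → ℝ} {N : ℤ} {c : ℝ} (h : ∀ i, a (i + N) = a i + c) (x : ℝ) (m : ℤ) :
    lin a (x + (m * N : ℤ)) = lin a x + m * c := by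
  have h1 := lin_add_int h
  induction m with
  | zero => simp
  | succ m ih =>
    grind
  | pred m ih =>
    grind

lemma IsChain.travel_of_eq {ρ a : ℤ → ℝ} (h : IsChain lab ρ a N w) (hw : w * w = 1) {x x' : ℝ}
    (e : chain lab ρ a x = chain lab ρ a x') :
    ∃ m : ℤ, lin (travel a) x' = lin (travel a) x + m * travel a N := by
  have hf (y : ℝ) : 0 ≤ height ρ a ⌊y⌋ (Int.fract y) :=
    height_nonneg h.nonneg _ (Int.fract_nonneg _) (Int.fract_lt_one _).le
  obtain ⟨-, ⟨m, hm⟩, -, -⟩ := pt_inj (hf x) (hf x') e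
  refine ⟨m * w, ?_⟩
  set x'' := x' + ((-(m * w)) * N : ℤ) with hx''
  have e1 : lin a x'' = lin a x := by
    have := lin_add_mul h.period x' (-(m * w))
    rw [hx'', this, hm]
    have hw2 : (w : ℝ) * w = 1 := by exact_mod_cast hw
    grind
  have e2 : chain lab ρ a x'' = chain lab ρ a x := by rw [hx'', h.chain_add, e]
  have e3 : lin (travel a) x'' = lin (travel a) x' + (-(m * w) : ℤ) * travel a N :=
    lin_add_mul h.travel_add x' _
  suffices e4 : lin (travel a) x'' = lin (travel a) x by
    grind
  rcases lt_trichotomy ⌊x⌋ ⌊x''⌋ with hlt | heq | hlt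
  · exact (h.inj x x'' hlt e2.symm e1.symm).symm
  · have f0 := Int.floor_le x
    have f1 := (Int.lt_floor_add_one x).le
    have g0 := Int.floor_le x''
    have g1 := (Int.lt_floor_add_one x'').le
    rw [← heq] at g0 g1
    rw [lin_on _ _ f0 f1, lin_on _ _ g0 g1] at e1
    rw [lin_on _ _ f0 f1, lin_on _ _ g0 g1, travel_succ]
    grind
  · exact h.inj x'' x hlt e2 e1

theorem lineIso_of_chains {ρ a : ℝ → ℤ → ℝ} (hN : 0 < N) (hw : w * w = 1)
    (ha : ∀ i, Continuous fun s => a s i) (hρ : ∀ i, Continuous fun s => ρ s i)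
    (h : ∀ s ∈ Set.Icc (0 : ℝ) 1, IsChain lab (ρ s) (a s) N w) :
    LineIso N N (chain lab (ρ 0) (a 0)) (chain lab (ρ 1) (a 1)) := by
  have hcT : ∀ i, Continuous fun s => travel (a s) i := by
    intro i
    unfold travel cumul
    have (k : ℤ) : Continuous fun s => |a s (k + 1) - a s k| := ((ha _).sub (ha _)).abs
    exact (continuous_finsetSum _ fun k _ => this _).sub
      (continuous_finsetSum _ fun k _ => this _)
  have cf : CurveFamily (fun s => chain lab (ρ s) (a s))
      (fun s x => lin (travel (a s)) x / travel (a s) N) N := by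
    refine ⟨by exact_mod_cast hN, ?_, ?_, ?_, ?_, ?_, ?_⟩
    · rw [continuousOn_iff_continuous_domRestrict]
      let c : Set.Icc (0 : ℝ) 1 × ℝ → ℂ × ℂ := fun q => chain lab (ρ q.1) (a q.1) q.2
      suffices hc : Continuous c by
        exact hc.comp (f := fun q : (Set.Icc (0 : ℝ) 1 ×ˢ Set.univ : Set (ℝ × ℝ)) =>
          ((⟨q.1.1, q.2.1⟩ : Set.Icc (0 : ℝ) 1), q.1.2)) (by fun_prop)
      refine continuous_glue (fun i q => pt (lab i).1 (lab i).2
        (height (ρ q.1) (a q.1) i (q.2 - i))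
          (a q.1 i + (q.2 - i) * (a q.1 (i + 1) - a q.1 i))) ?_ ?_
      · intro i
        have a0 := (ha i).comp (continuous_subtype_val.comp
          (continuous_fst (X := Set.Icc (0 : ℝ) 1) (Y := ℝ)))
        have a1 := (ha (i + 1)).comp (continuous_subtype_val.comp
          (continuous_fst (X := Set.Icc (0 : ℝ) 1) (Y := ℝ)))
        have r0 := (hρ i).comp (continuous_subtype_val.comp
          (continuous_fst (X := Set.Icc (0 : ℝ) 1) (Y := ℝ)))
        have r1 := (hρ (i + 1)).comp (continuous_subtype_val.comp
          (continuous_fst (X := Set.Icc (0 : ℝ) 1) (Y := ℝ)))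
        simp only [Function.comp_def] at a0 a1 r0 r1
        refine (continuous_pt (lab i).1 (lab i).2).comp
          (f := fun q : Set.Icc (0 : ℝ) 1 × ℝ => (height (ρ q.1) (a q.1) i (q.2 - i),
            a q.1 i + (q.2 - i) * (a q.1 (i + 1) - a q.1 i))) ?_
        unfold height
        fun_prop
      · intro i q h0 h1
        exact chain_on (h q.1 q.1.2).glue i h0 h1
    · refine ContinuousOn.div ?_ ?_ ?_
      · exact (continuous_lin_family hcT).continuousOn
      · exact ((hcT N).comp continuous_fst).continuousOn
      · rintro ⟨s, x⟩ ⟨hs, -⟩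
        exact ((h s hs).travel_pos hN hw).ne'
    · intro s hs x y hxy
      have := IsChain.travel_mono (a s) hxy
      have := ((h s hs).travel_pos hN hw).le
      simp only
      gcongr
    · intro s hs x
      have h1 := lin_add_int (h s hs).travel_add x
      have := ((h s hs).travel_pos hN hw).ne'
      grind
    · intro s hs x
      exact pt_mem (height_lt_one (h s hs).small (h s hs).short _ (Int.fract_nonneg _)
        (Int.fract_lt_one _).le)
    · intro s hs x x'
      have hp := (h s hs).travel_pos hN hw
      constructor
      · intro e
        obtain ⟨m, hm⟩ := (h s hs).travel_of_eq hw e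
        grind
      · rintro ⟨m, hm⟩
        have e1 : lin (travel (a s)) x' = lin (travel (a s)) (x + (m * N : ℤ)) := by
          rw [lin_add_mul (h s hs).travel_add x m]
          grind
        rw [← (h s hs).chain_add x m]
        rcases le_total x' (x + (m * N : ℤ)) with h' | h'
        · exact ((h s hs).eq_of_travel h' e1).symm
        · exact (h s hs).eq_of_travel h' e1.symm
  exact cf.lineIso

end

/-! ### Combinatorial motions of chains

Positions are integers, in units of `1 / 40`; a half-period of `h` vertices advances the position by
`D = ± 160`. -/

/-- The extension of a half-period of positions. -/
def extend (h : ℕ) (D : ℤ) (L : List ℤ) (i : ℤ) : ℤ := L.getD (i % h).toNat 0 + D * (i / h)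

/-- The extension of a half-period of labels. -/
def extendLab (h : ℕ) (L : List Label) (i : ℤ) : Label :=
  L.getD (i % h).toNat (false, false)

lemma extend_add {h : ℕ} (hh : 0 < h) (D : ℤ) (L : List ℤ) (i : ℤ) :
    extend h D L (i + h) = extend h D L i + D := by
  have : (h : ℤ) ≠ 0 := by grind
  unfold extend
  rw [Int.add_emod_right, Int.add_ediv_of_dvd_right (dvd_refl _), Int.ediv_self this]
  ring

lemma extendLab_add (h : ℕ) (L : List Label) (i : ℤ) :
    extendLab h L (i + h) = extendLab h L i := by
  unfold extendLab
  rw [Int.add_emod_right]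

lemma odd_add_four (k : ℤ) : odd (k + 4) = odd k := by unfold odd; grind

lemma odd_sub_four (k : ℤ) : odd (k + -4) = odd k := by unfold odd; grind

/-- The sheet of a label seen from the inner half-plane. -/
def lowerOf (l : Label) (k : ℤ) : Bool := lower l.1 l.2 k

/-- The unit interval that contains a moving position. -/
def cell (a0 a1 : ℤ → ℤ) (i : ℤ) : ℤ := (a0 i + a1 i) / 80

/-- All arcs from the vertex `i` to the vertex `j` are degenerate. -/
def Conn (a : ℤ → ℤ) (i j : ℤ) : Prop := ∀ m < (j - i).toNat, a (i + m) = a (i + m + 1)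

instance (a : ℤ → ℤ) (i j : ℤ) : Decidable (Conn a i j) := by unfold Conn; infer_instance

/-- The vertices `i` and `j` stay different, or connected by degenerate arcs. -/
def VertexOK (lab : ℤ → Label) (a0 a1 : ℤ → ℤ) (i j : ℤ) : Prop :=
  (0 < a0 j - a0 i ∧ 0 < a1 j - a1 i) ∨ (a0 j - a0 i < 0 ∧ a1 j - a1 i < 0) ∨
  ((a0 j - a0 i ≠ 0 ∨ (lowerOf (lab i) (cell a0 a1 i) ≠ lowerOf (lab j) (cell a0 a1 i) ∧
      a0 i % 40 ≠ 0) ∨ Conn a0 i j) ∧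
    (a1 j - a1 i ≠ 0 ∨ (lowerOf (lab i) (cell a0 a1 i) ≠ lowerOf (lab j) (cell a0 a1 i) ∧
      a1 i % 40 ≠ 0) ∨ Conn a1 i j) ∧
    ((0 ≤ a0 j - a0 i ∧ 0 ≤ a1 j - a1 i ∧ 0 < (a0 j - a0 i) + (a1 j - a1 i)) ∨
     (a0 j - a0 i ≤ 0 ∧ a1 j - a1 i ≤ 0 ∧ (a0 j - a0 i) + (a1 j - a1 i) < 0) ∨
     (lowerOf (lab i) (cell a0 a1 i) ≠ lowerOf (lab j) (cell a0 a1 i) ∧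
       (a0 i % 40 ≠ 0 ∨ a1 i % 40 ≠ 0)) ∨
     (Conn a0 i j ∧ Conn a1 i j)))

instance (lab : ℤ → Label) (a0 a1 : ℤ → ℤ) (i j : ℤ) : Decidable (VertexOK lab a0 a1 i j) := by
  unfold VertexOK; infer_instance

/-- The left end of an arc. -/
def lo (a : ℤ → ℤ) (i : ℤ) : ℤ := min (a i) (a (i + 1))

/-- The right end of an arc. -/
def hi (a : ℤ → ℤ) (i : ℤ) : ℤ := max (a i) (a (i + 1))

/-- The arc `j` is nested in the arc `i`. -/
def Nested (a0 a1 : ℤ → ℤ) (i j : ℤ) : Prop :=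
  lo a0 i ≤ lo a0 j ∧ hi a0 j ≤ hi a0 i ∧ lo a1 i ≤ lo a1 j ∧ hi a1 j ≤ hi a1 i ∧
  (lo a0 i ≠ lo a0 j ∨ hi a0 i ≠ hi a0 j ∨ lo a0 j = hi a0 j) ∧
  (lo a1 i ≠ lo a1 j ∨ hi a1 i ≠ hi a1 j ∨ lo a1 j = hi a1 j)

instance (a0 a1 : ℤ → ℤ) (i j : ℤ) : Decidable (Nested a0 a1 i j) := by
  unfold Nested; infer_instance

/-- The arcs `i` and `j` stay disjoint. -/
def ArcOK (lab : ℤ → Label) (a0 a1 : ℤ → ℤ) (i j : ℤ) : Prop :=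
  (hi a0 i ≤ lo a0 j ∧ hi a1 i ≤ lo a1 j) ∨ (hi a0 j ≤ lo a0 i ∧ hi a1 j ≤ lo a1 i) ∨
  lab i ≠ lab j ∨ Nested a0 a1 i j ∨ Nested a0 a1 j i

instance (lab : ℤ → Label) (a0 a1 : ℤ → ℤ) (i j : ℤ) : Decidable (ArcOK lab a0 a1 i j) := by
  unfold ArcOK; infer_instance

/-- The conditions on a single vertex. -/
def LocalOK (lab : ℤ → Label) (a0 a1 : ℤ → ℤ) (i : ℤ) : Prop :=
  40 * cell a0 a1 i ≤ a0 i ∧ a0 i ≤ 40 * cell a0 a1 i + 40 ∧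
  40 * cell a0 a1 i ≤ a1 i ∧ a1 i ≤ 40 * cell a0 a1 i + 40 ∧
  ((a0 i = a1 i ∧ a0 i % 40 = 0) ∨
    lowerOf (lab (i - 1)) (cell a0 a1 i) = lowerOf (lab i) (cell a0 a1 i)) ∧
  ((a0 i ≤ a0 (i + 1) ∧ a1 i ≤ a1 (i + 1)) ∨ (a0 (i + 1) ≤ a0 i ∧ a1 (i + 1) ≤ a1 i)) ∧
  |a0 (i + 1) - a0 i| ≤ 400 ∧ |a1 (i + 1) - a1 i| ≤ 400

instance (lab : ℤ → Label) (a0 a1 : ℤ → ℤ) (i : ℤ) : Decidable (LocalOK lab a0 a1 i) := by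
  unfold LocalOK; infer_instance

lemma forall_of_shift {P : ℤ → ℤ → Prop} {h : ℕ} (hh : 0 < h)
    (hP : ∀ i j, P (i + h) (j + h) ↔ P i j)
    (hQ : ∀ i j : ℤ, 0 ≤ i → i < h → i < j → P i j) {i j : ℤ} (hij : i < j) : P i j := by
  have key : ∀ (q i j : ℤ), P (i + q * h) (j + q * h) ↔ P i j := by
    intro q i j
    induction q with
    | zero => simp
    | succ q ih =>
      grind
    | pred q ih =>
      grind
  have hh' : (0 : ℤ) < h := by grind
  have e : i = i % h + (i / h) * h := by rw [mul_comm]; exact (Int.emod_add_mul_ediv i h).symm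
  have e' : j = (j - (i / h) * h) + (i / h) * h := by ring
  rw [e, e', key]
  exact hQ _ _ (Int.emod_nonneg _ hh'.ne') (Int.emod_lt_of_pos _ hh') (by linarith)

section shift
variable {lab : ℤ → Label} {a0 a1 : ℤ → ℤ} {h : ℕ} {D : ℤ}

lemma cell_add (hD : D = 160 ∨ D = -160) (h0 : ∀ i, a0 (i + h) = a0 i + D)
    (h1 : ∀ i, a1 (i + h) = a1 i + D) (i : ℤ) : cell a0 a1 (i + h) = cell a0 a1 i + 4 ∨
      cell a0 a1 (i + h) = cell a0 a1 i + -4 := by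
  unfold cell
  grind

lemma lowerOf_cell_add (hD : D = 160 ∨ D = -160) (h0 : ∀ i, a0 (i + h) = a0 i + D)
    (h1 : ∀ i, a1 (i + h) = a1 i + D) (i : ℤ) (l : Label) :
    lowerOf l (cell a0 a1 (i + h)) = lowerOf l (cell a0 a1 i) := by
  unfold lowerOf lower
  rcases cell_add hD h0 h1 i with e | e <;> rw [e]
  · rw [odd_add_four]
  · rw [odd_sub_four]

lemma emod_add_shift (hD : D = 160 ∨ D = -160) (x : ℤ) : (x + D) % 40 = x % 40 := by omega

lemma conn_add (h0 : ∀ i, a0 (i + h) = a0 i + D) (i j : ℤ) :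
    Conn a0 (i + h) (j + h) ↔ Conn a0 i j := by
  unfold Conn
  grind

lemma vertexOK_add (hD : D = 160 ∨ D = -160) (h0 : ∀ i, a0 (i + h) = a0 i + D)
    (h1 : ∀ i, a1 (i + h) = a1 i + D) (hl : ∀ i, lab (i + h) = lab i) (i j : ℤ) :
    VertexOK lab a0 a1 (i + h) (j + h) ↔ VertexOK lab a0 a1 i j := by
  unfold VertexOK
  simp only [h0, h1, hl, conn_add h0, conn_add h1, lowerOf_cell_add hD h0 h1, emod_add_shift hD,
    add_sub_add_right_eq_sub]

lemma lo_add (h0 : ∀ i, a0 (i + h) = a0 i + D) (i : ℤ) : lo a0 (i + h) = lo a0 i + D := by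
  unfold lo
  grind

lemma hi_add (h0 : ∀ i, a0 (i + h) = a0 i + D) (i : ℤ) : hi a0 (i + h) = hi a0 i + D := by
  unfold hi
  grind

lemma arcOK_add (h0 : ∀ i, a0 (i + h) = a0 i + D)
    (h1 : ∀ i, a1 (i + h) = a1 i + D) (hl : ∀ i, lab (i + h) = lab i) (i j : ℤ) :
    ArcOK lab a0 a1 (i + h) (j + h) ↔ ArcOK lab a0 a1 i j := by
  unfold ArcOK Nested
  simp only [lo_add h0, lo_add h1, hi_add h0, hi_add h1, hl, add_le_add_iff_right, ne_eq,
    add_left_inj]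

lemma localOK_of (hD : D = 160 ∨ D = -160) (hh : 0 < h) (h0 : ∀ i, a0 (i + h) = a0 i + D)
    (h1 : ∀ i, a1 (i + h) = a1 i + D) (hl : ∀ i, lab (i + h) = lab i)
    (hc : ∀ i : ℤ, 0 ≤ i → i < h → LocalOK lab a0 a1 i) (i : ℤ) : LocalOK lab a0 a1 i := by
  refine forall_of_shift (P := fun i _ => LocalOK lab a0 a1 i) hh (fun i j => ?_)
    (fun i _ h2 h3 _ => hc i h2 h3) (lt_add_one i)
  unfold LocalOK
  rw [lowerOf_cell_add hD h0 h1, lowerOf_cell_add hD h0 h1, h0, h1,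
    show i + (h : ℤ) + 1 = i + 1 + h by ring, show i + (h : ℤ) - 1 = i - 1 + h by ring, h0, h1,
    hl, hl, emod_add_shift hD]
  have := cell_add hD h0 h1 i
  have e : cell a0 a1 (i + h) * 40 = cell a0 a1 i * 40 + D := by unfold cell; grind
  refine and_congr (by omega) (and_congr (by omega) (and_congr (by omega) (and_congr (by omega)
    (and_congr (or_congr (and_congr (by omega) Iff.rfl) Iff.rfl) (and_congr (by omega) ?_)))))
  grind

end shift

/-- The decidable conditions for a motion of the vertices of a chain along the unit circle. -/
structure Motion (h K : ℕ) (D m M : ℤ) (lab : ℤ → Label) (a0 a1 : ℤ → ℤ) : Prop where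
  pos : 0 < h
  far : M - m < K * 160
  bounds : ∀ i < h + 1, m ≤ a0 i ∧ a0 i ≤ M ∧ m ≤ a1 i ∧ a1 i ≤ M
  loc : ∀ i < h, LocalOK lab a0 a1 i
  vertex : ∀ i < h, ∀ j < K * h, VertexOK lab a0 a1 i (i + j + 1)
  arc : ∀ i < h, ∀ j < K * h, ArcOK lab a0 a1 i (i + j + 1)

instance (h K : ℕ) (D m M : ℤ) (lab : ℤ → Label) (a0 a1 : ℤ → ℤ) :
    Decidable (Motion h K D m M lab a0 a1) :=
  decidable_of_iff (0 < h ∧ M - m < K * 160 ∧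
    (∀ i < h + 1, m ≤ a0 (i : ℕ) ∧ a0 (i : ℕ) ≤ M ∧ m ≤ a1 (i : ℕ) ∧ a1 (i : ℕ) ≤ M) ∧
    (∀ i < h, LocalOK lab a0 a1 (i : ℕ)) ∧
    (∀ i < h, ∀ j < K * h, VertexOK lab a0 a1 (i : ℕ) ((i : ℕ) + (j : ℕ) + 1)) ∧
    (∀ i < h, ∀ j < K * h, ArcOK lab a0 a1 (i : ℕ) ((i : ℕ) + (j : ℕ) + 1)))
    ⟨fun ⟨h1, h2, h3, h4, h5, h6⟩ => ⟨h1, h2, h3, h4, h5, h6⟩,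
      fun ⟨h1, h2, h3, h4, h5, h6⟩ => ⟨h1, h2, h3, h4, h5, h6⟩⟩

section motion
variable {lab : ℤ → Label} {a0 a1 : ℤ → ℤ} {h K : ℕ} {D m M : ℤ}

lemma far_apart (hD : D = 160 ∨ D = -160) (hh : 0 < h) (h0 : ∀ i, a0 (i + h) = a0 i + D)
    (hb : ∀ i < h + 1, m ≤ a0 (i : ℕ) ∧ a0 (i : ℕ) ≤ M) (hf : M - m < K * 160) {i j : ℤ}
    (hi0 : 0 ≤ i) (hih : i ≤ h) (hj : (K * h : ℕ) ≤ j) :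
    (D = 160 ∧ a0 i < a0 j) ∨ (D = -160 ∧ a0 j < a0 i) := by
  have hh' : (0 : ℤ) < h := by grind
  have sh : ∀ (q : ℕ) (i : ℤ), a0 (i + q * h) = a0 i + q * D := by
    intro q i
    induction q with
    | zero => simp
    | succ q ih =>
      grind
  have hj0 : 0 ≤ j := le_trans (by positivity) hj
  obtain ⟨q, hq⟩ := Int.eq_ofNat_of_zero_le (Int.ediv_nonneg hj0 hh'.le)
  obtain ⟨r, hr⟩ := Int.eq_ofNat_of_zero_le (Int.emod_nonneg j hh'.ne')
  have e : j = r + q * h := by rw [← hr, ← hq, mul_comm]; exact (Int.emod_add_mul_ediv j h).symm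
  have hrh : r < h := by
    have := Int.emod_lt_of_pos j hh'
    grind
  have hKq : K ≤ q := by
    have h1 : (K : ℤ) ≤ j / h := by rw [Int.le_ediv_iff_mul_le hh']; grind
    grind
  have b1 := hb r (by omega)
  obtain ⟨n, rfl⟩ := Int.eq_ofNat_of_zero_le hi0
  have b2 := hb n (by omega)
  have e2 := sh q r
  grind

lemma Motion.vertex_all (hm : Motion h K D m M lab a0 a1) (hD : D = 160 ∨ D = -160)
    (h0 : ∀ i, a0 (i + h) = a0 i + D) (h1 : ∀ i, a1 (i + h) = a1 i + D)
    (hl : ∀ i, lab (i + h) = lab i) {i j : ℤ} (hij : i < j) : VertexOK lab a0 a1 i j := by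
  refine forall_of_shift (P := VertexOK lab a0 a1) hm.pos (vertexOK_add hD h0 h1 hl) ?_ hij
  intro i j hi0 hih hij
  obtain ⟨n, rfl⟩ := Int.eq_ofNat_of_zero_le hi0
  by_cases hc : (K * h : ℕ) ≤ j
  · have f0 := far_apart hD hm.pos h0 (fun i hi => ⟨(hm.bounds i hi).1, (hm.bounds i hi).2.1⟩)
      hm.far hi0 hih.le hc
    have f1 := far_apart hD hm.pos h1 (fun i hi => (hm.bounds i hi).2.2) hm.far hi0 hih.le hc
    unfold VertexOK
    omega
  · obtain ⟨k, hk⟩ := Int.eq_ofNat_of_zero_le (show 0 ≤ j - n - 1 by omega)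
    have := hm.vertex n (by omega) k (by grind)
    grind

lemma Motion.arc_all (hm : Motion h K D m M lab a0 a1) (hD : D = 160 ∨ D = -160)
    (h0 : ∀ i, a0 (i + h) = a0 i + D) (h1 : ∀ i, a1 (i + h) = a1 i + D)
    (hl : ∀ i, lab (i + h) = lab i) {i j : ℤ} (hij : i < j) : ArcOK lab a0 a1 i j := by
  refine forall_of_shift (P := ArcOK lab a0 a1) hm.pos (arcOK_add h0 h1 hl) ?_ hij
  intro i j hi0 hih hij
  obtain ⟨n, rfl⟩ := Int.eq_ofNat_of_zero_le hi0
  by_cases hc : (K * h : ℕ) ≤ j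
  · have b0 := fun i hi => And.intro (hm.bounds i hi).1 (hm.bounds i hi).2.1
    have b1 := fun i hi => (hm.bounds i hi).2.2
    have f0 := far_apart hD hm.pos h0 b0 hm.far hi0 hih.le hc
    have f1 := far_apart hD hm.pos h1 b1 hm.far hi0 hih.le hc
    have f2 := far_apart hD hm.pos h0 b0 hm.far hi0 hih.le (show _ ≤ j + 1 by omega)
    have f3 := far_apart hD hm.pos h1 b1 hm.far hi0 hih.le (show _ ≤ j + 1 by omega)
    have f4 := far_apart (i := (n : ℤ) + 1) hD hm.pos h0 b0 hm.far (by omega) (by omega) hc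
    have f5 := far_apart (i := (n : ℤ) + 1) hD hm.pos h1 b1 hm.far (by omega) (by omega) hc
    have f6 := far_apart (i := (n : ℤ) + 1) hD hm.pos h0 b0 hm.far (by omega) (by omega)
      (show _ ≤ j + 1 by omega)
    have f7 := far_apart (i := (n : ℤ) + 1) hD hm.pos h1 b1 hm.far (by omega) (by omega)
      (show _ ≤ j + 1 by omega)
    unfold ArcOK lo hi
    rcases hD with rfl | rfl
    · grind
    · right; left; constructor <;> grind
  · obtain ⟨k, hk⟩ := Int.eq_ofNat_of_zero_le (show 0 ≤ j - n - 1 by omega)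
    have := hm.arc n (by omega) k (by grind)
    grind

lemma convex_zero {s : ℝ} (hs : s ∈ Set.Icc (0 : ℝ) 1) {x y : ℤ}
    (e : (1 - s) * (x : ℝ) + s * (y : ℝ) = 0) (hx : 0 ≤ x) (hy : 0 ≤ y) :
    (s = 1 ∨ x = 0) ∧ (s = 0 ∨ y = 0) := by
  have hx' : (0 : ℝ) ≤ x := by exact_mod_cast hx
  have hy' : (0 : ℝ) ≤ y := by exact_mod_cast hy
  have p1 := mul_nonneg (show 0 ≤ 1 - s by grind) hx'
  have p2 := mul_nonneg hs.1 hy'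
  have q1 : (1 - s) * (x : ℝ) = 0 := by linarith
  have q2 : s * (y : ℝ) = 0 := by linarith
  constructor
  · rcases mul_eq_zero.1 q1 with h | h
    · left; linarith
    · right; exact_mod_cast h
  · rcases mul_eq_zero.1 q2 with h | h
    · left; exact h
    · right; exact_mod_cast h

lemma eq_of_nested_parabolas {t p q p' q' : ℝ} (hp : p ≤ p') (hq : q' ≤ q) (h1 : p' < t)
    (h2 : t < q') (e : (t - p) * (q - t) = (t - p') * (q' - t)) : p = p' ∧ q = q' := by
  constructor
  · by_contra hne
    have := lt_of_le_of_ne hp hne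
    have h3 : (t - p') * (q - t) < (t - p) * (q - t) :=
      mul_lt_mul_of_pos_right (by linarith) (by linarith)
    have h4 : (t - p') * (q' - t) ≤ (t - p') * (q - t) :=
      mul_le_mul_of_nonneg_left (by linarith) (by linarith)
    linarith
  · by_contra hne
    have := lt_of_le_of_ne hq (Ne.symm hne)
    have h3 : (t - p') * (q' - t) < (t - p') * (q - t) :=
      mul_lt_mul_of_pos_left (by linarith) (by linarith)
    have h4 : (t - p') * (q - t) ≤ (t - p) * (q - t) :=
      mul_le_mul_of_nonneg_right (by linarith) (by linarith)
    linarith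

/-- The position at time `s`. -/
noncomputable def interp (a0 a1 : ℤ → ℤ) (s : ℝ) (i : ℤ) : ℝ := ((1 - s) * a0 i + s * a1 i) / 40

lemma arcOK_height {s : ℝ} (hs : s ∈ Set.Icc (0 : ℝ) 1) {i j : ℤ} (hA : ArcOK lab a0 a1 i j)
    (hi' : LocalOK lab a0 a1 i) (hj' : LocalOK lab a0 a1 j) {u v : ℝ}
    (hu : u ∈ Set.Ico (0 : ℝ) 1) (hv : v ∈ Set.Ico (0 : ℝ) 1)
    (ha : interp a0 a1 s i + u * (interp a0 a1 s (i + 1) - interp a0 a1 s i) =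
      interp a0 a1 s j + v * (interp a0 a1 s (j + 1) - interp a0 a1 s j))
    (hr : height 0 (interp a0 a1 s) i u = height 0 (interp a0 a1 s) j v)
    (hpos : 0 < height 0 (interp a0 a1 s) i u) : lab i ≠ lab j := by
  have hs' : 0 ≤ 1 - s := by grind
  have key : ∀ (i : ℤ) (u : ℝ), LocalOK lab a0 a1 i → u ∈ Set.Ico (0 : ℝ) 1 →
      0 < height 0 (interp a0 a1 s) i u → ∀ t, t = interp a0 a1 s i +
        u * (interp a0 a1 s (i + 1) - interp a0 a1 s i) →
      ((1 - s) * lo a0 i + s * lo a1 i) / 40 < t ∧ t < ((1 - s) * hi a0 i + s * hi a1 i) / 40 ∧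
      height 0 (interp a0 a1 s) i u = curv * ((t - ((1 - s) * lo a0 i + s * lo a1 i) / 40) *
        (((1 - s) * hi a0 i + s * hi a1 i) / 40 - t)) := by
    intro i u hl hu hp t ht
    have hup : 0 < u := by
      rcases hu.1.eq_or_lt with h | h
      · subst h; simp [height] at hp
      · exact h
    have hne : interp a0 a1 s (i + 1) - interp a0 a1 s i ≠ 0 := by intro h; simp [height, h] at hp
    have hu1 : 0 < 1 - u := by grind
    obtain ⟨-, -, -, -, -, hor, -⟩ := hl
    have e1 : height 0 (interp a0 a1 s) i u =
        curv * ((t - interp a0 a1 s i) * (interp a0 a1 s (i + 1) - t)) := by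
      rw [ht]; simp only [height, Pi.zero_apply]; ring
    rcases hor with ⟨o0, o1⟩ | ⟨o0, o1⟩
    · have l0 : lo a0 i = a0 i := min_eq_left o0
      have l1 : lo a1 i = a1 i := min_eq_left o1
      have k0 : hi a0 i = a0 (i + 1) := max_eq_right o0
      have k1 : hi a1 i = a1 (i + 1) := max_eq_right o1
      rw [l0, l1, k0, k1]
      have hle : interp a0 a1 s i ≤ interp a0 a1 s (i + 1) := by
        unfold interp
        have : (a0 i : ℝ) ≤ a0 (i + 1) := by exact_mod_cast o0
        have : (a1 i : ℝ) ≤ a1 (i + 1) := by exact_mod_cast o1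
        have := hs.1
        gcongr
      have hlt := lt_of_le_of_ne hle (fun h => hne (by rw [h]; ring))
      refine ⟨?_, ?_, e1⟩
      · change interp a0 a1 s i < t
        rw [ht]; nlinarith
      · change t < interp a0 a1 s (i + 1)
        rw [ht]; nlinarith
    · have l0 : lo a0 i = a0 (i + 1) := min_eq_right o0
      have l1 : lo a1 i = a1 (i + 1) := min_eq_right o1
      have k0 : hi a0 i = a0 i := max_eq_left o0
      have k1 : hi a1 i = a1 i := max_eq_left o1
      rw [l0, l1, k0, k1]
      have hle : interp a0 a1 s (i + 1) ≤ interp a0 a1 s i := by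
        unfold interp
        have : (a0 (i + 1) : ℝ) ≤ a0 i := by exact_mod_cast o0
        have : (a1 (i + 1) : ℝ) ≤ a1 i := by exact_mod_cast o1
        have := hs.1
        gcongr
      have hlt := lt_of_le_of_ne hle (fun h => hne (by rw [h]; ring))
      refine ⟨?_, ?_, by rw [e1]; unfold interp; ring⟩
      · change interp a0 a1 s (i + 1) < t
        rw [ht]; nlinarith
      · change t < interp a0 a1 s i
        rw [ht]; nlinarith
  intro hlab
  obtain ⟨A1, A2, A3⟩ := key i u hi' hu hpos _ rfl
  obtain ⟨B1, B2, B3⟩ := key j v hj' hv (hr ▸ hpos) _ ha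
  rw [A3, B3] at hr
  set t := interp a0 a1 s i + u * (interp a0 a1 s (i + 1) - interp a0 a1 s i)
  have hc : curv ≠ 0 := by norm_num [curv]
  have hr' := mul_left_cancel₀ hc hr
  have wle : ∀ {x0 x1 y0 y1 : ℤ}, x0 ≤ y0 → x1 ≤ y1 →
      ((1 - s) * x0 + s * x1) / 40 ≤ ((1 - s) * y0 + s * y1) / 40 := by
    intro x0 x1 y0 y1 h0 h1
    have : (x0 : ℝ) ≤ y0 := by exact_mod_cast h0
    have : (x1 : ℝ) ≤ y1 := by exact_mod_cast h1
    have := hs.1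
    gcongr
  have nest : ∀ i j : ℤ, Nested a0 a1 i j →
      ((1 - s) * lo a0 j + s * lo a1 j) / 40 < t → t < ((1 - s) * hi a0 j + s * hi a1 j) / 40 →
      (t - ((1 - s) * lo a0 i + s * lo a1 i) / 40) * (((1 - s) * hi a0 i + s * hi a1 i) / 40 - t) =
      (t - ((1 - s) * lo a0 j + s * lo a1 j) / 40) * (((1 - s) * hi a0 j + s * hi a1 j) / 40 - t) →
      False := by
    intro i j ⟨n1, n2, n3, n4, n5, n6⟩ B1 B2 e
    have w1 := wle n1 n3
    have w2 := wle n2 n4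
    obtain ⟨q1, q2⟩ := eq_of_nested_parabolas w1 w2 B1 B2 e
    obtain ⟨r0, r1⟩ := convex_zero hs (x := lo a0 j - lo a0 i) (y := lo a1 j - lo a1 i)
      (by grind) (by omega) (by omega)
    obtain ⟨r2, r3⟩ := convex_zero hs (x := hi a0 i - hi a0 j) (y := hi a1 i - hi a1 j)
      (by grind) (by omega) (by omega)
    have z0 : (1 - s) = 0 ∨ (lo a0 j = hi a0 j) := by grind
    have z1 : s = 0 ∨ (lo a1 j = hi a1 j) := by grind
    have f0 : (1 - s) * lo a0 j = (1 - s) * hi a0 j := by rcases z0 with h | h <;> simp [h]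
    have f1 : s * lo a1 j = s * hi a1 j := by rcases z1 with h | h <;> simp [h]
    grind
  rcases hA with ⟨c1, c2⟩ | ⟨c1, c2⟩ | c | c | c
  · linarith [wle c1 c2]
  · linarith [wle c1 c2]
  · exact c hlab
  · exact nest i j c B1 B2 hr'
  · exact nest j i c A1 A2 hr'.symm

lemma interp_mem_cell {s : ℝ} (hs : s ∈ Set.Icc (0 : ℝ) 1) {i : ℤ} (hl : LocalOK lab a0 a1 i) :
    interp a0 a1 s i ∈ Set.Icc (cell a0 a1 i : ℝ) (cell a0 a1 i + 1) := by
  obtain ⟨c1, c2, c3, c4, -⟩ := hl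
  have c1' : (40 : ℝ) * cell a0 a1 i ≤ a0 i := by exact_mod_cast c1
  have c2' : (a0 i : ℝ) ≤ 40 * cell a0 a1 i + 40 := by exact_mod_cast c2
  have c3' : (40 : ℝ) * cell a0 a1 i ≤ a1 i := by exact_mod_cast c3
  have c4' : (a1 i : ℝ) ≤ 40 * cell a0 a1 i + 40 := by exact_mod_cast c4
  have := hs.1
  have : 0 ≤ 1 - s := by grind
  unfold interp
  constructor
  · rw [le_div_iff₀ (by norm_num)]; nlinarith
  · rw [div_le_iff₀ (by norm_num)]; nlinarith

lemma interp_mem_open {s : ℝ} (hs : s ∈ Set.Icc (0 : ℝ) 1) {i : ℤ} (hl : LocalOK lab a0 a1 i)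
    (hn : (s < 1 ∧ a0 i % 40 ≠ 0) ∨ (0 < s ∧ a1 i % 40 ≠ 0)) :
    interp a0 a1 s i ∈ Set.Ioo (cell a0 a1 i : ℝ) (cell a0 a1 i + 1) := by
  obtain ⟨c1, c2, c3, c4, -⟩ := hl
  have c1' : (40 : ℝ) * cell a0 a1 i ≤ a0 i := by exact_mod_cast c1
  have c2' : (a0 i : ℝ) ≤ 40 * cell a0 a1 i + 40 := by exact_mod_cast c2
  have c3' : (40 : ℝ) * cell a0 a1 i ≤ a1 i := by exact_mod_cast c3
  have c4' : (a1 i : ℝ) ≤ 40 * cell a0 a1 i + 40 := by exact_mod_cast c4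
  have := hs.1
  have : 0 ≤ 1 - s := by grind
  unfold interp
  rcases hn with ⟨h1, h2⟩ | ⟨h1, h2⟩
  · have d1 : (40 : ℝ) * cell a0 a1 i < a0 i := by
      have : 40 * cell a0 a1 i < a0 i := by omega
      exact_mod_cast this
    have d2 : (a0 i : ℝ) < 40 * cell a0 a1 i + 40 := by
      have : a0 i < 40 * cell a0 a1 i + 40 := by omega
      exact_mod_cast this
    have : 0 < 1 - s := by linarith
    constructor
    · rw [lt_div_iff₀ (by norm_num)]; nlinarith
    · rw [div_lt_iff₀ (by norm_num)]; nlinarith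
  · have d1 : (40 : ℝ) * cell a0 a1 i < a1 i := by
      have : 40 * cell a0 a1 i < a1 i := by omega
      exact_mod_cast this
    have d2 : (a1 i : ℝ) < 40 * cell a0 a1 i + 40 := by
      have : a1 i < 40 * cell a0 a1 i + 40 := by omega
      exact_mod_cast this
    constructor
    · rw [lt_div_iff₀ (by norm_num)]; nlinarith
    · rw [div_lt_iff₀ (by norm_num)]; nlinarith

lemma vertexOK_conn {s : ℝ} (hs : s ∈ Set.Icc (0 : ℝ) 1) {i j : ℤ} (hV : VertexOK lab a0 a1 i j)
    (hl : LocalOK lab a0 a1 i) (ha : interp a0 a1 s i = interp a0 a1 s j)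
    (hy : ∀ k : ℤ, interp a0 a1 s i ∈ Set.Ioo (k : ℝ) (k + 1) →
      lowerOf (lab i) k = lowerOf (lab j) k) :
    (s = 1 ∨ Conn a0 i j) ∧ (s = 0 ∨ Conn a1 i j) := by
  have hs' : 0 ≤ 1 - s := by grind
  have e : (1 - s) * (a0 j - a0 i : ℤ) + s * (a1 j - a1 i : ℤ) = 0 := by
    unfold interp at ha
    grind
  have hyd := fun hn => hy _ (interp_mem_open hs hl hn)
  have b0 : s < 1 → lowerOf (lab i) (cell a0 a1 i) ≠ lowerOf (lab j) (cell a0 a1 i) →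
      a0 i % 40 = 0 := by grind
  have b1 : 0 < s → lowerOf (lab i) (cell a0 a1 i) ≠ lowerOf (lab j) (cell a0 a1 i) →
      a1 i % 40 = 0 := by grind
  have sgn := fun x y => @convex_zero s hs x y
  have sgn' : ∀ x y : ℤ, (1 - s) * (x : ℝ) + s * (y : ℝ) = 0 → x ≤ 0 → y ≤ 0 →
      (s = 1 ∨ x = 0) ∧ (s = 0 ∨ y = 0) := by
    intro x y e hx hy
    have := sgn (-x) (-y) (by grind) (by omega) (by omega)
    grind
  rcases hV with ⟨c1, c2⟩ | ⟨c1, c2⟩ | ⟨c1, c2, c3⟩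
  · have := sgn _ _ e c1.le c2.le
    grind
  · have := sgn' _ _ e c1.le c2.le
    grind
  · rcases hs.1.eq_or_lt with h | hpos
    · grind
    rcases hs.2.eq_or_lt with h | hlt
    · subst h
      grind
    grind

lemma travel_of_conn {a : ℤ → ℝ} {i j : ℤ} (hij : i ≤ j)
    (h : ∀ m < (j - i).toNat, a (i + m) = a (i + m + 1)) : travel a i = travel a j := by
  obtain ⟨n, hn⟩ := Int.eq_ofNat_of_zero_le (show 0 ≤ j - i by omega)
  have hn' : (j - i).toNat = n := by omega
  rw [hn'] at h
  obtain rfl : j = i + n := by omega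
  clear hn hn' hij
  induction n with
  | zero => simp
  | succ n ih =>
    rw [ih fun m hm => h m (by omega)]
    have := h n (by omega)
    push_cast
    rw [← add_assoc, travel_succ, this]
    simp

lemma Motion.isChain (hm : Motion h K D m M lab a0 a1) (hD : D = 160 ∨ D = -160)
    (h0 : ∀ i, a0 (i + h) = a0 i + D) (h1 : ∀ i, a1 (i + h) = a1 i + D)
    (hl : ∀ i, lab (i + h) = lab i) {s : ℝ} (hs : s ∈ Set.Icc (0 : ℝ) 1) :
    IsChain lab 0 (interp a0 a1 s) (2 * h) (D / 160) := by
  have hloc : ∀ i, LocalOK lab a0 a1 i := localOK_of hD hm.pos h0 h1 hl fun i hi0 hih => by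
    obtain ⟨n, rfl⟩ := Int.eq_ofNat_of_zero_le hi0
    exact hm.loc n (by omega)
  have hs' : 0 ≤ 1 - s := by grind
  have p0 : ∀ i, a0 (i + 2 * h) = a0 i + 2 * D := fun i => by grind
  have p1 : ∀ i, a1 (i + 2 * h) = a1 i + 2 * D := fun i => by grind
  refine ⟨?_, fun _ => rfl, ?_, ?_, fun _ _ => rfl, fun _ => le_rfl, fun _ => by norm_num, ?_, ?_⟩
  · intro i
    unfold interp
    rw [p0, p1]
    have : (D : ℝ) = 160 * (D / 160 : ℤ) := by rcases hD with rfl | rfl <;> norm_num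
    grind
  · grind
  · intro i
    have hc := interp_mem_cell hs (hloc i)
    obtain ⟨c1, c2, c3, c4, c5, -⟩ := hloc i
    rcases c5 with ⟨c5, c6⟩ | c5
    · have : interp a0 a1 s i = ((a0 i / 40 : ℤ) : ℝ) := by
        have e : a0 i = 40 * (a0 i / 40) := by omega
        have e' : (a0 i : ℝ) = 40 * (a0 i / 40 : ℤ) := by exact_mod_cast e
        unfold interp
        grind
      rw [this]; exact pt_int _ _ _ _ _
    · exact pt_axis_eq hc c5
  · intro i
    obtain ⟨-, -, -, -, -, -, c1, c2⟩ := hloc i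
    have c1' : |(a0 (i + 1) : ℝ) - a0 i| ≤ 400 := by exact_mod_cast c1
    have c2' : |(a1 (i + 1) : ℝ) - a1 i| ≤ 400 := by exact_mod_cast c2
    unfold interp
    rw [abs_le] at *
    constructor <;> nlinarith [hs.1, hs.2]
  · intro x x' hlt e ea
    have f0 := Int.fract_nonneg x
    have f1 := Int.fract_lt_one x
    have g0 := Int.fract_nonneg x'
    have g1 := Int.fract_lt_one x'
    have hx : lin (interp a0 a1 s) x = interp a0 a1 s ⌊x⌋ +
        Int.fract x * (interp a0 a1 s (⌊x⌋ + 1) - interp a0 a1 s ⌊x⌋) := rfl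
    have hx' : lin (interp a0 a1 s) x' = interp a0 a1 s ⌊x'⌋ +
        Int.fract x' * (interp a0 a1 s (⌊x'⌋ + 1) - interp a0 a1 s ⌊x'⌋) := rfl
    have n0 : 0 ≤ height 0 (interp a0 a1 s) ⌊x⌋ (Int.fract x) :=
      height_nonneg (fun _ => le_rfl) _ f0 f1.le
    have n1 : 0 ≤ height 0 (interp a0 a1 s) ⌊x'⌋ (Int.fract x') :=
      height_nonneg (fun _ => le_rfl) _ g0 g1.le
    rw [chain_eq, chain_eq] at e
    obtain ⟨er, -, e1, e2⟩ := pt_inj n0 n1 e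
    rcases n0.eq_or_lt with hz | hpos
    · have vert : ∀ y : ℝ, height 0 (interp a0 a1 s) ⌊y⌋ (Int.fract y) = 0 →
          lin (interp a0 a1 s) y = interp a0 a1 s ⌊y⌋ ∧
          lin (travel (interp a0 a1 s)) y = travel (interp a0 a1 s) ⌊y⌋ := by
        intro y hy
        have : Int.fract y * (interp a0 a1 s (⌊y⌋ + 1) - interp a0 a1 s ⌊y⌋) = 0 := by
          have : 0 < 1 - Int.fract y := by linarith [Int.fract_lt_one y]
          have hc : curv ≠ 0 := by norm_num [curv]
          simp only [height, Pi.zero_apply, sub_self, mul_zero, add_zero, zero_add,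
            mul_eq_zero, hc, false_or, this.ne', or_false, pow_eq_zero_iff, ne_eq,
            OfNat.ofNat_ne_zero, not_false_eq_true] at hy
          grind
        constructor
        · unfold lin; grind
        · unfold lin
          rw [travel_succ]
          grind
      obtain ⟨v1, v2⟩ := vert x hz.symm
      obtain ⟨v3, v4⟩ := vert x' (er ▸ hz.symm)
      rw [v2, v4]
      rw [v1, v3] at ea
      rw [v1] at e2
      obtain ⟨k0, k1⟩ := vertexOK_conn hs (hm.vertex_all hD h0 h1 hl hlt) (hloc _) ea (e2 hz.symm)
      refine travel_of_conn hlt.le fun m hm => ?_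
      unfold interp
      have t0 : (1 - s) * (a0 (⌊x⌋ + m) : ℝ) = (1 - s) * a0 (⌊x⌋ + m + 1) := by
        rcases k0 with h | h
        · rw [h]; ring
        · rw [h m hm]
      have t1 : s * (a1 (⌊x⌋ + m) : ℝ) = s * a1 (⌊x⌋ + m + 1) := by
        rcases k1 with h | h
        · rw [h]; ring
        · rw [h m hm]
      rw [t0, t1]
    · exfalso
      obtain ⟨l1, l2⟩ := e1 hpos
      exact arcOK_height hs (hm.arc_all hD h0 h1 hl hlt) (hloc _) (hloc _) ⟨f0, f1⟩ ⟨g0, g1⟩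
        (by grind) er hpos (Prod.ext l1 l2)

end motion

/-- The chain given by a half-period of labels and positions. -/
noncomputable def word (h : ℕ) (D : ℤ) (lab : List Label) (p : List ℤ) : ℝ → ℂ × ℂ :=
  chain (extendLab h lab) 0 fun i => (extend h D p i : ℝ) / 40

lemma sq_of_shift {D : ℤ} (hD : D = 160 ∨ D = -160) : D / 160 * (D / 160) = 1 := by grind

lemma interp_zero (a0 a1 : ℤ → ℤ) : interp a0 a1 0 = fun i => (a0 i : ℝ) / 40 := by
  funext i; simp [interp]

lemma interp_one (a0 a1 : ℤ → ℤ) : interp a0 a1 1 = fun i => (a1 i : ℝ) / 40 := by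
  funext i; simp [interp]

lemma continuous_interp (a0 a1 : ℤ → ℤ) (i : ℤ) : Continuous fun s => interp a0 a1 s i := by
  unfold interp; fun_prop

theorem word_motion {h K : ℕ} {D m M : ℤ} {lab : List Label} {p0 p1 : List ℤ}
    (hD : D = 160 ∨ D = -160)
    (hm : Motion h K D m M (extendLab h lab) (extend h D p0) (extend h D p1)) :
    LineIso (2 * h : ℤ) (2 * h : ℤ) (word h D lab p0) (word h D lab p1) := by
  have hh : (0 : ℤ) < h := by exact_mod_cast hm.pos
  have := lineIso_of_chains (N := 2 * h) (w := D / 160) (lab := extendLab h lab)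
    (ρ := fun _ => 0) (a := interp (extend h D p0) (extend h D p1)) (by omega) (sq_of_shift hD)
    (continuous_interp _ _) (fun _ => continuous_const) fun s hs =>
      hm.isChain hD (extend_add hm.pos D p0) (extend_add hm.pos D p1) (extendLab_add h lab) hs
  simp only [interp_zero, interp_one] at this
  exact this

/-- The conditions under which `φ` collapses degenerate arcs of the second word to get the first
one. -/
def Collapse (h h' : ℕ) (D : ℤ) (lab lab' : List Label) (p p' φ : List ℤ) : Prop :=
  0 < h ∧ 0 < h' ∧ ∀ i < h',
    extend h' D p' (i : ℕ) = extend h D p (extend h' h φ (i : ℕ)) ∧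
    ((extend h' h φ (i + 1 : ℕ) = extend h' h φ (i : ℕ) + 1 ∧
        extendLab h' lab' (i : ℕ) = extendLab h lab (extend h' h φ (i : ℕ))) ∨
      ((extend h' h φ (i + 1 : ℕ) = extend h' h φ (i : ℕ) ∨
        extend h' h φ (i + 1 : ℕ) = extend h' h φ (i : ℕ) + 1) ∧
        extend h' D p' (i : ℕ) = extend h' D p' (i + 1 : ℕ) ∧
        (extend h' D p' (i : ℕ) % 40 = 0 ∨
          lowerOf (extendLab h' lab' (i : ℕ)) (extend h' D p' (i : ℕ) / 40) =
          lowerOf (extendLab h lab (extend h' h φ (i : ℕ))) (extend h' D p' (i : ℕ) / 40))))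

instance (h h' : ℕ) (D : ℤ) (lab lab' : List Label) (p p' φ : List ℤ) :
    Decidable (Collapse h h' D lab lab' p p' φ) := by unfold Collapse; infer_instance

theorem word_collapse {h h' : ℕ} {D : ℤ} {lab lab' : List Label} {p p' φ : List ℤ}
    (hD : D = 160 ∨ D = -160)
    (hc : Collapse h h' D lab lab' p p' φ) {γ : Curve}
    (hγ : Rep (2 * h : ℤ) (word h D lab p) γ) : Rep (2 * h' : ℤ) (word h' D lab' p') γ := by
  obtain ⟨hh, hh', hc⟩ := hc
  set a := extend h D p with ha
  set a' := extend h' D p' with ha'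
  set f := extend h' h φ with hf
  set l := extendLab h lab with hl
  set l' := extendLab h' lab' with hl'
  have all : ∀ i : ℤ, a' i = a (f i) ∧ ((f (i + 1) = f i + 1 ∧ l' i = l (f i)) ∨
      ((f (i + 1) = f i ∨ f (i + 1) = f i + 1) ∧ a' i = a' (i + 1) ∧
        (a' i % 40 = 0 ∨ lowerOf (l' i) (a' i / 40) = lowerOf (l (f i)) (a' i / 40)))) := by
    intro i
    refine forall_of_shift (P := fun i _ => a' i = a (f i) ∧
      ((f (i + 1) = f i + 1 ∧ l' i = l (f i)) ∨
      ((f (i + 1) = f i ∨ f (i + 1) = f i + 1) ∧ a' i = a' (i + 1) ∧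
        (a' i % 40 = 0 ∨ lowerOf (l' i) (a' i / 40) = lowerOf (l (f i)) (a' i / 40)))))
      hh' (fun i j => ?_) (fun i _ h0 h1 _ => ?_) (lt_add_one i)
    · have e0 := extend_add hh' D p' i
      have e1 := extend_add hh' D p' (i + 1)
      have e2 := extend_add hh' h φ i
      have e3 := extend_add hh' h φ (i + 1)
      rw [show i + 1 + (h' : ℤ) = i + h' + 1 by ring] at e1 e3
      simp only [← ha', ← hf] at e0 e1 e2 e3
      simp only [e0, e1, e2, e3, hl, hl', ha, extendLab_add, extend_add hh, emod_add_shift hD,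
        add_left_inj]
      have e5 : ∀ lb : Label, lowerOf lb ((a' i + D) / 40) = lowerOf lb (a' i / 40) := by
        intro lb
        unfold lowerOf lower
        rcases hD with rfl | rfl
        · rw [show (a' i + 160) / 40 = a' i / 40 + 4 by omega, odd_add_four]
        · rw [show (a' i + -160) / 40 = a' i / 40 + -4 by omega, odd_sub_four]
      grind
    · obtain ⟨n, rfl⟩ := Int.eq_ofNat_of_zero_le h0
      grind
  have step : ∀ i, f (i + 1) = f i ∨ f (i + 1) = f i + 1 := fun i => by grind
  have key : ∀ x, word h' D lab' p' x = word h D lab p (lin (fun i => f i) x) := by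
    intro x
    have hA := all ⌊x⌋
    have hfl := exists_floor_eq (step ⌊x⌋)
    have e1 : lin (fun i => (a i : ℝ) / 40) (lin (fun i => f i) x) =
        lin (fun i => (a' i : ℝ) / 40) x := by
      rw [lin_reindex _ step]
      congr 1
      grind
    unfold word
    simp only [chain_eq, ← ha, ← ha', ← hl, ← hl', hfl, e1]
    rcases hA.2 with ⟨h1, h2⟩ | ⟨h1, h2, h3⟩
    · rw [h2]
      have h4 : Int.fract (lin (fun i => (f i : ℝ)) x) = Int.fract x := by
        rw [Int.fract, hfl]
        simp only [lin, h1]; grind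
      have h5 : height 0 (fun i => (a' i : ℝ) / 40) ⌊x⌋ (Int.fract x) =
          height 0 (fun i => (a i : ℝ) / 40) (f ⌊x⌋) (Int.fract x) := by
        simp only [height, Pi.zero_apply, (all _).1, h1]
      rw [h4, h5]
    · have h4 : height 0 (fun i => (a' i : ℝ) / 40) ⌊x⌋ (Int.fract x) = 0 := by simp [height, h2]
      have h5 : height 0 (fun i => (a i : ℝ) / 40) (f ⌊x⌋)
          (Int.fract (lin (fun i => (f i : ℝ)) x)) = 0 := by
        rcases h1 with h1 | h1
        · have : Int.fract (lin (fun i => (f i : ℝ)) x) = 0 := by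
            rw [Int.fract, hfl]
            simp [lin, h1]
          simp [height, this]
        · have e2 : a (f ⌊x⌋ + 1) = a (f ⌊x⌋) := by grind
          simp [height, e2]
      have h6 : lin (fun i => (a' i : ℝ) / 40) x = (a' ⌊x⌋ : ℝ) / 40 := by simp [lin, h2]
      rw [h4, h5, h6]
      rcases h3 with h3 | h3
      · have e : a' ⌊x⌋ = 40 * (a' ⌊x⌋ / 40) := by omega
        have e' : (a' ⌊x⌋ : ℝ) / 40 = ((a' ⌊x⌋ / 40 : ℤ) : ℝ) := by rw [e]; push_cast; simp
        rw [e']; exact pt_int _ _ _ _ _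
      · refine pt_axis_eq (k := a' ⌊x⌋ / 40) ?_ h3
        have e0 : 40 * (a' ⌊x⌋ / 40) ≤ a' ⌊x⌋ := by omega
        have e1 : a' ⌊x⌋ ≤ 40 * (a' ⌊x⌋ / 40) + 40 := by omega
        have e0' : (40 : ℝ) * (a' ⌊x⌋ / 40 : ℤ) ≤ a' ⌊x⌋ := by exact_mod_cast e0
        have e1' : (a' ⌊x⌋ : ℝ) ≤ 40 * (a' ⌊x⌋ / 40 : ℤ) + 40 := by exact_mod_cast e1
        constructor <;> linarith
  have : word h' D lab' p' = fun x => word h D lab p (lin (fun i => f i) x) := funext key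
  rw [this]
  refine hγ.comp (by positivity) (continuous_lin _) (lin_monotone fun i => ?_) fun x => ?_
  · rcases step i with h | h <;> rw [h]
    grind
  · refine lin_add_int (n := 2 * h') (fun i => ?_) x
    have e2 := extend_add hh' h φ i
    have e3 := extend_add hh' h φ (i + h')
    rw [show i + 2 * (h' : ℤ) = i + h' + h' by ring]
    rw [hf, e3, e2]; grind

/-! ### Withdrawing a finger -/

/-- The distance of the vertices from the unit circle while the tips of the fingers are withdrawn
along chords. -/
noncomputable def tipHeight (a0 a1 : ℤ → ℤ) (s : ℝ) (i : ℤ) : ℝ :=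
  curv * (s * (1 - s)) * ((a1 i - a0 i) / 40) ^ 2

/-- The vertices `i` and `j` are different points. -/
def Distinct (lab : ℤ → Label) (a : ℤ → ℤ) (i j : ℤ) : Prop :=
  a i ≠ a j ∨ (lowerOf (lab i) (a i / 40) ≠ lowerOf (lab j) (a i / 40) ∧ a i % 40 ≠ 0)

instance (lab : ℤ → Label) (a : ℤ → ℤ) (i j : ℤ) : Decidable (Distinct lab a i j) := by
  unfold Distinct; infer_instance

/-- The finger from the vertex `b` to the vertex `b + 3` is off the arc `k`. -/
def FingerOff (a : ℤ → ℤ) (b k : ℤ) : Prop :=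
  ((a b < lo a k ∨ hi a k < a b) ∧ (a (b + 1) < lo a k ∨ hi a k < a (b + 1)) ∧
    (a (b + 3) < lo a k ∨ hi a k < a (b + 3))) ∨
  ((lo a k < a b ∧ a b < hi a k) ∧ (lo a k < a (b + 1) ∧ a (b + 1) < hi a k) ∧
    (lo a k < a (b + 3) ∧ a (b + 3) < hi a k))

instance (a : ℤ → ℤ) (b k : ℤ) : Decidable (FingerOff a b k) := by unfold FingerOff; infer_instance

/-- The conditions on a pair of arcs, for a finger with tip on the arc `t + 1` modulo `h`. -/
def FingerPair (h t : ℕ) (lab : ℤ → Label) (a : ℤ → ℤ) (i j : ℤ) : Prop :=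
  (i % h = t + 1 ∨ i % h = t + 2 ∨ j % h = t + 1 ∨ j % h = t + 2 ∨ Distinct lab a i j) ∧
  if t ≤ i % h ∧ i % h ≤ t + 2 then
    if t ≤ j % h ∧ j % h ≤ t + 2 then i - i % h = j - j % h ∨
      (∀ p ∈ [0, 1, 3], ∀ q ∈ [0, 1, 3], a (i - i % h + t + p) < a (j - j % h + t + q)) ∨
      (∀ p ∈ [0, 1, 3], ∀ q ∈ [0, 1, 3], a (j - j % h + t + q) < a (i - i % h + t + p))
    else lab i ≠ lab j ∨ FingerOff a (i - i % h + t) j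
  else if t ≤ j % h ∧ j % h ≤ t + 2 then lab i ≠ lab j ∨ FingerOff a (j - j % h + t) i
    else ArcOK lab a a i j

instance (h t : ℕ) (lab : ℤ → Label) (a : ℤ → ℤ) (i j : ℤ) :
    Decidable (FingerPair h t lab a i j) := by unfold FingerPair; infer_instance

/-- The decidable conditions for withdrawing the finger from the vertex `t` to the vertex `t + 3`. -/
def Finger (h K t : ℕ) (m M : ℤ) (lab : ℤ → Label) (a0 a1 : ℤ → ℤ) : Prop :=
  (t + 3 ≤ h ∧ M - m < K * 160) ∧
  (∀ i < h + 1, m ≤ a0 (i : ℕ) ∧ a0 (i : ℕ) ≤ M ∧ m ≤ a1 (i : ℕ) ∧ a1 (i : ℕ) ≤ M) ∧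
  (lab (t + 1) = lab t ∧ lab (t + 2) = lab t) ∧
  (a0 (t + 2) = a0 (t + 1) ∧ a1 (t + 2) = a1 (t + 1) ∧
    ((a1 (t + 1) = a0 t ∧ ((a0 (t + 1) < a0 t ∧ a0 t < a0 (t + 3)) ∨
        (a0 (t + 3) < a0 t ∧ a0 t < a0 (t + 1)))) ∨
      (a1 (t + 1) = a0 (t + 3) ∧ ((a0 (t + 1) < a0 (t + 3) ∧ a0 (t + 3) < a0 t) ∨
        (a0 t < a0 (t + 3) ∧ a0 (t + 3) < a0 (t + 1)))))) ∧
  (∀ i < h, (i = t + 1 ∨ i = t + 2 ∨ a1 (i : ℕ) = a0 (i : ℕ)) ∧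
    ((t ≤ i ∧ i ≤ t + 2) ∨ a0 (i + 1 : ℕ) ≠ a0 (i : ℕ))) ∧
  (∀ i < h, ∀ j < (K + 1) * h, FingerPair h t lab a0 (i : ℕ) (i + j + 1))

instance (h K t : ℕ) (m M : ℤ) (lab : ℤ → Label) (a0 a1 : ℤ → ℤ) :
    Decidable (Finger h K t m M lab a0 a1) := by unfold Finger; infer_instance

section finger
variable {lab : ℤ → Label} {a0 a1 : ℤ → ℤ} {h K t : ℕ} {D m M : ℤ}

lemma odd_shift_div (hD : D = 160 ∨ D = -160) (lb : Label) (x : ℤ) :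
    lowerOf lb ((x + D) / 40) = lowerOf lb (x / 40) := by
  unfold lowerOf lower
  rcases hD with rfl | rfl
  · rw [show (x + 160) / 40 = x / 40 + 4 by omega, odd_add_four]
  · rw [show (x + -160) / 40 = x / 40 + -4 by omega, odd_sub_four]

lemma fingerPair_add (hD : D = 160 ∨ D = -160) (h0 : ∀ i, a0 (i + h) = a0 i + D)
    (hl : ∀ i, lab (i + h) = lab i) (i j : ℤ) :
    FingerPair h t lab a0 (i + h) (j + h) ↔ FingerPair h t lab a0 i j := by
  have e1 : ∀ i p : ℤ, a0 (i + h - i % h + t + p) = a0 (i - i % h + t + p) + D := fun i p => by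
    grind
  have e2 : ∀ i : ℤ, i + h - i % h + t = (i - i % h + t) + h := fun i => by ring
  have e3 : ∀ b k : ℤ, FingerOff a0 (b + h) (k + h) ↔ FingerOff a0 b k := by
    intro b k
    unfold FingerOff
    rw [lo_add h0, hi_add h0, show b + (h : ℤ) + 1 = b + 1 + h by ring,
      show b + (h : ℤ) + 3 = b + 3 + h by ring, h0, h0, h0]
    grind
  have e4 : Distinct lab a0 (i + h) (j + h) ↔ Distinct lab a0 i j := by
    unfold Distinct
    simp only [h0, hl, odd_shift_div hD, emod_add_shift hD, ne_eq, add_left_inj]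
  have e5 : (i + h - i % h = j + h - j % h) ↔ (i - i % h = j - j % h) := by
    constructor <;> intro e <;> linarith
  unfold FingerPair
  simp only [Int.add_emod_right, e1, e4, e5, hl, add_lt_add_iff_right]
  simp only [e2, e3, arcOK_add h0 h0 hl]

/-- A point of a finger is a convex combination of its vertices, in the coordinates in which arcs
are chords. -/
lemma finger_point {a ρ : ℤ → ℝ} {s x q e y : ℝ} {b δ : ℤ} {u : ℝ} (hs : s ∈ Set.Ioo (0 : ℝ) 1)
    (hx : a b = x) (h1 : a (b + 1) = (1 - s) * q + s * e) (h2 : a (b + 2) = (1 - s) * q + s * e)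
    (hy : a (b + 3) = y) (r0 : ρ b = 0) (r1 : ρ (b + 1) = curv * (s * (1 - s)) * (e - q) ^ 2)
    (r2 : ρ (b + 2) = curv * (s * (1 - s)) * (e - q) ^ 2) (r3 : ρ (b + 3) = 0)
    (hδ : δ = 0 ∨ δ = 1 ∨ δ = 2) (hu : u ∈ Set.Ico (0 : ℝ) 1) :
    ∃ wx wq we wy : ℝ, 0 ≤ wx ∧ 0 ≤ wq ∧ 0 ≤ we ∧ 0 ≤ wy ∧ wx + wq + we + wy = 1 ∧
      a (b + δ) + u * (a (b + δ + 1) - a (b + δ)) = wx * x + wq * q + we * e + wy * y ∧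
      ∀ l r, height ρ a (b + δ) u +
        curv * ((a (b + δ) + u * (a (b + δ + 1) - a (b + δ)) - l) *
          (a (b + δ) + u * (a (b + δ + 1) - a (b + δ)) - r)) =
        curv * (wx * ((x - l) * (x - r)) + wq * ((q - l) * (q - r)) + we * ((e - l) * (e - r)) +
          wy * ((y - l) * (y - r))) := by
  have s0 := hs.1
  have s1 : 0 < 1 - s := by grind
  have u0 := hu.1
  have u1 : 0 < 1 - u := by grind
  rcases hδ with rfl | rfl | rfl
  · refine ⟨1 - u, u * (1 - s), u * s, 0, by positivity, by positivity, by positivity, le_rfl,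
      by ring, ?_, fun l r => ?_⟩
    · grind
    · unfold height
      grind
  · rw [show b + 1 + 1 = b + 2 by ring]
    refine ⟨0, 1 - s, s, 0, by positivity, by positivity, by positivity, le_rfl,
      by ring, ?_, fun l r => ?_⟩
    · grind
    · unfold height
      grind
  · rw [show b + 2 + 1 = b + 3 by ring]
    refine ⟨0, (1 - u) * (1 - s), (1 - u) * s, u, by positivity, by positivity, by positivity, u0,
      by ring, ?_, fun l r => ?_⟩
    · grind
    · unfold height
      grind

lemma shift_mul (h0 : ∀ i, a0 (i + h) = a0 i + D) (q i : ℤ) : a0 (i + q * h) = a0 i + q * D := by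
  induction q with
  | zero => simp
  | succ q ih =>
    grind
  | pred q ih =>
    grind

lemma lab_mul (hl : ∀ i, lab (i + h) = lab i) (q i : ℤ) : lab (i + q * h) = lab i := by
  induction q with
  | zero => simp
  | succ q ih =>
    grind
  | pred q ih =>
    grind

lemma lin_between {a : ℤ → ℝ} {c : ℝ} {x : ℝ} (h0 : a ⌊x⌋ < c) (h1 : a (⌊x⌋ + 1) < c) :
    lin a x < c := by
  have := Int.fract_nonneg x
  have := Int.fract_lt_one x
  unfold lin
  nlinarith

lemma lin_between' {a : ℤ → ℝ} {c : ℝ} {x : ℝ} (h0 : c < a ⌊x⌋) (h1 : c < a (⌊x⌋ + 1)) :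
    c < lin a x := by
  have := Int.fract_nonneg x
  have := Int.fract_lt_one x
  unfold lin
  nlinarith

lemma interp_lt {s : ℝ} (hs : s ∈ Set.Icc (0 : ℝ) 1) {c0 c1 d0 d1 : ℤ} (h0 : c0 < d0)
    (h1 : c1 < d1) : ((1 - s) * c0 + s * c1 : ℝ) / 40 < ((1 - s) * d0 + s * d1) / 40 := by
  have h0' : (c0 : ℝ) < d0 := by exact_mod_cast h0
  have h1' : (c1 : ℝ) < d1 := by exact_mod_cast h1
  have := hs.1
  have : 0 ≤ 1 - s := by grind
  rcases hs.1.eq_or_lt with h | h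
  · subst h; linarith
  · have := mul_lt_mul_of_pos_left h1' h
    have : (1 - s) * c0 ≤ (1 - s) * d0 := by gcongr
    linarith

lemma lin_interp_far (hD : D = 160 ∨ D = -160) (hh : 0 < h) (h0 : ∀ i, a0 (i + h) = a0 i + D)
    (h1 : ∀ i, a1 (i + h) = a1 i + D) (hf : M - m < K * 160)
    (hb : ∀ i < h + 1, m ≤ a0 (i : ℕ) ∧ a0 (i : ℕ) ≤ M ∧ m ≤ a1 (i : ℕ) ∧ a1 (i : ℕ) ≤ M)
    {s : ℝ} (hs : s ∈ Set.Icc (0 : ℝ) 1) {x x' : ℝ} (hx : ((K + 1) * h : ℕ) < ⌊x'⌋ - ⌊x⌋) :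
    lin (interp a0 a1 s) x ≠ lin (interp a0 a1 s) x' := by
  have hlt : ⌊x⌋ < ⌊x'⌋ := by grind
  have key := forall_of_shift (P := fun i j => ((K + 1) * h : ℕ) < j - i →
    (hi a0 i < lo a0 j ∧ hi a1 i < lo a1 j) ∨ (hi a0 j < lo a0 i ∧ hi a1 j < lo a1 i)) hh
    (fun i j => by
      simp only [lo_add h0, lo_add h1, hi_add h0, hi_add h1, add_lt_add_iff_right,
        add_sub_add_right_eq_sub])
    (fun i j hi0 hih _ hj => by
      have b0 := fun i hi => And.intro (hb i hi).1 (hb i hi).2.1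
      have b1 := fun i hi => (hb i hi).2.2
      have hc : (K * h : ℕ) ≤ j := by grind
      have f0 := far_apart hD hh h0 b0 hf hi0 hih.le hc
      have f1 := far_apart hD hh h1 b1 hf hi0 hih.le hc
      have f2 := far_apart hD hh h0 b0 hf hi0 hih.le (show _ ≤ j + 1 by omega)
      have f3 := far_apart hD hh h1 b1 hf hi0 hih.le (show _ ≤ j + 1 by omega)
      have f4 := far_apart (i := i + 1) hD hh h0 b0 hf (by omega) (by omega) hc
      have f5 := far_apart (i := i + 1) hD hh h1 b1 hf (by omega) (by omega) hc
      have f6 := far_apart (i := i + 1) hD hh h0 b0 hf (by omega) (by omega)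
        (show _ ≤ j + 1 by omega)
      have f7 := far_apart (i := i + 1) hD hh h1 b1 hf (by omega) (by omega)
        (show _ ≤ j + 1 by omega)
      unfold lo hi
      rcases hD with rfl | rfl
      · left; constructor <;> grind
      · right; constructor <;> grind) hlt hx
  have aux : ∀ y z : ℝ, hi a0 ⌊y⌋ < lo a0 ⌊z⌋ → hi a1 ⌊y⌋ < lo a1 ⌊z⌋ →
      lin (interp a0 a1 s) y < lin (interp a0 a1 s) z := by
    intro y z k0 k1
    simp only [lo, hi, max_lt_iff, lt_min_iff] at k0 k1
    refine lin_between (lin_between' ?_ ?_) (lin_between' ?_ ?_) <;>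
      exact interp_lt hs (by tauto) (by tauto)
  grind

/-- The position of a finger. -/
structure TipData (lab : ℤ → Label) (a0 a1 : ℤ → ℤ) (b : ℤ) : Prop where
  lab1 : lab (b + 1) = lab b
  lab2 : lab (b + 2) = lab b
  eq0 : a0 (b + 2) = a0 (b + 1)
  eq1 : a1 (b + 2) = a1 (b + 1)
  start : a1 b = a0 b
  finish : a1 (b + 3) = a0 (b + 3)
  inner : (a1 (b + 1) = a0 b ∧ ((a0 (b + 1) < a0 b ∧ a0 b < a0 (b + 3)) ∨
        (a0 (b + 3) < a0 b ∧ a0 b < a0 (b + 1)))) ∨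
      (a1 (b + 1) = a0 (b + 3) ∧ ((a0 (b + 1) < a0 (b + 3) ∧ a0 (b + 3) < a0 b) ∨
        (a0 b < a0 (b + 3) ∧ a0 (b + 3) < a0 (b + 1))))

lemma Finger.tipData (hF : Finger h K t m M lab a0 a1) (h0 : ∀ i, a0 (i + h) = a0 i + D)
    (h1 : ∀ i, a1 (i + h) = a1 i + D) (hl : ∀ i, lab (i + h) = lab i) (q : ℤ) :
    TipData lab a0 a1 (t + q * h) := by
  obtain ⟨⟨f1, -⟩, -, ⟨f3, f4⟩, ⟨f5, f6, f7⟩, f8, -⟩ := hF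
  have e : ∀ p : ℤ, (t : ℤ) + q * h + p = t + p + q * h := fun p => by ring
  have sh0 := fun p => shift_mul h0 q (t + p)
  have sh1 := fun p => shift_mul h1 q (t + p)
  have z0 := shift_mul h0 q t
  have z1 := shift_mul h1 q t
  have st : a1 t = a0 t := by grind
  have sp : a1 (t + 3) = a0 (t + 3) := by
    rcases Nat.lt_or_ge (t + 3) h with hlt | hge
    · grind
    grind
  constructor
  · rw [e, lab_mul hl, lab_mul hl, f3]
  · rw [e, lab_mul hl, lab_mul hl, f4]
  · rw [e, e, sh0, sh0, f5]
  · rw [e, e, sh1, sh1, f6]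
  · grind
  · rw [e, sh0, sh1, sp]
  · rw [e, e, sh0, sh1, sh0, z0]
    omega

end finger

section finger
variable {lab : ℤ → Label} {a0 a1 : ℤ → ℤ} {h K t : ℕ} {D m M : ℤ}

lemma Finger.slot (hF : Finger h K t m M lab a0 a1) (hh : 0 < h) (h0 : ∀ i, a0 (i + h) = a0 i + D)
    (h1 : ∀ i, a1 (i + h) = a1 i + D) (hl : ∀ i, lab (i + h) = lab i) (i : ℤ) :
    ((t ≤ i % h ∧ i % h ≤ t + 2) ∧ TipData lab a0 a1 (i - i % h + t)) ∨
      (¬(t ≤ i % h ∧ i % h ≤ t + 2) ∧ a1 i = a0 i ∧ a1 (i + 1) = a0 (i + 1) ∧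
        a0 (i + 1) ≠ a0 i) := by
  have hh' : (0 : ℤ) < h := by grind
  have htd := hF.tipData h0 h1 hl (i / h)
  obtain ⟨⟨f1, -⟩, -, -, -, f8, -⟩ := hF
  have stat : ∀ (q : ℤ) (r : ℕ), r < h → r ≠ t + 1 → r ≠ t + 2 →
      a1 (r + q * h) = a0 (r + q * h) := by
    intro q r hr n1 n2
    rw [shift_mul h0, shift_mul h1]
    grind
  obtain ⟨r, hr⟩ := Int.eq_ofNat_of_zero_le (Int.emod_nonneg i hh'.ne')
  have hrh : r < h := by
    have := Int.emod_lt_of_pos i hh'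
    grind
  have e : i = r + (i / h) * h := by rw [← hr, mul_comm]; exact (Int.emod_add_mul_ediv i h).symm
  rw [hr]
  by_cases hc : (t : ℤ) ≤ r ∧ (r : ℤ) ≤ t + 2
  · grind
  · right
    refine ⟨hc, ?_, ?_, ?_⟩
    · rw [e]; exact stat _ _ hrh (by omega) (by omega)
    · rcases Nat.lt_or_ge (r + 1) h with hlt | hge
      · have := stat (i / h) (r + 1) hlt (by omega) (by omega)
        grind
      · have := stat (i / h + 1) 0 hh (by omega) (by omega)
        grind
    · have := (f8 r hrh).2
      have e1 := shift_mul h0 (i / h) r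
      have e2 := shift_mul h0 (i / h) (r + 1)
      grind

lemma Finger.pair_all (hF : Finger h K t m M lab a0 a1) (hD : D = 160 ∨ D = -160) (hh : 0 < h)
    (h0 : ∀ i, a0 (i + h) = a0 i + D) (hl : ∀ i, lab (i + h) = lab i) {i j : ℤ} (hij : i < j)
    (hn : j - i ≤ ((K + 1) * h : ℕ)) : FingerPair h t lab a0 i j := by
  refine forall_of_shift (P := fun i j => j - i ≤ ((K + 1) * h : ℕ) → FingerPair h t lab a0 i j)
    hh (fun i j => ?_) (fun i j hi0 hih hij hn => ?_) hij hn
  · rw [fingerPair_add hD h0 hl, add_sub_add_right_eq_sub]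
  · obtain ⟨n, rfl⟩ := Int.eq_ofNat_of_zero_le hi0
    obtain ⟨k, hk⟩ := Int.eq_ofNat_of_zero_le (show 0 ≤ j - n - 1 by omega)
    have := hF.2.2.2.2.2 n (by omega) k (by omega)
    grind

/-- The tip of a finger and its vertices. -/
lemma TipData.ne {b : ℤ} (hT : TipData lab a0 a1 b) {s : ℝ} (hs : s ∈ Set.Ioo (0 : ℝ) 1) :
    interp a0 a1 s (b + 1) ≠ interp a0 a1 s b ∧
      interp a0 a1 s (b + 3) ≠ interp a0 a1 s (b + 2) := by
  obtain ⟨-, -, e0, e1, st, sp, inn⟩ := hT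
  have s0 := hs.1
  have s1 : 0 < 1 - s := by grind
  unfold interp
  rw [e0, e1, st, sp]
  set x := a0 b
  set q := a0 (b + 1)
  set y := a0 (b + 3)
  set e := a1 (b + 1)
  have key : ∀ z w : ℤ, ((1 - s) * (z : ℝ) + s * e) = ((1 - s) * w + s * w) → z < w → e ≤ w →
      False := by
    intro z w h1 h2 h3
    have h2' : (z : ℝ) < w := by exact_mod_cast h2
    have h3' : (e : ℝ) ≤ w := by exact_mod_cast h3
    nlinarith
  have key' : ∀ z w : ℤ, ((1 - s) * (z : ℝ) + s * e) = ((1 - s) * w + s * w) → w < z → w ≤ e →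
      False := by
    intro z w h1 h2 h3
    have h2' : (w : ℝ) < z := by exact_mod_cast h2
    have h3' : (w : ℝ) ≤ e := by exact_mod_cast h3
    nlinarith
  grind

lemma tipHeight_eq_zero {i : ℤ} (h : a1 i = a0 i) (s : ℝ) : tipHeight a0 a1 s i = 0 := by
  simp [tipHeight, h]

lemma interp_static {i : ℤ} (h : a1 i = a0 i) (s : ℝ) : interp a0 a1 s i = (a0 i : ℝ) / 40 := by
  unfold interp; rw [h]; ring

lemma TipData.point {b : ℤ} (hT : TipData lab a0 a1 b) {s : ℝ} (hs : s ∈ Set.Ioo (0 : ℝ) 1)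
    {δ : ℤ} (hδ : δ = 0 ∨ δ = 1 ∨ δ = 2) {u : ℝ} (hu : u ∈ Set.Ico (0 : ℝ) 1) :
    ∃ wx wq we wy : ℝ, 0 ≤ wx ∧ 0 ≤ wq ∧ 0 ≤ we ∧ 0 ≤ wy ∧ wx + wq + we + wy = 1 ∧
      interp a0 a1 s (b + δ) + u * (interp a0 a1 s (b + δ + 1) - interp a0 a1 s (b + δ)) =
        wx * (a0 b / 40) + wq * (a0 (b + 1) / 40) + we * (a1 (b + 1) / 40) +
          wy * (a0 (b + 3) / 40) ∧
      ∀ l r, height (tipHeight a0 a1 s) (interp a0 a1 s) (b + δ) u +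
        curv * ((interp a0 a1 s (b + δ) +
            u * (interp a0 a1 s (b + δ + 1) - interp a0 a1 s (b + δ)) - l) *
          (interp a0 a1 s (b + δ) +
            u * (interp a0 a1 s (b + δ + 1) - interp a0 a1 s (b + δ)) - r)) =
        curv * (wx * ((a0 b / 40 - l) * (a0 b / 40 - r)) +
          wq * ((a0 (b + 1) / 40 - l) * (a0 (b + 1) / 40 - r)) +
          we * ((a1 (b + 1) / 40 - l) * (a1 (b + 1) / 40 - r)) +
          wy * ((a0 (b + 3) / 40 - l) * (a0 (b + 3) / 40 - r))) := by
  refine finger_point (a := interp a0 a1 s) (ρ := tipHeight a0 a1 s) hs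
    (interp_static hT.start s) ?_ ?_ (interp_static hT.finish s)
    (tipHeight_eq_zero hT.start s) ?_ ?_ (tipHeight_eq_zero hT.finish s) hδ hu
  · unfold interp; ring
  · unfold interp; rw [hT.eq0, hT.eq1]; ring
  · unfold tipHeight; ring
  · unfold tipHeight; rw [hT.eq0, hT.eq1]; ring

/-- Different arcs of the same finger meet only at the tip. -/
lemma TipData.same {b : ℤ} (hT : TipData lab a0 a1 b) {s : ℝ} (hs : s ∈ Set.Ioo (0 : ℝ) 1)
    {x x' : ℝ} (hx : b ≤ ⌊x⌋) (hlt : ⌊x⌋ < ⌊x'⌋) (hx' : ⌊x'⌋ ≤ b + 2)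
    (ea : lin (interp a0 a1 s) x = lin (interp a0 a1 s) x')
    (er : height (tipHeight a0 a1 s) (interp a0 a1 s) ⌊x⌋ (Int.fract x) =
      height (tipHeight a0 a1 s) (interp a0 a1 s) ⌊x'⌋ (Int.fract x')) :
    lin (travel (interp a0 a1 s)) x = lin (travel (interp a0 a1 s)) x' := by
  obtain ⟨n1, n2⟩ := hT.ne hs
  have e12 : interp a0 a1 s (b + 2) = interp a0 a1 s (b + 1) := by
    unfold interp; rw [hT.eq0, hT.eq1]
  have u1 : 0 < 1 - Int.fract x := by linarith [Int.fract_lt_one x]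
  have s1 : 0 < 1 - s := by grind
  have c0 : curv ≠ 0 := by norm_num [curv]
  have first : ⌊x⌋ = b → lin (interp a0 a1 s) x = interp a0 a1 s (b + 1) → False := by
    intro h1 h2
    unfold lin at h2
    grind
  have last : ⌊x'⌋ = b + 2 → Int.fract x' = 0 → lin (interp a0 a1 s) x' = interp a0 a1 s (b + 1) := by
    intro h1 h2
    unfold lin
    grind
  rcases (show ⌊x⌋ = b ∨ ⌊x⌋ = b + 1 by omega) with k | k
  · exfalso
    rcases (show ⌊x'⌋ = b + 1 ∨ ⌊x'⌋ = b + 2 by omega) with k' | k'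
    · refine first k ?_
      rw [ea]; unfold lin
      grind
    · rw [k, k'] at er
      have ha0 : lin (interp a0 a1 s) x = interp a0 a1 s b +
          Int.fract x * (interp a0 a1 s (b + 1) - interp a0 a1 s b) := by unfold lin; rw [k]
      have ha1 : lin (interp a0 a1 s) x' = interp a0 a1 s (b + 1) +
          Int.fract x' * (interp a0 a1 s (b + 3) - interp a0 a1 s (b + 1)) := by unfold lin; grind
      simp only [height] at er
      rw [show b + 2 + 1 = b + 3 by ring, tipHeight_eq_zero hT.start, tipHeight_eq_zero hT.finish,
        e12] at er
      have t2 : tipHeight a0 a1 s (b + 2) = tipHeight a0 a1 s (b + 1) := by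
        unfold tipHeight; rw [hT.eq0, hT.eq1]
      have t1 : tipHeight a0 a1 s (b + 1) = curv * (s * (1 - s)) *
        ((a1 (b + 1) : ℝ) / 40 - a0 (b + 1) / 40) ^ 2 := by unfold tipHeight; ring
      have p0 := interp_static hT.start s
      have p1 : interp a0 a1 s (b + 1) = (1 - s) * (a0 (b + 1) / 40) + s * (a1 (b + 1) / 40) := by
        unfold interp; ring
      have p3 := interp_static hT.finish s
      rw [t2, t1] at er
      have ea' := ea
      rw [ha0, ha1] at ea'
      rw [p0, p1, p3] at er ea'
      set X := (a0 b : ℝ) / 40 with hX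
      set Q := (a0 (b + 1) : ℝ) / 40 with hQ
      set E := (a1 (b + 1) : ℝ) / 40 with hE
      set Y := (a0 (b + 3) : ℝ) / 40 with hY
      set u := Int.fract x
      set v := Int.fract x'
      have ne_of : ∀ {p q : ℤ}, p ≠ q → (p : ℝ) / 40 - q / 40 ≠ 0 := by
        intro p q hpq h
        apply hpq
        have : (p : ℝ) = q := by linarith
        exact_mod_cast this
      rcases hT.inner with ⟨i1, i2⟩ | ⟨i1, i2⟩
      · have hEX : E = X := by grind
        have d1 : Y - Q ≠ 0 := ne_of (by omega)
        have d2 : Y - X ≠ 0 := ne_of (by omega)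
        have : curv * (v * ((Y - Q) * (Y - X))) = 0 := by
          rw [hEX] at er ea'
          linear_combination -er - curv * ((X + u * ((1 - s) * Q + s * X - X)) +
            ((1 - s) * Q + s * X + v * (Y - ((1 - s) * Q + s * X))) - Q - X) * ea'
        have hv : v = 0 := by
          rcases mul_eq_zero.1 this with h | h
          · grind
          · rcases mul_eq_zero.1 h with h | h
            · exact h
            · exact absurd h (mul_ne_zero d1 d2)
        grind
      · have hEY : E = Y := by grind
        have d1 : X - Q ≠ 0 := ne_of (by omega)
        have d2 : X - Y ≠ 0 := ne_of (by omega)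
        have : curv * ((1 - u) * ((X - Q) * (X - Y))) = 0 := by
          rw [hEY] at er ea'
          linear_combination er + curv * ((X + u * ((1 - s) * Q + s * Y - X)) +
            ((1 - s) * Q + s * Y + v * (Y - ((1 - s) * Q + s * Y))) - Q - Y) * ea'
        rcases mul_eq_zero.1 this with h | h
        · grind
        · rcases mul_eq_zero.1 h with h | h
          · exact u1.ne' h
          · exact mul_ne_zero d1 d2 h
  · have k' : ⌊x'⌋ = b + 2 := by omega
    have hx1 : lin (interp a0 a1 s) x = interp a0 a1 s (b + 1) := by unfold lin; grind
    have hv : Int.fract x' = 0 := by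
      rw [hx1] at ea
      unfold lin at ea
      grind
    have tr : travel (interp a0 a1 s) (b + 2) = travel (interp a0 a1 s) (b + 1) := by
      have := travel_succ (interp a0 a1 s) (b + 1)
      grind
    unfold lin
    grind

lemma fingerOff_sum {b k : ℤ} (h : FingerOff a0 b k) {e : ℤ} (he : e = a0 b ∨ e = a0 (b + 3))
    {wx wq we wy : ℝ} (h1 : 0 ≤ wx) (h2 : 0 ≤ wq) (h3 : 0 ≤ we) (h4 : 0 ≤ wy)
    (hw : wx + wq + we + wy = 1) :
    wx * (((a0 b : ℝ) / 40 - a0 k / 40) * (a0 b / 40 - a0 (k + 1) / 40)) +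
      wq * (((a0 (b + 1) : ℝ) / 40 - a0 k / 40) * (a0 (b + 1) / 40 - a0 (k + 1) / 40)) +
      we * (((e : ℝ) / 40 - a0 k / 40) * (e / 40 - a0 (k + 1) / 40)) +
      wy * (((a0 (b + 3) : ℝ) / 40 - a0 k / 40) * (a0 (b + 3) / 40 - a0 (k + 1) / 40)) ≠ 0 := by
  have pos : ∀ p : ℤ, (p < lo a0 k ∨ hi a0 k < p) →
      0 < ((p : ℝ) / 40 - a0 k / 40) * (p / 40 - a0 (k + 1) / 40) := by
    intro p hp
    simp only [lo, hi, lt_min_iff, max_lt_iff] at hp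
    rcases hp with ⟨p1, p2⟩ | ⟨p1, p2⟩
    · have p1' : (p : ℝ) < a0 k := by exact_mod_cast p1
      have p2' : (p : ℝ) < a0 (k + 1) := by exact_mod_cast p2
      nlinarith
    · have p1' : (a0 k : ℝ) < p := by exact_mod_cast p1
      have p2' : (a0 (k + 1) : ℝ) < p := by exact_mod_cast p2
      nlinarith
  have neg : ∀ p : ℤ, (lo a0 k < p ∧ p < hi a0 k) →
      ((p : ℝ) / 40 - a0 k / 40) * (p / 40 - a0 (k + 1) / 40) < 0 := by
    intro p hp
    simp only [lo, hi, lt_max_iff, min_lt_iff] at hp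
    rcases hp with ⟨p1 | p1, p2 | p2⟩
    · omega
    · have p1' : (a0 k : ℝ) < p := by exact_mod_cast p1
      have p2' : (p : ℝ) < a0 (k + 1) := by exact_mod_cast p2
      nlinarith
    · have p1' : (a0 (k + 1) : ℝ) < p := by exact_mod_cast p1
      have p2' : (p : ℝ) < a0 k := by exact_mod_cast p2
      nlinarith
    · omega
  have sum_pos : ∀ A B C E : ℝ, 0 < A → 0 < B → 0 < C → 0 < E →
      0 < wx * A + wq * B + we * C + wy * E := by
    intro A B C E hA hB hC hE
    set mn := min (min A B) (min C E)
    have hm : 0 < mn := lt_min (lt_min hA hB) (lt_min hC hE)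
    have a1 : mn ≤ A := (min_le_left _ _).trans (min_le_left _ _)
    have a2 : mn ≤ B := (min_le_left _ _).trans (min_le_right _ _)
    have a3 : mn ≤ C := (min_le_right _ _).trans (min_le_left _ _)
    have a4 : mn ≤ E := (min_le_right _ _).trans (min_le_right _ _)
    have : wx * mn + wq * mn + we * mn + wy * mn ≤ wx * A + wq * B + we * C + wy * E := by gcongr
    have : wx * mn + wq * mn + we * mn + wy * mn = mn := by grind
    linarith
  rcases h with ⟨q1, q2, q3⟩ | ⟨q1, q2, q3⟩
  · have : e < lo a0 k ∨ hi a0 k < e := by grind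
    exact (sum_pos _ _ _ _ (pos _ q1) (pos _ q2) (pos _ this) (pos _ q3)).ne'
  · have : lo a0 k < e ∧ e < hi a0 k := by grind
    have := sum_pos _ _ _ _ (neg_pos.2 (neg _ q1)) (neg_pos.2 (neg _ q2)) (neg_pos.2 (neg _ this))
      (neg_pos.2 (neg _ q3))
    grind

end finger

section finger
variable {lab : ℤ → Label} {a0 a1 : ℤ → ℤ} {h K t : ℕ} {D m M : ℤ}

lemma TipData.tip_ne {b : ℤ} (hT : TipData lab a0 a1 b) : a1 (b + 1) ≠ a0 (b + 1) := by
  have := hT.inner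
  omega

lemma tipHeight_nonneg {s : ℝ} (hs : s ∈ Set.Icc (0 : ℝ) 1) (i : ℤ) : 0 ≤ tipHeight a0 a1 s i := by
  have := hs.1
  have : 0 ≤ 1 - s := by grind
  have : 0 < curv := by norm_num [curv]
  unfold tipHeight
  positivity

lemma TipData.tip_pos {b : ℤ} (hT : TipData lab a0 a1 b) {s : ℝ} (hs : s ∈ Set.Ioo (0 : ℝ) 1) :
    0 < tipHeight a0 a1 s (b + 1) ∧ 0 < tipHeight a0 a1 s (b + 2) := by
  have t2 : tipHeight a0 a1 s (b + 2) = tipHeight a0 a1 s (b + 1) := by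
    unfold tipHeight; rw [hT.eq0, hT.eq1]
  rw [t2, and_self]
  have := hs.1
  have : 0 < 1 - s := by grind
  have : 0 < curv := by norm_num [curv]
  have h1 : ((a1 (b + 1) : ℝ) - a0 (b + 1)) ≠ 0 := by rw [sub_ne_zero]; exact_mod_cast hT.tip_ne
  unfold tipHeight
  positivity

/-- The fingers touch the unit circle in static vertices only. -/
lemma Finger.static_of_zero (hF : Finger h K t m M lab a0 a1) (hh : 0 < h)
    (h0 : ∀ i, a0 (i + h) = a0 i + D) (h1 : ∀ i, a1 (i + h) = a1 i + D)
    (hl : ∀ i, lab (i + h) = lab i) {s : ℝ} (hs : s ∈ Set.Ioo (0 : ℝ) 1) {i : ℤ} {u : ℝ}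
    (hu : u ∈ Set.Ico (0 : ℝ) 1)
    (hz : height (tipHeight a0 a1 s) (interp a0 a1 s) i u = 0) :
    u = 0 ∧ a1 i = a0 i ∧ i % h ≠ t + 1 ∧ i % h ≠ t + 2 := by
  have hn := fun i => tipHeight_nonneg (a0 := a0) (a1 := a1) ⟨hs.1.le, hs.2.le⟩ i
  have u0 := hu.1
  have u1 : 0 < 1 - u := by grind
  have c0 : 0 < curv := by norm_num [curv]
  have e : height (tipHeight a0 a1 s) (interp a0 a1 s) i u =
      (1 - u) * tipHeight a0 a1 s i + u * tipHeight a0 a1 s (i + 1) +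
        curv * (u * (1 - u)) * (interp a0 a1 s (i + 1) - interp a0 a1 s i) ^ 2 := by
    unfold height; ring
  have p1 := mul_nonneg u1.le (hn i)
  have p2 := mul_nonneg u0 (hn (i + 1))
  have p3 : 0 ≤ curv * (u * (1 - u)) * (interp a0 a1 s (i + 1) - interp a0 a1 s i) ^ 2 := by
    positivity
  have z1 : (1 - u) * tipHeight a0 a1 s i = 0 := by linarith
  have z2 : u * tipHeight a0 a1 s (i + 1) = 0 := by linarith
  have z3 : curv * (u * (1 - u)) * (interp a0 a1 s (i + 1) - interp a0 a1 s i) ^ 2 = 0 := by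
    linarith
  have z1' := (mul_eq_zero.1 z1).resolve_left u1.ne'
  rcases hF.slot hh h0 h1 hl i with ⟨k1, k2⟩ | ⟨k1, k2, k3, k4⟩
  · obtain ⟨q1, q2⟩ := k2.tip_pos hs
    rcases (show i % h = t ∨ i % h = t + 1 ∨ i % h = t + 2 by omega) with k | k | k
    · rw [k, sub_add_cancel] at q1 k2
      refine ⟨(mul_eq_zero.1 z2).resolve_right q1.ne', k2.start, by omega, by omega⟩
    · rw [show i - i % h + t + 1 = i by omega] at q1
      exact absurd z1' q1.ne'
    · rw [show i - i % h + t + 2 = i by omega] at q2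
      exact absurd z1' q2.ne'
  · refine ⟨?_, k2, by omega, by omega⟩
    have : (interp a0 a1 s (i + 1) - interp a0 a1 s i) ^ 2 ≠ 0 := by
      refine pow_ne_zero _ ?_
      rw [interp_static k2, interp_static k3]
      have : (a0 (i + 1) : ℝ) ≠ a0 i := by exact_mod_cast k4
      intro h; apply this; linarith
    have z := (mul_eq_zero.1 z3).resolve_right this
    have z := (mul_eq_zero.1 z).resolve_left c0.ne'
    exact (mul_eq_zero.1 z).resolve_right u1.ne'

lemma weighted_le {p q r s x y z w c : ℝ} (hp : 0 ≤ p) (hq : 0 ≤ q) (hr : 0 ≤ r) (hs : 0 ≤ s)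
    (h : p + q + r + s = 1) (hx : x ≤ c) (hy : y ≤ c) (hz : z ≤ c) (hw : w ≤ c) :
    p * x + q * y + r * z + s * w ≤ c := by
  calc p * x + q * y + r * z + s * w ≤ p * c + q * c + r * c + s * c := by gcongr
    _ = c := by rw [← add_mul, ← add_mul, ← add_mul, h, one_mul]

lemma le_weighted {p q r s x y z w c : ℝ} (hp : 0 ≤ p) (hq : 0 ≤ q) (hr : 0 ≤ r) (hs : 0 ≤ s)
    (h : p + q + r + s = 1) (hx : c ≤ x) (hy : c ≤ y) (hz : c ≤ z) (hw : c ≤ w) :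
    c ≤ p * x + q * y + r * z + s * w := by
  linarith [weighted_le hp hq hr hs h (neg_le_neg hx) (neg_le_neg hy) (neg_le_neg hz)
    (neg_le_neg hw)]

lemma Finger.isChain (hF : Finger h K t m M lab a0 a1) (hm0 : Motion h K D m M lab a0 a0)
    (hm1 : Motion h K D m M lab a1 a1) (hD : D = 160 ∨ D = -160)
    (h0 : ∀ i, a0 (i + h) = a0 i + D) (h1 : ∀ i, a1 (i + h) = a1 i + D)
    (hl : ∀ i, lab (i + h) = lab i) {s : ℝ} (hs : s ∈ Set.Ioo (0 : ℝ) 1) :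
    IsChain lab (tipHeight a0 a1 s) (interp a0 a1 s) (2 * h) (D / 160) := by
  have hh := hm0.pos
  have hs' : s ∈ Set.Icc (0 : ℝ) 1 := ⟨hs.1.le, hs.2.le⟩
  have hs1 : 0 < 1 - s := by linarith [hs.2]
  have hloc : ∀ i, LocalOK lab a0 a0 i := localOK_of hD hh h0 h0 hl fun i hi0 hih => by
    obtain ⟨n, rfl⟩ := Int.eq_ofNat_of_zero_le hi0
    exact hm0.loc n (by omega)
  have hloc1 : ∀ i, LocalOK lab a1 a1 i := localOK_of hD hh h1 h1 hl fun i hi0 hih => by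
    obtain ⟨n, rfl⟩ := Int.eq_ofNat_of_zero_le hi0
    exact hm1.loc n (by omega)
  have p0 : ∀ i, a0 (i + 2 * h) = a0 i + 2 * D := fun i => by
    rw [show i + 2 * (h : ℤ) = i + h + h by ring, h0, h0]; ring
  have p1 : ∀ i, a1 (i + 2 * h) = a1 i + 2 * D := fun i => by
    rw [show i + 2 * (h : ℤ) = i + h + h by ring, h1, h1]; ring
  have c0 : 0 < curv := by norm_num [curv]
  have hsl := hF.slot hh h0 h1 hl
  have hrho : ∀ i, 0 ≤ tipHeight a0 a1 s i := tipHeight_nonneg hs'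
  have hbase := (hm0.isChain hD h0 h0 hl (s := 0) (by simp)).glue
  refine ⟨?_, ?_, ?_, ?_, ?_, hrho, ?_, ?_, ?_⟩
  · intro i
    unfold interp
    rw [p0, p1]
    have : (D : ℝ) = 160 * (D / 160 : ℤ) := by rcases hD with rfl | rfl <;> norm_num
    push_cast at this ⊢
    rw [this]; ring
  · intro i
    unfold tipHeight
    rw [p0, p1]; push_cast; ring
  · intro i
    rw [show i + 2 * (h : ℤ) = i + h + h by ring, hl, hl]
  · intro i
    have stat : a1 i = a0 i → pt (lab (i - 1)).1 (lab (i - 1)).2 (tipHeight a0 a1 s i)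
        (interp a0 a1 s i) = pt (lab i).1 (lab i).2 (tipHeight a0 a1 s i) (interp a0 a1 s i) := by
      intro e
      rw [tipHeight_eq_zero e, interp_static e]
      have := hbase i
      rw [interp_static rfl] at this
      exact this
    rcases hsl i with ⟨k1, k2⟩ | ⟨k1, k2, k3, k4⟩
    · rcases (show i % h = t ∨ i % h = t + 1 ∨ i % h = t + 2 by omega) with k | k | k
      · rw [k, sub_add_cancel] at k2
        exact stat k2.start
      · have := k2.lab1
        rw [show i - i % h + t + 1 = i by omega, show i - i % h + t = i - 1 by omega] at this
        rw [this]
      · have e1 := k2.lab1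
        have e2 := k2.lab2
        rw [show i - i % h + t + 2 = i by omega] at e2
        rw [show i - i % h + t + 1 = i - 1 by omega] at e1
        rw [e1, e2]
    · exact stat k2
  · intro i e
    rcases hsl i with ⟨k1, k2⟩ | ⟨k1, k2, k3, k4⟩
    · obtain ⟨n1, n2⟩ := k2.ne hs
      rcases (show i % h = t ∨ i % h = t + 1 ∨ i % h = t + 2 by omega) with k | k | k
      · rw [show i - i % h + t + 1 = i + 1 by omega, show i - i % h + t = i by omega] at n1
        exact absurd e n1
      · have e1 := k2.eq0
        have e2 := k2.eq1
        rw [show i - i % h + t + 1 = i by omega, show i - i % h + t + 2 = i + 1 by omega] at e1 e2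
        unfold tipHeight
        rw [e1, e2]
      · rw [show i - i % h + t + 3 = i + 1 by omega, show i - i % h + t + 2 = i by omega] at n2
        exact absurd e n2
    · rw [tipHeight_eq_zero k2, tipHeight_eq_zero k3]
  · intro i
    have hd : |a1 i - a0 i| ≤ 400 := by
      rcases hsl i with ⟨k1, k2⟩ | ⟨k1, k2, k3, k4⟩
      · have l0 := (hloc (i - i % h + t)).2.2.2.2.2.2.1
        have l2 := (hloc (i - i % h + t + 2)).2.2.2.2.2.2.1
        have i1 := k2.inner
        have i2 := k2.eq0
        have i3 := k2.eq1
        have i4 := k2.start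
        rw [show i - i % h + t + 2 + 1 = i - i % h + t + 3 by ring] at l2
        rcases (show i % h = t ∨ i % h = t + 1 ∨ i % h = t + 2 by omega) with k | k | k
        · rw [k, sub_add_cancel] at i4
          rw [i4]; simp
        · rw [show i - i % h + t + 1 = i by omega] at *
          rw [abs_le] at *
          omega
        · rw [show i - i % h + t + 2 = i by omega] at *
          rw [abs_le] at *
          omega
      · rw [k2]; simp
    have hd' : |(a1 i : ℝ) - a0 i| ≤ 400 := by exact_mod_cast hd
    have h2 : ((a1 i : ℝ) - a0 i) ^ 2 ≤ 400 ^ 2 := sq_le_sq' (abs_le.1 hd').1 (abs_le.1 hd').2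
    have h3 : s * (1 - s) ≤ 1 / 4 := by nlinarith [sq_nonneg (s - 1 / 2)]
    have h4 : (((a1 i : ℝ) - a0 i) / 40) ^ 2 ≤ 100 := by rw [div_pow]; linarith
    unfold tipHeight curv
    have h5 : s * (1 - s) * (((a1 i : ℝ) - a0 i) / 40) ^ 2 ≤ 1 / 4 * 100 :=
      mul_le_mul h3 h4 (sq_nonneg _) (by norm_num)
    linarith
  · intro i
    have c1 := (hloc i).2.2.2.2.2.2.1
    have c2 := (hloc1 i).2.2.2.2.2.2.1
    have c1' : |(a0 (i + 1) : ℝ) - a0 i| ≤ 400 := by exact_mod_cast c1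
    have c2' : |(a1 (i + 1) : ℝ) - a1 i| ≤ 400 := by exact_mod_cast c2
    unfold interp
    rw [abs_le] at *
    constructor <;> nlinarith [hs.1, hs.2]
  · intro x x' hlt e ea
    have f0 : Int.fract x ∈ Set.Ico (0 : ℝ) 1 := ⟨Int.fract_nonneg x, Int.fract_lt_one x⟩
    have g0 : Int.fract x' ∈ Set.Ico (0 : ℝ) 1 := ⟨Int.fract_nonneg x', Int.fract_lt_one x'⟩
    have hx : lin (interp a0 a1 s) x = interp a0 a1 s ⌊x⌋ +
        Int.fract x * (interp a0 a1 s (⌊x⌋ + 1) - interp a0 a1 s ⌊x⌋) := rfl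
    have hx' : lin (interp a0 a1 s) x' = interp a0 a1 s ⌊x'⌋ +
        Int.fract x' * (interp a0 a1 s (⌊x'⌋ + 1) - interp a0 a1 s ⌊x'⌋) := rfl
    by_cases hfar : ((K + 1) * h : ℕ) < ⌊x'⌋ - ⌊x⌋
    · exact absurd ea (lin_interp_far hD hh h0 h1 hF.1.2 hF.2.1 hs' hfar)
    push Not at hfar
    obtain ⟨d1, d2⟩ := hF.pair_all hD hh h0 hl hlt hfar
    have n0 := height_nonneg hrho (a := interp a0 a1 s) ⌊x⌋ f0.1 f0.2.le
    have n1 := height_nonneg hrho (a := interp a0 a1 s) ⌊x'⌋ g0.1 g0.2.le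
    rw [chain_eq, chain_eq] at e
    obtain ⟨er, -, e1, e2⟩ := pt_inj n0 n1 e
    rcases n0.eq_or_lt with hz | hpos
    · exfalso
      obtain ⟨z1, z2, z3, z4⟩ := hF.static_of_zero hh h0 h1 hl hs f0 hz.symm
      obtain ⟨y1, y2, y3, y4⟩ := hF.static_of_zero hh h0 h1 hl hs g0 (er ▸ hz.symm)
      have hxa : lin (interp a0 a1 s) x = (a0 ⌊x⌋ : ℝ) / 40 := by
        rw [hx, z1, interp_static z2]; ring
      have hxa' : lin (interp a0 a1 s) x' = (a0 ⌊x'⌋ : ℝ) / 40 := by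
        rw [hx', y1, interp_static y2]; ring
      rcases d1 with d | d | d | d | d | ⟨d, d'⟩
      · exact z3 d
      · exact z4 d
      · exact y3 d
      · exact y4 d
      · apply d
        rw [hxa, hxa'] at ea
        have : (a0 ⌊x⌋ : ℝ) = a0 ⌊x'⌋ := by linarith
        exact_mod_cast this
      · apply d
        refine e2 hz.symm _ ?_
        rw [hxa]
        have q1 : 40 * (a0 ⌊x⌋ / 40) < a0 ⌊x⌋ := by omega
        have q2 : a0 ⌊x⌋ < 40 * (a0 ⌊x⌋ / 40) + 40 := by omega
        have q1' : (40 : ℝ) * (a0 ⌊x⌋ / 40 : ℤ) < a0 ⌊x⌋ := by exact_mod_cast q1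
        have q2' : (a0 ⌊x⌋ : ℝ) < 40 * (a0 ⌊x⌋ / 40 : ℤ) + 40 := by exact_mod_cast q2
        constructor <;> linarith
    · obtain ⟨l1, l2⟩ := e1 hpos
      have hlab : lab ⌊x⌋ = lab ⌊x'⌋ := Prod.ext l1 l2
      have off : ∀ i j : ℤ, ∀ u v : ℝ, u ∈ Set.Ico (0 : ℝ) 1 →
          (t ≤ i % h ∧ i % h ≤ t + 2) → TipData lab a0 a1 (i - i % h + t) →
          a1 j = a0 j → a1 (j + 1) = a0 (j + 1) → FingerOff a0 (i - i % h + t) j →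
          interp a0 a1 s i + u * (interp a0 a1 s (i + 1) - interp a0 a1 s i) =
            interp a0 a1 s j + v * (interp a0 a1 s (j + 1) - interp a0 a1 s j) →
          height (tipHeight a0 a1 s) (interp a0 a1 s) i u =
            height (tipHeight a0 a1 s) (interp a0 a1 s) j v → False := by
        intro i j u v hu hi hT s1 s2 hoff ea er
        obtain ⟨wx, wq, we, wy, w1, w2, w3, w4, w5, -, w6⟩ := hT.point hs
          (δ := i % h - t) (by omega) hu
        have ht := w6 (a0 j / 40) (a0 (j + 1) / 40)
        rw [show i - i % h + t + (i % h - t) = i by ring] at ht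
        have he : a1 (i - i % h + t + 1) = a0 (i - i % h + t) ∨
            a1 (i - i % h + t + 1) = a0 (i - i % h + t + 3) := by have := hT.inner; omega
        have hne := fingerOff_sum hoff he w1 w2 w3 w4 w5
        apply hne
        rw [er, ea, interp_static s1, interp_static s2] at ht
        have hj : height (tipHeight a0 a1 s) (interp a0 a1 s) j v =
            curv * (v * (1 - v)) * ((a0 (j + 1) : ℝ) / 40 - a0 j / 40) ^ 2 := by
          unfold height
          rw [tipHeight_eq_zero s1, tipHeight_eq_zero s2, interp_static s1, interp_static s2]
          ring
        rw [hj] at ht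
        refine (mul_eq_zero.1 (ht.symm.trans ?_)).resolve_left c0.ne'
        ring
      have sep : ∀ i j : ℤ, ∀ u v : ℝ, u ∈ Set.Ico (0 : ℝ) 1 → v ∈ Set.Ico (0 : ℝ) 1 →
          (t ≤ i % h ∧ i % h ≤ t + 2) → TipData lab a0 a1 (i - i % h + t) →
          (t ≤ j % h ∧ j % h ≤ t + 2) → TipData lab a0 a1 (j - j % h + t) →
          (∀ p ∈ [0, 1, 3], ∀ q ∈ [0, 1, 3],
            a0 (i - i % h + t + p) < a0 (j - j % h + t + q)) →
          interp a0 a1 s i + u * (interp a0 a1 s (i + 1) - interp a0 a1 s i) ≠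
            interp a0 a1 s j + v * (interp a0 a1 s (j + 1) - interp a0 a1 s j) := by
        intro i j u v hu hv hi hT hj hT' hlt ea
        obtain ⟨wx, wq, we, wy, w1, w2, w3, w4, w5, w6, -⟩ := hT.point hs
          (δ := i % h - t) (by omega) hu
        obtain ⟨vx, vq, ve, vy, v1, v2, v3, v4, v5, v6, -⟩ := hT'.point hs
          (δ := j % h - t) (by omega) hv
        rw [show i - i % h + t + (i % h - t) = i by ring] at w6
        rw [show j - j % h + t + (j % h - t) = j by ring] at v6
        rw [w6, v6] at ea
        simp only [List.mem_cons, List.not_mem_nil, or_false, forall_eq_or_imp, forall_eq,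
          add_zero] at hlt
        have i1 := hT.inner
        have i2 := hT'.inner
        set b := i - i % h + t
        set b' := j - j % h + t
        obtain ⟨c, hc1, hc2, hc3, hc4, hc5, hc6, hc7, hc8⟩ : ∃ c : ℤ, a0 b ≤ c ∧ a0 (b + 1) ≤ c ∧
            a1 (b + 1) ≤ c ∧ a0 (b + 3) ≤ c ∧ c < a0 b' ∧ c < a0 (b' + 1) ∧ c < a1 (b' + 1) ∧
            c < a0 (b' + 3) := by
          refine ⟨max (max (a0 b) (a0 (b + 1))) (a0 (b + 3)), ?_⟩
          simp only [le_max_iff, max_lt_iff]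
          omega
        have up : ∀ {z w : ℤ}, z ≤ w → (z : ℝ) / 40 ≤ w / 40 := fun h => by gcongr
        have A := weighted_le w1 w2 w3 w4 w5 (up hc1) (up hc2) (up hc3) (up hc4)
        have B := le_weighted v1 v2 v3 v4 v5 (up (Int.add_one_le_of_lt hc5))
          (up (Int.add_one_le_of_lt hc6)) (up (Int.add_one_le_of_lt hc7))
          (up (Int.add_one_le_of_lt hc8))
        push_cast at B
        linarith
      rw [hx, hx'] at ea
      rcases hsl ⌊x⌋ with ⟨k1, k2⟩ | ⟨k1, k2, k3, k4⟩ <;>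
        rcases hsl ⌊x'⌋ with ⟨k1', k2'⟩ | ⟨k1', k2', k3', k4'⟩
      · rw [if_pos k1, if_pos k1'] at d2
        rcases d2 with d | d | d
        · refine k2.same hs (by omega) hlt (by omega) (by rw [hx, hx', ea]) er
        · exact absurd ea (sep _ _ _ _ f0 g0 k1 k2 k1' k2' d)
        · exact absurd ea.symm (sep _ _ _ _ g0 f0 k1' k2' k1 k2 fun p hp q hq => d q hq p hp)
      · rw [if_pos k1, if_neg k1'] at d2
        exact (off _ _ _ _ f0 k1 k2 k2' k3' (d2.resolve_left fun h => h hlab) ea er).elim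
      · rw [if_neg k1, if_pos k1'] at d2
        exact (off _ _ _ _ g0 k1' k2' k2 k3 (d2.resolve_left fun h => h hlab) ea.symm er.symm).elim
      · rw [if_neg k1, if_neg k1'] at d2
        exfalso
        have hst : ∀ i u, a1 i = a0 i → a1 (i + 1) = a0 (i + 1) →
            height (tipHeight a0 a1 s) (interp a0 a1 s) i u = height 0 (interp a0 a0 0) i u := by
          intro i u q1 q2
          unfold height
          rw [tipHeight_eq_zero q1, tipHeight_eq_zero q2, interp_static q1, interp_static q2,
            interp_static rfl, interp_static rfl]
          simp
        have hst' : ∀ i u, a1 i = a0 i → a1 (i + 1) = a0 (i + 1) →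
            interp a0 a1 s i + u * (interp a0 a1 s (i + 1) - interp a0 a1 s i) =
            interp a0 a0 0 i + u * (interp a0 a0 0 (i + 1) - interp a0 a0 0 i) := by
          intro i u q1 q2
          rw [interp_static q1, interp_static q2, interp_static rfl, interp_static rfl]
        rw [hst _ _ k2 k3] at er hpos
        rw [hst _ _ k2' k3'] at er
        rw [hst' _ _ k2 k3, hst' _ _ k2' k3'] at ea
        exact arcOK_height (s := 0) (by simp) d2 (hloc _) (hloc _) f0 g0 ea er hpos hlab

theorem lineIso_of_finger (hF : Finger h K t m M lab a0 a1) (hm0 : Motion h K D m M lab a0 a0)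
    (hm1 : Motion h K D m M lab a1 a1) (hD : D = 160 ∨ D = -160)
    (h0 : ∀ i, a0 (i + h) = a0 i + D) (h1 : ∀ i, a1 (i + h) = a1 i + D)
    (hl : ∀ i, lab (i + h) = lab i) :
    LineIso (2 * h : ℤ) (2 * h : ℤ) (chain lab 0 fun i => (a0 i : ℝ) / 40)
      (chain lab 0 fun i => (a1 i : ℝ) / 40) := by
  have t0 : tipHeight a0 a1 0 = 0 := by funext i; simp [tipHeight]
  have t1 : tipHeight a0 a1 1 = 0 := by funext i; simp [tipHeight]
  have hh : 0 < 2 * (h : ℤ) := by have := hm0.pos; omega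
  have key := lineIso_of_chains (lab := lab) (ρ := tipHeight a0 a1) (a := interp a0 a1) hh
    (sq_of_shift hD) (fun i => continuous_interp a0 a1 i)
    (fun i => by unfold tipHeight; fun_prop) (fun s hs => ?_)
  · rwa [t0, t1, interp_zero, interp_one] at key
  · rcases hs.1.eq_or_lt with h' | h'
    · subst h'
      rw [t0, interp_zero, ← interp_zero a0 a0]
      exact hm0.isChain hD h0 h0 hl (by simp)
    rcases hs.2.eq_or_lt with h'' | h''
    · subst h''
      rw [t1, interp_one, ← interp_one a1 a1]
      exact hm1.isChain hD h1 h1 hl (by simp)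
    · exact hF.isChain hm0 hm1 hD h0 h1 hl ⟨h', h''⟩

theorem word_finger {lab : List Label} {p0 p1 : List ℤ} (hD : D = 160 ∨ D = -160)
    (hm0 : Motion h K D m M (extendLab h lab) (extend h D p0) (extend h D p0))
    (hm1 : Motion h K D m M (extendLab h lab) (extend h D p1) (extend h D p1))
    (hF : Finger h K t m M (extendLab h lab) (extend h D p0) (extend h D p1)) :
    LineIso (2 * h : ℤ) (2 * h : ℤ) (word h D lab p0) (word h D lab p1) :=
  lineIso_of_finger hF hm0 hm1 hD (extend_add hm0.pos _ _) (extend_add hm0.pos _ _)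
    (extendLab_add _ _)

end finger

/-! ### Curves made of graphs -/

/-- A continuous injective function on an interval has a continuous inverse. -/
lemma exists_section {f : ℝ → ℝ} {p q : ℝ} (hpq : p ≤ q) (hc : Continuous f)
    (hi : Set.InjOn f (Set.Icc p q)) :
    ∃ g : ℝ → ℝ, ContinuousOn g (Set.uIcc (f p) (f q)) ∧
      ∀ a ∈ Set.uIcc (f p) (f q), g a ∈ Set.Icc p q ∧ f (g a) = a := by
  have hemb : Topology.IsClosedEmbedding fun u : Set.Icc p q => f u :=
    Continuous.isClosedEmbedding (by fun_prop) fun u v h => Subtype.ext (hi u.2 v.2 h)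
  let e := hemb.isEmbedding.toHomeomorph
  have hmem : ∀ a ∈ Set.uIcc (f p) (f q), a ∈ Set.range fun u : Set.Icc p q => f u := by
    intro a ha
    obtain ⟨u, hu, rfl⟩ := intermediate_value_uIcc hc.continuousOn ha
    rw [Set.uIcc_of_le hpq] at hu
    exact ⟨⟨u, hu⟩, rfl⟩
  classical
  refine ⟨fun a => if h : a ∈ Set.range fun u : Set.Icc p q => f u then (e.symm ⟨a, h⟩).1 else 0,
    ?_, ?_⟩
  · rw [continuousOn_iff_continuous_domRestrict]
    have : Continuous fun a : Set.uIcc (f p) (f q) => (e.symm ⟨a.1, hmem a.1 a.2⟩).1 :=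
      continuous_subtype_val.comp (e.symm.continuous.comp (by fun_prop))
    convert this using 1
    grind
  · intro a ha
    simp only [dif_pos (hmem a ha)]
    refine ⟨(e.symm ⟨a, hmem a ha⟩).2, ?_⟩
    have := e.apply_symm_apply ⟨a, hmem a ha⟩
    exact congrArg Subtype.val this

/-- The map of the line whose unit intervals are graphs `r` over the angle `α`. -/
noncomputable def graphMap (lab : ℤ → Label) (r α : ℝ → ℝ) (x : ℝ) : ℂ × ℂ :=
  pt (lab ⌊x⌋).1 (lab ⌊x⌋).2 (r x) (α x)

/-- The data of a periodic map made of graphs. -/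
structure IsGraph (lab : ℤ → Label) (r α : ℝ → ℝ) (N w : ℤ) : Prop where
  pos : 0 < N
  unit : w * w = 1
  period : ∀ x, α (x + N) = α x + 8 * w
  period_r : ∀ x, r (x + N) = r x
  period_lab : ∀ i, lab (i + N) = lab i
  cont : Continuous α
  cont_r : Continuous r
  injOn : ∀ i : ℤ, Set.InjOn α (Set.Icc (i : ℝ) (i + 1))
  zero : ∀ i : ℤ, r i = 0
  nonneg : ∀ x, 0 ≤ r x
  lt_one : ∀ x, r x < 1
  short : ∀ i : ℤ, |α (i + 1) - α i| ≤ 10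
  glue : ∀ i : ℤ, pt (lab (i - 1)).1 (lab (i - 1)).2 0 (α i) = pt (lab i).1 (lab i).2 0 (α i)
  alt : ∀ i, (lab (i + 1)).1 ≠ (lab i).1
  inj : ∀ x x', ⌊x⌋ < ⌊x'⌋ → graphMap lab r α x = graphMap lab r α x' → α x ≠ α x'

section graph
variable {lab : ℤ → Label} {r α : ℝ → ℝ} {N w : ℤ}

lemma lt_of_graph_lt {i j : ℤ} (hα : Continuous α) (hr : Continuous r) (h0 : ∀ x, 0 ≤ r x)
    (hz : ∀ i : ℤ, r i = 0) (hi : Set.InjOn α (Set.Icc (i : ℝ) (i + 1)))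
    (hj : Set.InjOn α (Set.Icc (j : ℝ) (j + 1)))
    (hne : ∀ u ∈ Set.Icc (i : ℝ) (i + 1), ∀ v ∈ Set.Icc (j : ℝ) (j + 1), α u = α v → r u ≠ r v)
    {u v : ℝ} (hu : u ∈ Set.Icc (i : ℝ) (i + 1)) (hv : v ∈ Set.Icc (j : ℝ) (j + 1))
    (e : α u = α v) (hlt : r u < r v) :
    (α u - α i) * (α (i + 1) - α u) < (α v - α j) * (α (j + 1) - α v) := by
  have between : ∀ (i : ℤ), Set.InjOn α (Set.Icc (i : ℝ) (i + 1)) → ∀ u ∈ Set.Icc (i : ℝ) (i + 1),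
      α u ∈ Set.uIcc (α i) (α (i + 1)) := by
    intro i hi u hu
    rcases hα.continuousOn.strictMonoOn_of_injOn_Icc' (by linarith) hi with h | h
    · exact Set.mem_uIcc.2 (Or.inl ⟨h.monotoneOn ⟨le_rfl, by linarith⟩ hu hu.1,
        h.monotoneOn hu ⟨by linarith, le_rfl⟩ hu.2⟩)
    · exact Set.mem_uIcc.2 (Or.inr ⟨h.antitoneOn hu ⟨by linarith, le_rfl⟩ hu.2,
        h.antitoneOn ⟨le_rfl, by linarith⟩ hu hu.1⟩)
  have bi := between i hi u hu
  have bj := between j hj v hv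
  obtain ⟨g, gc, hg⟩ := exists_section (by linarith) hα hi
  obtain ⟨k, kc, hk⟩ := exists_section (by linarith) hα hj
  have gu : g (α u) = u := hi (hg _ bi).1 hu (hg _ bi).2
  have kv : k (α v) = v := hj (hk _ bj).1 hv (hk _ bj).2
  set li := min (α i) (α (i + 1)) with hli
  set ui := max (α i) (α (i + 1)) with hui
  set lj := min (α j) (α (j + 1)) with hlj
  set uj := max (α j) (α (j + 1)) with huj
  change α u ∈ Set.Icc li ui at bi
  change α v ∈ Set.Icc lj uj at bj
  change ∀ a ∈ Set.Icc li ui, _ at hg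
  change ∀ a ∈ Set.Icc lj uj, _ at hk
  change ContinuousOn g (Set.Icc li ui) at gc
  change ContinuousOn k (Set.Icc lj uj) at kc
  have pi : ∀ t, (t - α i) * (α (i + 1) - t) = (t - li) * (ui - t) := by grind
  have pj : ∀ t, (t - α j) * (α (j + 1) - t) = (t - lj) * (uj - t) := by grind
  rw [← e] at bj kv
  have pos : ∀ a ∈ Set.Icc (max li lj) (min ui uj), r (g a) < r (k a) := by
    intro a ha
    have hsub : ∀ a ∈ Set.Icc (max li lj) (min ui uj), a ∈ Set.Icc li ui ∧ a ∈ Set.Icc lj uj := by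
      grind
    by_contra hcon
    push Not at hcon
    have cF : ContinuousOn (fun a => r (k a) - r (g a)) (Set.Icc (max li lj) (min ui uj)) :=
      (hr.comp_continuousOn (kc.mono fun a ha => (hsub a ha).2)).sub
        (hr.comp_continuousOn (gc.mono fun a ha => (hsub a ha).1))
    have hm : α u ∈ Set.Icc (max li lj) (min ui uj) :=
      ⟨max_le bi.1 bj.1, le_min bi.2 bj.2⟩
    have := isPreconnected_Icc.intermediate_value ha hm cF
      (show (0 : ℝ) ∈ Set.Icc _ _ from ⟨by linarith, by grind⟩)
    grind
  have hm : max li lj ≤ min ui uj := (max_le bi.1 bj.1).trans (le_min bi.2 bj.2)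
  have endk : ∀ a ∈ Set.Icc lj uj, a = α j ∨ a = α (j + 1) → r (k a) = 0 := by
    intro a ha h
    rcases h with h | h
    · have : k a = j := hj (hk a ha).1 ⟨le_rfl, by linarith⟩ (by grind)
      rw [this, hz]
    · have : k a = j + 1 := hj (hk a ha).1 ⟨by linarith, le_rfl⟩ (by grind)
      rw [this]
      exact_mod_cast hz (j + 1)
  have q1 : lj < li := by
    by_contra hcon
    push Not at hcon
    have h1 := pos (max li lj) ⟨le_rfl, hm⟩
    grind
  have q2 : ui < uj := by
    by_contra hcon
    push Not at hcon
    have h1 := pos (min ui uj) ⟨hm, le_rfl⟩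
    grind
  rw [pi, pj, ← e]
  nlinarith [bi.1, bi.2]

/-- The height of the chord over a graph. -/
noncomputable def bend (α : ℝ → ℝ) (i : ℤ) (x : ℝ) : ℝ := curv * ((α x - α i) * (α (i + 1) - α x))

lemma IsGraph.mono_or (h : IsGraph lab r α N w) (i : ℤ) :
    StrictMonoOn α (Set.Icc (i : ℝ) (i + 1)) ∨ StrictAntiOn α (Set.Icc (i : ℝ) (i + 1)) :=
  h.cont.continuousOn.strictMonoOn_of_injOn_Icc' (by linarith) (h.injOn i)

lemma IsGraph.bend_nonneg (h : IsGraph lab r α N w) {i : ℤ} {x : ℝ}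
    (hx : x ∈ Set.Icc (i : ℝ) (i + 1)) : 0 ≤ bend α i x := by
  have c0 : 0 < curv := by norm_num [curv]
  unfold bend
  refine mul_nonneg c0.le ?_
  rcases h.mono_or i with k | k
  · exact mul_nonneg (sub_nonneg.2 (k.monotoneOn ⟨le_rfl, by linarith⟩ hx hx.1))
      (sub_nonneg.2 (k.monotoneOn hx ⟨by linarith, le_rfl⟩ hx.2))
  · exact mul_nonneg_of_nonpos_of_nonpos
      (sub_nonpos.2 (k.antitoneOn ⟨le_rfl, by linarith⟩ hx hx.1))
      (sub_nonpos.2 (k.antitoneOn hx ⟨by linarith, le_rfl⟩ hx.2))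

lemma IsGraph.bend_pos (h : IsGraph lab r α N w) {i : ℤ} {x : ℝ}
    (hx : x ∈ Set.Ioo (i : ℝ) (i + 1)) : 0 < bend α i x := by
  have c0 : 0 < curv := by norm_num [curv]
  have hx' := Set.Ioo_subset_Icc_self hx
  unfold bend
  refine mul_pos c0 ?_
  rcases h.mono_or i with k | k
  · exact mul_pos (sub_pos.2 (k ⟨le_rfl, by linarith⟩ hx' hx.1))
      (sub_pos.2 (k hx' ⟨by linarith, le_rfl⟩ hx.2))
  · exact mul_pos_of_neg_of_neg (sub_neg.2 (k ⟨le_rfl, by linarith⟩ hx' hx.1))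
      (sub_neg.2 (k hx' ⟨by linarith, le_rfl⟩ hx.2))

lemma IsGraph.bend_le (h : IsGraph lab r α N w) (i : ℤ) (x : ℝ) : bend α i x ≤ 1 / 4 := by
  have h1 := sq_le_sq' (abs_le.1 (h.short i)).1 (abs_le.1 (h.short i)).2
  unfold bend curv
  nlinarith [sq_nonneg (α x - α i - (α (i + 1) - α x))]

/-- The graphs on the way to the chain with the same vertices. -/
noncomputable def toChain (lab : ℤ → Label) (r α : ℝ → ℝ) (s x : ℝ) : ℂ × ℂ :=
  pt (lab ⌊x⌋).1 (lab ⌊x⌋).2 ((1 - s) * r x + s * bend α ⌊x⌋ x) (α x)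

lemma bend_left (i : ℤ) : bend α i i = 0 := by simp [bend]

lemma bend_right (i : ℤ) : bend α i (i + 1) = 0 := by simp [bend]

lemma IsGraph.toChain_on (h : IsGraph lab r α N w) (s : ℝ) (i : ℤ) {x : ℝ} (h0 : i ≤ x)
    (h1 : x ≤ i + 1) : toChain lab r α s x =
      pt (lab i).1 (lab i).2 ((1 - s) * r x + s * bend α i x) (α x) := by
  rcases h1.eq_or_lt with e | e
  · subst e
    have e : ((i : ℝ) + 1) = ((i + 1 : ℤ) : ℝ) := by grind
    have z := bend_right (α := α) i
    rw [e] at z ⊢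
    have g := h.glue (i + 1)
    rw [add_sub_cancel_right] at g
    unfold toChain
    rw [Int.floor_intCast, h.zero, z, bend_left, mul_zero, mul_zero, add_zero, g]
  · have hf : ⌊x⌋ = i := Int.floor_eq_iff.2 ⟨h0, e⟩
    unfold toChain
    rw [hf]

lemma IsGraph.add_mul (h : IsGraph lab r α N w) (m : ℤ) :
    (∀ x, α (x + (m * N : ℤ)) = α x + 8 * (m * w : ℤ)) ∧ (∀ x, r (x + (m * N : ℤ)) = r x) ∧
      ∀ i, lab (i + m * N) = lab i := by
  induction m with
  | zero => simp
  | succ m ih =>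
    obtain ⟨i1, i2, i3⟩ := ih
    refine ⟨fun x => ?_, fun x => ?_, fun i => ?_⟩
    · have := h.period (x + ((m : ℤ) * N : ℤ))
      grind
    · have := h.period_r (x + ((m : ℤ) * N : ℤ))
      grind
    · rw [show i + ((m : ℤ) + 1) * N = i + m * N + N by ring, h.period_lab, i3]
  | pred m ih =>
    obtain ⟨i1, i2, i3⟩ := ih
    refine ⟨fun x => ?_, fun x => ?_, fun i => ?_⟩
    · have := h.period (x + ((-(m : ℤ) - 1) * N : ℤ))
      grind
    · have := h.period_r (x + ((-(m : ℤ) - 1) * N : ℤ))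
      grind
    · have := h.period_lab (i + (-(m : ℤ) - 1) * N)
      grind

lemma IsGraph.toChain_add (h : IsGraph lab r α N w) (s x : ℝ) (m : ℤ) :
    toChain lab r α s (x + (m * N : ℤ)) = toChain lab r α s x := by
  obtain ⟨h1, h2, h3⟩ := h.add_mul m
  unfold toChain
  have e : bend α (⌊x⌋ + m * N) (x + (m * N : ℤ)) = bend α ⌊x⌋ x := by
    have k1 := h1 ⌊x⌋
    have k2 := h1 (⌊x⌋ + 1)
    unfold bend
    grind
  rw [Int.floor_add_intCast, h3, e, h2, h1, pt_add]

lemma IsGraph.toChain_inj (h : IsGraph lab r α N w) {s : ℝ} (hs : s ∈ Set.Icc (0 : ℝ) 1) {x x' : ℝ}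
    (e : toChain lab r α s x = toChain lab r α s x') (ea : α x = α x') : x = x' := by
  have hs1 : 0 ≤ 1 - s := by grind
  have mem : ∀ x : ℝ, x ∈ Set.Icc (⌊x⌋ : ℝ) (⌊x⌋ + 1) := fun x =>
    ⟨Int.floor_le x, (Int.lt_floor_add_one x).le⟩
  have nn : ∀ x, 0 ≤ (1 - s) * r x + s * bend α ⌊x⌋ x := fun x =>
    add_nonneg (mul_nonneg hs1 (h.nonneg x)) (mul_nonneg hs.1 (h.bend_nonneg (mem x)))
  rcases hs.1.eq_or_lt with hs0 | hs0
  · subst hs0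
    have e' : graphMap lab r α x = graphMap lab r α x' := by simpa [toChain, graphMap] using e
    rcases lt_trichotomy ⌊x⌋ ⌊x'⌋ with hlt | heq | hlt
    · exact absurd ea (h.inj x x' hlt e')
    · exact h.injOn ⌊x⌋ (mem x) (heq ▸ mem x') ea
    · exact absurd ea.symm (h.inj x' x hlt e'.symm)
  obtain ⟨er, -, e1, e2⟩ := pt_inj (nn x) (nn x') e
  by_cases heq : ⌊x⌋ = ⌊x'⌋
  · exact h.injOn ⌊x⌋ (mem x) (heq ▸ mem x') ea
  exfalso
  have integral : ∀ x, (1 - s) * r x + s * bend α ⌊x⌋ x = 0 → x = ⌊x⌋ := by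
    intro x hx
    have b0 := h.bend_nonneg (mem x)
    have b1 := mul_nonneg hs1 (h.nonneg x)
    have b2 := mul_nonneg hs.1 b0
    have : s * bend α ⌊x⌋ x = 0 := by linarith
    have b3 := (mul_eq_zero.1 this).resolve_left hs0.ne'
    by_contra hne
    have := h.bend_pos (i := ⌊x⌋) (x := x)
      ⟨lt_of_le_of_ne (Int.floor_le x) (Ne.symm hne), Int.lt_floor_add_one x⟩
    linarith
  have vtx : ∀ x : ℝ, x = ⌊x⌋ → toChain lab r α s x = graphMap lab r α x := by
    intro x hx
    have b : bend α ⌊x⌋ x = 0 := by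
      have := bend_left (α := α) ⌊x⌋
      grind
    have z : r x = 0 := by rw [hx]; exact h.zero _
    unfold toChain graphMap
    grind
  rcases (nn x).eq_or_lt with hz | hpos
  · have i1 := integral x hz.symm
    have i2 := integral x' (er ▸ hz.symm)
    rw [vtx x i1, vtx x' i2] at e
    rcases lt_or_gt_of_ne heq with hlt | hlt
    · exact h.inj x x' hlt e ea
    · exact h.inj x' x hlt e.symm ea.symm
  · obtain ⟨l1, l2⟩ := e1 hpos
    have hlab : lab ⌊x⌋ = lab ⌊x'⌋ := Prod.ext l1 l2
    have key : ∀ x x' : ℝ, α x = α x' → lab ⌊x⌋ = lab ⌊x'⌋ → ⌊x⌋ ≠ ⌊x'⌋ →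
        ∀ u ∈ Set.Icc (⌊x⌋ : ℝ) (⌊x⌋ + 1), ∀ v ∈ Set.Icc (⌊x'⌋ : ℝ) (⌊x'⌋ + 1), α u = α v →
          r u ≠ r v := by
      intro x x' ea hlab hne u hu v hv euv er
      have g0 : ∀ (i : ℤ) u, u ∈ Set.Icc (i : ℝ) (i + 1) →
          graphMap lab r α u = pt (lab i).1 (lab i).2 (r u) (α u) := by
        intro i u hu
        have := h.toChain_on 0 i hu.1 hu.2
        simpa [toChain, graphMap] using this
      have eg : graphMap lab r α u = graphMap lab r α v := by grind
      have huv : u = v := by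
        rcases lt_trichotomy ⌊u⌋ ⌊v⌋ with hlt | hq | hlt
        · exact absurd euv (h.inj u v hlt eg)
        · exact h.injOn ⌊u⌋ (mem u) (hq ▸ mem v) euv
        · exact absurd euv.symm (h.inj v u hlt eg.symm)
      subst huv
      have c1 : (⌊x⌋ : ℝ) ≤ (⌊x'⌋ + 1 : ℤ) := by grind
      have c2 : (⌊x'⌋ : ℝ) ≤ (⌊x⌋ + 1 : ℤ) := by grind
      have c1' : ⌊x⌋ ≤ ⌊x'⌋ + 1 := by exact_mod_cast c1
      have c2' : ⌊x'⌋ ≤ ⌊x⌋ + 1 := by exact_mod_cast c2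
      rcases (show ⌊x⌋ = ⌊x'⌋ + 1 ∨ ⌊x'⌋ = ⌊x⌋ + 1 by omega) with c | c
      · have := h.alt ⌊x'⌋
        grind
      · have := h.alt ⌊x⌋
        grind
    have cmp : ∀ x x' : ℝ, α x = α x' → lab ⌊x⌋ = lab ⌊x'⌋ → ⌊x⌋ ≠ ⌊x'⌋ → r x < r x' →
        (1 - s) * r x + s * bend α ⌊x⌋ x ≠ (1 - s) * r x' + s * bend α ⌊x'⌋ x' := by
      intro x x' ea hlab hne hlt heq
      have c0 : 0 < curv := by norm_num [curv]
      have q := lt_of_graph_lt h.cont h.cont_r h.nonneg h.zero (h.injOn _) (h.injOn _)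
        (key x x' ea hlab hne) (mem x) (mem x') ea hlt
      have q' : bend α ⌊x⌋ x < bend α ⌊x'⌋ x' := mul_lt_mul_of_pos_left q c0
      have := mul_lt_mul_of_pos_left q' hs0
      have := mul_le_mul_of_nonneg_left hlt.le hs1
      linarith
    grind

lemma IsGraph.injFamily (h : IsGraph lab r α N w) : InjFamily (toChain lab r α) N := by
  refine ⟨by exact_mod_cast h.pos, ?_, ?_, ?_⟩
  · rw [continuousOn_iff_continuous_domRestrict]
    suffices hc : Continuous fun q : Set.Icc (0 : ℝ) 1 × ℝ => toChain lab r α q.1 q.2 by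
      exact hc.comp (f := fun q : (Set.Icc (0 : ℝ) 1 ×ˢ Set.univ : Set (ℝ × ℝ)) =>
        ((⟨q.1.1, q.2.1⟩ : Set.Icc (0 : ℝ) 1), q.1.2)) (by fun_prop)
    refine continuous_glue (fun i q => pt (lab i).1 (lab i).2
      ((1 - q.1) * r q.2 + q.1 * bend α i q.2) (α q.2)) (fun i => ?_) fun i q h0 h1 =>
        h.toChain_on q.1 i h0 h1
    have := h.cont
    have := h.cont_r
    refine (continuous_pt (lab i).1 (lab i).2).comp
      (f := fun q : Set.Icc (0 : ℝ) 1 × ℝ => ((1 - (q.1 : ℝ)) * r q.2 + q.1 * bend α i q.2,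
        α q.2)) ?_
    unfold bend
    fun_prop
  · intro s hs x
    refine pt_mem ?_
    have h1 := h.lt_one x
    have h2 := h.bend_le ⌊x⌋ x
    have a0 := hs.1
    rcases a0.eq_or_lt with e | e
    · subst e; linarith
    · have a1 := mul_le_mul_of_nonneg_left h1.le (show 0 ≤ 1 - s by grind)
      have a2 := mul_le_mul_of_nonneg_left h2 a0
      linarith
  · intro s hs x x'
    constructor
    · intro e
      have nn : ∀ x, 0 ≤ (1 - s) * r x + s * bend α ⌊x⌋ x := fun x =>
        add_nonneg (mul_nonneg (by linarith [hs.2]) (h.nonneg x)) (mul_nonneg hs.1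
          (h.bend_nonneg ⟨Int.floor_le x, (Int.lt_floor_add_one x).le⟩))
      obtain ⟨-, ⟨m, hm⟩, -⟩ := pt_inj (nn x) (nn x') e
      have := h.toChain_inj hs (x := x + ((m * w) * N : ℤ)) (x' := x') ?_ ?_
      · exact ⟨m * w, by rw [← this]; push_cast; ring⟩
      · rw [h.toChain_add, e]
      · rw [(h.add_mul _).1, hm]
        have hw2 : (w : ℝ) * w = 1 := by exact_mod_cast h.unit
        push_cast
        linear_combination 8 * (m : ℝ) * hw2
    · rintro ⟨m, rfl⟩
      have := h.toChain_add s x m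
      push_cast at this
      exact this.symm

/-- A curve made of graphs is isotopic to the chain with the same vertices. -/
theorem IsGraph.lineIso (h : IsGraph lab r α N w) :
    LineIso N N (graphMap lab r α) (chain lab 0 fun i => α i) := by
  set ψ : ℝ → ℝ := fun x => ⌊x⌋ + (α x - α ⌊x⌋) / (α (⌊x⌋ + 1) - α ⌊x⌋) with hψ
  have dne : ∀ i : ℤ, α (i + 1) - α i ≠ 0 := by
    intro i e
    have := h.injOn i ⟨by linarith, le_rfl⟩ ⟨le_rfl, by linarith⟩ (sub_eq_zero.1 e)
    linarith
  have on : ∀ (i : ℤ) (x : ℝ), i ≤ x → x ≤ i + 1 →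
      ψ x = i + (α x - α i) / (α (i + 1) - α i) := by
    intro i x h0 h1
    rcases h1.eq_or_lt with e | e
    · subst e
      have e : ((i : ℝ) + 1) = ((i + 1 : ℤ) : ℝ) := by push_cast; ring
      rw [div_self (dne i)]
      simp only [hψ, e, Int.floor_intCast]
      simp
    · have hf : ⌊x⌋ = i := Int.floor_eq_iff.2 ⟨h0, e⟩
      simp only [hψ, hf]
  have hc : Continuous ψ := continuous_glue_real
    (fun i x => i + (α x - α i) / (α (i + 1) - α i)) (fun i => by have := h.cont; fun_prop) on
  have smono : ∀ (i : ℤ) (x y : ℝ), i ≤ x → x < y → y ≤ i + 1 → ψ x < ψ y := by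
    intro i x y h0 h1 h2
    rw [on i x h0 (h1.le.trans h2), on i y (h0.trans h1.le) h2]
    have mx : x ∈ Set.Icc (i : ℝ) (i + 1) := ⟨h0, h1.le.trans h2⟩
    have my : y ∈ Set.Icc (i : ℝ) (i + 1) := ⟨h0.trans h1.le, h2⟩
    have m0 : (i : ℝ) ∈ Set.Icc (i : ℝ) (i + 1) := ⟨le_rfl, by linarith⟩
    have m1 : (i : ℝ) + 1 ∈ Set.Icc (i : ℝ) (i + 1) := ⟨by linarith, le_rfl⟩
    have : (α x - α i) / (α (i + 1) - α i) < (α y - α i) / (α (i + 1) - α i) := by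
      rcases h.mono_or i with k | k
      · have a1 := k m0 m1 (by linarith)
        have a2 := k mx my h1
        exact div_lt_div_of_pos_right (by linarith) (by linarith)
      · have a1 := k m0 m1 (by linarith)
        have a2 := k mx my h1
        exact div_lt_div_of_neg_of_lt (by linarith) (by linarith)
    linarith
  have hm : Monotone ψ := monotone_of_unit fun i x y h0 h1 h2 => by
    rcases h1.eq_or_lt with e | e
    · rw [e]
    · exact (smono i x y h0 e h2).le
  have hsh : ∀ x, ψ (x + N) = ψ x + N := by
    intro x
    have k1 := h.period ⌊x⌋
    have k2 := h.period (⌊x⌋ + 1)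
    simp only [hψ, Int.floor_add_intCast]
    have e1 : ((⌊x⌋ + N : ℤ) : ℝ) = ⌊x⌋ + (N : ℝ) := by push_cast; ring
    rw [e1, show (⌊x⌋ : ℝ) + N + 1 = ⌊x⌋ + 1 + N by ring, k1, k2, h.period]
    rw [add_sub_add_right_eq_sub, add_sub_add_right_eq_sub]
    ring
  have hsm : StrictMono ψ := by
    refine hm.strictMono_of_injective ?_
    have key : ∀ x y, x < y → ψ x ≠ ψ y := by
      intro x y hxy he
      set z := min y (⌊x⌋ + 1) with hz
      have hxz : x < z := lt_min hxy (Int.lt_floor_add_one x)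
      have h1 := smono ⌊x⌋ x z (Int.floor_le x) hxz (min_le_right _ _)
      have h2 := hm (min_le_left y ((⌊x⌋ : ℝ) + 1))
      rw [← hz] at h2
      linarith
    intro x y he
    rcases lt_trichotomy x y with hlt | heq | hlt
    · exact absurd he (key x y hlt)
    · exact heq
    · exact absurd he.symm (key y x hlt)
  have hN : (0 : ℝ) < N := by exact_mod_cast h.pos
  have hsurj : Function.Surjective ψ := by
    intro t
    have hτ := surjective_of_shift (τ := fun x => ψ x / N) hN
      (fun x => by simp only [hsh]; field_simp)
      (fun x y hxy => by have := hm hxy; simp only; gcongr) (by fun_prop)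
    obtain ⟨x, hx⟩ := hτ (t / N)
    refine ⟨x, ?_⟩
    simp only at hx
    field_simp at hx
    exact hx
  let e := hsm.orderIsoOfSurjective ψ hsurj
  have he : ∀ x, ψ (e.symm x) = x := fun x => e.apply_symm_apply x
  have hend : ∀ x, toChain lab r α 1 x = chain lab 0 (fun i => α i) (ψ x) := by
    intro x
    have h0 := Int.floor_le x
    have h1 := Int.lt_floor_add_one x
    have e1 := on ⌊x⌋ x h0 h1.le
    have hfl : ⌊ψ x⌋ = ⌊x⌋ := by
      rw [Int.floor_eq_iff]
      have a1 := hm h0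
      have a2 := hsm h1
      rw [on ⌊x⌋ ⌊x⌋ le_rfl (by linarith)] at a1
      rw [on ⌊x⌋ (⌊x⌋ + 1) (by linarith) le_rfl, div_self (dne _)] at a2
      simp only [sub_self, zero_div, add_zero] at a1
      exact ⟨a1, a2⟩
    have hfr : Int.fract (ψ x) = (α x - α ⌊x⌋) / (α (⌊x⌋ + 1) - α ⌊x⌋) := by
      rw [Int.fract, hfl, e1]; ring
    have d := dne ⌊x⌋
    have hl : lin (fun i : ℤ => α i) (ψ x) = α x := by
      unfold lin
      rw [hfl, hfr]
      push_cast
      field_simp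
      ring
    rw [chain_eq, hfl, hl, hfr]
    unfold toChain height bend
    simp only [Pi.zero_apply]
    congr 1
    push_cast
    field_simp
    ring
  have key := h.injFamily.lineIso
  have h00 : toChain lab r α 0 = graphMap lab r α := by funext x; simp [toChain, graphMap]
  rw [h00] at key
  obtain ⟨γ, γ', h1, h2, h3⟩ := key
  refine ⟨γ, γ', h1, ?_, h3⟩
  have := h2.comp (ψ := e.symm) hN e.symm.continuous e.symm.monotone (fun x => by
    apply hsm.injective
    rw [he, hsh, he])
  convert this using 1
  funext x
  rw [hend, he]

end graph

/-! ### Piecewise linear curves -/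

/-- The piecewise linear map of the line with nodes at distance `R i` from the unit circle and at
angle `A i`, in units of `1 / 40`. -/
noncomputable def plMap (lab : ℤ → Label) (R A : ℤ → ℤ) (y : ℝ) : ℂ × ℂ :=
  pt (lab ⌊y⌋).1 (lab ⌊y⌋).2 (lin (fun i => (R i : ℝ) / 40) y) (lin (fun i => (A i : ℝ) / 40) y)

/-- The height of the segment `i` over `p`, multiplied by its width. -/
def rise (R A : ℤ → ℤ) (i p : ℤ) : ℤ := R i * (A (i + 1) - p) + R (i + 1) * (p - A i)

/-- A number with the sign of the difference of the heights of two segments over `p`. -/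
def gap (R A : ℤ → ℤ) (i j p : ℤ) : ℤ :=
  (rise R A i p * (A (j + 1) - A j) - rise R A j p * (A (i + 1) - A i)) *
    ((A (i + 1) - A i) * (A (j + 1) - A j))

/-- The segments `i` and `j` are disjoint. -/
def SegPair (lab : ℤ → Label) (R A : ℤ → ℤ) (i j : ℤ) : Prop :=
  (lab i ≠ lab j ∨ ((hi A i ≤ lo A j ∨ hi A j ≤ lo A i) ∧ (A i ≠ A j ∨ R i ≠ R j)) ∨
    (0 < gap R A i j (max (lo A i) (lo A j)) ∧ 0 < gap R A i j (min (hi A i) (hi A j))) ∨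
    (gap R A i j (max (lo A i) (lo A j)) < 0 ∧ gap R A i j (min (hi A i) (hi A j)) < 0)) ∧
  (R i ≠ 0 ∨ R j ≠ 0 ∨ A i ≠ A j ∨ lowerOf (lab i) (A i / 40) ≠ lowerOf (lab j) (A i / 40))

instance (lab : ℤ → Label) (R A : ℤ → ℤ) (i j : ℤ) : Decidable (SegPair lab R A i j) := by
  unfold SegPair; infer_instance

/-- The conditions on a single node. -/
def SegLocal (lab : ℤ → Label) (R A : ℤ → ℤ) (i : ℤ) : Prop :=
  0 ≤ R i ∧ R i < 40 ∧ (0 < R i ∨ 0 < R (i + 1)) ∧ A (i + 1) ≠ A i ∧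
  if R i = 0 then lowerOf (lab (i - 1)) (A i / 40) = lowerOf (lab i) (A i / 40) ∧ A i % 40 ≠ 0
  else lab (i - 1) = lab i

instance (lab : ℤ → Label) (R A : ℤ → ℤ) (i : ℤ) : Decidable (SegLocal lab R A i) := by
  unfold SegLocal; infer_instance

/-- The data of a closed piecewise linear curve. -/
structure IsPL (n K : ℕ) (D m M : ℤ) (lab : ℤ → Label) (R A : ℤ → ℤ) : Prop where
  pos : 0 < n
  far : M - m < K * 320
  bounds : ∀ i < n + 1, m ≤ A i ∧ A i ≤ M
  loc : ∀ i < n, SegLocal lab R A i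
  pair : ∀ i < n, ∀ j < K * n, SegPair lab R A i (i + j + 1)

instance (n K : ℕ) (D m M : ℤ) (lab : ℤ → Label) (R A : ℤ → ℤ) :
    Decidable (IsPL n K D m M lab R A) :=
  decidable_of_iff (0 < n ∧ M - m < K * 320 ∧
    (∀ i < n + 1, m ≤ A (i : ℕ) ∧ A (i : ℕ) ≤ M) ∧ (∀ i < n, SegLocal lab R A (i : ℕ)) ∧
    (∀ i < n, ∀ j < K * n, SegPair lab R A (i : ℕ) ((i : ℕ) + (j : ℕ) + 1)))
    ⟨fun ⟨h1, h2, h3, h4, h5⟩ => ⟨h1, h2, h3, h4, h5⟩,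
      fun ⟨h1, h2, h3, h4, h5⟩ => ⟨h1, h2, h3, h4, h5⟩⟩

section pl
variable {lab : ℤ → Label} {R A : ℤ → ℤ} {n K : ℕ} {D m M : ℤ}

lemma odd_add_eight (k : ℤ) : odd (k + 8) = odd k := by unfold odd; grind

lemma odd_sub_eight (k : ℤ) : odd (k + -8) = odd k := by unfold odd; grind

lemma lowerOf_turn (hD : D = 320 ∨ D = -320) (l : Label) (x : ℤ) :
    lowerOf l ((x + D) / 40) = lowerOf l (x / 40) := by
  unfold lowerOf lower
  rcases hD with rfl | rfl
  · rw [show (x + 320) / 40 = x / 40 + 8 by omega, odd_add_eight]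
  · rw [show (x + -320) / 40 = x / 40 + -8 by omega, odd_sub_eight]

lemma emod_turn (hD : D = 320 ∨ D = -320) (x : ℤ) : (x + D) % 40 = x % 40 := by omega

lemma far_turn (hD : D = 320 ∨ D = -320) (hn : 0 < n) (hA : ∀ i, A (i + n) = A i + D)
    (hb : ∀ i < n + 1, m ≤ A (i : ℕ) ∧ A (i : ℕ) ≤ M) (hf : M - m < K * 320) {i j : ℤ}
    (hi0 : 0 ≤ i) (hih : i ≤ n) (hj : (K * n : ℕ) ≤ j) :
    (D = 320 ∧ A i < A j) ∨ (D = -320 ∧ A j < A i) := by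
  have hn' : (0 : ℤ) < n := by grind
  have hj0 : 0 ≤ j := le_trans (by positivity) hj
  obtain ⟨q, hq⟩ := Int.eq_ofNat_of_zero_le (Int.ediv_nonneg hj0 hn'.le)
  obtain ⟨r, hr⟩ := Int.eq_ofNat_of_zero_le (Int.emod_nonneg j hn'.ne')
  have e : j = r + q * n := by rw [← hr, ← hq, mul_comm]; exact (Int.emod_add_mul_ediv j n).symm
  have hrh : r < n := by
    have := Int.emod_lt_of_pos j hn'
    grind
  have hKq : (K : ℤ) ≤ q := by rw [← hq, Int.le_ediv_iff_mul_le hn']; grind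
  have b1 := hb r (by omega)
  obtain ⟨k, rfl⟩ := Int.eq_ofNat_of_zero_le hi0
  have b2 := hb k (by omega)
  have e2 := shift_mul hA q r
  grind

lemma segPair_add (hD : D = 320 ∨ D = -320) (hA : ∀ i, A (i + n) = A i + D)
    (hR : ∀ i, R (i + n) = R i) (hl : ∀ i, lab (i + n) = lab i) (i j : ℤ) :
    SegPair lab R A (i + n) (j + n) ↔ SegPair lab R A i j := by
  have sA : ∀ i, A (i + n + 1) = A (i + 1) + D := fun i => by grind
  have sR : ∀ i, R (i + n + 1) = R (i + 1) := fun i => by grind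
  have sg : ∀ p, gap R A (i + n) (j + n) (p + D) = gap R A i j p := by
    intro p
    unfold gap rise
    rw [hA, hA, sA, sA, hR, hR, sR, sR]; ring
  unfold SegPair
  simp only [lo_add hA, hi_add hA, hA, hR, hl, max_add_add_right, min_add_add_right, sg,
    add_le_add_iff_right, ne_eq, add_left_inj, lowerOf_turn hD]

lemma segLocal_add (hD : D = 320 ∨ D = -320) (hA : ∀ i, A (i + n) = A i + D)
    (hR : ∀ i, R (i + n) = R i) (hl : ∀ i, lab (i + n) = lab i) (i : ℤ) :
    SegLocal lab R A (i + n) ↔ SegLocal lab R A i := by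
  unfold SegLocal
  rw [show i + (n : ℤ) + 1 = i + 1 + n by ring, show i + (n : ℤ) - 1 = i - 1 + n by ring]
  simp only [hA, hR, hl, ne_eq, add_left_inj, lowerOf_turn hD, emod_turn hD]

lemma IsPL.local_all (h : IsPL n K D m M lab R A) (hD : D = 320 ∨ D = -320)
    (hA : ∀ i, A (i + n) = A i + D) (hR : ∀ i, R (i + n) = R i) (hl : ∀ i, lab (i + n) = lab i)
    (i : ℤ) : SegLocal lab R A i := by
  refine forall_of_shift (P := fun i _ => SegLocal lab R A i) h.pos
    (fun i j => segLocal_add hD hA hR hl i) (fun i _ h0 h1 _ => ?_) (lt_add_one i)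
  obtain ⟨k, rfl⟩ := Int.eq_ofNat_of_zero_le h0
  exact h.loc k (by omega)

lemma IsPL.pair_all (h : IsPL n K D m M lab R A) (hD : D = 320 ∨ D = -320)
    (hA : ∀ i, A (i + n) = A i + D) (hR : ∀ i, R (i + n) = R i) (hl : ∀ i, lab (i + n) = lab i)
    {i j : ℤ} (hij : i < j) : SegPair lab R A i j := by
  refine forall_of_shift (P := SegPair lab R A) h.pos (segPair_add hD hA hR hl) ?_ hij
  intro i j hi0 hih hij
  obtain ⟨k, rfl⟩ := Int.eq_ofNat_of_zero_le hi0
  by_cases hc : (K * n : ℕ) ≤ j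
  · have f0 := far_turn hD h.pos hA h.bounds h.far hi0 hih.le hc
    have f2 := far_turn hD h.pos hA h.bounds h.far hi0 hih.le (show _ ≤ j + 1 by omega)
    have f4 := far_turn (i := (k : ℤ) + 1) hD h.pos hA h.bounds h.far (by omega) (by omega) hc
    have f6 := far_turn (i := (k : ℤ) + 1) hD h.pos hA h.bounds h.far (by omega) (by omega)
      (show _ ≤ j + 1 by omega)
    unfold SegPair lo hi
    refine ⟨Or.inr (Or.inl ⟨?_, Or.inl (by omega)⟩), Or.inr (Or.inr (Or.inl (by omega)))⟩
    rcases hD with rfl | rfl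
    · grind
    grind
  · obtain ⟨q, hq⟩ := Int.eq_ofNat_of_zero_le (show 0 ≤ j - k - 1 by omega)
    have := h.pair k (by omega) q (by grind)
    grind

section
variable (hloc : ∀ i, SegLocal lab R A i)
include hloc

lemma plMap_on (i : ℤ) {y : ℝ} (h0 : i ≤ y) (h1 : y ≤ i + 1) :
    plMap lab R A y = pt (lab i).1 (lab i).2 (lin (fun i => (R i : ℝ) / 40) y)
      (lin (fun i => (A i : ℝ) / 40) y) := by
  rcases h1.eq_or_lt with e | e
  · subst e
    have e : ((i : ℝ) + 1) = ((i + 1 : ℤ) : ℝ) := by grind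
    rw [e]
    unfold plMap
    rw [Int.floor_intCast, lin_int, lin_int]
    have := (hloc (i + 1)).2.2.2.2
    rw [add_sub_cancel_right] at this
    split_ifs at this with hz
    · simp only [hz, Int.cast_zero, zero_div]
      refine pt_axis_eq (k := A (i + 1) / 40) ?_ this.1.symm
      have e0 : 40 * (A (i + 1) / 40) ≤ A (i + 1) := by omega
      have e1 : A (i + 1) ≤ 40 * (A (i + 1) / 40) + 40 := by omega
      have e0' : (40 : ℝ) * (A (i + 1) / 40 : ℤ) ≤ A (i + 1) := by exact_mod_cast e0
      have e1' : (A (i + 1) : ℝ) ≤ 40 * (A (i + 1) / 40 : ℤ) + 40 := by exact_mod_cast e1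
      constructor <;> linarith
    · rw [this]
  · have hf : ⌊y⌋ = i := Int.floor_eq_iff.2 ⟨h0, e⟩
    unfold plMap
    rw [hf]

lemma lin_height_mem (y : ℝ) : lin (fun i => (R i : ℝ) / 40) y ∈ Set.Ico (0 : ℝ) 1 := by
  obtain ⟨a0, a1, -⟩ := hloc ⌊y⌋
  obtain ⟨b0, b1, -⟩ := hloc (⌊y⌋ + 1)
  have a0' : (0 : ℝ) ≤ R ⌊y⌋ := by exact_mod_cast a0
  have b0' : (0 : ℝ) ≤ R (⌊y⌋ + 1) := by exact_mod_cast b0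
  have a1' : (R ⌊y⌋ : ℝ) < 40 := by exact_mod_cast a1
  have b1' : (R (⌊y⌋ + 1) : ℝ) < 40 := by exact_mod_cast b1
  have f0 := Int.fract_nonneg y
  have f1 := Int.fract_lt_one y
  unfold lin
  constructor
  · have := mul_nonneg f0 b0'
    have := mul_nonneg (sub_nonneg.2 f1.le) a0'
    linarith
  · have h1 := mul_le_mul_of_nonneg_left b1'.le f0
    have h2 := mul_lt_mul_of_pos_left a1' (sub_pos.2 f1)
    linarith

lemma node_of_zero {y : ℝ} (h : lin (fun i => (R i : ℝ) / 40) y = 0) :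
    Int.fract y = 0 ∧ R ⌊y⌋ = 0 := by
  obtain ⟨a0, a1, a2, -⟩ := hloc ⌊y⌋
  obtain ⟨b0, -⟩ := hloc (⌊y⌋ + 1)
  have a0' : (0 : ℝ) ≤ R ⌊y⌋ := by exact_mod_cast a0
  have b0' : (0 : ℝ) ≤ R (⌊y⌋ + 1) := by exact_mod_cast b0
  have f0 := Int.fract_nonneg y
  have f1 := Int.fract_lt_one y
  unfold lin at h
  have h1 := mul_nonneg f0 b0'
  have h2 := mul_nonneg (sub_nonneg.2 f1.le) a0'
  have h3 : (1 - Int.fract y) * R ⌊y⌋ = 0 := by linarith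
  have h4 : Int.fract y * R (⌊y⌋ + 1) = 0 := by linarith
  have h5 : R ⌊y⌋ = 0 := by exact_mod_cast (mul_eq_zero.1 h3).resolve_left (by linarith)
  refine ⟨(mul_eq_zero.1 h4).resolve_right ?_, h5⟩
  have : R (⌊y⌋ + 1) ≠ 0 := by omega
  exact_mod_cast this

lemma plMap_ne (hpair : ∀ i j, i < j → SegPair lab R A i j) {y y' : ℝ} (hlt : ⌊y⌋ < ⌊y'⌋)
    (e : plMap lab R A y = plMap lab R A y') :
    lin (fun i => (A i : ℝ) / 40) y ≠ lin (fun i => (A i : ℝ) / 40) y' := by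
  intro ea
  obtain ⟨p1, p2⟩ := hpair _ _ hlt
  have r0 := (lin_height_mem hloc y).1
  have r0' := (lin_height_mem hloc y').1
  unfold plMap at e
  obtain ⟨er, -, e1, e2⟩ := pt_inj r0 r0' e
  have f0 := Int.fract_nonneg y
  have f1 := Int.fract_lt_one y
  have g0 := Int.fract_nonneg y'
  have g1 := Int.fract_lt_one y'
  rcases r0.eq_or_lt with hz | hpos
  · obtain ⟨k1, k2⟩ := node_of_zero hloc hz.symm
    obtain ⟨k3, k4⟩ := node_of_zero hloc (er ▸ hz.symm)
    have t1 : lin (fun i => (A i : ℝ) / 40) y = (A ⌊y⌋ : ℝ) / 40 := by simp [lin, k1]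
    have t2 : lin (fun i => (A i : ℝ) / 40) y' = (A ⌊y'⌋ : ℝ) / 40 := by simp [lin, k3]
    have hloc' := (hloc ⌊y⌋).2.2.2.2
    rw [if_pos k2] at hloc'
    rcases p2 with p | p | p | p
    · exact p k2
    · exact p k4
    · apply p
      rw [t1, t2] at ea
      have : (A ⌊y⌋ : ℝ) = A ⌊y'⌋ := by linarith
      exact_mod_cast this
    · apply p
      refine e2 hz.symm _ ?_
      rw [t1]
      have q1 : 40 * (A ⌊y⌋ / 40) < A ⌊y⌋ := by omega
      have q2 : A ⌊y⌋ < 40 * (A ⌊y⌋ / 40) + 40 := by omega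
      have q1' : (40 : ℝ) * (A ⌊y⌋ / 40 : ℤ) < A ⌊y⌋ := by exact_mod_cast q1
      have q2' : (A ⌊y⌋ : ℝ) < 40 * (A ⌊y⌋ / 40 : ℤ) + 40 := by exact_mod_cast q2
      constructor <;> linarith
  · obtain ⟨l1, l2⟩ := e1 hpos
    have n1 := (hloc ⌊y⌋).2.2.2.1
    have n2 := (hloc ⌊y'⌋).2.2.2.1
    unfold lin at ea er
    set i := ⌊y⌋
    set j := ⌊y'⌋
    set u := Int.fract y
    set v := Int.fract y'
    set a : ℝ := A i + u * (A (i + 1) - A i) with ha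
    have ea' : a = A j + v * (A (j + 1) - A j) := by rw [ha]; linarith
    have er' : (R i : ℝ) + u * (R (i + 1) - R i) = R j + v * (R (j + 1) - R j) := by linarith
    have bd : ∀ (i : ℤ) (u a : ℝ), 0 ≤ u → u < 1 → a = A i + u * (A (i + 1) - A i) →
        (lo A i : ℝ) ≤ a ∧ a ≤ hi A i ∧ ((a = lo A i ∨ a = hi A i) → A (i + 1) ≠ A i → u = 0) := by
      intro i u a h0 h1 ha
      unfold lo hi
      rcases le_total (A i) (A (i + 1)) with h | h
      · rw [min_eq_left h, max_eq_right h]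
        have h' : (A i : ℝ) ≤ A (i + 1) := by exact_mod_cast h
        refine ⟨by nlinarith, by nlinarith, fun hor hne => ?_⟩
        have hne' : (A (i + 1) : ℝ) - A i ≠ 0 := by rw [sub_ne_zero]; exact_mod_cast hne
        rcases hor with hor | hor
        · have : u * ((A (i + 1) : ℝ) - A i) = 0 := by linarith
          exact (mul_eq_zero.1 this).resolve_right hne'
        · have : (1 - u) * ((A (i + 1) : ℝ) - A i) = 0 := by linarith
          have := (mul_eq_zero.1 this).resolve_right hne'
          linarith
      · rw [min_eq_right h, max_eq_left h]
        have h' : (A (i + 1) : ℝ) ≤ A i := by exact_mod_cast h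
        refine ⟨by nlinarith, by nlinarith, fun hor hne => ?_⟩
        have hne' : (A (i + 1) : ℝ) - A i ≠ 0 := by rw [sub_ne_zero]; exact_mod_cast hne
        rcases hor with hor | hor
        · have : (1 - u) * ((A (i + 1) : ℝ) - A i) = 0 := by linarith
          have := (mul_eq_zero.1 this).resolve_right hne'
          linarith
        · have : u * ((A (i + 1) : ℝ) - A i) = 0 := by linarith
          exact (mul_eq_zero.1 this).resolve_right hne'
    obtain ⟨b1, b2, b3⟩ := bd i u a f0 f1 ha
    obtain ⟨c1, c2, c3⟩ := bd j v a g0 g1 ea'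
    have gapne : ∀ (ε : ℝ), 0 < ε * gap R A i j (max (lo A i) (lo A j)) →
        0 < ε * gap R A i j (min (hi A i) (hi A j)) → False := by
      intro ε h1 h2
      set p := max (lo A i) (lo A j)
      set q := min (hi A i) (hi A j)
      have hp : (p : ℝ) ≤ a := by simp only [p]; push_cast; exact max_le b1 c1
      have hq : a ≤ (q : ℝ) := by simp only [q]; push_cast; exact le_min b2 c2
      set G : ℝ → ℝ := fun t => ((R i * (A (i + 1) - t) + R (i + 1) * (t - A i)) *
        (A (j + 1) - A j) - (R j * (A (j + 1) - t) + R (j + 1) * (t - A j)) *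
        (A (i + 1) - A i)) * ((A (i + 1) - A i) * (A (j + 1) - A j)) with hG
      have hGi : ∀ t : ℤ, (gap R A i j t : ℝ) = G t := by intro t; unfold gap rise; push_cast; rfl
      have hGa : G a = 0 := by
        have x1 : (R i : ℝ) * (A (i + 1) - a) + R (i + 1) * (a - A i) =
            (R i + u * (R (i + 1) - R i)) * (A (i + 1) - A i) := by rw [ha]; ring
        have x2 : (R j : ℝ) * (A (j + 1) - a) + R (j + 1) * (a - A j) =
            (R j + v * (R (j + 1) - R j)) * (A (j + 1) - A j) := by rw [ea']; ring
        simp only [hG]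
        rw [x1, x2, er']; ring
      rw [hGi] at h1 h2
      have aff : G a * (q - p) = G p * (q - a) + G q * (a - p) := by simp only [hG]; ring
      rw [hGa, zero_mul] at aff
      rcases hp.eq_or_lt with hpe | hpl
      · rw [hpe, hGa] at h1; simp at h1
      · have t1 : 0 < ε * G q * (a - p) := mul_pos h2 (by linarith)
        have t2 : 0 ≤ ε * G p * (q - a) := mul_nonneg h1.le (by linarith)
        have : ε * (G p * (q - a) + G q * (a - p)) = 0 := by rw [← aff, mul_zero]
        linarith
    rcases p1 with p | ⟨p, p'⟩ | ⟨p, p'⟩ | ⟨p, p'⟩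
    · exact p (Prod.ext l1 l2)
    · have huv : u = 0 ∧ v = 0 := by
        rcases p with p | p
        · have : (hi A i : ℝ) ≤ lo A j := by exact_mod_cast p
          exact ⟨b3 (Or.inr (by linarith)) n1, c3 (Or.inl (by linarith)) n2⟩
        · have : (hi A j : ℝ) ≤ lo A i := by exact_mod_cast p
          exact ⟨b3 (Or.inl (by linarith)) n1, c3 (Or.inr (by linarith)) n2⟩
      rw [huv.1] at ha er'
      rw [huv.2] at ea' er'
      rcases p' with p' | p'
      · apply p'
        have : (A i : ℝ) = A j := by linarith
        exact_mod_cast this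
      · apply p'
        have : (R i : ℝ) = R j := by linarith
        exact_mod_cast this
    · exact gapne 1 (by rw [one_mul]; exact_mod_cast p) (by rw [one_mul]; exact_mod_cast p')
    · refine gapne (-1) ?_ ?_
      · have : (gap R A i j (max (lo A i) (lo A j)) : ℝ) < 0 := by exact_mod_cast p
        linarith
      · have : (gap R A i j (min (hi A i) (hi A j)) : ℝ) < 0 := by exact_mod_cast p'
        linarith

lemma continuous_plMap : Continuous (plMap lab R A) :=
  continuous_glue_real (fun i y => pt (lab i).1 (lab i).2 (lin (fun i => (R i : ℝ) / 40) y)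
      (lin (fun i => (A i : ℝ) / 40) y)) (fun i => by
    have := continuous_lin fun i => (R i : ℝ) / 40
    have := continuous_lin fun i => (A i : ℝ) / 40
    exact (continuous_pt (lab i).1 (lab i).2).comp
      (f := fun y => (lin (fun i => (R i : ℝ) / 40) y, lin (fun i => (A i : ℝ) / 40) y))
      (by fun_prop)) fun i y h0 h1 => plMap_on hloc i h0 h1

lemma plMap_snd_ne_zero (y : ℝ) : (plMap lab R A y).2 ≠ 0 := by
  intro h
  obtain ⟨h1, k, hk⟩ := pt_snd_eq_zero h
  obtain ⟨h2, h3⟩ := node_of_zero hloc (le_antisymm h1 (lin_height_mem hloc y).1)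
  have := (hloc ⌊y⌋).2.2.2.2
  rw [if_pos h3] at this
  apply this.2
  have t1 : lin (fun i => (A i : ℝ) / 40) y = (A ⌊y⌋ : ℝ) / 40 := by simp [lin, h2]
  rw [t1] at hk
  have : (A ⌊y⌋ : ℝ) = (40 * k : ℤ) := by push_cast; linarith
  have : A ⌊y⌋ = 40 * k := by exact_mod_cast this
  omega

lemma lin_injOn_unit {y y' : ℝ} (hf : ⌊y⌋ = ⌊y'⌋)
    (e : lin (fun i => (A i : ℝ) / 40) y = lin (fun i => (A i : ℝ) / 40) y') : y = y' := by
  have n1 := (hloc ⌊y⌋).2.2.2.1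
  unfold lin at e
  rw [← hf] at e
  have hne : (A (⌊y⌋ + 1) : ℝ) - A ⌊y⌋ ≠ 0 := by rw [sub_ne_zero]; exact_mod_cast n1
  have : (Int.fract y - Int.fract y') * ((A (⌊y⌋ + 1) : ℝ) - A ⌊y⌋) = 0 := by linarith
  have := (mul_eq_zero.1 this).resolve_right hne
  have e1 := Int.floor_add_fract y
  have e2 := Int.floor_add_fract y'
  rw [← hf] at e2
  linarith

end

lemma plMap_add (hD : D = 320 ∨ D = -320) (hA : ∀ i, A (i + n) = A i + D)
    (hR : ∀ i, R (i + n) = R i) (hl : ∀ i, lab (i + n) = lab i) (y : ℝ) (q : ℤ) :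
    plMap lab R A (y + (q * n : ℤ)) = plMap lab R A y := by
  have eA : lin (fun i => (A i : ℝ) / 40) (y + (q * n : ℤ)) =
      lin (fun i => (A i : ℝ) / 40) y + 8 * (q * (D / 320) : ℤ) := by
    refine lin_add_int (fun i => ?_) y
    rw [shift_mul hA]
    rcases hD with rfl | rfl <;> norm_num <;> ring
  have eR : lin (fun i => (R i : ℝ) / 40) (y + (q * n : ℤ)) =
      lin (fun i => (R i : ℝ) / 40) y + 0 := by
    refine lin_add_int (fun i => ?_) y
    rw [shift_mul (a0 := R) (h := n) (D := 0) (fun i => by rw [hR, add_zero])]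
    simp
  unfold plMap
  rw [eA, eR, Int.floor_add_intCast, lab_mul hl, pt_add, add_zero]

/-- A closed piecewise linear curve is simple. -/
lemma IsPL.simple (h : IsPL n K D m M lab R A) (hD : D = 320 ∨ D = -320)
    (hA : ∀ i, A (i + n) = A i + D) (hR : ∀ i, R (i + n) = R i) (hl : ∀ i, lab (i + n) = lab i) :
    IsSimpleClosed fun t => plMap lab R A (n * t) := by
  have hloc := h.local_all hD hA hR hl
  have hn : (0 : ℝ) < n := by exact_mod_cast h.pos
  refine ⟨(continuous_plMap hloc).comp (by fun_prop), fun t => ?_, ?_, fun t => ?_⟩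
  · have := plMap_add hD hA hR hl (n * t) 1
    change plMap lab R A (n * (t + 1)) = plMap lab R A (n * t)
    rw [← this]; congr 1; push_cast; ring
  · intro t ht t' ht' e
    simp only at e
    obtain ⟨-, ⟨k, hk⟩, -⟩ := pt_inj (lin_height_mem hloc _).1 (lin_height_mem hloc _).1 e
    have e1 : plMap lab R A (n * t' + ((-(k * (D / 320)) * n : ℤ))) = plMap lab R A (n * t) := by
      rw [plMap_add hD hA hR hl, e]
    have e2 : lin (fun i => (A i : ℝ) / 40) (n * t' + ((-(k * (D / 320)) * n : ℤ))) =
        lin (fun i => (A i : ℝ) / 40) (n * t) := by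
      have : lin (fun i => (A i : ℝ) / 40) (n * t' + ((-(k * (D / 320)) * n : ℤ))) =
        lin (fun i => (A i : ℝ) / 40) (n * t') + 8 * (-(k * (D / 320)) * (D / 320) : ℤ) := by
        refine lin_add_int (fun i => ?_) _
        rw [shift_mul hA]
        rcases hD with rfl | rfl <;> norm_num <;> ring
      rw [this, hk]
      rcases hD with rfl | rfl <;> norm_num
    have e3 : n * t' + ((-(k * (D / 320)) * n : ℤ)) = n * t := by
      rcases lt_trichotomy ⌊n * t'+ ((-(k * (D / 320)) * n : ℤ))⌋ ⌊n * t⌋ with hlt | heq | hlt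
      · exact absurd e2 (plMap_ne hloc (fun i j => h.pair_all hD hA hR hl) hlt e1)
      · exact lin_injOn_unit hloc heq e2
      · exact absurd e2.symm (plMap_ne hloc (fun i j => h.pair_all hD hA hR hl) hlt e1.symm)
    push_cast at e3
    have e4 : t' + (-(k * (D / 320 : ℤ)) : ℤ) = t := by
      push_cast
      exact mul_left_cancel₀ hn.ne' (by linear_combination e3)
    have e5 : (-(k * (D / 320 : ℤ)) : ℤ) = 0 := by
      have a1 : ((-(k * (D / 320 : ℤ)) : ℤ) : ℝ) < (1 : ℤ) := by
        push_cast at e4 ⊢; linarith [ht.1, ht.2, ht'.1, ht'.2]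
      have a2 : ((-1 : ℤ) : ℝ) < (-(k * (D / 320 : ℤ)) : ℤ) := by
        push_cast at e4 ⊢; linarith [ht.1, ht.2, ht'.1, ht'.2]
      have a1' := Int.cast_lt.1 a1
      have a2' := Int.cast_lt.1 a2
      omega
    rw [e5] at e4
    push_cast at e4
    linarith
  · exact pt_mem (lin_height_mem hloc _).2

end pl

/-! ### Piecewise linear lifts and the words of their crossings -/

lemma lin_strictMonoOn {f : ℤ → ℝ} {p q : ℤ} (h : ∀ i, p ≤ i → i < q → f i < f (i + 1)) :
    StrictMonoOn (lin f) (Set.Icc (p : ℝ) q) := by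
  rcases lt_or_ge q p with hqp | hpq
  · rw [Set.Icc_eq_empty (by rw [not_le]; exact_mod_cast hqp)]
    exact fun x hx => hx.elim
  set g : ℤ → ℝ := fun i => if i < p then f p + (i - p) else if i ≤ q then f i else f q + (i - q)
    with hg
  have hmono : StrictMono (lin g) := lin_strictMono fun i => by
    simp only [hg]
    split_ifs with h1 h2 h3 h4 h5 h6 h7
    · grind
    · have : i + 1 = p := by omega
      have e : (i : ℝ) = p - 1 := by have : (i : ℝ) + 1 = p := by exact_mod_cast this
                                     linarith
      grind
    · omega
    · omega
    · grind
    · grind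
    · omega
    · omega
    grind
  have agree : ∀ x ∈ Set.Icc (p : ℝ) q, lin f x = lin g x := by
    rintro x ⟨h0, h1⟩
    have gi : ∀ i, p ≤ i → i ≤ q → g i = f i := fun i h0 h1 => by grind
    have f0 : p ≤ ⌊x⌋ := Int.le_floor.2 h0
    rcases h1.eq_or_lt with e | e
    · have hpq : p ≤ q := by grind
      rw [e, lin_int, lin_int, gi q hpq le_rfl]
    · have f1 : ⌊x⌋ < q := Int.floor_lt.2 e
      unfold lin
      grind
  intro x hx y hy hxy
  rw [agree x hx, agree y hy]
  exact hmono hxy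

/-- The nodes between the crossings `k` and `k + 1` make up an arc. -/
def SlotOK (lab : ℤ → Label) (R A ν : ℤ → ℤ) (S : ℤ → Label) (k : ℤ) : Prop :=
  ν k < ν (k + 1) ∧ R (ν k) = 0 ∧ (∀ i < (ν (k + 1) - ν k).toNat, lab (ν k + i) = S k) ∧
  ((∀ i < (ν (k + 1) - ν k).toNat, A (ν k + i) < A (ν k + i + 1)) ∨
    (∀ i < (ν (k + 1) - ν k).toNat, A (ν k + i + 1) < A (ν k + i))) ∧
  (S (k + 1)).1 ≠ (S k).1 ∧ |A (ν (k + 1)) - A (ν k)| ≤ 400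

instance (lab : ℤ → Label) (R A ν : ℤ → ℤ) (S : ℤ → Label) (k : ℤ) :
    Decidable (SlotOK lab R A ν S k) := by unfold SlotOK; infer_instance

section slots
variable {lab S : ℤ → Label} {R A ν : ℤ → ℤ} {n K N : ℕ} {D m M : ℤ}

lemma slotOK_add (hA : ∀ i, A (i + n) = A i + D)
    (hR : ∀ i, R (i + n) = R i) (hl : ∀ i, lab (i + n) = lab i) (hν : ∀ k, ν (k + N) = ν k + n)
    (hS : ∀ k, S (k + N) = S k) (k : ℤ) :
    SlotOK lab R A ν S (k + N) ↔ SlotOK lab R A ν S k := by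
  unfold SlotOK
  rw [show k + (N : ℤ) + 1 = k + 1 + N by ring]
  have e : ∀ i : ℤ, ν k + n + i = ν k + i + n := fun i => by ring
  have e' : ∀ i : ℤ, ν k + i + n + 1 = ν k + i + 1 + n := fun i => by ring
  simp only [hν, hS, hR, hA, e, hl, e', add_lt_add_iff_right, add_sub_add_right_eq_sub]

theorem IsPL.isGraph (h : IsPL n K D m M lab R A) (hD : D = 320 ∨ D = -320)
    (hA : ∀ i, A (i + n) = A i + D) (hR : ∀ i, R (i + n) = R i) (hl : ∀ i, lab (i + n) = lab i)
    (hN : 0 < N) (hν : ∀ k, ν (k + N) = ν k + n) (hS : ∀ k, S (k + N) = S k)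
    (hs : ∀ k, SlotOK lab R A ν S k) :
    IsGraph S (fun x => lin (fun i => (R i : ℝ) / 40) (lin (fun k => (ν k : ℝ)) x))
      (fun x => lin (fun i => (A i : ℝ) / 40) (lin (fun k => (ν k : ℝ)) x)) N (D / 320) ∧
    graphMap S (fun x => lin (fun i => (R i : ℝ) / 40) (lin (fun k => (ν k : ℝ)) x))
      (fun x => lin (fun i => (A i : ℝ) / 40) (lin (fun k => (ν k : ℝ)) x)) =
      fun x => plMap lab R A (lin (fun k => (ν k : ℝ)) x) := by
  have hloc := h.local_all hD hA hR hl
  have smono : StrictMono (lin fun k => (ν k : ℝ)) :=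
    lin_strictMono fun k => by exact_mod_cast (hs k).1
  have νper : ∀ x, lin (fun k => (ν k : ℝ)) (x + N) = lin (fun k => (ν k : ℝ)) x + n := fun x =>
    lin_add_int (n := N) (fun k => by rw [hν]; push_cast; rfl) x
  have mono : Monotone ν := monotone_int_of_le_succ fun k => (hs k).1.le
  have in_slot : ∀ (k : ℤ) (x : ℝ), x ∈ Set.Icc (k : ℝ) (k + 1) →
      lin (fun k => (ν k : ℝ)) x ∈ Set.Icc (ν k : ℝ) (ν (k + 1)) := by
    intro k x hx
    have h1 := smono.monotone hx.1
    have h2 := smono.monotone hx.2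
    have e : ((k : ℝ) + 1) = ((k + 1 : ℤ) : ℝ) := by push_cast; ring
    rw [e, lin_int] at h2
    rw [lin_int] at h1
    grind
  have floor_slot : ∀ x, ν ⌊x⌋ ≤ ⌊lin (fun k => (ν k : ℝ)) x⌋ ∧
      ⌊lin (fun k => (ν k : ℝ)) x⌋ < ν (⌊x⌋ + 1) := by
    intro x
    have h1 := smono.monotone (Int.floor_le x)
    have h2 := smono (Int.lt_floor_add_one x)
    have e : ((⌊x⌋ : ℝ) + 1) = ((⌊x⌋ + 1 : ℤ) : ℝ) := by grind
    rw [e, lin_int] at h2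
    rw [lin_int] at h1
    exact ⟨Int.le_floor.2 h1, Int.floor_lt.2 h2⟩
  have hlab : ∀ x, S ⌊x⌋ = lab ⌊lin (fun k => (ν k : ℝ)) x⌋ := by
    intro x
    obtain ⟨f0, f1⟩ := floor_slot x
    have := (hs ⌊x⌋).2.2.1 (⌊lin (fun k => (ν k : ℝ)) x⌋ - ν ⌊x⌋).toNat (by omega)
    grind
  have hgr : graphMap S (fun x => lin (fun i => (R i : ℝ) / 40) (lin (fun k => (ν k : ℝ)) x))
      (fun x => lin (fun i => (A i : ℝ) / 40) (lin (fun k => (ν k : ℝ)) x)) =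
      fun x => plMap lab R A (lin (fun k => (ν k : ℝ)) x) := by
    funext x
    unfold graphMap plMap
    rw [hlab]
  refine ⟨⟨by grind, by grind, fun x => ?_, fun x => ?_,
    hS, (continuous_lin _).comp (continuous_lin _), (continuous_lin _).comp (continuous_lin _),
    ?_, ?_, fun x => (lin_height_mem hloc _).1, fun x => (lin_height_mem hloc _).2, ?_, ?_,
    fun k => (hs k).2.2.2.2.1, ?_⟩, hgr⟩
  · have e := lin_add_int (f := fun i => (A i : ℝ) / 40) (n := n) (c := 8 * (D / 320 : ℤ))
      (fun i => by rw [hA]; rcases hD with rfl | rfl <;> norm_num <;> ring)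
      (lin (fun k => (ν k : ℝ)) x)
    push_cast at e ⊢
    rw [νper, e]
  · have e := lin_add_int (f := fun i => (R i : ℝ) / 40) (n := n) (c := 0)
      (fun i => by rw [hR]; simp) (lin (fun k => (ν k : ℝ)) x)
    push_cast at e ⊢
    grind
  · intro k
    have : Set.InjOn (lin fun i => (A i : ℝ) / 40) (Set.Icc (ν k : ℝ) (ν (k + 1))) := by
      have cov : ∀ i, ν k ≤ i → i < ν (k + 1) →
          (i - ν k).toNat < (ν (k + 1) - ν k).toNat ∧ ν k + ((i - ν k).toNat : ℤ) = i :=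
        fun i h0 h1 => by omega
      rcases (hs k).2.2.2.1 with q | q
      · refine (lin_strictMonoOn fun i h0 h1 => ?_).injOn
        obtain ⟨c1, c2⟩ := cov i h0 h1
        have := q _ c1
        rw [c2] at this
        have : (A i : ℝ) < A (i + 1) := by exact_mod_cast this
        linarith
      · have hneg : StrictMonoOn (lin fun i => -((A i : ℝ) / 40)) (Set.Icc (ν k : ℝ) (ν (k + 1))) :=
          lin_strictMonoOn fun i h0 h1 => by
            obtain ⟨c1, c2⟩ := cov i h0 h1
            have := q _ c1
            rw [c2] at this
            have : (A (i + 1) : ℝ) < A i := by exact_mod_cast this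
            linarith
        have e : (lin fun i => -((A i : ℝ) / 40)) = fun y => -lin (fun i => (A i : ℝ) / 40) y := by
          funext y; unfold lin; ring
        rw [e] at hneg
        intro x hx y hy hxy
        exact hneg.injOn hx hy (by grind)
    intro x hx y hy e
    exact smono.injective (this (in_slot k x hx) (in_slot k y hy) e)
  · intro k
    simp only [lin_int]
    rw [(hs k).2.1]; simp
  · intro k
    have e : ((k : ℝ) + 1) = ((k + 1 : ℤ) : ℝ) := by grind
    simp only [e, lin_int]
    have := (hs k).2.2.2.2.2
    have : |(A (ν (k + 1)) : ℝ) - A (ν k)| ≤ 400 := by exact_mod_cast this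
    rw [abs_le] at *
    constructor <;> linarith
  · intro k
    simp only [lin_int]
    have h1 := (hloc (ν k)).2.2.2.2
    rw [if_pos (hs k).2.1] at h1
    have l0 := (hs k).2.2.1 0 (by have := (hs k).1; omega)
    have l1 := (hs (k - 1)).2.2.1 (ν k - ν (k - 1) - 1).toNat (by
      have := (hs (k - 1)).1
      rw [sub_add_cancel] at this ⊢
      omega)
    have hlt := (hs (k - 1)).1
    rw [sub_add_cancel] at hlt
    rw [show ν (k - 1) + ((ν k - ν (k - 1) - 1).toNat : ℤ) = ν k - 1 by omega] at l1
    simp only [Nat.cast_zero, add_zero] at l0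
    rw [l0, l1] at h1
    refine pt_axis_eq (k := A (ν k) / 40) ?_ h1.1
    have e0 : 40 * (A (ν k) / 40) ≤ A (ν k) := by omega
    have e1 : A (ν k) ≤ 40 * (A (ν k) / 40) + 40 := by omega
    have e0' : (40 : ℝ) * (A (ν k) / 40 : ℤ) ≤ A (ν k) := by exact_mod_cast e0
    have e1' : (A (ν k) : ℝ) ≤ 40 * (A (ν k) / 40 : ℤ) + 40 := by exact_mod_cast e1
    constructor <;> linarith
  · intro x x' hlt e
    rw [hgr] at e
    refine plMap_ne hloc (fun i j => h.pair_all hD hA hR hl) ?_ e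
    have h1 := (floor_slot x).2
    have h2 := (floor_slot x').1
    have h3 := mono (show ⌊x⌋ + 1 ≤ ⌊x'⌋ by omega)
    omega

end slots

/-- A closed piecewise linear curve and the positions `p` of its crossings with the unit circle. -/
def Crossings (n h K : ℕ) (D m M : ℤ) (lab : List Label) (R A : List ℤ)
    (S : List Label) (p ν : List ℤ) : Prop :=
  IsPL n K (2 * D) m M (extendLab n lab) (extend n 0 R) (extend n (2 * D) A) ∧ 0 < h ∧
  ∀ k < 2 * h, SlotOK (extendLab n lab) (extend n 0 R) (extend n (2 * D) A) (extend (2 * h) n ν)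
      (extendLab h S) (k : ℕ) ∧
    extend n (2 * D) A (extend (2 * h) n ν (k : ℕ)) = extend h D p (k : ℕ)

instance (n h K : ℕ) (D m M : ℤ) (lab : List Label) (R A : List ℤ)
    (S : List Label) (p ν : List ℤ) : Decidable (Crossings n h K D m M lab R A S p ν) := by
  unfold Crossings; infer_instance

/-- The curve `β` is isotopic to the one with the given word. -/
def Draws (β : Curve) (h : ℕ) (D : ℤ) (lab : List Label) (p : List ℤ) : Prop :=
  ∃ γ, Rep (2 * h : ℤ) (word h D lab p) γ ∧ Iso β γ

theorem Crossings.draws {n h K : ℕ} {D m M : ℤ} {lab : List Label} {R A : List ℤ}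
    {S : List Label} {p ν : List ℤ} (hc : Crossings n h K D m M lab R A S p ν)
    (hD : D = 160 ∨ D = -160) :
    Draws (fun t => plMap (extendLab n lab) (extend n 0 R) (extend n (2 * D) A) (n * t))
      h D S p := by
  obtain ⟨hpl, hh, hk⟩ := hc
  have hD2 : 2 * D = 320 ∨ 2 * D = -320 := by omega
  have hn := hpl.pos
  have hA := extend_add hn (2 * D) A
  have hR : ∀ i, extend n 0 R (i + n) = extend n 0 R i := fun i => by rw [extend_add hn, add_zero]
  have hl := extendLab_add n lab
  have hν : ∀ k, extend (2 * h) n ν (k + (2 * h : ℕ)) = extend (2 * h) n ν k + n :=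
    extend_add (by omega) _ _
  have hS : ∀ k, extendLab h S (k + (2 * h : ℕ)) = extendLab h S k := fun k => by
    push_cast
    rw [show k + 2 * (h : ℤ) = k + h + h by ring, extendLab_add, extendLab_add]
  have hp : ∀ k, extend h D p (k + (2 * h : ℕ)) = extend h D p k + 2 * D := fun k => by
    push_cast
    rw [show k + 2 * (h : ℤ) = k + h + h by ring, extend_add hh, extend_add hh]; ring
  have hN : 0 < 2 * h := by omega
  have all : ∀ k, SlotOK (extendLab n lab) (extend n 0 R) (extend n (2 * D) A)
      (extend (2 * h) n ν) (extendLab h S) k ∧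
      extend n (2 * D) A (extend (2 * h) n ν k) = extend h D p k := by
    intro k
    refine forall_of_shift (P := fun k _ => SlotOK (extendLab n lab) (extend n 0 R)
      (extend n (2 * D) A) (extend (2 * h) n ν) (extendLab h S) k ∧
      extend n (2 * D) A (extend (2 * h) n ν k) = extend h D p k) hN (fun k _ => ?_)
      (fun k _ h0 h1 _ => ?_) (lt_add_one k)
    · rw [slotOK_add hA hR hl hν hS, hν, hA, hp, add_left_inj]
    · obtain ⟨q, rfl⟩ := Int.eq_ofNat_of_zero_le h0
      exact hk q (by omega)
  obtain ⟨hg, he⟩ := hpl.isGraph hD2 hA hR hl hN hν hS fun k => (all k).1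
  have key := hg.lineIso
  have hsimple := hpl.simple hD2 hA hR hl
  have hchain : chain (extendLab h S) 0 (fun i => lin (fun i => (extend n (2 * D) A i : ℝ) / 40)
      (lin (fun k => (extend (2 * h) n ν k : ℝ)) i)) = word h D S p := by
    unfold word
    congr 1
    funext i
    rw [lin_int, lin_int, (all i).2]
  rw [hchain, he] at key
  have hn' : (0 : ℝ) < n := by exact_mod_cast hn
  have rep := hsimple.rep (P := n) hn'
  have rep' := rep.comp (P' := (2 * h : ℕ)) (by positivity) (continuous_lin fun k =>
    (extend (2 * h) n ν k : ℝ)) (lin_monotone fun k => by exact_mod_cast (all k).1.1.le)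
    (fun x => lin_add_int (n := (2 * h : ℕ)) (fun k => by rw [hν]; push_cast; rfl) x)
  have ee : (fun x => plMap (extendLab n lab) (extend n 0 R) (extend n (2 * D) A)
      (n * (lin (fun k => (extend (2 * h) n ν k : ℝ)) x / n))) =
      fun x => plMap (extendLab n lab) (extend n 0 R) (extend n (2 * D) A)
      (lin (fun k => (extend (2 * h) n ν k : ℝ)) x) := by
    funext x
    rw [mul_div_cancel₀ _ hn'.ne']
  rw [ee] at rep'
  obtain ⟨γ, γ', h1, h2, h3⟩ := key
  refine ⟨γ', ?_, (rep'.isotopic ?_).iso.trans h3⟩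
  · exact_mod_cast h2
  · exact_mod_cast h1

/-- The integral sign of a half-plane. -/
def sgz (b : Bool) : ℤ := if b then 1 else -1

/-- The piecewise linear map runs through the vertices `V`; every second node is a midpoint. -/
def Traces (n : ℕ) (lab : ℤ → Label) (R A : ℤ → ℤ) (V : List (ℤ × ℤ)) : Prop :=
  V.length = n + 1 ∧ ∀ j < n,
    sgz (lab (2 * j : ℕ)).1 * R (2 * j : ℕ) = (V.getD j 0).1 ∧
    2 * (sgz (lab (2 * j : ℕ)).1 * R (2 * j + 1 : ℕ)) = (V.getD j 0).1 + (V.getD (j + 1) 0).1 ∧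
    2 * (sgz (lab (2 * j + 1 : ℕ)).1 * R (2 * j + 1 : ℕ)) =
      (V.getD j 0).1 + (V.getD (j + 1) 0).1 ∧
    sgz (lab (2 * j + 1 : ℕ)).1 * R (2 * j + 2 : ℕ) = (V.getD (j + 1) 0).1 ∧
    A (2 * j : ℕ) = (V.getD j 0).2 ∧ 2 * A (2 * j + 1 : ℕ) = (V.getD j 0).2 + (V.getD (j + 1) 0).2 ∧
    A (2 * j + 2 : ℕ) = (V.getD (j + 1) 0).2

instance (n : ℕ) (lab : ℤ → Label) (R A : ℤ → ℤ) (V : List (ℤ × ℤ)) :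
    Decidable (Traces n lab R A V) := by unfold Traces; infer_instance

lemma sg_eq_sgz (b : Bool) : sg b = sgz b := by cases b <;> simp [sg, sgz]

lemma sg_pos_im {u σ : Bool} {r : ℝ} {k : ℤ} :
    0 < sg (lower u σ k) * (pt u σ r (1 / 2 + k)).2.im := by
  simp only [pt, branch_half]
  have hp := slitRoot_half_pos r
  have hq : 0 < (if u then Real.exp (4 * max r 0) else 1) := by
    split_ifs
    · exact Real.exp_pos _
    · exact one_pos
  have e : (((sg σ : ℝ) : ℂ) * (((sg (!(u && odd k)) * (if u then Real.exp (4 * max r 0) else 1) *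
      (1 + Real.exp (-8 * max r 0)) ^ (2⁻¹ : ℝ) : ℝ) : ℂ) * Complex.I)).im =
      sg (lower u σ k) * ((if u then Real.exp (4 * max r 0) else 1) *
      (1 + Real.exp (-8 * max r 0)) ^ (2⁻¹ : ℝ)) := by
    rw [lower, sg_xor, ← mul_assoc, ← Complex.ofReal_mul, Complex.im_ofReal_mul, Complex.I_im]
    ring
  rw [e, ← mul_assoc, sg_mul_self, one_mul]
  positivity

lemma Traces.isLift {n K : ℕ} {D m M : ℤ} {lab : ℤ → Label} {R A : ℤ → ℤ} {V : List (ℤ × ℤ)}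
    (hT : Traces n lab R A V) (h : IsPL (2 * n) K D m M lab R A) (hD : D = 320 ∨ D = -320)
    (hA : ∀ i, A (i + (2 * n : ℕ)) = A i + D) (hR : ∀ i, R (i + (2 * n : ℕ)) = R i)
    (hl : ∀ i, lab (i + (2 * n : ℕ)) = lab i) {ε : ℝ}
    (h0 : A 0 % 40 = 20) (hε : ε = sg (lowerOf (lab 0) (A 0 / 40))) :
    IsLift (V.map fun v => ((v.1 : ℝ) / 40, (v.2 : ℝ) / 40), ε)
      (fun t => plMap lab R A ((2 * n : ℕ) * t)) := by
  have hs := h.simple hD hA hR hl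
  have hloc := h.local_all hD hA hR hl
  refine ⟨hs.continuous, hs.periodic, hs.mem, fun t => plMap_snd_ne_zero hloc _, ?_, ?_⟩
  · intro j hj u hu
    obtain ⟨hlen, hT⟩ := hT
    simp only [List.length_map, hlen, add_tsub_cancel_right] at hj ⊢
    obtain ⟨t1, t2, t3, t4, t5, t6, t7⟩ := hT j (by omega)
    have hn : (n : ℝ) ≠ 0 := by
      have : 0 < n := by omega
      positivity
    have ey : (2 * n : ℕ) * (((j : ℝ) + u) / n) = 2 * j + 2 * u := by push_cast; field_simp
    rw [ey]
    simp only [List.getElem_map]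
    rw [List.getD_eq_getElem V 0 (by omega)] at t1 t2 t3 t5 t6
    rw [List.getD_eq_getElem V 0 (by omega)] at t2 t3 t4 t6 t7
    set v := V[j]
    set v' := V[j + 1]
    have fin : ∀ (i : ℤ) (y : ℝ), (i : ℝ) ≤ y → y ≤ i + 1 →
        sg (lab i).1 * lin (fun i => (R i : ℝ) / 40) y = (1 - u) * (v.1 / 40) + u * (v'.1 / 40) →
        lin (fun i => (A i : ℝ) / 40) y = (1 - u) * (v.2 / 40) + u * (v'.2 / 40) →
        (plMap lab R A y).1 = polar ((1 - u) • ((v.1 : ℝ) / 40, (v.2 : ℝ) / 40) +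
          u • ((v'.1 : ℝ) / 40, (v'.2 : ℝ) / 40)) := by
      intro i y a0 a1 b0 b1
      rw [plMap_on hloc i a0 a1]
      simp only [pt]
      rw [max_eq_left (lin_height_mem hloc y).1, b0, b1]
      rfl
    have c1 : (sgz (lab ((2 * j : ℕ) : ℤ)).1 : ℝ) * R ((2 * j : ℕ) : ℤ) = v.1 := by exact_mod_cast t1
    have c2 : 2 * ((sgz (lab ((2 * j : ℕ) : ℤ)).1 : ℝ) * R ((2 * j + 1 : ℕ) : ℤ)) = v.1 + v'.1 := by
      exact_mod_cast t2
    have c3 : 2 * ((sgz (lab ((2 * j + 1 : ℕ) : ℤ)).1 : ℝ) * R ((2 * j + 1 : ℕ) : ℤ)) =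
      v.1 + v'.1 := by exact_mod_cast t3
    have c4 : (sgz (lab ((2 * j + 1 : ℕ) : ℤ)).1 : ℝ) * R ((2 * j + 2 : ℕ) : ℤ) = v'.1 := by
      exact_mod_cast t4
    have c5 : (A ((2 * j : ℕ) : ℤ) : ℝ) = v.2 := by exact_mod_cast t5
    have c6 : 2 * (A ((2 * j + 1 : ℕ) : ℤ) : ℝ) = v.2 + v'.2 := by exact_mod_cast t6
    have c7 : (A ((2 * j + 2 : ℕ) : ℤ) : ℝ) = v'.2 := by exact_mod_cast t7
    rcases le_total u (1 / 2) with hu2 | hu2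
    · have a0 : (((2 * j : ℕ) : ℤ) : ℝ) ≤ 2 * j + 2 * u := by push_cast; linarith [hu.1]
      have a1 : (2 * j + 2 * u : ℝ) ≤ ((2 * j : ℕ) : ℤ) + 1 := by push_cast; linarith
      have e1 : (((2 * j : ℕ) : ℤ) + 1) = ((2 * j + 1 : ℕ) : ℤ) := by push_cast; ring
      refine fin (2 * j : ℕ) _ a0 a1 ?_ ?_
      · rw [lin_on _ _ a0 a1, sg_eq_sgz, e1]
        push_cast
        push_cast at c1 c2
        linear_combination (1 - 2 * u) / 40 * c1 + 2 * u / 80 * c2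
      · rw [lin_on _ _ a0 a1, e1]
        push_cast
        push_cast at c5 c6
        linear_combination (1 - 2 * u) / 40 * c5 + 2 * u / 80 * c6
    · have a0 : (((2 * j + 1 : ℕ) : ℤ) : ℝ) ≤ 2 * j + 2 * u := by push_cast; linarith
      have a1 : (2 * j + 2 * u : ℝ) ≤ ((2 * j + 1 : ℕ) : ℤ) + 1 := by push_cast; linarith [hu.2]
      have e1 : (((2 * j + 1 : ℕ) : ℤ) + 1) = ((2 * j + 2 : ℕ) : ℤ) := by push_cast; ring
      refine fin (2 * j + 1 : ℕ) _ a0 a1 ?_ ?_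
      · rw [lin_on _ _ a0 a1, sg_eq_sgz, e1]
        push_cast
        push_cast at c3 c4
        linear_combination (2 - 2 * u) / 80 * c3 + (2 * u - 1) / 40 * c4
      · rw [lin_on _ _ a0 a1, e1]
        push_cast
        push_cast at c6 c7
        linear_combination (2 - 2 * u) / 80 * c6 + (2 * u - 1) / 40 * c7
  · simp only [mul_zero]
    have e : (A 0 : ℝ) / 40 = 1 / 2 + (A 0 / 40 : ℤ) := by
      have : A 0 = 40 * (A 0 / 40) + 20 := by omega
      have : (A 0 : ℝ) = 40 * (A 0 / 40 : ℤ) + 20 := by exact_mod_cast this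
      linarith
    unfold plMap
    have f0 : ⌊(0 : ℝ)⌋ = 0 := Int.floor_zero
    have e1 : lin (fun i => (A i : ℝ) / 40) 0 = (A 0 : ℝ) / 40 := by
      have := lin_int (fun i => (A i : ℝ) / 40) 0
      simpa using this
    rw [f0, e1, e, hε]
    exact sg_pos_im

/-- Everything that has to be checked to find a lift and its crossings. -/
def LiftCheck (n h K : ℕ) (D m M : ℤ) (lab : List Label) (R A : List ℤ)
    (S : List Label) (p ν : List ℤ) (V : List (ℤ × ℤ)) (b : Bool) : Prop :=
  Crossings (2 * n) h K D m M lab R A S p ν ∧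
  Traces n (extendLab (2 * n) lab) (extend (2 * n) 0 R) (extend (2 * n) (2 * D) A) V ∧
  extend (2 * n) (2 * D) A 0 % 40 = 20 ∧
  lowerOf (extendLab (2 * n) lab 0) (extend (2 * n) (2 * D) A 0 / 40) = b

instance (n h K : ℕ) (D m M : ℤ) (lab : List Label) (R A : List ℤ)
    (S : List Label) (p ν : List ℤ) (V : List (ℤ × ℤ)) (b : Bool) :
    Decidable (LiftCheck n h K D m M lab R A S p ν V b) := by unfold LiftCheck; infer_instance

theorem exists_lift {n h K : ℕ} {D m M : ℤ} {lab : List Label} {R A : List ℤ}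
    {S : List Label} {p ν : List ℤ} {V : List (ℤ × ℤ)} {b : Bool}
    (hc : LiftCheck n h K D m M lab R A S p ν V b) (hD : D = 160 ∨ D = -160)
    {L : List (ℝ × ℝ) × ℝ} (hL : (V.map fun v => ((v.1 : ℝ) / 40, (v.2 : ℝ) / 40), sg b) = L) :
    ∃ γ : Curve, IsLift L γ ∧ Draws γ h D S p := by
  subst hL
  obtain ⟨h1, h2, h3, h4⟩ := hc
  have hn := h1.1.pos
  exact ⟨_, h2.isLift h1.1 (by omega) (extend_add hn _ _)
    (fun i => by rw [extend_add hn, add_zero]) (extendLab_add _ _) h3 (by rw [h4]), h1.draws hD⟩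

lemma IsLift.hyp {L : List (ℝ × ℝ)} {ε : ℝ} {γ : Curve} (h : IsLift (L, ε) γ) :
    IsLift (L, -ε) (hyp ∘ γ) where
  continuous := (continuous_fst.comp h.continuous).prodMk (continuous_snd.comp h.continuous).neg
  periodic := fun t => by simp only [Function.comp, h.periodic t]
  mem := fun t => by
    obtain ⟨h1, h2⟩ := h.mem t
    exact ⟨by simp only [Function.comp, SmithPencil.hyp, neg_sq]; exact h1, h2⟩
  ne_zero := fun t => neg_ne_zero.2 (h.ne_zero t)
  path := fun j hj u hu => h.path j hj u hu
  start := by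
    have := h.start
    simp only [Function.comp, SmithPencil.hyp, Complex.neg_im]
    simp only at this
    linarith

/-! ### Annuli around the waves -/

/-- A smooth odd function that is the identity on `[-3/10, 3/10]` and constant outside of
`[-9/20, 9/20]`. -/
noncomputable def clamp (v : ℝ) : ℝ :=
  v - (v - 3 / 10) * Real.smoothTransition ((v - 3 / 10) / (3 / 20)) +
    (-v - 3 / 10) * Real.smoothTransition ((-v - 3 / 10) / (3 / 20))

lemma contDiff_clamp : ContDiff ℝ ∞ clamp := by
  have h1 : ContDiff ℝ ∞ fun v : ℝ => Real.smoothTransition ((v - 3 / 10) / (3 / 20)) :=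
    Real.smoothTransition.contDiff.comp (by fun_prop)
  have h2 : ContDiff ℝ ∞ fun v : ℝ => Real.smoothTransition ((-v - 3 / 10) / (3 / 20)) :=
    Real.smoothTransition.contDiff.comp (by fun_prop)
  unfold clamp
  fun_prop

lemma clamp_neg (v : ℝ) : clamp (-v) = -clamp v := by unfold clamp; grind

lemma clamp_of_nonneg {v : ℝ} (h : 0 ≤ v) :
    clamp v = v - (v - 3 / 10) * Real.smoothTransition ((v - 3 / 10) / (3 / 20)) := by
  unfold clamp
  rw [Real.smoothTransition.zero_of_nonpos (x := (-v - 3 / 10) / (3 / 20)) (by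
    rw [div_nonpos_iff]; right; constructor <;> linarith)]
  ring

lemma clamp_eq {v : ℝ} (h : |v| ≤ 3 / 10) : clamp v = v := by
  obtain ⟨h1, h2⟩ := abs_le.1 h
  unfold clamp
  rw [Real.smoothTransition.zero_of_nonpos (x := (-v - 3 / 10) / (3 / 20)) (by
    rw [div_nonpos_iff]; right; constructor <;> linarith),
    Real.smoothTransition.zero_of_nonpos (x := (v - 3 / 10) / (3 / 20)) (by
    rw [div_nonpos_iff]; right; constructor <;> linarith)]
  ring

lemma clamp_high {v : ℝ} (h : 9 / 20 ≤ v) : clamp v = 3 / 10 := by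
  rw [clamp_of_nonneg (by linarith), Real.smoothTransition.one_of_one_le (by
    rw [le_div_iff₀ (by norm_num)]; linarith)]
  ring

lemma clamp_le {v : ℝ} (h : 0 ≤ v) : clamp v ≤ v := by
  rcases le_or_gt v (3 / 10) with h1 | h1
  · rw [clamp_eq (abs_le.2 ⟨by linarith, h1⟩)]
  · rw [clamp_of_nonneg h]
    have := Real.smoothTransition.nonneg ((v - 3 / 10) / (3 / 20))
    nlinarith

lemma le_clamp {v : ℝ} (h : 0 ≤ v) : min v (3 / 10) ≤ clamp v := by
  rcases le_or_gt v (3 / 10) with h1 | h1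
  · rw [clamp_eq (abs_le.2 ⟨by linarith, h1⟩)]; grind
  · rw [clamp_of_nonneg h, min_eq_right h1.le]
    have := Real.smoothTransition.le_one ((v - 3 / 10) / (3 / 20))
    nlinarith

lemma clamp_bound {v : ℝ} (h : |v| ≤ 1 / 2) : |clamp v| ≤ 1 / 2 := by
  rcases le_total 0 v with h0 | h0
  · have h1 := clamp_le h0
    have h2 := le_clamp h0
    grind
  · have h1 := clamp_le (v := -v) (by linarith)
    have h2 := le_clamp (v := -v) (by linarith)
    have h3 := le_min (show 0 ≤ -v by linarith) (show (0 : ℝ) ≤ 3 / 10 by norm_num)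
    rw [clamp_neg] at h1 h2
    grind

/-- A wave: its sides of the branch points, the sheet of its outer half, its width. -/
structure Wave where
  side : ℤ → Bool
  sheet : ℤ → Bool
  width : ℝ
  width_pos : 0 < width
  width_le : width ≤ 1
  side_add : ∀ k, side (k + 4) = side k
  sheet_add : ∀ k, sheet (k + 4) = sheet k
  compat : ∀ k, if side k then sheet k = sheet (k - 1)
    else (sheet k ^^ odd k) = (sheet (k - 1) ^^ odd (k - 1))

namespace Wave
variable (W : Wave)

/-- The piecewise linear wave. -/
noncomputable def line (a : ℝ) : ℝ := lin (fun k => sg (W.side k) / 2) a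

/-- The smooth wave. -/
noncomputable def core (a : ℝ) : ℝ := clamp (W.line a)

/-- The label of the wave in a unit interval. -/
def label (u : Bool) (k : ℤ) : Bool := if u then W.sheet k else W.sheet k ^^ odd k

/-- The point of the surface over the logarithmic polar coordinates `(ρ, a)` on the sheet of the
wave. -/
noncomputable def point (ρ a : ℝ) : ℂ × ℂ :=
  if 0 ≤ ρ then pt true (W.label true ⌊a⌋) ρ a else pt false (W.label false ⌊a⌋) (-ρ) a

/-- The annulus around the wave. -/
noncomputable def band (q : ℝ × ℝ) : ℂ × ℂ :=
  W.point (W.width * (W.core (8 * q.1) - q.2 / 10)) (8 * q.1)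

lemma line_add (a : ℝ) : W.line (a + 4) = W.line a := by
  have := lin_add_int (f := fun k => sg (W.side k) / 2) (n := 4) (c := 0)
    (fun k => by rw [W.side_add, add_zero]) a
  simpa [line] using this

lemma core_add (a : ℝ) : W.core (a + 4) = W.core a := by unfold core; rw [line_add]

lemma line_abs (a : ℝ) : |W.line a| ≤ 1 / 2 := by
  have f0 := Int.fract_nonneg a
  have f1 := Int.fract_lt_one a
  unfold line lin
  rw [abs_le]
  have h : ∀ b, sg b = 1 ∨ sg b = -1 := fun b => by cases b <;> simp [sg]
  rcases h (W.side ⌊a⌋) with h1 | h1 <;> rcases h (W.side (⌊a⌋ + 1)) with h2 | h2 <;>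
    simp only [h1, h2] <;> constructor <;> linarith

lemma core_abs (a : ℝ) : |W.core a| ≤ 1 / 2 := clamp_bound (W.line_abs a)

lemma line_near (k : ℤ) {a : ℝ} (ha : |a - k| ≤ 1 / 20) : 9 / 20 ≤ sg (W.side k) * W.line a := by
  obtain ⟨h1, h2⟩ := abs_le.1 ha
  unfold line
  rcases le_total (k : ℝ) a with h | h
  · rw [lin_on _ k h (by linarith)]
    cases W.side k <;> cases W.side (k + 1) <;> simp only [sg] <;> norm_num <;> linarith
  · rw [lin_on _ (k - 1) (by grind) (by grind), sub_add_cancel]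
    cases W.side k <;> cases W.side (k - 1) <;> simp only [sg] <;> push_cast <;> norm_num <;>
      linarith

lemma core_near (k : ℤ) {a : ℝ} (ha : |a - k| ≤ 1 / 20) : W.core a = sg (W.side k) * (3 / 10) := by
  have h := W.line_near k ha
  unfold core
  cases hk : W.side k
  · rw [hk] at h
    simp only [sg, Bool.false_eq_true, if_false] at h ⊢
    have := clamp_high (v := -W.line a) (by linarith)
    rw [clamp_neg] at this
    linarith
  · rw [hk] at h
    simp only [sg, if_true] at h ⊢
    rw [clamp_high (by linarith)]; norm_num

lemma contDiff_core : ContDiff ℝ ∞ W.core := by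
  rw [contDiff_iff_contDiffAt]
  intro a
  by_cases ha : a = ⌊a⌋
  · have : W.core =ᶠ[𝓝 a] fun _ => sg (W.side ⌊a⌋) * (3 / 10) := by
      filter_upwards [Metric.closedBall_mem_nhds a (show (0 : ℝ) < 1 / 20 by norm_num)] with x hx
      rw [Metric.mem_closedBall, Real.dist_eq, ha] at hx
      exact W.core_near _ hx
    exact contDiffAt_const.congr_of_eventuallyEq this
  · have h0 : (⌊a⌋ : ℝ) < a := lt_of_le_of_ne (Int.floor_le a) (Ne.symm ha)
    have h1 := Int.lt_floor_add_one a
    have : W.core =ᶠ[𝓝 a] fun x => clamp (sg (W.side ⌊a⌋) / 2 +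
        (x - ⌊a⌋) * (sg (W.side (⌊a⌋ + 1)) / 2 - sg (W.side ⌊a⌋) / 2)) := by
      filter_upwards [Ioo_mem_nhds h0 h1] with x hx
      unfold core line
      rw [lin_on _ ⌊a⌋ hx.1.le hx.2.le]
    refine ContDiffAt.congr_of_eventuallyEq ?_ this
    exact (contDiff_clamp.comp (by fun_prop)).contDiffAt

lemma point_fst (ρ a : ℝ) : (W.point ρ a).1 = polar (ρ, a) := by
  unfold point
  split_ifs with h
  · simp [pt, sg, max_eq_left h]
  · simp [pt, sg, max_eq_left (show 0 ≤ -ρ by linarith)]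

lemma point_sq (ρ a : ℝ) : (W.point ρ a).2 ^ 2 = (W.point ρ a).1 ^ 8 - 1 := by
  unfold point
  split_ifs <;> exact pt_snd_sq _ _ _ _

lemma point_ne {ρ a : ℝ} (h : ρ = 0 → ∀ k : ℤ, a ≠ k) : (W.point ρ a).2 ≠ 0 := by
  intro h0
  unfold point at h0
  split_ifs at h0 with hρ
  · obtain ⟨h1, k, hk⟩ := pt_snd_eq_zero h0
    grind
  · obtain ⟨h1, k, hk⟩ := pt_snd_eq_zero h0
    linarith

lemma point_mem {ρ a : ℝ} (h : |ρ| < 1) : W.point ρ a ∈ SurfInt := by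
  obtain ⟨h1, h2⟩ := abs_lt.1 h
  unfold point
  split_ifs
  · exact pt_mem h2
  · exact pt_mem (by linarith)

lemma sheet_add_eight (k : ℤ) : W.sheet (k + 8) = W.sheet k := by
  rw [show k + 8 = k + 4 + 4 by ring, W.sheet_add, W.sheet_add]

lemma label_add (u : Bool) (k : ℤ) : W.label u (k + 8) = W.label u k := by
  unfold label
  rw [odd_add_eight, W.sheet_add_eight]

lemma point_add (ρ a : ℝ) : W.point ρ (a + 8) = W.point ρ a := by
  have h : ∀ u σ r, pt u σ r (a + 8) = pt u σ r a := fun u σ r => by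
    have := pt_add u σ r a 1
    grind
  have hf : ⌊a + 8⌋ = ⌊a⌋ + 8 := by
    have := Int.floor_add_intCast a 8
    grind
  unfold point
  rw [hf, W.label_add, W.label_add, h, h]

lemma label_true_eq (k : ℤ) (h : W.side k = true) : W.label true (k - 1) = W.label true k := by
  have := W.compat k
  rw [if_pos h] at this
  simp [label, this]

lemma label_false_eq (k : ℤ) (h : W.side k = false) :
    W.label false (k - 1) = W.label false k := by
  have := W.compat k
  rw [h, if_neg (by simp)] at this
  simp only [label, Bool.false_eq_true, if_false]
  grind

/-- The height of a point of the annulus. -/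
noncomputable def level (q : ℝ × ℝ) : ℝ := W.width * (W.core (8 * q.1) - q.2 / 10)

lemma band_eq (q : ℝ × ℝ) : W.band q = W.point (W.level q) (8 * q.1) := rfl

lemma contDiff_level : ContDiff ℝ ∞ W.level := by
  have := W.contDiff_core
  unfold level
  have h : ContDiff ℝ ∞ fun q : ℝ × ℝ => W.core (8 * q.1) := this.comp (by fun_prop)
  fun_prop

lemma level_abs {q : ℝ × ℝ} (hq : |q.2| < 2) : |W.level q| < 1 := by
  obtain ⟨h1, h2⟩ := abs_lt.1 hq
  obtain ⟨h3, h4⟩ := abs_le.1 (W.core_abs (8 * q.1))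
  have := W.width_pos
  have := W.width_le
  unfold level
  rw [abs_lt]
  constructor <;> nlinarith

lemma level_near (k : ℤ) {q : ℝ × ℝ} (hq : |q.2| < 2) (ha : |8 * q.1 - k| ≤ 1 / 20) :
    0 < sg (W.side k) * W.level q := by
  obtain ⟨h1, h2⟩ := abs_lt.1 hq
  have := W.width_pos
  unfold level
  rw [W.core_near k ha]
  cases W.side k <;> simp only [sg, Bool.false_eq_true, if_false, if_true] <;> nlinarith

lemma continuousAt_band {q : ℝ × ℝ} (hq : |q.2| < 2) : ContinuousAt W.band q := by
  have hl := W.contDiff_level.continuous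
  by_cases ha : 8 * q.1 = ⌊8 * q.1⌋
  · set k := ⌊8 * q.1⌋
    have ev : ∀ᶠ x : ℝ × ℝ in 𝓝 q, |x.2| < 2 ∧ |8 * x.1 - k| < 1 / 20 := by
      refine (((continuous_snd.abs).continuousAt).eventually_lt continuousAt_const hq).and ?_
      refine ContinuousAt.eventually_lt (by fun_prop) continuousAt_const ?_
      grind
    have fl : ∀ x : ℝ × ℝ, |8 * x.1 - k| < 1 / 20 → ⌊8 * x.1⌋ = k - 1 ∨ ⌊8 * x.1⌋ = k := by
      intro x hx
      obtain ⟨h1, h2⟩ := abs_lt.1 hx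
      rcases le_or_gt (k : ℝ) (8 * x.1) with h | h
      · right; rw [Int.floor_eq_iff]; constructor <;> linarith
      · left; rw [Int.floor_eq_iff]; grind
    cases hk : W.side k
    · have : W.band =ᶠ[𝓝 q] fun x => pt false (W.label false k) (-W.level x) (8 * x.1) := by
        filter_upwards [ev] with x hx
        have h1 := W.level_near k hx.1 hx.2.le
        rw [hk] at h1
        simp only [sg, Bool.false_eq_true, if_false] at h1
        rw [W.band_eq, point, if_neg (by linarith)]
        rcases fl x hx.2 with h | h <;> rw [h]
        rw [W.label_false_eq k hk]
      refine ContinuousAt.congr ?_ this.symm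
      exact ((continuous_pt _ _).comp (f := fun x : ℝ × ℝ => (-W.level x, 8 * x.1))
        (by fun_prop)).continuousAt
    · have : W.band =ᶠ[𝓝 q] fun x => pt true (W.label true k) (W.level x) (8 * x.1) := by
        filter_upwards [ev] with x hx
        have h1 := W.level_near k hx.1 hx.2.le
        rw [hk] at h1
        simp only [sg, if_true] at h1
        rw [W.band_eq, point, if_pos (by linarith)]
        rcases fl x hx.2 with h | h <;> rw [h]
        rw [W.label_true_eq k hk]
      refine ContinuousAt.congr ?_ this.symm
      exact ((continuous_pt _ _).comp (f := fun x : ℝ × ℝ => (W.level x, 8 * x.1))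
        (by fun_prop)).continuousAt
  · set k := ⌊8 * q.1⌋ with hk
    have h0 : (k : ℝ) < 8 * q.1 := lt_of_le_of_ne (Int.floor_le _) (Ne.symm ha)
    have h1 : 8 * q.1 < k + 1 := Int.lt_floor_add_one _
    let cl : ℝ → ℝ := fun a => max k (min a (k + 1))
    have hcl : ∀ a, cl a ∈ Set.Icc (k : ℝ) (k + 1) := fun a =>
      ⟨le_max_left _ _, max_le (by linarith) (min_le_right _ _)⟩
    have hcc : Continuous cl := by fun_prop
    have : W.band =ᶠ[𝓝 q] fun x => if 0 ≤ W.level x then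
        pt true (W.label true k) (W.level x) (cl (8 * x.1))
        else pt false (W.label false k) (-W.level x) (cl (8 * x.1)) := by
      have ev : ∀ᶠ x : ℝ × ℝ in 𝓝 q, 8 * x.1 ∈ Set.Ioo (k : ℝ) (k + 1) :=
        (show ContinuousAt (fun x : ℝ × ℝ => 8 * x.1) q by fun_prop) (Ioo_mem_nhds h0 h1)
      filter_upwards [ev] with x hx
      have hf : ⌊8 * x.1⌋ = k := Int.floor_eq_iff.2 ⟨hx.1.le, hx.2⟩
      have hc : cl (8 * x.1) = 8 * x.1 := by grind
      rw [W.band_eq, point, hf, hc]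
    refine ContinuousAt.congr ?_ this.symm
    refine Continuous.continuousAt ?_
    refine Continuous.if_le ?_ ?_ continuous_const hl ?_
    · exact (continuous_pt _ _).comp (f := fun x : ℝ × ℝ => (W.level x, cl (8 * x.1)))
        (by fun_prop)
    · exact (continuous_pt _ _).comp (f := fun x : ℝ × ℝ => (-W.level x, cl (8 * x.1)))
        (by fun_prop)
    · intro x hx
      rw [← hx, neg_zero]
      refine pt_axis_eq (hcl _) ?_
      simp [lower, label]

lemma band_snd_ne {q : ℝ × ℝ} (hq : |q.2| < 2) : (W.band q).2 ≠ 0 := by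
  refine W.point_ne fun h k hk => ?_
  have := W.level_near k hq (by grind)
  rw [level, h, mul_zero] at this
  grind

lemma band_fst (q : ℝ × ℝ) : (W.band q).1 = polar (W.level q, 8 * q.1) := W.point_fst _ _

lemma band_mem {q : ℝ × ℝ} (hq : |q.2| < 2) : W.band q ∈ SurfInt := W.point_mem (W.level_abs hq)

end Wave

/-- A continuous lift of a smooth map to the surface is smooth away from the branch points. -/
lemma contDiffAt_of_sq {E : Type*} [NormedAddCommGroup E] [NormedSpace ℝ E] {F : E → ℂ × ℂ} {q : E}
    (h1 : ContDiffAt ℝ ∞ (fun x => (F x).1) q) (hc : ContinuousAt F q)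
    (hsq : ∀ x, (F x).2 ^ 2 = (F x).1 ^ 8 - 1) (hne : (F q).2 ≠ 0) : ContDiffAt ℝ ∞ F q := by
  refine ContDiffAt.prodMk h1 ?_
  set y := (F q).2 with hy
  have hw : ContinuousAt (fun x => ((F x).2 / y).re) q := by
    refine Complex.continuous_re.continuousAt.comp ?_
    exact (continuous_snd.continuousAt.comp hc).div_const y
  have ev : ∀ᶠ x in 𝓝 q, 0 < ((F x).2 / y).re :=
    continuousAt_const.eventually_lt hw (by rw [← hy, div_self hne]; simp)
  have e : (fun x => (F x).2) =ᶠ[𝓝 q] fun x => y * (((F x).1 ^ 8 - 1) / y ^ 2) ^ (2⁻¹ : ℂ) := by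
    filter_upwards [ev] with x hx
    rw [← hsq, ← div_pow, Complex.sq_cpow_two_inv hx, mul_div_cancel₀ _ hne]
  refine ContDiffAt.congr_of_eventuallyEq ?_ e
  have hcp : ContDiffAt ℝ ∞ (fun ζ : ℂ => ζ ^ (2⁻¹ : ℂ)) (((F q).1 ^ 8 - 1) / y ^ 2) := by
    have hs : (((F q).1 ^ 8 - 1) / y ^ 2) ∈ Complex.slitPlane := by
      rw [← hsq, ← hy, div_self (pow_ne_zero 2 hne)]
      exact Complex.one_mem_slitPlane
    have : AnalyticAt ℂ (fun ζ : ℂ => ζ ^ (2⁻¹ : ℂ)) (((F q).1 ^ 8 - 1) / y ^ 2) :=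
      analyticAt_id.cpow analyticAt_const hs
    exact (this.contDiffAt (n := ∞)).restrict_scalars ℝ
  have : ContDiffAt ℝ ∞ (fun x => ((F x).1 ^ 8 - 1) / y ^ 2) q := by
    have := (h1.pow 8).sub (contDiffAt_const (c := (1 : ℂ)))
    exact this.div_const _
  exact contDiffAt_const.mul (ContDiffAt.comp q (g := fun ζ : ℂ => ζ ^ (2⁻¹ : ℂ))
    (f := fun x => ((F x).1 ^ 8 - 1) / y ^ 2) hcp this)

lemma contDiff_polar : ContDiff ℝ ∞ polar := by
  unfold polar
  have h1 : ContDiff ℝ ∞ fun w : ℝ × ℝ => (w.1 : ℂ) := Complex.ofRealCLM.contDiff.comp contDiff_fst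
  have h2 : ContDiff ℝ ∞ fun w : ℝ × ℝ => (w.2 : ℂ) := Complex.ofRealCLM.contDiff.comp contDiff_snd
  exact (h1.add ((h2.mul contDiff_const).mul contDiff_const)).cexp

namespace Wave
variable (W : Wave)

lemma contDiffAt_band {q : ℝ × ℝ} (hq : |q.2| < 2) : ContDiffAt ℝ ∞ W.band q := by
  refine contDiffAt_of_sq ?_ (W.continuousAt_band hq) (fun x => W.point_sq _ _) (W.band_snd_ne hq)
  have : (fun x => (W.band x).1) = fun x : ℝ × ℝ => polar (W.level x, 8 * x.1) :=
    funext fun x => W.band_fst x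
  rw [this]
  have := W.contDiff_level
  exact (contDiff_polar.comp (f := fun x : ℝ × ℝ => (W.level x, 8 * x.1)) (by fun_prop)).contDiffAt

lemma level_add (s t : ℝ) : W.level (s + 1, t) = W.level (s, t) := by
  unfold level
  simp only
  rw [show 8 * (s + 1) = 8 * s + 4 + 4 by ring, W.core_add, W.core_add]

lemma band_add (s t : ℝ) : W.band (s + 1, t) = W.band (s, t) := by
  rw [W.band_eq, W.band_eq, W.level_add]
  simp only
  rw [show 8 * (s + 1) = 8 * s + 8 by ring, W.point_add]

lemma band_add_int (s t : ℝ) (m : ℤ) : W.band (s + m, t) = W.band (s, t) := by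
  induction m with
  | zero => simp
  | succ m ih =>
    have := W.band_add (s + m) t
    push_cast at ih ⊢
    grind
  | pred m ih =>
    have := W.band_add (s + (-m - 1)) t
    push_cast at ih ⊢
    grind

lemma level_add_int (s t : ℝ) (m : ℤ) : W.level (s + m, t) = W.level (s, t) := by
  induction m with
  | zero => simp
  | succ m ih =>
    have := W.level_add (s + m) t
    push_cast at ih ⊢
    grind
  | pred m ih =>
    have := W.level_add (s + (-m - 1)) t
    push_cast at ih ⊢
    grind

lemma band_inj {q q' : ℝ × ℝ} (h : W.band q = W.band q') :
    ∃ m : ℤ, q' = (q.1 + m, q.2) := by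
  have h1 := congrArg Prod.fst h
  rw [W.band_fst, W.band_fst, polar_eq_iff] at h1
  obtain ⟨h2, m, h3⟩ := h1
  simp only at h2 h3
  have e : q'.1 = q.1 + m := by linarith
  refine ⟨m, Prod.ext e ?_⟩
  have h4 : W.level (q.1, q'.2) = W.level q := by rw [h2, ← W.level_add_int q.1 q'.2 m, ← e]
  have := W.width_pos
  unfold level at h4
  have := mul_left_cancel₀ this.ne' h4
  grind

lemma strip_abs {q : ℝ × ℝ} (hq : q ∈ Strip) : |q.2| < 2 := by
  have := hq.2
  grind

/-- The derivative of the annulus is a complex multiple of that of its projection. -/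
lemma area_band {q : ℝ × ℝ} (hq : |q.2| < 2) :
    0 < areaForm (fderiv ℝ W.band q (1, 0)) (fderiv ℝ W.band q (0, 1)) := by
  have hd := (W.contDiffAt_band hq).differentiableAt (by simp)
  have hF := hd.hasFDerivAt
  set F' := fderiv ℝ W.band q
  have hF1 : HasFDerivAt (fun x => (W.band x).1) ((ContinuousLinearMap.fst ℝ ℂ ℂ).comp F') q :=
    hF.fst
  have hF2 : HasFDerivAt (fun x => (W.band x).2) ((ContinuousLinearMap.snd ℝ ℂ ℂ).comp F') q :=
    hF.snd
  set z := (W.band q).1 with hz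
  set y := (W.band q).2 with hy
  have hy0 : y ≠ 0 := W.band_snd_ne hq
  -- the second component
  have hrel : ∀ v, (F' v).2 = 4 * z ^ 7 / y * (F' v).1 := by
    intro v
    have e1 := hF2.pow 2
    have e2 := (hF1.pow 8).sub_const (1 : ℂ)
    have e3 : (fun x => (W.band x).2 ^ 2) = fun x => (W.band x).1 ^ 8 - 1 :=
      funext fun x => W.point_sq _ _
    rw [e3] at e1
    have := congrArg (fun L => L v) (e1.unique e2)
    simp at this
    grind
  -- the first component
  obtain ⟨g, hg⟩ : ∃ g, HasFDerivAt W.level g q :=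
    ⟨_, (W.contDiff_level.differentiable (by simp) q).hasFDerivAt⟩
  have hg2 : g (0, 1) = -W.width / 10 := by
    have h1 : HasDerivAt (fun t : ℝ => W.level (q.1, t)) (-W.width / 10) q.2 :=
      ((((hasDerivAt_id q.2).div_const 10).const_sub (W.core (8 * q.1))).const_mul
        W.width).congr_deriv (by ring)
    have h2 : HasDerivAt (fun t : ℝ => ((q.1, t) : ℝ × ℝ)) (0, 1) q.2 :=
      (hasDerivAt_const _ _).prodMk (hasDerivAt_id _)
    have h3 : HasDerivAt (fun t : ℝ => W.level (q.1, t)) (g (0, 1)) q.2 :=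
      HasFDerivAt.comp_hasDerivAt (l := W.level) q.2 hg h2
    exact h3.unique h1
  have hK : ∀ v, (F' v).1 = z * (g v + 2 * Real.pi * v.1 * Complex.I) := by
    intro v
    have e : (fun x => (W.band x).1) = fun x : ℝ × ℝ =>
        Complex.exp ((W.level x : ℂ) + ((8 * x.1 : ℝ) : ℂ) * (Real.pi / 4) * Complex.I) :=
      funext fun x => W.band_fst x
    have h1 : HasFDerivAt (fun x : ℝ × ℝ => (W.level x : ℂ)) (Complex.ofRealCLM.comp g) q :=
      Complex.ofRealCLM.hasFDerivAt.comp q hg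
    have h2 : HasFDerivAt (fun x : ℝ × ℝ => ((8 * x.1 : ℝ) : ℂ))
        (Complex.ofRealCLM.comp ((8 : ℝ) • ContinuousLinearMap.fst ℝ ℝ ℝ)) q :=
      Complex.ofRealCLM.hasFDerivAt.comp q ((hasFDerivAt_fst).const_mul 8)
    have h3 := (h1.add ((h2.mul_const (Real.pi / 4 : ℂ)).mul_const Complex.I)).cexp
    have h4 := hF1
    rw [e] at h4
    have := congrArg (fun L => L v) (h4.unique h3)
    have hz' : z = Complex.exp ((W.level q : ℂ) + ((8 * q.1 : ℝ) : ℂ) * (Real.pi / 4) * Complex.I) :=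
      W.band_fst q
    simp at this
    rw [this, hz']
    push_cast
    ring
  have hz0 : z ≠ 0 := by rw [hz, W.band_fst]; exact Complex.exp_ne_zero _
  have hα := W.width_pos
  have hA : ∀ a b : ℂ, areaForm (a, 4 * z ^ 7 / y * a) (b, 4 * z ^ 7 / y * b) =
      (1 + Complex.normSq (4 * z ^ 7 / y)) * (starRingEnd ℂ a * b).im := by
    intro a b
    unfold areaForm
    simp only [map_mul]
    rw [show starRingEnd ℂ (4 * z ^ 7 / y) * starRingEnd ℂ a * (4 * z ^ 7 / y * b) =
      (starRingEnd ℂ (4 * z ^ 7 / y) * (4 * z ^ 7 / y)) * (starRingEnd ℂ a * b) by ring,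
      ← Complex.normSq_eq_conj_mul_self, Complex.im_ofReal_mul]
    ring
  have e1 : F' (1, 0) = ((F' (1, 0)).1, 4 * z ^ 7 / y * (F' (1, 0)).1) := Prod.ext rfl (hrel _)
  have e2 : F' (0, 1) = ((F' (0, 1)).1, 4 * z ^ 7 / y * (F' (0, 1)).1) := Prod.ext rfl (hrel _)
  rw [e1, e2, hA]
  refine mul_pos (by have := Complex.normSq_nonneg (4 * z ^ 7 / y); linarith) ?_
  rw [hK, hK, hg2]
  simp only [map_mul]
  have : starRingEnd ℂ z * starRingEnd ℂ ((g (1, 0) : ℂ) + 2 * Real.pi * ((1 : ℝ) : ℂ) * Complex.I) *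
      (z * (((-W.width / 10 : ℝ) : ℂ) + 2 * Real.pi * ((0 : ℝ) : ℂ) * Complex.I)) =
      ((Complex.normSq z * (-W.width / 10) : ℝ) : ℂ) *
        starRingEnd ℂ ((g (1, 0) : ℂ) + 2 * Real.pi * ((1 : ℝ) : ℂ) * Complex.I) := by
    push_cast
    rw [Complex.normSq_eq_conj_mul_self]
    ring
  rw [this, Complex.im_ofReal_mul]
  have hi : (starRingEnd ℂ ((g (1, 0) : ℂ) + 2 * Real.pi * ((1 : ℝ) : ℂ) * Complex.I)).im =
      -(2 * Real.pi) := by simp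
  rw [hi]
  have := Complex.normSq_pos.2 hz0
  have := Real.pi_pos
  have : 0 < Complex.normSq z * (W.width / 10) * (2 * Real.pi) := by positivity
  linarith

theorem isAnnulus : IsAnnulus (fun s => W.band (s, 0)) W.band where
  smooth := fun q hq => (W.contDiffAt_band (strip_abs hq)).contDiffWithinAt
  periodic := W.band_add
  injOn := by
    rintro ⟨s, t⟩ ⟨hs, -⟩ ⟨s', t'⟩ ⟨hs', -⟩ h
    obtain ⟨m, hm⟩ := W.band_inj h
    simp only [Prod.mk.injEq] at hm hs hs'
    obtain ⟨h1, h2⟩ := hm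
    have a1 : (m : ℝ) < (1 : ℤ) := by grind
    have a2 : ((-1 : ℤ) : ℝ) < m := by grind
    have a1' := Int.cast_lt.1 a1
    have a2' := Int.cast_lt.1 a2
    have : m = 0 := by omega
    subst this
    grind
  mapsTo := fun q hq => W.band_mem (strip_abs hq)
  orientation := fun q hq => by
    have hu : UniqueDiffWithinAt ℝ Strip q :=
      (uniqueDiffOn_univ.prod (uniqueDiffOn_Icc (by norm_num : (-1 : ℝ) < 1))) q hq
    rw [((W.contDiffAt_band (strip_abs hq)).differentiableAt (by simp)).fderivWithin hu]
    exact W.area_band (strip_abs hq)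
  core := fun _ => rfl

end Wave

/-! ### Twists along the annuli of the waves -/

/-- The graphs of the twists of the annulus `(ℝ / ℤ) × [-1, 1]` that are supported in the middle. -/
structure IsShear (χ : ℝ → ℝ) (c : ℤ) : Prop where
  smooth : ContDiff ℝ ∞ χ
  low : ∀ t ≤ -(1 / 2), χ t = 0
  high : ∀ t ≥ 1 / 2, χ t = c

lemma IsShear.neg {χ : ℝ → ℝ} {c : ℤ} (h : IsShear χ c) : IsShear (fun t => -χ t) (-c) where
  smooth := h.smooth.neg
  low := fun t ht => by rw [h.low t ht, neg_zero]
  high := fun t ht => by rw [h.high t ht, Int.cast_neg]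

/-- The profile of a right-handed twist. -/
noncomputable def profile (t : ℝ) : ℝ := Real.smoothTransition (t + 1 / 2)

lemma profile_isShear : IsShear profile 1 where
  smooth := Real.smoothTransition.contDiff.comp (by fun_prop)
  low := fun t ht => Real.smoothTransition.zero_of_nonpos (by linarith)
  high := fun t ht => by rw [Int.cast_one]; exact Real.smoothTransition.one_of_one_le (by linarith)

lemma areaForm_map (L : ℝ × ℝ →L[ℝ] ℂ × ℂ) (v w : ℝ × ℝ) :
    areaForm (L v) (L w) = (v.1 * w.2 - v.2 * w.1) * areaForm (L (1, 0)) (L (0, 1)) := by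
  have h : ∀ v : ℝ × ℝ, L v = v.1 • L (1, 0) + v.2 • L (0, 1) := fun v => by
    rw [← map_smul, ← map_smul, ← map_add]
    congr 1
    ext <;> simp
  rw [h v, h w]
  unfold areaForm
  simp only [Prod.fst_add, Prod.snd_add, Prod.smul_fst, Prod.smul_snd, Complex.mul_im,
    Complex.conj_re, Complex.conj_im, Complex.add_re, Complex.add_im, Complex.real_smul,
    Complex.ofReal_re, Complex.ofReal_im, zero_mul, sub_zero, add_zero, Complex.mul_re]
  ring

lemma areaForm_I_pos {v : ℂ × ℂ} (hv : v ≠ 0) : 0 < areaForm v (Complex.I • v) := by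
  have e : areaForm v (Complex.I • v) = Complex.normSq v.1 + Complex.normSq v.2 := by
    unfold areaForm
    simp only [Prod.smul_fst, Prod.smul_snd, smul_eq_mul, Complex.mul_im, Complex.mul_re,
      Complex.conj_re, Complex.conj_im, Complex.I_re, Complex.I_im, Complex.normSq_apply]
    ring
  rw [e]
  by_cases h : v.1 = 0
  · have h2 : v.2 ≠ 0 := fun h2 => hv (Prod.ext h h2)
    have := Complex.normSq_pos.2 h2
    grind
  · have := Complex.normSq_pos.2 h
    have := Complex.normSq_nonneg v.2
    linarith

/-- The derivative of a map to the surface is tangent to it. -/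
lemma tangent_of_sq {E : Type*} [NormedAddCommGroup E] [NormedSpace ℝ E] {F : E → ℂ × ℂ} {q : E}
    {F' : E →L[ℝ] ℂ × ℂ} (hF : HasFDerivAt F F' q)
    (hsq : ∀ x, (F x).2 ^ 2 = (F x).1 ^ 8 - 1) (v : E) : IsTangent (F q) (F' v) := by
  have e1 := hF.snd.pow 2
  have e2 := (hF.fst.pow 8).sub_const (1 : ℂ)
  rw [funext hsq] at e1
  have := congrArg (fun L => L v) (e1.unique e2)
  simp at this
  unfold IsTangent
  grind

namespace Wave
variable (W : Wave)

/-- The projection of the annulus to the plane has smooth local sections. -/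
lemma exists_local_inverse (q : ℝ × ℝ) : ∃ σ : ℂ → ℝ × ℝ, ContDiffAt ℝ ∞ σ (W.band q).1 ∧
    σ (W.band q).1 = q ∧ ∀ z ≠ 0, (W.band (σ z)).1 = z := by
  have hα := W.width_pos.ne'
  set z₀ := (W.band q).1 with hz₀
  have hz : z₀ = Complex.exp ((W.level q : ℂ) + ((8 * q.1 : ℝ) : ℂ) * (Real.pi / 4) * Complex.I) :=
    W.band_fst q
  have h0 : z₀ ≠ 0 := by rw [hz]; exact Complex.exp_ne_zero _
  set S : ℂ → ℝ := fun z => q.1 + (Complex.log (z / z₀)).im / (2 * Real.pi) with hS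
  set R : ℂ → ℝ := fun z => W.level q + (Complex.log (z / z₀)).re with hR
  have hlog : ContDiffAt ℝ ∞ (fun z => Complex.log (z / z₀)) z₀ := by
    have h1 : ContDiffAt ℝ ∞ (fun z : ℂ => z / z₀) z₀ := contDiffAt_id.div_const _
    have h2 : ContDiffAt ℝ ∞ Complex.log (z₀ / z₀) := by
      rw [div_self h0]
      exact (Complex.contDiffAt_log (n := ∞) Complex.one_mem_slitPlane).restrict_scalars ℝ
    exact ContDiffAt.comp (f := fun z : ℂ => z / z₀) z₀ h2 h1
  have hSc : ContDiffAt ℝ ∞ S z₀ := by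
    have : ContDiffAt ℝ ∞ (fun z => (Complex.log (z / z₀)).im) z₀ :=
      Complex.imCLM.contDiff.contDiffAt.comp z₀ hlog
    exact contDiffAt_const.add (this.div_const _)
  have hRc : ContDiffAt ℝ ∞ R z₀ := by
    have : ContDiffAt ℝ ∞ (fun z => (Complex.log (z / z₀)).re) z₀ :=
      Complex.reCLM.contDiff.contDiffAt.comp z₀ hlog
    exact contDiffAt_const.add this
  have hC : ContDiffAt ℝ ∞ (fun z => W.core (8 * S z)) z₀ :=
    W.contDiff_core.contDiffAt.comp z₀ (contDiffAt_const.mul hSc)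
  refine ⟨fun z => (S z, 10 * (W.core (8 * S z) - R z / W.width)),
    hSc.prodMk (contDiffAt_const.mul (hC.sub (hRc.div_const _))), ?_, ?_⟩
  · have e1 : S z₀ = q.1 := by simp [hS, div_self h0]
    have e2 : R z₀ = W.level q := by simp [hR, div_self h0]
    refine Prod.ext e1 ?_
    simp only [e1, e2, level]
    grind
  · intro z hz1
    have e : W.level (S z, 10 * (W.core (8 * S z) - R z / W.width)) = R z := by
      simp only [level]
      grind
    rw [W.band_fst, e]
    have h2 : z / z₀ ≠ 0 := div_ne_zero hz1 h0
    have h3 : ((R z : ℂ) + ((8 * S z : ℝ) : ℂ) * (Real.pi / 4) * Complex.I) =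
        ((W.level q : ℂ) + ((8 * q.1 : ℝ) : ℂ) * (Real.pi / 4) * Complex.I) +
          Complex.log (z / z₀) := by
      conv_rhs => rw [← Complex.re_add_im (Complex.log (z / z₀))]
      have hpi : (Real.pi : ℂ) ≠ 0 := Complex.ofReal_ne_zero.2 Real.pi_ne_zero
      simp only [hR, hS]
      push_cast
      grind
    unfold polar
    simp only
    rw [h3, Complex.exp_add, Complex.exp_log h2, ← hz, mul_div_cancel₀ _ h0]

lemma eventually_band_eq {q : ℝ × ℝ} (hq : |q.2| < 2) {σ : ℂ → ℝ × ℝ}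
    (hσ : ContinuousAt σ (W.band q).1) (h0 : σ (W.band q).1 = q)
    (h1 : ∀ z ≠ 0, (W.band (σ z)).1 = z) :
    ∀ᶠ p in 𝓝[Surf] W.band q, W.band (σ p.1) = p := by
  have hc : ContinuousAt (fun p : ℂ × ℂ => (W.band (σ p.1)).2 + p.2) (W.band q) := by
    have a : ContinuousAt (fun p : ℂ × ℂ => σ p.1) (W.band q) :=
      ContinuousAt.comp (f := Prod.fst) hσ continuous_fst.continuousAt
    have b : ContinuousAt W.band ((fun p : ℂ × ℂ => σ p.1) (W.band q)) := by
      simp only [h0]; exact W.continuousAt_band hq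
    have c : ContinuousAt (fun p : ℂ × ℂ => W.band (σ p.1)) (W.band q) :=
      ContinuousAt.comp (f := fun p : ℂ × ℂ => σ p.1) b a
    exact (continuous_snd.continuousAt.comp c).add continuous_snd.continuousAt
  have hne : (W.band (σ (W.band q).1)).2 + (W.band q).2 ≠ 0 := by
    rw [h0, ← two_mul]; exact mul_ne_zero two_ne_zero (W.band_snd_ne hq)
  filter_upwards [nhdsWithin_le_nhds (hc.eventually_ne hne), self_mem_nhdsWithin] with p hp hS
  have hp0 : p.1 ≠ 0 := fun h => by
    have := hS.2.1
    rw [h, norm_zero] at this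
    exact absurd this (not_le.2 (Real.exp_pos _))
  refine Prod.ext (h1 _ hp0) ?_
  have e : (W.band (σ p.1)).2 ^ 2 = p.2 ^ 2 := by
    rw [hS.1, show (W.band (σ p.1)).2 ^ 2 = (W.band (σ p.1)).1 ^ 8 - 1 from W.point_sq _ _,
      h1 _ hp0]
  grind

open Classical in
/-- The twist of the annulus of a wave, extended by the identity. -/
noncomputable def twistMap (χ : ℝ → ℝ) (p : ℂ × ℂ) : ℂ × ℂ :=
  if h : ∃ q ∈ Strip, W.band q = p then W.band (h.choose.1 + χ h.choose.2, h.choose.2) else p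

lemma twistMap_band (χ : ℝ → ℝ) {q : ℝ × ℝ} (hq : q ∈ Strip) :
    W.twistMap χ (W.band q) = W.band (q.1 + χ q.2, q.2) := by
  have h : ∃ q' ∈ Strip, W.band q' = W.band q := ⟨q, hq, rfl⟩
  rw [twistMap, dif_pos h]
  obtain ⟨m, hm⟩ := W.band_inj h.choose_spec.2.symm
  rw [hm]
  simp only
  rw [show q.1 + m + χ q.2 = q.1 + χ q.2 + m by ring, W.band_add_int]

lemma twistMap_of_not (χ : ℝ → ℝ) {p : ℂ × ℂ} (hp : p ∉ W.band '' Strip) :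
    W.twistMap χ p = p := by
  rw [twistMap, dif_neg]
  grind

variable {χ : ℝ → ℝ} {c : ℤ}

lemma twistMap_outer (hχ : IsShear χ c) {p : ℂ × ℂ}
    (hp : p ∉ W.band '' (Set.univ ×ˢ Set.Icc (-(1 / 2)) (1 / 2))) : W.twistMap χ p = p := by
  by_cases h : p ∈ W.band '' Strip
  · obtain ⟨⟨s, t⟩, hq, rfl⟩ := h
    rw [W.twistMap_band χ hq]
    have ht : t < -(1 / 2) ∨ 1 / 2 < t := by grind
    simp only
    rcases ht with ht | ht
    · rw [hχ.low t ht.le, add_zero]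
    · rw [hχ.high t ht.le, W.band_add_int]
  · exact W.twistMap_of_not χ h

lemma mapsTo_twistMap (χ : ℝ → ℝ) {S : Set (ℂ × ℂ)} (hS : SurfInt ⊆ S) :
    Set.MapsTo (W.twistMap χ) S S := by
  intro p hp
  by_cases h : p ∈ W.band '' Strip
  · obtain ⟨q, hq, rfl⟩ := h
    rw [W.twistMap_band χ hq]
    exact hS (W.band_mem (strip_abs hq))
  · rwa [W.twistMap_of_not χ h]

lemma twistMap_comp {χ χ' : ℝ → ℝ} (h : ∀ t, χ' t = -χ t) (p : ℂ × ℂ) :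
    W.twistMap χ' (W.twistMap χ p) = p := by
  by_cases hp : p ∈ W.band '' Strip
  · obtain ⟨q, hq, rfl⟩ := hp
    rw [W.twistMap_band χ hq, W.twistMap_band χ' (q := (q.1 + χ q.2, q.2)) ⟨Set.mem_univ _, hq.2⟩]
    grind
  · rw [W.twistMap_of_not χ hp, W.twistMap_of_not χ' hp]

lemma surfInt_subset : SurfInt ⊆ Surf := fun _ h => ⟨h.1, h.2.1.le, h.2.2.le⟩

lemma isClosed_band : IsClosed (W.band '' (Set.univ ×ˢ Set.Icc (-(1 / 2)) (1 / 2))) := by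
  have e : W.band '' (Set.univ ×ˢ Set.Icc (-(1 / 2)) (1 / 2)) =
      W.band '' (Set.Icc 0 1 ×ˢ Set.Icc (-(1 / 2)) (1 / 2)) := by
    refine Set.Subset.antisymm ?_ (Set.image_mono (Set.prod_mono (Set.subset_univ _) subset_rfl))
    rintro _ ⟨⟨s, t⟩, hq, rfl⟩
    refine ⟨(Int.fract s, t), ⟨⟨Int.fract_nonneg s, (Int.fract_lt_one s).le⟩, hq.2⟩, ?_⟩
    have := W.band_add_int (Int.fract s) t ⌊s⌋
    rw [Int.fract_add_floor] at this
    grind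
  rw [e]
  refine ((isCompact_Icc.prod isCompact_Icc).image_of_continuousOn ?_).isClosed
  intro q hq
  refine (W.continuousAt_band ?_).continuousWithinAt
  grind

/-- Near a point of the open annulus the twist is a smooth map of the projection. -/
lemma twistMap_near (χ : ℝ → ℝ) {q : ℝ × ℝ} (hq : |q.2| < 1) : ∃ σ : ℂ → ℝ × ℝ,
    ContDiffAt ℝ ∞ σ (W.band q).1 ∧ σ (W.band q).1 = q ∧ (∀ z ≠ 0, (W.band (σ z)).1 = z) ∧
    ∀ᶠ p in 𝓝[Surf] W.band q,
      W.twistMap χ p = W.band ((σ p.1).1 + χ (σ p.1).2, (σ p.1).2) := by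
  obtain ⟨σ, h1, h2, h3⟩ := W.exists_local_inverse q
  refine ⟨σ, h1, h2, h3, ?_⟩
  have h4 := W.eventually_band_eq (by linarith) h1.continuousAt h2 h3
  have h5 : ∀ᶠ p : ℂ × ℂ in 𝓝 (W.band q), |(σ p.1).2| < 1 := by
    have a : ContinuousAt (fun p : ℂ × ℂ => σ p.1) (W.band q) :=
      ContinuousAt.comp (f := Prod.fst) h1.continuousAt continuous_fst.continuousAt
    refine ContinuousAt.eventually_lt (continuous_abs.continuousAt.comp
      (continuous_snd.continuousAt.comp a)) continuousAt_const ?_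
    grind
  filter_upwards [h4, nhdsWithin_le_nhds h5] with p hp hp2
  conv_lhs => rw [← hp]
  rw [W.twistMap_band]
  obtain ⟨a, b⟩ := abs_lt.1 hp2
  exact ⟨Set.mem_univ _, a.le, b.le⟩

lemma not_mem_inner {p : ℂ × ℂ} (hp : ¬∃ q : ℝ × ℝ, |q.2| < 1 ∧ W.band q = p) :
    p ∉ W.band '' (Set.univ ×ˢ Set.Icc (-(1 / 2)) (1 / 2)) := by grind

lemma eventually_twistMap_outer (hχ : IsShear χ c) {p : ℂ × ℂ}
    (hp : ¬∃ q : ℝ × ℝ, |q.2| < 1 ∧ W.band q = p) : ∀ᶠ p' in 𝓝 p, W.twistMap χ p' = p' := by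
  filter_upwards [W.isClosed_band.isOpen_compl.mem_nhds (W.not_mem_inner hp)] with p' hp'
  exact W.twistMap_outer hχ hp'

lemma contDiffAt_shear (hχ : IsShear χ c) (q : ℝ × ℝ) :
    ContDiffAt ℝ ∞ (fun q : ℝ × ℝ => (q.1 + χ q.2, q.2)) q := by
  have := hχ.smooth
  have : ContDiff ℝ ∞ fun q : ℝ × ℝ => χ q.2 := this.comp contDiff_snd
  fun_prop

lemma contDiffOn_twistMap (hχ : IsShear χ c) : ContDiffOn ℝ ∞ (W.twistMap χ) Surf := by
  intro p hp
  by_cases h : ∃ q : ℝ × ℝ, |q.2| < 1 ∧ W.band q = p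
  · obtain ⟨q, hq, rfl⟩ := h
    obtain ⟨σ, h1, h2, -, h4⟩ := W.twistMap_near χ hq
    refine ContDiffWithinAt.congr_of_eventuallyEq ?_ h4 (h4.self_of_nhdsWithin hp)
    refine ContDiffAt.contDiffWithinAt ?_
    have a : ContDiffAt ℝ ∞ (fun p : ℂ × ℂ => σ p.1) (W.band q) :=
      ContDiffAt.comp (f := Prod.fst) _ h1 contDiff_fst.contDiffAt
    have b := ContDiffAt.comp (f := fun p : ℂ × ℂ => σ p.1) _
      (contDiffAt_shear hχ (σ (W.band q).1)) a
    refine ContDiffAt.comp (g := W.band) _ ?_ b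
    simp only [h2]
    exact W.contDiffAt_band (by grind)
  · have ev := W.eventually_twistMap_outer hχ h
    exact contDiffWithinAt_id.congr_of_eventuallyEq (nhdsWithin_le_nhds ev) ev.self_of_nhds

lemma orientation_twistMap (hχ : IsShear χ c) {p : ℂ × ℂ} (hp : p ∈ Surf) :
    ∃ L : ℂ × ℂ →L[ℝ] ℂ × ℂ, HasFDerivWithinAt (W.twistMap χ) L Surf p ∧
      ∀ v : ℂ × ℂ, IsTangent p v → v ≠ 0 → 0 < areaForm (L v) (L (Complex.I • v)) := by
  by_cases h : ∃ q : ℝ × ℝ, |q.2| < 1 ∧ W.band q = p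
  · obtain ⟨q, hq, rfl⟩ := h
    obtain ⟨σ, h1, h2, h3, h4⟩ := W.twistMap_near χ hq
    have hq2 : |q.2| < 2 := by linarith
    have dσ := (h1.differentiableAt (by simp)).hasFDerivAt
    set σ' := fderiv ℝ σ (W.band q).1
    have dχ : HasDerivAt χ (deriv χ q.2) q.2 :=
      (hχ.smooth.differentiable (by simp) q.2).hasDerivAt
    set q' : ℝ × ℝ := (q.1 + χ q.2, q.2)
    have dB := ((W.contDiffAt_band (q := q') hq2).differentiableAt (by simp)).hasFDerivAt
    set B' := fderiv ℝ W.band q' with hB'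
    have dA := ((W.contDiffAt_band hq2).differentiableAt (by simp)).hasFDerivAt
    set A' := fderiv ℝ W.band q with hA'
    set X' : ℝ × ℝ →L[ℝ] ℝ × ℝ := (ContinuousLinearMap.fst ℝ ℝ ℝ +
      (deriv χ q.2) • ContinuousLinearMap.snd ℝ ℝ ℝ).prod (ContinuousLinearMap.snd ℝ ℝ ℝ) with hX'
    have dX : HasFDerivAt (fun q : ℝ × ℝ => (q.1 + χ q.2, q.2)) X' q := by
      have a : HasFDerivAt (fun q : ℝ × ℝ => χ q.2)
          ((deriv χ q.2) • ContinuousLinearMap.snd ℝ ℝ ℝ) q :=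
        HasDerivAt.comp_hasFDerivAt (f := Prod.snd) q dχ hasFDerivAt_snd
      exact (hasFDerivAt_fst.add a).prodMk hasFDerivAt_snd
    have d1 : HasFDerivAt (fun p : ℂ × ℂ => σ p.1) (σ'.comp (ContinuousLinearMap.fst ℝ ℂ ℂ))
        (W.band q) := HasFDerivAt.comp (f := Prod.fst) _ dσ hasFDerivAt_fst
    have d2 : HasFDerivAt (fun p : ℂ × ℂ => ((σ p.1).1 + χ (σ p.1).2, (σ p.1).2))
        (X'.comp (σ'.comp (ContinuousLinearMap.fst ℝ ℂ ℂ))) (W.band q) := by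
      refine HasFDerivAt.comp (f := fun p : ℂ × ℂ => σ p.1)
        (g := fun q : ℝ × ℝ => (q.1 + χ q.2, q.2)) _ ?_ d1
      grind
    have d3 : HasFDerivAt (fun p : ℂ × ℂ => W.band ((σ p.1).1 + χ (σ p.1).2, (σ p.1).2))
        (B'.comp (X'.comp (σ'.comp (ContinuousLinearMap.fst ℝ ℂ ℂ)))) (W.band q) := by
      refine HasFDerivAt.comp
        (f := fun p : ℂ × ℂ => (((σ p.1).1 + χ (σ p.1).2, (σ p.1).2) : ℝ × ℝ)) (g := W.band) _ ?_ d2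
      grind
    refine ⟨_, d3.hasFDerivWithinAt.congr_of_eventuallyEq h4 (h4.self_of_nhdsWithin hp), ?_⟩
    intro v hv hv0
    have hv1 : v.1 ≠ 0 := by
      intro h
      unfold IsTangent at hv
      rw [h, mul_zero] at hv
      exact hv0 (Prod.ext h ((mul_eq_zero.1 hv).resolve_left (W.band_snd_ne hq2)))
    simp only [ContinuousLinearMap.comp_apply, ContinuousLinearMap.coe_fst', Prod.smul_fst]
    rw [areaForm_map]
    refine mul_pos ?_ (W.area_band (q := q') hq2)
    have hdet : (X' (σ' v.1)).1 * (X' (σ' (Complex.I • v.1))).2 -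
        (X' (σ' v.1)).2 * (X' (σ' (Complex.I • v.1))).1 =
        (σ' v.1).1 * (σ' (Complex.I • v.1)).2 - (σ' v.1).2 * (σ' (Complex.I • v.1)).1 := by
      simp only [hX', ContinuousLinearMap.prod_apply, add_apply,
        smul_apply, ContinuousLinearMap.coe_fst', ContinuousLinearMap.coe_snd',
        smul_eq_mul]
      ring
    rw [hdet]
    -- the section of the annulus is tangent and inverse to the projection
    have hz0 : (W.band q).1 ≠ 0 := by rw [W.band_fst]; exact Complex.exp_ne_zero _
    have dC : HasFDerivAt (fun z => W.band (σ z)) (A'.comp σ') (W.band q).1 := by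
      refine HasFDerivAt.comp (g := W.band) (f := σ) _ ?_ dσ
      grind
    have hC1 : ∀ w, (A' (σ' w)).1 = w := by
      intro w
      have e : (fun z => (W.band (σ z)).1) =ᶠ[𝓝 (W.band q).1] id := by
        filter_upwards [isOpen_ne.mem_nhds hz0] with z hz using h3 z hz
      have := (dC.fst.congr_of_eventuallyEq e.symm).unique (hasFDerivAt_id (W.band q).1)
      exact congrArg (fun L => L w) this
    have hC2 : ∀ w, (A' (σ' w)).2 = 4 * (W.band q).1 ^ 7 / (W.band q).2 * w := by
      intro w
      have := tangent_of_sq dC (fun x => W.point_sq _ _) w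
      simp only [IsTangent, h2, ContinuousLinearMap.comp_apply] at this
      rw [hC1] at this
      have := W.band_snd_ne hq2
      grind
    have hCI : A' (σ' (Complex.I • v.1)) = Complex.I • A' (σ' v.1) := by
      refine Prod.ext ?_ ?_
      · rw [Prod.smul_fst, hC1, hC1]
      · rw [Prod.smul_snd, hC2, hC2, smul_eq_mul, smul_eq_mul]; ring
    have hpos := areaForm_I_pos (v := A' (σ' v.1)) (fun h => hv1 (by
      have := hC1 v.1
      rw [h] at this
      exact this.symm))
    rw [← hCI, areaForm_map] at hpos
    exact pos_of_mul_pos_left hpos (W.area_band hq2).le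
  · have ev := W.eventually_twistMap_outer hχ h
    refine ⟨ContinuousLinearMap.id ℝ _, (hasFDerivWithinAt_id p Surf).congr_of_eventuallyEq
      (nhdsWithin_le_nhds ev) ev.self_of_nhds, fun v _ hv => ?_⟩
    exact areaForm_I_pos hv

lemma marked_not_mem {p : ℂ × ℂ} (hp : p ∈ Marked) : p ∉ W.band '' Strip := by
  rintro ⟨q, hq, rfl⟩
  have h := W.band_mem (strip_abs hq)
  rcases hp.2 with h1 | h1
  · have := h.2.1
    rw [h1] at this
    simp [Complex.norm_exp] at this
  · have := h.2.2
    rw [h1] at this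
    simp [Complex.norm_exp] at this

/-- The twist along the core of the annulus of a wave. -/
noncomputable def twist (hχ : IsShear χ c) : SurfDiffeo where
  toFun := W.twistMap χ
  invFun := W.twistMap fun t => -χ t
  mapsTo := W.mapsTo_twistMap χ surfInt_subset
  mapsTo_inv := W.mapsTo_twistMap _ surfInt_subset
  left_inv := fun p _ => W.twistMap_comp (fun _ => rfl) p
  right_inv := fun p _ => W.twistMap_comp (fun t => (neg_neg (χ t)).symm) p
  smooth := W.contDiffOn_twistMap hχ
  smooth_inv := W.contDiffOn_twistMap hχ.neg
  orientation := fun _ hp => W.orientation_twistMap hχ hp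
  marked := fun p hp => by rwa [W.twistMap_of_not χ (W.marked_not_mem hp)]

theorem twist_isDehnTwist :
    IsDehnTwist (fun s => W.band (s, 0)) (W.twist profile_isShear) := by
  refine ⟨W.band, profile, W.isAnnulus, profile_isShear.smooth, profile_isShear.low,
    fun t ht => by rw [profile_isShear.high t ht, Int.cast_one], ?_, ?_⟩
  · intro s t ht
    exact W.twistMap_band profile (q := (s, t)) ⟨Set.mem_univ _, ht⟩
  · intro p hp
    exact W.twistMap_of_not profile hp.2

end Wave

/-! ### The rotation of the surface -/

/-- The rotation of the plane by the angle `k * π` acts on the surface. -/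
noncomputable def turn (k : ℤ) (p : ℂ × ℂ) : ℂ × ℂ := ((-1) ^ k * p.1, p.2)

lemma turn_zero (p : ℂ × ℂ) : turn 0 p = p := by simp [turn]

lemma turn_turn (k l : ℤ) (p : ℂ × ℂ) : turn k (turn l p) = turn (k + l) p := by
  simp only [turn]
  rw [zpow_add₀ (by norm_num), mul_assoc]

lemma turn_even (m : ℤ) (p : ℂ × ℂ) : turn (2 * m) p = p := by simp [turn, zpow_mul]

lemma turn_neg (k : ℤ) (p : ℂ × ℂ) : turn (-k) p = turn k p := by
  rw [show -k = k + 2 * (-k) by ring, ← turn_turn, turn_even]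

lemma turn_eq_iff {k : ℤ} {p p' : ℂ × ℂ} : turn k p = p' ↔ p = turn (-k) p' := by
  constructor
  · rintro rfl; rw [turn_turn, neg_add_cancel, turn_zero]
  · rintro rfl; rw [turn_turn, add_neg_cancel, turn_zero]

lemma norm_turn (k : ℤ) (p : ℂ × ℂ) : ‖(turn k p).1‖ = ‖p.1‖ := by simp [turn]

lemma turn_mem {k : ℤ} {p : ℂ × ℂ} (h : p ∈ SurfInt) : turn k p ∈ SurfInt := by
  refine ⟨?_, by rw [norm_turn]; exact h.2.1, by rw [norm_turn]; exact h.2.2⟩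
  have e : ((-1 : ℂ) ^ k) ^ 8 = 1 := by
    rw [← zpow_natCast, ← zpow_mul, mul_comm, zpow_mul]; norm_num
  simp only [turn]
  rw [mul_pow, e, one_mul]
  exact h.1

lemma continuous_turn (k : ℤ) : Continuous (turn k) := by unfold turn; fun_prop

lemma polar_add_four (ρ a : ℝ) (k : ℤ) : polar (ρ, a + 4 * k) = (-1) ^ k * polar (ρ, a) := by
  unfold polar
  rw [← Complex.exp_pi_mul_I, ← Complex.exp_int_mul, ← Complex.exp_add]
  congr 1
  push_cast
  ring

lemma branch_add_four (u : Bool) (r a : ℝ) (k : ℤ) : branch u r (a + 4 * k) = branch u r a := by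
  have e1 : slitRoot r (a + 4 * k) = slitRoot r a := by
    have := slitRoot_add_int r a (4 * k)
    grind
  have e2 : slitRoot r (-(a + 4 * k)) = slitRoot r (-a) := by
    have := slitRoot_add_int r (-a) (-(4 * k))
    push_cast at this
    rw [← this]; congr 1; ring
  unfold branch
  rw [e1, e2]
  congr 2
  rw [Complex.exp_eq_exp_iff_exists_int]
  exact ⟨2 * k, by push_cast; ring⟩

lemma pt_add_four (u σ : Bool) (r a : ℝ) (k : ℤ) : pt u σ r (a + 4 * k) = turn k (pt u σ r a) := by
  unfold pt turn
  rw [polar_add_four, branch_add_four]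

lemma chain_turn {lab : ℤ → Label} {a : ℤ → ℝ} {h : ℤ} {w : ℤ}
    (hl : ∀ i, lab (i + h) = lab i) (ha : ∀ i, a (i + h) = a i + 4 * w) (hw : w = 1 ∨ w = -1)
    (x : ℝ) (k : ℤ) : chain lab 0 a (x + (k * h : ℤ)) = turn k (chain lab 0 a x) := by
  have e1 : ∀ i, lab (i + k * h) = lab i := by
    intro i
    induction k with
    | zero => simp
    | succ k ih => grind
    | pred k ih => grind
  have e2 : ∀ x, lin a (x + (k * h : ℤ)) = lin a x + k * (4 * w) := fun x => lin_add_mul ha x k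
  have e3 : ∀ i : ℤ, a (i + k * h) = a i + k * (4 * w) := fun i => by
    have := e2 i
    rw [← Int.cast_add, lin_int, lin_int] at this
    exact this
  have key : ∀ u σ r, pt u σ r (lin a x + k * (4 * w)) = turn k (pt u σ r (lin a x)) := by
    intro u σ r
    have := pt_add_four u σ r (lin a x) (k * w)
    push_cast at this
    rw [show lin a x + (k : ℝ) * (4 * w) = lin a x + 4 * (k * w) by ring, this]
    rcases hw with rfl | rfl
    · rw [mul_one]
    · rw [mul_neg_one, turn_neg]
  have hf : Int.fract (x + (k * h : ℤ)) = Int.fract x := Int.fract_add_intCast _ _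
  rw [chain_eq, chain_eq, e2, hf, Int.floor_add_intCast, e1, key]
  congr 2
  unfold height
  rw [show ⌊x⌋ + k * h + 1 = ⌊x⌋ + 1 + k * h by ring, e3, e3]
  simp

/-- The extension of a map of `[0, h]` to the line by means of the rotation. -/
noncomputable def unroll (h : ℝ) (F : ℝ → ℂ × ℂ) (y : ℝ) : ℂ × ℂ :=
  turn ⌊y / h⌋ (F (y - ⌊y / h⌋ * h))

lemma unroll_mem {h : ℝ} (hh : 0 < h) (y : ℝ) : y - ⌊y / h⌋ * h ∈ Set.Ico 0 h := by
  have h1 := Int.floor_le (y / h)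
  have h2 := Int.lt_floor_add_one (y / h)
  rw [le_div_iff₀ hh] at h1
  rw [div_lt_iff₀ hh] at h2
  constructor <;> linarith

lemma unroll_eq {h : ℝ} (hh : 0 < h) {F g : ℝ → ℂ × ℂ}
    (hg : ∀ (y : ℝ) (k : ℤ), g (y + k * h) = turn k (g y)) (hF : ∀ y ∈ Set.Ico 0 h, F y = g y) :
    unroll h F = g := by
  funext y
  rw [unroll, hF _ (unroll_mem hh y), ← hg, sub_add_cancel]

lemma InjFamily.unroll {F : ℝ → ℝ → ℂ × ℂ} {h : ℝ} (hh : 0 < h)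
    (hc : ContinuousOn (fun q : ℝ × ℝ => F q.1 q.2) (Set.Icc 0 1 ×ˢ Set.Icc 0 h))
    (hend : ∀ s ∈ Set.Icc (0 : ℝ) 1, F s h = turn 1 (F s 0))
    (hmem : ∀ s ∈ Set.Icc (0 : ℝ) 1, ∀ y ∈ Set.Ico 0 h, F s y ∈ SurfInt)
    (hinj : ∀ s ∈ Set.Icc (0 : ℝ) 1, ∀ y ∈ Set.Ico 0 h, ∀ y' ∈ Set.Ico 0 h, ∀ k : ℤ,
      F s y = turn k (F s y') → y = y' ∧ ∃ m, k = 2 * m) :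
    InjFamily (fun s => unroll h (F s)) (2 * h) := by
  refine ⟨by linarith, ?_, fun s hs y => turn_mem (hmem s hs _ (unroll_mem hh y)), ?_⟩
  · rw [continuousOn_iff_continuous_domRestrict]
    let pr : ℝ → ℝ := fun y => max 0 (min y h)
    have hpr : ∀ y, pr y ∈ Set.Icc 0 h := fun y =>
      ⟨le_max_left _ _, max_le hh.le (min_le_right _ _)⟩
    have hpc : Continuous pr := by fun_prop
    have hFc : Continuous fun q : Set.Icc (0 : ℝ) 1 × ℝ => F q.1 (pr q.2) :=
      hc.comp_continuous (f := fun q : Set.Icc (0 : ℝ) 1 × ℝ => ((q.1 : ℝ), pr q.2))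
        (by fun_prop) fun q => ⟨q.1.2, hpr _⟩
    have key : Continuous fun q : Set.Icc (0 : ℝ) 1 × ℝ =>
        SmithPencil.unroll h (F q.1) (q.2 * h) := by
      refine continuous_glue (fun i q => turn i (F q.1 (pr ((q.2 - i) * h)))) (fun i => ?_) ?_
      · exact (continuous_turn i).comp (hFc.comp
          (f := fun q : Set.Icc (0 : ℝ) 1 × ℝ => (q.1, (q.2 - i) * h)) (by fun_prop))
      · intro i q h0 h1
        have hp : pr ((q.2 - i) * h) = (q.2 - i) * h := by
          simp only [pr]
          rw [min_eq_left (by nlinarith), max_eq_right (mul_nonneg (by linarith) hh.le)]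
        rw [hp, SmithPencil.unroll, mul_div_cancel_right₀ _ hh.ne', ← sub_mul]
        rcases h1.eq_or_lt with e | e
        · have : ⌊q.2⌋ = i + 1 := by rw [e, Int.floor_add_one, Int.floor_intCast]
          rw [this, e]
          push_cast
          rw [sub_self, zero_mul, add_sub_cancel_left, one_mul, hend _ q.1.2, turn_turn]
        · rw [Int.floor_eq_iff.2 ⟨h0, e⟩]
    have := key.comp (f := fun q : (Set.Icc (0 : ℝ) 1 ×ˢ Set.univ : Set (ℝ × ℝ)) =>
      ((⟨q.1.1, q.2.1⟩ : Set.Icc (0 : ℝ) 1), q.1.2 / h)) (by fun_prop)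
    convert this using 1
    grind
  · intro s hs y y'
    constructor
    · intro e
      simp only [SmithPencil.unroll] at e
      rw [turn_eq_iff, turn_turn] at e
      obtain ⟨h1, m, h2⟩ := hinj s hs _ (unroll_mem hh y) _ (unroll_mem hh y') _ e
      refine ⟨m, ?_⟩
      have : (⌊y' / h⌋ : ℝ) = ⌊y / h⌋ + 2 * m := by
        have : ⌊y' / h⌋ = ⌊y / h⌋ + 2 * m := by omega
        rw [this]; grind
      grind
    · rintro ⟨m, rfl⟩
      have e : ⌊(y + m * (2 * h)) / h⌋ = ⌊y / h⌋ + 2 * m := by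
        rw [show (y + m * (2 * h)) / h = y / h + ((2 * m : ℤ) : ℝ) by grind,
          Int.floor_add_intCast]
      simp only [SmithPencil.unroll, e]
      rw [← turn_turn, turn_turn, add_comm, ← turn_turn, turn_even]
      grind

lemma IsChain.injective {lab : ℤ → Label} {ρ a : ℤ → ℝ} {N w : ℤ} (h : IsChain lab ρ a N w)
    (hw : w * w = 1) (ha : ∀ i, a (i + 1) ≠ a i) {x x' : ℝ}
    (e : chain lab ρ a x = chain lab ρ a x') : ∃ m : ℤ, x' = x + (m * N : ℤ) := by
  obtain ⟨m, hm⟩ := h.travel_of_eq hw e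
  refine ⟨m, ?_⟩
  have hs : StrictMono (lin (travel a)) := lin_strictMono fun i => by
    rw [travel_succ]
    grind
  apply hs.injective
  rw [hm, lin_add_mul h.travel_add]

namespace Wave
variable (W : Wave)

lemma core_add_mul (a : ℝ) (k : ℤ) : W.core (a + 4 * k) = W.core a := by
  induction k with
  | zero => simp
  | succ k ih =>
    have := W.core_add (a + 4 * k)
    push_cast at ih ⊢
    grind
  | pred k ih =>
    have := W.core_add (a + 4 * (-k - 1))
    push_cast at ih ⊢
    grind

lemma odd_add_mul (k m : ℤ) : odd (k + 4 * m) = odd k := by unfold odd; grind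

lemma label_add_mul (u : Bool) (k m : ℤ) : W.label u (k + 4 * m) = W.label u k := by
  have h : W.sheet (k + 4 * m) = W.sheet k := by
    induction m with
    | zero => simp
    | succ m ih => rw [← ih, ← W.sheet_add (k + 4 * m)]; congr 1; ring
    | pred m ih => rw [← ih, ← W.sheet_add (k + 4 * (-m - 1))]; congr 1; ring
  unfold label
  rw [odd_add_mul, h]

lemma point_add_mul (ρ a : ℝ) (k : ℤ) : W.point ρ (a + 4 * k) = turn k (W.point ρ a) := by
  have hf : ⌊a + 4 * (k : ℝ)⌋ = ⌊a⌋ + 4 * k := by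
    have := Int.floor_add_intCast a (4 * k)
    grind
  unfold point
  rw [hf, W.label_add_mul, W.label_add_mul, pt_add_four, pt_add_four]
  split_ifs <;> rfl

lemma level_turn (q : ℝ × ℝ) (k : ℤ) : W.level (q.1 + k / 2, q.2) = W.level q := by
  unfold level
  simp only
  rw [show 8 * (q.1 + (k : ℝ) / 2) = 8 * q.1 + 4 * k by ring, W.core_add_mul]

lemma band_turn (q : ℝ × ℝ) (k : ℤ) : W.band (q.1 + k / 2, q.2) = turn k (W.band q) := by
  rw [W.band_eq, W.level_turn, W.band_eq, ← W.point_add_mul]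
  congr 1
  ring

lemma twistMap_turn (χ : ℝ → ℝ) (p : ℂ × ℂ) (k : ℤ) :
    W.twistMap χ (turn k p) = turn k (W.twistMap χ p) := by
  by_cases hp : p ∈ W.band '' Strip
  · obtain ⟨q, hq, rfl⟩ := hp
    rw [W.twistMap_band χ hq, ← W.band_turn,
      W.twistMap_band χ (q := (q.1 + k / 2, q.2)) ⟨Set.mem_univ _, hq.2⟩,
      ← W.band_turn (q.1 + χ q.2, q.2)]
    grind
  · rw [W.twistMap_of_not χ hp, W.twistMap_of_not]
    rintro ⟨q, hq, h⟩
    refine hp ⟨(q.1 + (-k : ℤ) / 2, q.2), ⟨Set.mem_univ _, hq.2⟩, ?_⟩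
    rw [W.band_turn, h, turn_turn, neg_add_cancel, turn_zero]

end Wave

/-! ### The effect of a twist on a chain -/

lemma IsChain.lineIso_self {lab : ℤ → Label} {ρ a : ℤ → ℝ} {N w : ℤ}
    (h : IsChain lab ρ a N w) (hN : 0 < N) (hw : w * w = 1) :
    LineIso N N (chain lab ρ a) (chain lab ρ a) :=
  lineIso_of_chains (a := fun _ => a) (ρ := fun _ => ρ) hN hw (fun _ => continuous_const)
    (fun _ => continuous_const) fun _ _ => h

/-- The reparametrization that stretches `[0, 2]` to `[0, n]`. -/
noncomputable def shrink (n : ℕ) (y : ℝ) : ℝ := if y ≤ n then 2 * y / n else y - n + 2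

/-- The chain `b` crosses the annulus of the wave `W` along its first two arcs, and `c` is the chain
obtained by replacing them with `n` arcs that wind once around the annulus. -/
structure TwistPlan (W : Wave) (hb hc n : ℕ) (lb lc : ℤ → Label) (b c : ℤ → ℝ) (τ : ℤ)
    (tb : ℝ → ℝ) : Prop where
  chain_b : IsChain lb 0 b (2 * hb) τ
  chain_c : IsChain lc 0 c (2 * hc) (-τ)
  unit : τ = 1 ∨ τ = -1
  half_b : ∀ i, b (i + hb) = b i + 4 * τ
  half_c : ∀ i, c (i + hc) = c i + 4 * (-τ : ℤ)
  half_lb : ∀ i, lb (i + hb) = lb i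
  half_lc : ∀ i, lc (i + hc) = lc i
  strict_b : ∀ i, b (i + 1) ≠ b i
  strict_c : ∀ i, c (i + 1) ≠ c i
  size : hc + 2 = hb + n
  n_pos : 0 < n
  hb_ge : 2 ≤ hb
  start : c 0 = b 0
  tail : ∀ i : ℤ, n ≤ i → i ≤ hc → c i = b (i - n + 2) - 8 * τ
  tail_lab : ∀ i : ℤ, n ≤ i → i < hc → lc i = lb (i - n + 2)
  cont_t : Continuous tb
  anti : StrictAntiOn (fun x => τ * tb x) (Set.Icc 0 2)
  t_zero : tb 0 = τ
  t_two : tb 2 = -τ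
  band_b : ∀ x ∈ Set.Icc (0 : ℝ) 2, chain lb 0 b x = W.band (lin b x / 8, tb x)
  out : ∀ x ∈ Set.Icc (2 : ℝ) hb, ∀ q : ℝ × ℝ, |q.2| < 1 → W.band q ≠ chain lb 0 b x
  band_c : ∀ j : ℤ, 0 ≤ j → j < n → ∀ y ∈ Set.Ico (j : ℝ) (j + 1), ∃ r, 0 ≤ r ∧
    W.band (lin c y / 8, τ * (1 - 2 * y / n)) = pt (lc j).1 (lc j).2 r (lin c y)
  axis_c : ∀ j : ℤ, 0 ≤ j → j ≤ n → W.level (c j / 8, τ * (1 - 2 * j / n)) = 0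
  alt : ∀ i, (lc (i + 1)).1 ≠ (lc i).1

namespace TwistPlan
variable {W : Wave} {hb hc n : ℕ} {lb lc : ℤ → Label} {b c : ℤ → ℝ} {τ : ℤ} {tb : ℝ → ℝ}

/-- The images of the chain `b` on the way from the twist to a chain. -/
noncomputable def deform (W : Wave) (n : ℕ) (lb : ℤ → Label) (b c : ℤ → ℝ) (τ : ℤ)
    (tb : ℝ → ℝ) (s y : ℝ) : ℂ × ℂ :=
  if y ≤ n then
    W.band (((1 - s) * (lin b (2 * y / n) + 8 * (profile (tb (2 * y / n)) - profile τ)) +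
      s * lin c y) / 8, (1 - s) * tb (2 * y / n) + s * (τ * (1 - 2 * y / n)))
  else chain lb 0 b (y - n + 2)

variable (h : TwistPlan W hb hc n lb lc b c τ tb)
include h

lemma n_pos' : (0 : ℝ) < n := by exact_mod_cast h.n_pos

lemma unit_mul : τ * τ = 1 := by rcases h.unit with h | h <;> rw [h] <;> norm_num

lemma unit_real : (τ : ℝ) * τ = 1 := by exact_mod_cast h.unit_mul

lemma size_real : (hc : ℝ) + 2 = hb + n := by exact_mod_cast h.size

lemma hb_real : (2 : ℝ) ≤ hb := by exact_mod_cast h.hb_ge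

lemma hc_pos : (0 : ℝ) < hc := by have := h.size_real; have := h.hb_real; have := h.n_pos'; linarith

lemma n_le : (n : ℝ) ≤ hc := by have := h.size_real; have := h.hb_real; linarith

lemma two_div : 2 * (n : ℝ) / n = 2 := by rw [mul_div_assoc, div_self h.n_pos'.ne', mul_one]

lemma profile_ends : profile (tb 2) - profile τ = -τ := by
  rw [h.t_two]
  have h1 : profile 1 = 1 := by rw [profile_isShear.high 1 (by norm_num), Int.cast_one]
  have h2 : profile (-1) = 0 := profile_isShear.low _ (by norm_num)
  rcases h.unit with h | h <;> rw [h] <;> push_cast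
  · grind
  grind

lemma c_n : c n = b 2 - 8 * τ := by
  have := h.tail n le_rfl (by exact_mod_cast h.n_le)
  grind

lemma chain_b_turn (x : ℝ) (k : ℤ) : chain lb 0 b (x + k * hb) = turn k (chain lb 0 b x) := by
  have := chain_turn h.half_lb h.half_b h.unit x k
  push_cast at this
  exact this

/-- The end of the first part of the deformation. -/
lemma deform_at_n (s : ℝ) : deform W n lb b c τ tb s n = chain lb 0 b 2 := by
  have e2 : lin b 2 = b 2 := by
    have := lin_int b 2
    grind
  have en : lin c n = c n := by
    have := lin_int c n
    exact_mod_cast this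
  rw [deform, if_pos le_rfl, h.two_div, h.profile_ends, en, h.c_n, h.band_b 2 ⟨by norm_num, le_rfl⟩,
    e2, h.t_two]
  have := W.band_add_int (b 2 / 8) (-τ) (-τ)
  grind

lemma deform_tail (s : ℝ) {y : ℝ} (hy : n ≤ y) :
    deform W n lb b c τ tb s y = chain lb 0 b (y - n + 2) := by
  rcases hy.eq_or_lt with e | e
  · rw [← e, h.deform_at_n, sub_self, zero_add]
  · rw [deform, if_neg (not_le.2 e)]

lemma deform_zero (s : ℝ) : deform W n lb b c τ tb s 0 = chain lb 0 b 0 := by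
  have e0 : lin b 0 = b 0 := by
    have := lin_int b 0
    grind
  have ec : lin c 0 = c 0 := by
    have := lin_int c 0
    grind
  rw [deform, if_pos (by positivity), mul_zero, zero_div, h.t_zero, sub_self, ec, h.start, e0,
    h.band_b 0 ⟨le_rfl, by norm_num⟩, e0, h.t_zero]
  grind

lemma deform_end (s : ℝ) :
    deform W n lb b c τ tb s hc = turn 1 (deform W n lb b c τ tb s 0) := by
  rw [h.deform_tail s h.n_le, h.deform_zero, ← h.chain_b_turn]
  congr 1
  have := h.size_real
  grind

/-- The time in the annulus. -/
lemma time_mem {x : ℝ} (hx : x ∈ Set.Icc (0 : ℝ) 2) : |tb x| ≤ 1 := by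
  have m0 : (0 : ℝ) ∈ Set.Icc (0 : ℝ) 2 := ⟨le_rfl, by norm_num⟩
  have m2 : (2 : ℝ) ∈ Set.Icc (0 : ℝ) 2 := ⟨by norm_num, le_rfl⟩
  have h1 := h.anti.antitoneOn m0 hx hx.1
  have h2 := h.anti.antitoneOn hx m2 hx.2
  have hu := h.unit_real
  simp only [h.t_zero, h.t_two] at h1 h2
  rcases h.unit with k | k <;> rw [k] at h1 h2 <;> grind

lemma mix_anti {s : ℝ} (hs : s ∈ Set.Icc (0 : ℝ) 1) {x x' : ℝ} (hx : x ∈ Set.Icc (0 : ℝ) 2)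
    (hx' : x' ∈ Set.Icc (0 : ℝ) 2) (hlt : x < x') :
    τ * ((1 - s) * tb x' + s * (τ * (1 - x'))) < τ * ((1 - s) * tb x + s * (τ * (1 - x))) := by
  have h1 := h.anti hx hx' hlt
  simp only at h1
  have hu := h.unit_real
  have e : ∀ x, (τ : ℝ) * ((1 - s) * tb x + s * (τ * (1 - x))) =
      (1 - s) * (τ * tb x) + s * (1 - x) := fun x => by grind
  rw [e, e]
  rcases hs.1.eq_or_lt with h0 | h0
  · rw [← h0]; linarith
  · have := hs.2
    nlinarith

lemma mix_abs {s : ℝ} (hs : s ∈ Set.Icc (0 : ℝ) 1) {x : ℝ} (hx : x ∈ Set.Ioo (0 : ℝ) 2) :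
    |(1 - s) * tb x + s * (τ * (1 - x))| < 1 := by
  have m0 : (0 : ℝ) ∈ Set.Icc (0 : ℝ) 2 := ⟨le_rfl, by norm_num⟩
  have m2 : (2 : ℝ) ∈ Set.Icc (0 : ℝ) 2 := ⟨by norm_num, le_rfl⟩
  have h1 := h.mix_anti hs m0 (Set.Ioo_subset_Icc_self hx) hx.1
  have h2 := h.mix_anti hs (Set.Ioo_subset_Icc_self hx) m2 hx.2
  rw [h.t_zero] at h1
  rw [h.t_two] at h2
  rcases h.unit with k | k <;> rw [k] at h1 h2 ⊢ <;> grind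

lemma ratio_mem {y : ℝ} (h0 : 0 ≤ y) (h1 : y ≤ n) : 2 * y / n ∈ Set.Icc (0 : ℝ) 2 := by
  have := h.n_pos'
  refine ⟨by positivity, ?_⟩
  rw [div_le_iff₀ this]; linarith

lemma ratio_mem' {y : ℝ} (h0 : 0 < y) (h1 : y < n) : 2 * y / n ∈ Set.Ioo (0 : ℝ) 2 := by
  have := h.n_pos'
  refine ⟨by positivity, ?_⟩
  rw [div_lt_iff₀ this]; linarith

/-- The points of the deformation are inside of the annulus, or points of the chain `b` outside. -/
lemma deform_cases {s : ℝ} (hs : s ∈ Set.Icc (0 : ℝ) 1) {y : ℝ} (hy : y ∈ Set.Ico (0 : ℝ) hc) :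
    (deform W n lb b c τ tb s y = chain lb 0 b (shrink n y) ∧
      (shrink n y = 0 ∨ shrink n y ∈ Set.Icc (2 : ℝ) hb)) ∨
    ((0 < y ∧ y < n) ∧ |(1 - s) * tb (2 * y / n) + s * (τ * (1 - 2 * y / n))| < 1) := by
  have hn := h.n_pos'
  rcases hy.1.eq_or_lt with e | e
  · left
    rw [← e, h.deform_zero]
    have : shrink n 0 = 0 := by simp [shrink]
    grind
  · rcases lt_or_ge y n with e1 | e1
    · right
      exact ⟨⟨e, e1⟩, h.mix_abs hs (h.ratio_mem' e e1)⟩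
    · left
      have hs : shrink n y = y - n + 2 := by
        unfold shrink
        grind
      rw [hs, h.deform_tail s e1]
      have := h.size_real
      grind

lemma shrink_strict {y y' : ℝ} (hlt : y < y') : shrink n y < shrink n y' := by
  have hn := h.n_pos'
  unfold shrink
  split_ifs with h1 h2 h2
  · gcongr
  · have : 2 * y / n ≤ 2 := by rw [div_le_iff₀ hn]; linarith
    linarith
  · linarith
  · linarith

lemma shrink_mem {y : ℝ} (hy : y ∈ Set.Ico (0 : ℝ) hc) : shrink n y ∈ Set.Ico (0 : ℝ) hb := by
  have hn := h.n_pos'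
  have := h.size_real
  have := h.hb_real
  unfold shrink
  split_ifs with h1
  · refine ⟨by have := hy.1; positivity, ?_⟩
    rcases h1.eq_or_lt with k | k
    · grind
    · have : 2 * y / n < 2 := by rw [div_lt_iff₀ hn]; linarith
      linarith
  grind

omit h in
lemma continuous_annulus : Continuous fun q : ℝ × ℝ => W.band (q.1, max (-1) (min 1 q.2)) := by
  rw [continuous_iff_continuousAt]
  intro q
  have ha : |max (-1) (min 1 q.2)| < 2 := by grind
  exact ContinuousAt.comp (f := fun q : ℝ × ℝ => (q.1, max (-1) (min 1 q.2)))
    (W.continuousAt_band (q := (q.1, max (-1) (min 1 q.2))) ha) (by fun_prop)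

lemma continuousOn_deform : ContinuousOn
    (fun q : ℝ × ℝ => deform W n lb b c τ tb q.1 q.2) (Set.Icc 0 1 ×ˢ Set.Icc 0 (hc : ℝ)) := by
  have hn := h.n_pos'
  have hB : Continuous (chain lb 0 b) := by
    obtain ⟨γ, -, ⟨-, h1, σ, h2, -, -, h3⟩, -⟩ := h.chain_b.lineIso_self (by
      have := h.hb_ge; omega) h.unit_mul
    rw [show chain lb 0 b = fun x => γ (σ x) from funext h3]
    exact h1.continuous.comp h2
  have hlb := continuous_lin b
  have hlc := continuous_lin c
  have ht := h.cont_t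
  have hp : Continuous profile := profile_isShear.smooth.continuous
  have hF : Continuous fun q : ℝ × ℝ => if q.2 ≤ n then
      W.band (((1 - q.1) * (lin b (2 * q.2 / n) + 8 * (profile (tb (2 * q.2 / n)) - profile τ)) +
        q.1 * lin c q.2) / 8,
        max (-1) (min 1 ((1 - q.1) * tb (2 * q.2 / n) + q.1 * (τ * (1 - 2 * q.2 / n)))))
      else chain lb 0 b (q.2 - n + 2) := by
    refine Continuous.if_le ?_ (by fun_prop) continuous_snd continuous_const ?_
    · exact continuous_annulus.comp (f := fun q : ℝ × ℝ =>
        (((1 - q.1) * (lin b (2 * q.2 / n) + 8 * (profile (tb (2 * q.2 / n)) - profile τ)) +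
        q.1 * lin c q.2) / 8, (1 - q.1) * tb (2 * q.2 / n) + q.1 * (τ * (1 - 2 * q.2 / n))))
        (by fun_prop)
    · rintro ⟨s, y⟩ rfl
      have e := h.deform_at_n s
      rw [deform, if_pos le_rfl] at e
      simp only
      rw [sub_self, zero_add, ← e]
      congr 2
      rw [h.two_div, h.t_two]
      have : (1 - s) * (-(τ : ℝ)) + s * (τ * (1 - 2)) = -τ := by ring
      rw [this]
      rcases h.unit with k | k <;> rw [k] <;> norm_num
  refine hF.continuousOn.congr ?_
  rintro ⟨s, y⟩ ⟨hs, hy⟩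
  simp only [deform]
  split_ifs with hyn
  · congr 2
    have hx := h.ratio_mem hy.1 hyn
    have h1 := h.time_mem hx
    have h2 : |(τ : ℝ) * (1 - 2 * y / n)| ≤ 1 := by
      rw [abs_mul]
      have : |(τ : ℝ)| = 1 := by rcases h.unit with k | k <;> rw [k] <;> norm_num
      rw [this, one_mul, abs_le]
      constructor <;> grind
    obtain ⟨a1, a2⟩ := abs_le.1 h1
    obtain ⟨b1, b2⟩ := abs_le.1 h2
    have s0 := hs.1
    have s1 := hs.2
    rw [min_eq_right (by nlinarith), max_eq_right (by nlinarith)]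
  · rfl

lemma deform_mem {s : ℝ} (hs : s ∈ Set.Icc (0 : ℝ) 1) {y : ℝ} (hy : y ∈ Set.Ico (0 : ℝ) hc) :
    deform W n lb b c τ tb s y ∈ SurfInt := by
  rcases h.deform_cases hs hy with ⟨e, -⟩ | ⟨⟨-, e⟩, ha⟩
  · rw [e]
    exact pt_mem (height_lt_one (fun _ => by simp) h.chain_b.short _ (Int.fract_nonneg _)
      (Int.fract_lt_one _).le)
  · rw [deform, if_pos e.le]
    exact W.band_mem (by grind)

lemma chain_ne_band {x : ℝ} (hx : x = 0 ∨ x ∈ Set.Icc (2 : ℝ) hb) (k : ℤ) {q : ℝ × ℝ}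
    (hq : |q.2| < 1) : chain lb 0 b x ≠ turn k (W.band q) := by
  intro e
  rcases hx with rfl | hx
  · have := h.chain_b_turn 0 1
    rw [e, turn_turn, ← W.band_turn] at this
    push_cast at this
    exact h.out (0 + 1 * hb) ⟨by have := h.hb_real; linarith, by linarith⟩
      (q.1 + ((1 + k : ℤ) : ℝ) / 2, q.2) hq (by grind)
  · rw [← W.band_turn] at e
    exact h.out x hx (q.1 + k / 2, q.2) hq e.symm

lemma deform_inj {s : ℝ} (hs : s ∈ Set.Icc (0 : ℝ) 1) {y y' : ℝ} (hy : y ∈ Set.Ico (0 : ℝ) hc)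
    (hy' : y' ∈ Set.Ico (0 : ℝ) hc) {k : ℤ}
    (e : deform W n lb b c τ tb s y = turn k (deform W n lb b c τ tb s y')) :
    y = y' ∧ ∃ m, k = 2 * m := by
  have hn := h.n_pos'
  rcases h.deform_cases hs hy with ⟨e1, k1⟩ | ⟨i1, k1⟩ <;>
    rcases h.deform_cases hs hy' with ⟨e2, k2⟩ | ⟨i2, k2⟩
  · rw [e1, e2, ← h.chain_b_turn] at e
    obtain ⟨m, hm⟩ := h.chain_b.injective h.unit_mul h.strict_b e
    have m1 := h.shrink_mem hy
    have m2 := h.shrink_mem hy'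
    have hb0 : (0 : ℝ) < hb := by grind
    push_cast at hm
    have a1 : ((2 * m - k : ℤ) : ℝ) * hb < (1 : ℤ) * hb := by grind
    have a2 : ((-1 : ℤ) : ℝ) * hb < ((2 * m - k : ℤ) : ℝ) * hb := by grind
    have a1' := Int.cast_lt.1 (lt_of_mul_lt_mul_right a1 hb0.le)
    have a2' := Int.cast_lt.1 (lt_of_mul_lt_mul_right a2 hb0.le)
    have hk : k = 2 * m := by omega
    refine ⟨?_, m, hk⟩
    rw [hk] at hm
    push_cast at hm
    have e3 : shrink n y = shrink n y' := by linarith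
    by_contra hne
    rcases lt_or_gt_of_ne hne with hlt | hlt
    · exact absurd e3 (h.shrink_strict hlt).ne
    · exact absurd e3 (h.shrink_strict hlt).ne'
  · exfalso
    rw [e1, deform, if_pos i2.2.le] at e
    exact h.chain_ne_band k1 k k2 e
  · exfalso
    rw [e2, eq_comm, turn_eq_iff, deform, if_pos i1.2.le] at e
    exact h.chain_ne_band k2 (-k) k1 e
  · rw [deform, if_pos i1.2.le, deform, if_pos i2.2.le, ← W.band_turn] at e
    obtain ⟨m, hm⟩ := W.band_inj e
    simp only [Prod.mk.injEq] at hm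
    obtain ⟨h1, h2⟩ := hm
    have m1 := h.ratio_mem i1.1.le i1.2.le
    have m2 := h.ratio_mem i2.1.le i2.2.le
    have hyy : y = y' := by
      by_contra hne
      rcases lt_or_gt_of_ne hne with hlt | hlt
      · have := h.mix_anti hs m1 m2 (by gcongr)
        rw [h2] at this
        grind
      · have := h.mix_anti hs m2 m1 (by gcongr)
        rw [h2] at this
        grind
    refine ⟨hyy, m, ?_⟩
    subst hyy
    have : (k : ℝ) = 2 * m := by linarith
    exact_mod_cast this

lemma injFamily : InjFamily (fun s => unroll hc (deform W n lb b c τ tb s)) (2 * hc) :=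
  InjFamily.unroll h.hc_pos h.continuousOn_deform (fun s _ => h.deform_end s)
    (fun _ hs _ hy => h.deform_mem hs hy) fun _ hs _ hy _ hy' _ e => h.deform_inj hs hy hy' e

/-- The nodes of the extension of the reparametrization. -/
noncomputable def nodes (hb hc n : ℕ) (i : ℤ) : ℝ := hb * (i / hc : ℤ) + shrink n (i % hc : ℤ)

lemma nodes_add (i : ℤ) : nodes hb hc n (i + hc) = nodes hb hc n i + hb := by
  have : (hc : ℤ) ≠ 0 := by have := h.hc_pos; exact_mod_cast this.ne'
  unfold nodes
  rw [Int.add_emod_right, Int.add_ediv_of_dvd_right (dvd_refl _), Int.ediv_self this]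
  grind

lemma shrink_n : shrink n n = 2 := by rw [shrink, if_pos le_rfl, h.two_div]

lemma shrink_hc : shrink n hc = hb := by
  have := h.size_real
  rcases h.n_le.eq_or_lt with e | e
  · rw [← e, h.shrink_n]; linarith
  · rw [shrink, if_neg (not_le.2 e)]; linarith

lemma nodes_eq {i : ℤ} (h0 : 0 ≤ i) (h1 : i ≤ hc) : nodes hb hc n i = shrink n i := by
  rcases h1.eq_or_lt with e | e
  · subst e
    have := h.nodes_add 0
    rw [zero_add] at this
    rw [this, Int.cast_natCast, h.shrink_hc]
    simp [nodes, shrink]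
  · unfold nodes
    rw [Int.ediv_eq_zero_of_lt h0 e, Int.emod_eq_of_lt h0 e]
    simp

lemma lin_nodes {y : ℝ} (hy : y ∈ Set.Ico (0 : ℝ) hc) : lin (nodes hb hc n) y = shrink n y := by
  have hn := h.n_pos'
  have f0 := Int.floor_le y
  have f1 := Int.lt_floor_add_one y
  have g0 : 0 ≤ ⌊y⌋ := Int.floor_nonneg.2 hy.1
  have g1 : ⌊y⌋ < hc := Int.floor_lt.2 (by exact_mod_cast hy.2)
  rw [lin_on _ ⌊y⌋ f0 f1.le, h.nodes_eq g0 g1.le, h.nodes_eq (by omega) (by omega)]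
  rcases lt_or_ge ⌊y⌋ (n : ℤ) with e | e
  · have e1 : ((⌊y⌋ + 1 : ℤ) : ℝ) ≤ n := by exact_mod_cast e
    have e2 : (⌊y⌋ : ℝ) ≤ n := by grind
    push_cast at e1
    have : shrink n y = 2 * y / n := by rw [shrink, if_pos (by linarith)]
    rw [this]
    unfold shrink
    grind
  · have e1 : (n : ℝ) ≤ ⌊y⌋ := by exact_mod_cast e
    have key : ∀ z : ℝ, n ≤ z → shrink n z = z - n + 2 := by
      intro z hz
      rcases hz.eq_or_lt with k | k
      · rw [← k, h.shrink_n]; ring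
      · rw [shrink, if_neg (not_le.2 k)]
    grind

lemma nodes_mono (i : ℤ) : nodes hb hc n i ≤ nodes hb hc n (i + 1) := by
  have hc0 : (0 : ℤ) < hc := by have := h.hc_pos; exact_mod_cast this
  have key : ∀ i : ℤ, ∀ k : ℤ, nodes hb hc n (i + k * hc) = nodes hb hc n i + k * hb := by
    intro i k
    induction k with
    | zero => simp
    | succ k ih =>
      have := h.nodes_add (i + k * hc)
      rw [ih] at this
      rw [add_mul, one_mul, ← add_assoc, this]; push_cast; ring
    | pred k ih =>
      have := h.nodes_add (i + (-k - 1) * hc)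
      grind
  have e : i = i % hc + i / hc * hc := by
    have := Int.emod_add_mul_ediv i hc
    linarith
  have r0 := Int.emod_nonneg i hc0.ne'
  have r1 := Int.emod_lt_of_pos i hc0
  rw [e, show i % (hc : ℤ) + i / hc * hc + 1 = i % hc + 1 + i / hc * hc by ring, key, key,
    h.nodes_eq r0 r1.le, h.nodes_eq (by omega) (by omega)]
  have := h.shrink_strict (y := (i % (hc : ℤ) : ℤ)) (y' := (i % (hc : ℤ) + 1 : ℤ)) (by
    push_cast; linarith)
  linarith

/-- The deformation starts at the image of the chain. -/
lemma unroll_zero : unroll hc (deform W n lb b c τ tb 0) =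
    fun y => (W.twist profile_isShear).toFun (chain lb 0 b (lin (nodes hb hc n) y)) := by
  refine unroll_eq h.hc_pos ?_ ?_
  · intro y k
    have := lin_add_mul h.nodes_add y k
    push_cast at this
    rw [this, h.chain_b_turn]
    exact W.twistMap_turn _ _ _
  · intro y hy
    have hn := h.n_pos'
    rw [h.lin_nodes hy]
    rcases le_or_gt y n with e | e
    · have hs : shrink n y = 2 * y / n := if_pos e
      have hx := h.ratio_mem hy.1 e
      have ht := abs_le.1 (h.time_mem hx)
      rw [deform, if_pos e, hs, h.band_b _ hx]
      simp only [Wave.twist]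
      rw [W.twistMap_band profile (q := (lin b (2 * y / n) / 8, tb (2 * y / n)))
        ⟨Set.mem_univ _, ht⟩]
      have hp : ∃ m : ℤ, profile τ = m := by
        rcases h.unit with k | k
        · exact ⟨1, by rw [k]; exact profile_isShear.high _ (by norm_num)⟩
        · exact ⟨0, by rw [k]; exact (profile_isShear.low _ (by norm_num)).trans (by simp)⟩
      obtain ⟨m, hm⟩ := hp
      rw [hm]
      have := W.band_add_int (lin b (2 * y / n) / 8 + profile (tb (2 * y / n))) (tb (2 * y / n)) (-m)
      grind
    · have hs : shrink n y = y - n + 2 := if_neg (not_le.2 e)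
      have hx : y - n + 2 ∈ Set.Icc (2 : ℝ) hb := by
        have := h.size_real
        grind
      rw [h.deform_tail 0 e.le, hs]
      refine (W.twistMap_outer profile_isShear ?_).symm
      rintro ⟨q, hq, hqe⟩
      refine h.out _ hx q ?_ hqe
      grind

lemma deform_one {y : ℝ} (hy : y ∈ Set.Ico (0 : ℝ) hc) : ∃ r, 0 ≤ r ∧
    deform W n lb b c τ tb 1 y = pt (lc ⌊y⌋).1 (lc ⌊y⌋).2 r (lin c y) := by
  have f0 := Int.floor_le y
  have f1 := Int.lt_floor_add_one y
  have g0 : 0 ≤ ⌊y⌋ := Int.floor_nonneg.2 hy.1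
  have g1 : ⌊y⌋ < hc := Int.floor_lt.2 (by exact_mod_cast hy.2)
  rcases lt_or_ge ⌊y⌋ (n : ℤ) with e | e
  · have e1 : ((⌊y⌋ + 1 : ℤ) : ℝ) ≤ n := by exact_mod_cast e
    push_cast at e1
    obtain ⟨r, hr, hb⟩ := h.band_c ⌊y⌋ g0 e y ⟨f0, f1⟩
    refine ⟨r, hr, ?_⟩
    rw [deform, if_pos (by linarith), ← hb]
    grind
  · have e1 : (n : ℝ) ≤ ⌊y⌋ := by exact_mod_cast e
    rw [h.deform_tail 1 (by linarith)]
    have hf : ⌊y - n + 2⌋ = ⌊y⌋ - n + 2 := by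
      have := Int.floor_add_intCast y (-n + 2)
      push_cast at this
      grind
    have hlin : lin b (y - n + 2) = lin c y + 8 * τ := by
      rw [lin_on c ⌊y⌋ f0 f1.le, lin_on b (⌊y⌋ - n + 2) (by push_cast; linarith)
        (by push_cast; linarith), h.tail ⌊y⌋ e g1.le, h.tail (⌊y⌋ + 1) (by omega) (by omega)]
      push_cast
      grind
    rw [chain_eq, hf, ← h.tail_lab ⌊y⌋ e g1, hlin, pt_add]
    exact ⟨_, height_nonneg (fun _ => le_rfl) _ (Int.fract_nonneg _) (Int.fract_lt_one _).le, rfl⟩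

lemma lin_c_add (y : ℝ) (k : ℤ) : lin c (y + k * hc) = lin c y + 4 * (k * (-τ) : ℤ) := by
  have := lin_add_mul h.half_c y k
  push_cast at this ⊢
  grind

lemma lab_c_mul (i k : ℤ) : lc (i + k * hc) = lc i := by
  induction k with
  | zero => simp
  | succ k ih => rw [add_mul, one_mul, ← add_assoc, h.half_lc, ih]
  | pred k ih => rw [← ih, sub_mul, one_mul, ← h.half_lc (i + (-k * hc - hc))]; congr 1; ring

lemma unroll_one (y : ℝ) : ∃ r, 0 ≤ r ∧
    unroll hc (deform W n lb b c τ tb 1) y = pt (lc ⌊y⌋).1 (lc ⌊y⌋).2 r (lin c y) := by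
  set k := ⌊y / hc⌋ with hk
  obtain ⟨r, hr, e⟩ := h.deform_one (unroll_mem h.hc_pos y)
  rw [← hk] at e
  refine ⟨r, hr, ?_⟩
  rw [unroll, ← hk, e]
  set x := y - k * hc with hx
  have hy : y = x + k * hc := by rw [hx]; ring
  have hf : ⌊y⌋ = ⌊x⌋ + k * hc := by
    have := Int.floor_add_intCast x (k * hc)
    push_cast at this
    rw [hy, this]
  rw [hf, h.lab_c_mul, hy, h.lin_c_add, pt_add_four]
  rcases h.unit with h | h <;> rw [h]
  · rw [mul_neg_one, turn_neg]
  · norm_num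

lemma axis (i : ℤ) : ‖(unroll hc (deform W n lb b c τ tb 1) i).1‖ = 1 := by
  set k := ⌊(i : ℝ) / hc⌋ with hk
  have hm := unroll_mem h.hc_pos (i : ℝ)
  rw [← hk] at hm
  rw [unroll, norm_turn, ← hk]
  have hj : (i : ℝ) - k * hc = ((i - k * hc : ℤ) : ℝ) := by push_cast; ring
  rw [hj] at hm ⊢
  set j := i - k * hc with hjd
  have j0 : 0 ≤ j := by exact_mod_cast hm.1
  have j1 : j < hc := by exact_mod_cast hm.2
  rcases le_or_gt j n with e | e
  · have e1 : (j : ℝ) ≤ n := by exact_mod_cast e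
    rw [deform, if_pos e1]
    have hl := h.axis_c j j0 e
    have hq : (((1 - 1) * (lin b (2 * j / n) + 8 * (profile (tb (2 * j / n)) - profile τ)) +
        1 * lin c j) / 8, (1 - 1) * tb (2 * j / n) + 1 * (τ * (1 - 2 * j / n))) =
        ((c j / 8, τ * (1 - 2 * j / n)) : ℝ × ℝ) := by rw [lin_int]; ext <;> simp only <;> ring
    rw [hq, W.band_fst, hl, norm_polar]
    simp
  · have e1 : (n : ℝ) ≤ j := by exact_mod_cast e.le
    rw [h.deform_tail 1 e1, show (j : ℝ) - n + 2 = ((j - n + 2 : ℤ) : ℝ) by push_cast; ring,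
      chain_eq]
    simp [pt, height, norm_polar]

lemma isGraph : IsGraph lc
    (fun y => |Real.log ‖(unroll hc (deform W n lb b c τ tb 1) y).1‖|) (lin c) (2 * hc) (-τ) := by
  have m1 : (1 : ℝ) ∈ Set.Icc (0 : ℝ) 1 := ⟨zero_le_one, le_rfl⟩
  have hI := h.injFamily
  have hmem := hI.mem 1 m1
  have hinj := hI.eq_iff 1 m1
  set g := unroll hc (deform W n lb b c τ tb 1) with hg
  have hgc : Continuous g := hI.cont.comp_continuous (f := fun y : ℝ => ((1 : ℝ), y)) (by fun_prop)
    fun y => ⟨m1, trivial⟩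
  have npos : ∀ y, ‖(g y).1‖ ≠ 0 := fun y =>
    ((Real.exp_pos _).trans (hmem y).2.1).ne'
  have hr : ∀ y, g y = graphMap lc (fun y => |Real.log ‖(g y).1‖|) (lin c) y := by
    intro y
    obtain ⟨r, hr, e⟩ := h.unroll_one y
    rw [← hg] at e
    have : |Real.log ‖(g y).1‖| = r := by
      rw [e]
      simp only [pt, norm_polar, Real.log_exp]
      rw [abs_mul, max_eq_left hr, abs_of_nonneg hr]
      cases (lc ⌊y⌋).1 <;> simp [sg]
    rw [graphMap, this, e]
  have hper : ∀ y, g (y + ((2 * hc : ℤ) : ℝ)) = g y := by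
    intro y
    refine ((hinj _ _).2 ⟨1, ?_⟩).symm
    push_cast; ring
  refine ⟨by have := h.hc_pos; have : 0 < hc := by exact_mod_cast this
             omega, ?_, ?_, ?_, ?_, continuous_lin c, ?_, ?_, ?_, fun _ => abs_nonneg _, ?_,
    ?_, ?_, h.alt, ?_⟩
  · rw [neg_mul_neg]; exact h.unit_mul
  · intro x
    have := h.lin_c_add x 2
    push_cast at this ⊢
    grind
  · grind
  · exact h.chain_c.period_lab
  · exact ((continuous_norm.comp (continuous_fst.comp hgc)).log npos).abs
  · intro i x hx x' hx' e
    rw [lin_on c i hx.1 hx.2, lin_on c i hx'.1 hx'.2] at e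
    have := sub_ne_zero.2 (h.strict_c i)
    grind
  · intro i
    rw [hg, h.axis, Real.log_one, abs_zero]
  · intro y
    have h1 := Real.log_lt_log (Real.exp_pos _) (hmem y).2.1
    have h2 := Real.log_lt_log (lt_of_le_of_ne (norm_nonneg _) (npos y).symm) (hmem y).2.2
    rw [Real.log_exp] at h1 h2
    grind
  · intro i
    have e : (i : ℝ) + 1 = ((i + 1 : ℤ) : ℝ) := by grind
    rw [e, lin_int, lin_int]
    exact h.chain_c.short i
  · intro i
    rw [lin_int]
    exact h.chain_c.glue i
  · intro x x' hlt e ea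
    rw [← hr, ← hr] at e
    obtain ⟨m, hm⟩ := (hinj x x').1 e
    have h1 := h.lin_c_add x (2 * m)
    push_cast at h1
    rw [show x + 2 * (m : ℝ) * hc = x + m * (2 * hc) by ring, ← hm, ← ea] at h1
    have hτ : (τ : ℝ) ≠ 0 := by rcases h.unit with k | k <;> rw [k] <;> norm_num
    grind

theorem lineIso {γ : Curve} (hγ : Rep (2 * hb : ℤ) (chain lb 0 b) γ)
    (hT : IsSimpleClosed ((W.twist profile_isShear).toFun ∘ γ)) :
    LineIso (2 * hb : ℤ) (2 * hc : ℤ)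
      (fun x => (W.twist profile_isShear).toFun (chain lb 0 b x)) (chain lc 0 c) := by
  set T := W.twist profile_isShear
  have r1 : Rep (2 * hb : ℤ) (fun x => T.toFun (chain lb 0 b x)) (T.toFun ∘ γ) := by
    obtain ⟨h0, h1, σ, h2, h3, h4, h5⟩ := hγ
    exact ⟨h0, hT, σ, h2, h3, h4, fun x => by grind⟩
  have r2 : Rep (2 * hc : ℤ) (unroll hc (deform W n lb b c τ tb 0)) (T.toFun ∘ γ) := by
    rw [h.unroll_zero]
    refine r1.comp (by have := h.hc_pos; push_cast; linarith) (continuous_lin _)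
      (lin_monotone h.nodes_mono) fun x => ?_
    have := lin_add_mul h.nodes_add x 2
    push_cast at this ⊢
    exact this
  have l1 := h.injFamily.lineIso
  have l2 := h.isGraph.lineIso
  have e1 : graphMap lc (fun y => |Real.log ‖(unroll hc (deform W n lb b c τ tb 1) y).1‖|)
      (lin c) = unroll hc (deform W n lb b c τ tb 1) := by
    funext y
    obtain ⟨r, hr, e⟩ := h.unroll_one y
    rw [graphMap, e]
    congr 1
    simp only [pt, norm_polar, Real.log_exp]
    rw [abs_mul, max_eq_left hr, abs_of_nonneg hr]
    cases (lc ⌊y⌋).1 <;> simp [sg]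
  have e2 : (fun i : ℤ => lin c i) = c := funext fun i => lin_int c i
  rw [e1, e2] at l2
  have e3 : ((2 * hc : ℤ) : ℝ) = 2 * hc := by push_cast; ring
  rw [← e3] at l1
  obtain ⟨δ, δ', k1, k2, k3⟩ := l1.trans l2
  exact ⟨T.toFun ∘ γ, δ', r1, k2, (r2.isotopic k1).iso.trans k3⟩

end TwistPlan

/-! ### The lobes of a wave -/

namespace Wave

/-- The wave with the given periods of sides and sheets, of width `P / 1000`. -/
noncomputable def ofLists (side sheet : List Bool) (P : ℕ) (hP : 0 < P ∧ P ≤ 1000)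
    (hc : ∀ k < 4, if side.getD k false then sheet.getD k false = sheet.getD ((k + 3) % 4) false
      else (sheet.getD k false ^^ odd k) =
        (sheet.getD ((k + 3) % 4) false ^^ odd ((k + 3) % 4 : ℕ))) : Wave where
  side k := side.getD (k % 4).toNat false
  sheet k := sheet.getD (k % 4).toNat false
  width := P / 1000
  width_pos := by have : (0 : ℝ) < P := by exact_mod_cast hP.1
                  positivity
  width_le := by
    have : (P : ℝ) ≤ 1000 := by exact_mod_cast hP.2
    grind
  side_add k := by rw [Int.add_emod_right]
  sheet_add k := by rw [Int.add_emod_right]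
  compat k := by
    have h := hc (k % 4).toNat (by omega)
    have e1 : ((k % 4).toNat + 3) % 4 = ((k - 1) % 4).toNat := by omega
    have e2 : odd ((k % 4).toNat : ℤ) = odd k := by unfold odd; congr 1; rw [eq_iff_iff]; omega
    have e3 : odd (((k - 1) % 4).toNat : ℤ) = odd (k - 1) := by
      unfold odd; congr 1; rw [eq_iff_iff]; omega
    rw [e1, e2, e3] at h
    exact h

variable (W : Wave)

/-- Between its zeros at `k + 1 / 2` and `k' + 1 / 2` the wave is on the side `l.1` of the branch
points, on the sheet `l.2`. -/
structure IsLobe (k k' : ℤ) (l : Label) : Prop where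
  lt : k < k'
  inner : ∀ j, k < j → j ≤ k' → W.side j = l.1
  left : W.side k = !l.1
  right : W.side (k' + 1) = !l.1
  sheet : ∀ j, k ≤ j → j ≤ k' → W.label l.1 j = l.2

variable {W}

lemma IsLobe.add {k k' : ℤ} {l : Label} (h : W.IsLobe k k' l) (m : ℤ) :
    W.IsLobe (k + 4 * m) (k' + 4 * m) l := by
  have hs : ∀ j m : ℤ, W.side (j + 4 * m) = W.side j := by
    intro j m
    induction m with
    | zero => simp
    | succ m ih => rw [← ih, ← W.side_add (j + 4 * m)]; congr 1; ring
    | pred m ih => rw [← ih, ← W.side_add (j + 4 * (-m - 1))]; congr 1; ring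
  have hs' : ∀ j, W.side j = W.side (j - 4 * m) := fun j => by
    rw [← hs (j - 4 * m) m, sub_add_cancel]
  have hl' : ∀ j, W.label l.1 j = W.label l.1 (j - 4 * m) := fun j => by
    rw [← W.label_add_mul _ (j - 4 * m) m, sub_add_cancel]
  refine ⟨by linarith [h.lt], fun j h1 h2 => ?_, ?_, ?_, fun j h1 h2 => ?_⟩
  · rw [hs' j]; exact h.inner _ (by linarith) (by linarith)
  · rw [hs]; exact h.left
  · rw [show k' + 4 * m + 1 = k' + 1 + 4 * m by ring, hs]; exact h.right
  · rw [hl' j]; exact h.sheet _ (by linarith) (by linarith)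

/-- The height of the piecewise linear wave on a lobe. -/
lemma IsLobe.line {k k' : ℤ} {l : Label} (h : W.IsLobe k k' l) {a : ℝ}
    (h0 : k + 2 / 5 ≤ a) (h1 : a ≤ k' + 3 / 5) :
    sg l.1 * W.line a = min (min (a - (k + 1 / 2)) (k' + 1 / 2 - a)) (1 / 2) := by
  have hlt : (k : ℝ) + 1 ≤ k' := by exact_mod_cast h.lt
  have hsq := sg_mul_self l.1
  rcases le_or_gt a (k + 1) with e | e
  · unfold Wave.line
    rw [lin_on _ k (by linarith) e, h.left, h.inner (k + 1) (by linarith) h.lt, sg_not,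
      min_eq_left (a := a - (k + 1 / 2)) (by linarith), min_eq_left (by linarith)]
    grind
  · rcases le_or_gt (k' : ℝ) a with e' | e'
    · unfold Wave.line
      rw [lin_on _ k' e' (by linarith), h.right, h.inner k' h.lt le_rfl, sg_not,
        min_eq_right (a := a - (k + 1 / 2)) (by linarith), min_eq_left (by linarith)]
      grind
    · have f0 := Int.floor_le a
      have f1 := Int.lt_floor_add_one a
      have g0 : k < ⌊a⌋ := by
        have : k + 1 ≤ ⌊a⌋ := Int.le_floor.2 (by grind)
        linarith
      have g1 : ⌊a⌋ < k' := Int.floor_lt.2 e'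
      have g0' : (k : ℝ) + 1 ≤ ⌊a⌋ := by exact_mod_cast g0
      have g1' : (⌊a⌋ : ℝ) + 1 ≤ k' := by exact_mod_cast g1
      unfold Wave.line
      rw [lin_on _ ⌊a⌋ f0 f1.le, h.inner ⌊a⌋ g0 g1.le, h.inner (⌊a⌋ + 1) (by linarith) g1,
        min_eq_right (le_min (by linarith) (by linarith))]
      grind

lemma clamp_range {v : ℝ} (h : -(1 / 10) ≤ v) : min v (3 / 10) ≤ clamp v ∧ clamp v ≤ v := by
  rcases le_or_gt 0 v with h0 | h0
  · exact ⟨le_clamp h0, clamp_le h0⟩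
  · rw [clamp_eq (abs_le.2 ⟨by linarith, by linarith⟩)]
    grind

lemma sg_clamp (b : Bool) (v : ℝ) : sg b * clamp v = clamp (sg b * v) := by
  cases b <;> simp [sg, clamp_neg]

/-- The height of the smooth wave on a lobe. -/
lemma IsLobe.core {k k' : ℤ} {l : Label} (h : W.IsLobe k k' l) {a : ℝ}
    (h0 : k + 2 / 5 ≤ a) (h1 : a ≤ k' + 3 / 5) :
    min (min (a - (k + 1 / 2)) (k' + 1 / 2 - a)) (3 / 10) ≤ sg l.1 * W.core a ∧
      sg l.1 * W.core a ≤ a - (k + 1 / 2) ∧ sg l.1 * W.core a ≤ k' + 1 / 2 - a := by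
  have e := h.line h0 h1
  have hv : -(1 / 10) ≤ sg l.1 * W.line a := by grind
  obtain ⟨c1, c2⟩ := clamp_range hv
  rw [← sg_clamp, e] at c1 c2
  refine ⟨le_trans ?_ c1, c2.trans ((min_le_left _ _).trans (min_le_left _ _)),
    c2.trans ((min_le_left _ _).trans (min_le_right _ _))⟩
  grind

/-- The points of the sheet of the wave over a lobe. -/
lemma IsLobe.point {k k' : ℤ} {l : Label} (h : W.IsLobe k k' l) {a ρ : ℝ}
    (h0 : k + 2 / 5 ≤ a) (h1 : a ≤ k' + 3 / 5) (hρ : 0 ≤ sg l.1 * ρ) :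
    W.point ρ a = pt l.1 l.2 (sg l.1 * ρ) a := by
  have hs : W.label l.1 ⌊a⌋ = l.2 :=
    h.sheet _ (Int.le_floor.2 (by linarith)) (Int.le_of_lt_add_one (Int.floor_lt.2 (by
      push_cast; linarith)))
  obtain ⟨u, σ⟩ := l
  unfold Wave.point
  cases u
  · simp only [sg, Bool.false_eq_true, if_false] at hρ hs ⊢
    split_ifs with hz
    · have : ρ = 0 := by linarith
      subst this
      rw [mul_zero, ← hs]
      refine pt_axis_eq (k := ⌊a⌋) ⟨Int.floor_le a, (Int.lt_floor_add_one a).le⟩ ?_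
      simp [lower, label]
    · rw [hs, neg_one_mul]
  · simp only [sg, if_true, one_mul] at hρ hs ⊢
    rw [if_pos hρ, hs]

/-- An arc over a lobe that joins two levels near its ends stays on the side of the lobe. -/
lemma IsLobe.above {k k' : ℤ} {l : Label} (h : W.IsLobe k k' l) {x x' f : ℝ}
    (hf : f ∈ Set.Icc (0 : ℝ) 1) (hx : |x - (k + 1 / 2)| ≤ 1 / 10)
    (hx' : |x' - (k' + 1 / 2)| ≤ 1 / 10) :
    (k + 2 / 5 ≤ (1 - f) * x + f * x' ∧ (1 - f) * x + f * x' ≤ k' + 3 / 5) ∧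
    (1 - f) * (x - (k + 1 / 2)) + f * (k' + 1 / 2 - x') ≤
      sg l.1 * W.core ((1 - f) * x + f * x') := by
  have hlt : (k : ℝ) + 1 ≤ k' := by exact_mod_cast h.lt
  obtain ⟨a1, a2⟩ := abs_le.1 hx
  obtain ⟨b1, b2⟩ := abs_le.1 hx'
  obtain ⟨f0, f1⟩ := hf
  have r0 : (k : ℝ) + 2 / 5 ≤ (1 - f) * x + f * x' := by nlinarith
  have r1 : (1 - f) * x + f * x' ≤ k' + 3 / 5 := by nlinarith
  refine ⟨⟨r0, r1⟩, le_trans ?_ (h.core r0 r1).1⟩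
  refine le_min (le_min ?_ ?_) ?_ <;> nlinarith

end Wave

/-- The zeros and labels of the lobes of a wave, in units of `1 / 40`. -/
structure Lobes (W : Wave) (hw : ℕ) (lw : ℤ → Label) (z : ℤ → ℤ) : Prop where
  pos : 0 < hw
  add : ∀ i, z (i + hw) = z i + 160
  half : ∀ i, z i % 40 = 20
  lobe : ∀ i, W.IsLobe (z i / 40) (z (i + 1) / 40) (lw i)

namespace Lobes
variable {W : Wave} {hw : ℕ} {lw : ℤ → Label} {z : ℤ → ℤ} (h : Lobes W hw lw z)
include h

lemma cast_z (i : ℤ) : ((z i / 40 : ℤ) : ℝ) + 1 / 2 = z i / 40 := by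
  have h1 : z i = 40 * (z i / 40) + 20 := by have := h.half i; omega
  have h2 : (z i : ℝ) = 40 * ((z i / 40 : ℤ) : ℝ) + 20 := by exact_mod_cast h1
  linarith

lemma gap (i : ℤ) : (z i : ℝ) + 40 ≤ z (i + 1) := by
  have h1 := (h.lobe i).lt
  have h2 := h.half i
  have h3 := h.half (i + 1)
  have : z i + 40 ≤ z (i + 1) := by omega
  exact_mod_cast this

lemma mono {i j : ℤ} (hij : i ≤ j) : z i ≤ z j := by
  have : Monotone z := monotone_int_of_le_succ fun i => by
    have := h.gap i
    have : (z i : ℝ) ≤ z (i + 1) := by linarith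
    exact_mod_cast this
  exact this hij

lemma alt (i : ℤ) : (lw (i + 1)).1 = !(lw i).1 := by
  have h1 := (h.lobe i).right
  have h2 := (h.lobe (i + 1)).inner (z (i + 1) / 40 + 1) (by linarith) (h.lobe (i + 1)).lt
  grind

lemma sg_alt (i : ℤ) : sg (lw (i + 1)).1 = -sg (lw i).1 := by rw [h.alt, sg_not]

/-- The neighbourhood of a lobe. -/
def near (z : ℤ → ℤ) (i : ℤ) (a : ℝ) : Prop := (z i - 4) / 40 ≤ a ∧ a ≤ (z (i + 1) + 4) / 40

lemma near_bounds {i : ℤ} {a : ℝ} (ha : near z i a) :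
    ((z i / 40 : ℤ) : ℝ) + 2 / 5 ≤ a ∧ a ≤ ((z (i + 1) / 40 : ℤ) : ℝ) + 3 / 5 := by
  have h1 := h.cast_z i
  have h2 := h.cast_z (i + 1)
  obtain ⟨h3, h4⟩ := ha
  constructor <;> linarith

lemma core {i : ℤ} {a : ℝ} (ha : near z i a) :
    min (min (a - z i / 40) (z (i + 1) / 40 - a)) (3 / 10) ≤ sg (lw i).1 * W.core a ∧
      sg (lw i).1 * W.core a ≤ a - z i / 40 ∧ sg (lw i).1 * W.core a ≤ z (i + 1) / 40 - a := by
  obtain ⟨h1, h2⟩ := h.near_bounds ha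
  have := (h.lobe i).core h1 h2
  rwa [h.cast_z, h.cast_z] at this

/-- The smooth wave near a zero. -/
lemma core_zero {i : ℤ} {a : ℝ} (ha : |a - z i / 40| ≤ 1 / 10) :
    W.core a = sg (lw i).1 * (a - z i / 40) := by
  obtain ⟨a1, a2⟩ := abs_le.1 ha
  have g := h.gap i
  have := h.core (i := i) (a := a) ⟨by linarith, by linarith⟩
  rw [min_eq_left (a := a - (z i : ℝ) / 40) (by linarith), min_eq_left (by linarith)] at this
  have e : sg (lw i).1 * W.core a = a - z i / 40 := le_antisymm this.2.1 this.1
  rw [← e, ← mul_assoc, sg_mul_self, one_mul]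

lemma point {i : ℤ} {a ρ : ℝ} (ha : near z i a) (hρ : 0 ≤ sg (lw i).1 * ρ) :
    W.point ρ a = pt (lw i).1 (lw i).2 (sg (lw i).1 * ρ) a := by
  obtain ⟨h1, h2⟩ := h.near_bounds ha
  exact (h.lobe i).point h1 h2 hρ

lemma exists_lobe (a : ℝ) : ∃ i, (z i : ℝ) / 40 ≤ a ∧ a ≤ z (i + 1) / 40 := by
  have hm : Monotone (lin fun i => (z i : ℝ) / 160) := lin_monotone fun i => by
    have := h.gap i
    linarith
  have hs : ∀ x, lin (fun i => (z i : ℝ) / 160) (x + (hw : ℝ)) = lin (fun i => (z i : ℝ) / 160) x + 1 := by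
    intro x
    have := lin_add_int (f := fun i => (z i : ℝ) / 160) (n := hw) (c := 1) (fun i => by
      rw [h.add]; grind) x
    exact_mod_cast this
  obtain ⟨x, hx⟩ := surjective_of_shift (by exact_mod_cast h.pos) hs hm (continuous_lin _) (a / 4)
  have f0 := Int.floor_le x
  have f1 := Int.lt_floor_add_one x
  have m0 := hm f0
  have m1 := hm f1.le
  have e : ((⌊x⌋ : ℝ) + 1) = ((⌊x⌋ + 1 : ℤ) : ℝ) := by grind
  rw [hx, lin_int] at m0
  rw [hx, e, lin_int] at m1
  grind

/-- A point of the annulus lies over a lobe whose sheet contains it. -/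
lemma exists_near {q : ℝ × ℝ} (hq : |q.2| < 1) :
    ∃ i, near z i (8 * q.1) ∧ 0 ≤ sg (lw i).1 * W.level q := by
  obtain ⟨i, h0, h1⟩ := h.exists_lobe (8 * q.1)
  obtain ⟨q0, q1⟩ := abs_lt.1 hq
  have hn : near z i (8 * q.1) := ⟨by linarith, by linarith⟩
  rcases le_or_gt 0 (sg (lw i).1 * W.level q) with hp | hp
  · grind
  · have hc := (h.core hn).1
    have hw := W.width_pos
    have hlt : sg (lw i).1 * W.core (8 * q.1) < 1 / 10 := by
      have e : sg (lw i).1 * W.level q =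
          W.width * (sg (lw i).1 * W.core (8 * q.1) - sg (lw i).1 * q.2 / 10) := by
        unfold Wave.level; ring
      rw [e] at hp
      have h3 : sg (lw i).1 * W.core (8 * q.1) - sg (lw i).1 * q.2 / 10 < 0 := by
        by_contra! h3
        exact absurd hp (not_lt.2 (mul_nonneg hw.le h3))
      have h4 : sg (lw i).1 * q.2 < 1 := by
        cases (lw i).1 <;> simp only [sg, Bool.false_eq_true, if_false, if_true] <;> linarith
      linarith
    have g := h.gap i
    rcases min_lt_iff.1 (lt_of_le_of_lt hc hlt) with h5 | h5
    · rcases min_lt_iff.1 h5 with h6 | h6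
      · refine ⟨i - 1, ⟨?_, ?_⟩, ?_⟩
        · have := h.gap (i - 1)
          grind
        · grind
        · have := h.sg_alt (i - 1)
          rw [sub_add_cancel] at this
          rw [this] at hp
          linarith
      · refine ⟨i + 1, ⟨by linarith, ?_⟩, ?_⟩
        · have := h.gap (i + 1)
          linarith
        · rw [h.sg_alt]; linarith
    grind

end Lobes

/-- Finitely many conditions for the lobes of a wave. -/
def LobesCheck (W : Wave) (hw : ℕ) (lw : List Label) (z : List ℤ) : Prop :=
  0 < hw ∧ ∀ i < hw, extend hw 160 z (i : ℕ) % 40 = 20 ∧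
    ∃ d < 4, extend hw 160 z (i + 1 : ℕ) / 40 = extend hw 160 z (i : ℕ) / 40 + (d + 1 : ℕ) ∧
    (∀ j < d + 1, W.side (extend hw 160 z (i : ℕ) / 40 + (j + 1 : ℕ)) = (extendLab hw lw i).1) ∧
    W.side (extend hw 160 z (i : ℕ) / 40) = !(extendLab hw lw i).1 ∧
    W.side (extend hw 160 z (i + 1 : ℕ) / 40 + 1) = !(extendLab hw lw i).1 ∧
    (∀ j < d + 2, W.label (extendLab hw lw i).1 (extend hw 160 z (i : ℕ) / 40 + (j : ℕ)) =
      (extendLab hw lw i).2)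

lemma LobesCheck.lobes {W : Wave} {hw : ℕ} {lw : List Label} {z : List ℤ}
    (h : LobesCheck W hw lw z) : Lobes W hw (extendLab hw lw) (extend hw 160 z) := by
  obtain ⟨hh, hc⟩ := h
  have hh' : (0 : ℤ) < hw := by grind
  have ha := extend_add hh 160 z
  have hl := extendLab_add hw lw
  have key : ∀ i : ℤ, ∃ j < hw, ∃ m : ℤ, i = (j : ℕ) + m * hw := by
    intro i
    have := Int.emod_add_mul_ediv i hw
    have r0 := Int.emod_nonneg i hh'.ne'
    have r1 := Int.emod_lt_of_pos i hh'
    exact ⟨(i % hw).toNat, by omega, i / hw, by grind⟩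
  have hb : ∀ i < hw, extend hw 160 z (i : ℕ) % 40 = 20 ∧
      W.IsLobe (extend hw 160 z (i : ℕ) / 40) (extend hw 160 z ((i : ℕ) + 1) / 40)
        (extendLab hw lw i) := by
    intro i hi
    obtain ⟨h1, d, -, h2, h3, h4, h5, h6⟩ := hc i hi
    push_cast at h2 h5
    refine ⟨h1, by omega, fun j j0 j1 => ?_, h4, h5, fun j j0 j1 => ?_⟩
    · have := h3 (j - extend hw 160 z (i : ℕ) / 40 - 1).toNat (by omega)
      rw [← this]; congr 1; omega
    · have := h6 (j - extend hw 160 z (i : ℕ) / 40).toNat (by omega)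
      rw [← this]; congr 1; omega
  refine ⟨hh, ha, fun i => ?_, fun i => ?_⟩
  · obtain ⟨j, hj, m, rfl⟩ := key i
    rw [shift_mul ha]
    grind
  · obtain ⟨j, hj, m, rfl⟩ := key i
    have := (hb j hj).2.add m
    rw [show (j : ℤ) + m * hw + 1 = (j + 1 : ℤ) + m * hw by ring, shift_mul ha, shift_mul ha,
      lab_mul hl]
    convert this using 1 <;> omega

/-! ### Arcs off the annulus of a wave -/

/-- The arc `i` of a chain is off the part of the annulus over the lobe `m`. -/
def ArcOff (P : ℕ) (lb : ℤ → Label) (a : ℤ → ℤ) (lw : ℤ → Label) (z : ℤ → ℤ)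
    (i m : ℤ) : Prop :=
  lb i ≠ lw m ∨ hi a i ≤ z m - 4 ∨ z (m + 1) + 4 ≤ lo a i ∨
  (z m + 4 ≤ lo a i ∧ hi a i ≤ z (m + 1) - 4 ∧ hi a i - lo a i ≤ 4 * P ∧
    (hi a i - lo a i) ^ 2 ≤ 128 * P) ∨
  (lo a i ≤ z m - 4 ∧ z (m + 1) + 4 ≤ hi a i ∧ 8 * P < hi a i - lo a i)

instance (P : ℕ) (lb : ℤ → Label) (a : ℤ → ℤ) (lw : ℤ → Label) (z : ℤ → ℤ)
    (i m : ℤ) : Decidable (ArcOff P lb a lw z i m) := by unfold ArcOff; infer_instance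

/-- The vertex `i` of a chain is off the part of the annulus near the zero `m`. -/
def VertexOff (lb : ℤ → Label) (a : ℤ → ℤ) (lw : ℤ → Label) (z : ℤ → ℤ)
    (i m : ℤ) : Prop :=
  4 ≤ |a i - z m| ∨ lowerOf (lb i) (a i / 40) ≠ lowerOf (lw m) (a i / 40)

instance (lb : ℤ → Label) (a : ℤ → ℤ) (lw : ℤ → Label) (z : ℤ → ℤ)
    (i m : ℤ) : Decidable (VertexOff lb a lw z i m) := by unfold VertexOff; infer_instance

/-- The arcs of a chain from the vertex `i₀` to the vertex `i₁` are off the annulus; the lobes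
`j₀, …, j₀ + J` suffice. -/
structure OffCheck (P : ℕ) (lb : ℤ → Label) (a : ℤ → ℤ) (lw : ℤ → Label) (z : ℤ → ℤ)
    (i₀ i₁ : ℕ) (j₀ : ℤ) (J : ℕ) : Prop where
  range : ∀ i < i₁ + 1, i₀ ≤ i → z j₀ + 4 < a (i : ℕ) ∧ a (i : ℕ) + 4 < z (j₀ + J)
  arc : ∀ i < i₁, i₀ ≤ i → ∀ j < J, ArcOff P lb a lw z (i : ℕ) (j₀ + (j : ℕ))
  vertex : ∀ i < i₁ + 1, i₀ ≤ i → ∀ j < J + 1, VertexOff lb a lw z (i : ℕ) (j₀ + (j : ℕ))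

instance (P : ℕ) (lb : ℤ → Label) (a : ℤ → ℤ) (lw : ℤ → Label) (z : ℤ → ℤ)
    (i₀ i₁ : ℕ) (j₀ : ℤ) (J : ℕ) : Decidable (OffCheck P lb a lw z i₀ i₁ j₀ J) :=
  decidable_of_iff ((∀ i < i₁ + 1, i₀ ≤ i → z j₀ + 4 < a (i : ℕ) ∧ a (i : ℕ) + 4 < z (j₀ + J)) ∧
    (∀ i < i₁, i₀ ≤ i → ∀ j < J, ArcOff P lb a lw z (i : ℕ) (j₀ + (j : ℕ))) ∧
    (∀ i < i₁ + 1, i₀ ≤ i → ∀ j < J + 1, VertexOff lb a lw z (i : ℕ) (j₀ + (j : ℕ))))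
    ⟨fun ⟨h1, h2, h3⟩ => ⟨h1, h2, h3⟩, fun ⟨h1, h2, h3⟩ => ⟨h1, h2, h3⟩⟩

section off
variable {W : Wave} {hw : ℕ} {lw : ℤ → Label} {z : ℤ → ℤ} {lb : ℤ → Label} {a : ℤ → ℤ}
  {P : ℕ}

lemma height_lo_hi (a : ℤ → ℤ) (i : ℤ) {u : ℝ} (hu : u ∈ Set.Icc (0 : ℝ) 1) {t : ℝ}
    (ht : t = (a i : ℝ) / 40 + u * ((a (i + 1) : ℝ) / 40 - a i / 40)) :
    (lo a i : ℝ) / 40 ≤ t ∧ t ≤ hi a i / 40 ∧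
    height 0 (fun i => (a i : ℝ) / 40) i u = curv * ((t - lo a i / 40) * (hi a i / 40 - t)) := by
  have e : ((lo a i : ℝ) = a i ∧ (hi a i : ℝ) = a (i + 1) ∧ (a i : ℝ) ≤ a (i + 1)) ∨
      ((lo a i : ℝ) = a (i + 1) ∧ (hi a i : ℝ) = a i ∧ (a (i + 1) : ℝ) ≤ a i) := by
    unfold lo hi
    rcases le_total (a i) (a (i + 1)) with h | h
    · left; rw [min_eq_left h, max_eq_right h]; exact ⟨rfl, rfl, by exact_mod_cast h⟩
    · right; rw [min_eq_right h, max_eq_left h]; exact ⟨rfl, rfl, by exact_mod_cast h⟩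
  obtain ⟨u0, u1⟩ := hu
  unfold height
  simp only [Pi.zero_apply]
  rcases e with ⟨e1, e2, e3⟩ | ⟨e1, e2, e3⟩ <;> rw [e1, e2, ht] <;>
    refine ⟨by nlinarith, by nlinarith, by ring⟩

/-- The level of an arc with the label of a lobe is never in the annulus. -/
lemma ArcOff.contra (h : Lobes W hw lw z) (hP : 0 < P) (hwP : W.width = P / 1000) {i m : ℤ}
    (ho : ArcOff P lb a lw z i m) (hl : lb i = lw m) {t r τ : ℝ} (hn : Lobes.near z m t)
    (h0 : (lo a i : ℝ) / 40 ≤ t) (h1 : t ≤ hi a i / 40)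
    (hr : r = curv * ((t - lo a i / 40) * (hi a i / 40 - t))) (hpos : 0 < r)
    (hτ : |τ| < 1) (he : r = sg (lw m).1 * (W.width * (W.core t - τ / 10))) : False := by
  have hP' : (0 : ℝ) < P := by exact_mod_cast hP
  obtain ⟨τ0, τ1⟩ := abs_lt.1 hτ
  obtain ⟨c1, c2, c3⟩ := h.core hn
  obtain ⟨n1, n2⟩ := hn
  set A := t - (lo a i : ℝ) / 40 with hA
  set B := (hi a i : ℝ) / 40 - t with hB
  have A0 : 0 ≤ A := by linarith
  have B0 : 0 ≤ B := by linarith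
  set S := sg (lw m).1 * W.core t with hS
  have hsτ : |sg (lw m).1 * τ| < 1 := by cases (lw m).1 <;> simp [sg, hτ]
  obtain ⟨σ0, σ1⟩ := abs_lt.1 hsτ
  have hX : P * S - 10 * (A * B) = P * (sg (lw m).1 * τ) / 10 := by
    rw [hwP, hr, curv] at he
    grind
  have u1 : P * (sg (lw m).1 * τ) < P * 1 := by gcongr
  have u2 : P * (-1) < P * (sg (lw m).1 * τ) := by gcongr
  rcases ho with ho | ho | ho | ho | ho
  · exact ho hl
  · have : (hi a i : ℝ) ≤ z m - 4 := by exact_mod_cast ho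
    have : B = 0 := by linarith
    grind
  · have : (z (m + 1) : ℝ) + 4 ≤ lo a i := by exact_mod_cast ho
    have : A = 0 := by linarith
    grind
  · obtain ⟨o1, o2, o3, o4⟩ := ho
    have o1 : (z m : ℝ) + 4 ≤ lo a i := by exact_mod_cast o1
    have o2 : (hi a i : ℝ) ≤ z (m + 1) - 4 := by exact_mod_cast o2
    have o3 : (hi a i : ℝ) - lo a i ≤ 4 * P := by exact_mod_cast o3
    have o4 : ((hi a i : ℝ) - lo a i) ^ 2 ≤ 128 * P := by exact_mod_cast o4
    have s1 : A + B ≤ P / 10 := by linarith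
    have s2 : (A + B) ^ 2 ≤ 2 * P / 25 := by grind
    have x1 : 10 * (A * B) ≤ P * A := by
      rw [show 10 * (A * B) = 10 * B * A by ring]
      exact mul_le_mul_of_nonneg_right (by linarith) A0
    have x2 : 10 * (A * B) ≤ P * B := by
      rw [show 10 * (A * B) = 10 * A * B by ring]
      exact mul_le_mul_of_nonneg_right (by linarith) B0
    have x3 : 10 * (A * B) ≤ P * (1 / 5) := by
      have : A * B = ((A + B) ^ 2 - (A - B) ^ 2) / 4 := by ring
      have := sq_nonneg (A - B)
      linarith
    have y : S < 1 / 10 + A ∧ S < 1 / 10 + B ∧ S < 1 / 10 + 1 / 5 := by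
      refine ⟨?_, ?_, ?_⟩ <;> refine lt_of_mul_lt_mul_left ?_ hP'.le <;> linarith
    grind
  · obtain ⟨o1, o2, o3⟩ := ho
    have o1 : (lo a i : ℝ) ≤ z m - 4 := by exact_mod_cast o1
    have o2 : (z (m + 1) : ℝ) + 4 ≤ hi a i := by exact_mod_cast o2
    have o3 : 8 * (P : ℝ) < hi a i - lo a i := by exact_mod_cast o3
    have s1 : P / 5 < A + B := by linarith
    rcases le_total A B with hAB | hAB
    · have : P * A ≤ 10 * (A * B) := by
        rw [show 10 * (A * B) = 10 * B * A by ring]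
        exact mul_le_mul_of_nonneg_right (by linarith) A0
      have : P * S > P * (A - 1 / 10) := by linarith
      have := lt_of_mul_lt_mul_left this hP'.le
      linarith
    · have : P * B ≤ 10 * (A * B) := by
        rw [show 10 * (A * B) = 10 * A * B by ring]
        exact mul_le_mul_of_nonneg_right (by linarith) B0
      have : P * S > P * (B - 1 / 10) := by linarith
      have := lt_of_mul_lt_mul_left this hP'.le
      linarith

lemma OffCheck.off (h : Lobes W hw lw z) (hP : 0 < P) (hwP : W.width = P / 1000) {i₀ i₁ : ℕ}
    {j₀ : ℤ} {J : ℕ} (ho : OffCheck P lb a lw z i₀ i₁ j₀ J) (ha : ∀ i, a (i + 1) ≠ a i)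
    {x : ℝ} (hx : x ∈ Set.Icc (i₀ : ℝ) i₁) {q : ℝ × ℝ} (hq : |q.2| < 1) :
    W.band q ≠ chain lb 0 (fun i => (a i : ℝ) / 40) x := by
  intro e
  -- move the point of the annulus to the same angle
  obtain ⟨q, hq, he, e⟩ : ∃ q' : ℝ × ℝ, |q'.2| < 1 ∧ 8 * q'.1 = lin (fun i => (a i : ℝ) / 40) x ∧
      W.band q' = chain lb 0 (fun i => (a i : ℝ) / 40) x := by
    have h1 := congrArg Prod.fst e
    rw [W.band_fst, chain_eq] at h1
    obtain ⟨-, m, h2⟩ := polar_eq_iff.1 h1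
    simp only at h2
    refine ⟨(q.1 + m, q.2), hq, by grind, ?_⟩
    rw [W.band_add_int]; exact e
  set t := lin (fun i => (a i : ℝ) / 40) x with ht
  set i := ⌊x⌋ with hi'
  set u := Int.fract x with hu
  have u0 : 0 ≤ u := Int.fract_nonneg x
  have u1 : u < 1 := Int.fract_lt_one x
  have htu : t = (a i : ℝ) / 40 + u * ((a (i + 1) : ℝ) / 40 - a i / 40) := rfl
  obtain ⟨t0, t1, hh⟩ := height_lo_hi a i ⟨u0, u1.le⟩ htu
  have i0 : (i₀ : ℤ) ≤ i := Int.le_floor.2 (by exact_mod_cast hx.1)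
  have i1 : i ≤ i₁ := by
    have : ⌊x⌋ ≤ ⌊((i₁ : ℤ) : ℝ)⌋ := Int.floor_mono (by exact_mod_cast hx.2)
    rwa [Int.floor_intCast] at this
  have iu : i < i₁ ∨ u = 0 := by
    rcases i1.lt_or_eq with k | k
    · exact Or.inl k
    · right
      have := Int.self_sub_floor x
      have h1 : (i : ℝ) ≤ x := Int.floor_le x
      have h2 : (i : ℝ) = i₁ := by rw [k]; simp
      grind
  have R := ho.range i.toNat (by omega) (by omega)
  rw [show ((i.toNat : ℕ) : ℤ) = i by omega] at R
  have R0 : (z j₀ : ℝ) + 4 < a i := by exact_mod_cast R.1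
  have R1 : (a i : ℝ) + 4 < z (j₀ + J) := by exact_mod_cast R.2
  have rt : (z j₀ : ℝ) + 4 < 40 * t ∧ 40 * t + 4 < z (j₀ + J) := by
    rcases iu with k | k
    · have R' := ho.range (i + 1).toNat (by omega) (by omega)
      rw [show (((i + 1).toNat : ℕ) : ℤ) = i + 1 by omega] at R'
      have R0' : (z j₀ : ℝ) + 4 < a (i + 1) := by exact_mod_cast R'.1
      have R1' : (a (i + 1) : ℝ) + 4 < z (j₀ + J) := by exact_mod_cast R'.2
      rw [htu]
      constructor <;> nlinarith
    · rw [htu, k]; constructor <;> linarith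
  have rangeOf : ∀ m, Lobes.near z m t → j₀ ≤ m ∧ m < j₀ + J := by
    intro m hm
    constructor
    · by_contra! k
      have := h.mono (show m + 1 ≤ j₀ by linarith)
      have : (z (m + 1) : ℝ) ≤ z j₀ := by exact_mod_cast this
      linarith [hm.2]
    · by_contra! k
      have := h.mono k
      have : (z (j₀ + J) : ℝ) ≤ z m := by exact_mod_cast this
      linarith [hm.1]
  obtain ⟨m, hn, hs⟩ := h.exists_near hq
  rw [he] at hn
  obtain ⟨m0, m1⟩ := rangeOf m hn
  have e' := e
  rw [W.band_eq, he, h.point hn hs, chain_eq, hh] at e'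
  have r0 : 0 ≤ curv * ((t - lo a i / 40) * (hi a i / 40 - t)) := by
    rw [← hh]; exact height_nonneg (fun _ => le_rfl) _ u0 u1.le
  obtain ⟨p1, -, p3, p4⟩ := pt_inj hs r0 e'
  rcases hs.eq_or_lt with hz | hz
  · -- a vertex
    have hr0 := p1.symm.trans hz.symm
    have hu0 : u = 0 := by
      rw [← hh] at hr0
      unfold height curv at hr0
      simp only [Pi.zero_apply] at hr0
      have hne : (a (i + 1) : ℝ) / 40 - a i / 40 ≠ 0 := by
        have : (a (i + 1) : ℝ) ≠ a i := by exact_mod_cast ha i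
        grind
      grind
    have hta : t = a i / 40 := by grind
    have hlev : W.level q = 0 := (mul_eq_zero.1 hz.symm).resolve_left (sg_ne _)
    have hcore : |W.core t| < 1 / 10 := by
      have := W.width_pos
      unfold Wave.level at hlev
      rw [he] at hlev
      have : W.core t = q.2 / 10 := by grind
      rw [this, abs_div, abs_of_pos (show (0 : ℝ) < 10 by norm_num)]
      linarith
    have near_zero : ∀ m', j₀ ≤ m' → m' ≤ j₀ + J → |t - z m' / 40| ≤ 1 / 10 →
        pt (lw m').1 (lw m').2 0 t = pt (lb i).1 (lb i).2 0 t → False := by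
      intro m' k0 k1 ha' hpt
      have hc := h.core_zero ha'
      have hlt : |t - z m' / 40| < 1 / 10 := by
        rw [hc, abs_mul] at hcore
        have : |sg (lw m').1| = 1 := by cases (lw m').1 <;> simp [sg]
        rwa [this, one_mul] at hcore
      have hV := ho.vertex i.toNat (by omega) (by omega) (m' - j₀).toNat (by omega)
      rw [show ((i.toNat : ℕ) : ℤ) = i by omega,
        show j₀ + (((m' - j₀).toNat : ℕ) : ℤ) = m' by omega] at hV
      have habs : |a i - z m'| < 4 := by
        have : |((a i - z m' : ℤ) : ℝ)| < 4 := by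
          rw [hta] at hlt
          push_cast
          rw [show (a i : ℝ) - z m' = 40 * (a i / 40 - z m' / 40) by ring, abs_mul,
            abs_of_pos (show (0 : ℝ) < 40 by norm_num)]
          linarith
        exact_mod_cast this
      rcases hV with hV | hV
      · omega
      · have hz20 := h.half m'
        obtain ⟨b1, b2⟩ := abs_lt.1 habs
        have d1 : 40 * (a i / 40) < a i := by omega
        have d2 : a i < 40 * (a i / 40) + 40 := by omega
        have d1' : 40 * ((a i / 40 : ℤ) : ℝ) < a i := by exact_mod_cast d1
        have d2' : (a i : ℝ) < 40 * ((a i / 40 : ℤ) : ℝ) + 40 := by exact_mod_cast d2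
        have := (pt_inj le_rfl le_rfl hpt).2.2.2 rfl (a i / 40) ⟨by grind,
          by grind⟩
        exact hV this.symm
    have hpt : pt (lw m).1 (lw m).2 0 t = pt (lb i).1 (lb i).2 0 t := by grind
    have hc := (h.core hn).1
    have g := h.gap m
    have hsc : sg (lw m).1 * W.core t < 1 / 10 := by
      obtain ⟨k0, k1⟩ := abs_lt.1 hcore
      cases (lw m).1 <;> simp only [sg, Bool.false_eq_true, if_false, if_true] <;> linarith
    obtain ⟨n1, n2⟩ := hn
    rcases min_lt_iff.1 (lt_of_le_of_lt hc hsc) with h5 | h5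
    · rcases min_lt_iff.1 h5 with h6 | h6
      · exact near_zero m m0 m1.le (abs_le.2 ⟨by linarith, by linarith⟩) hpt
      · refine near_zero (m + 1) (by linarith) m1 (abs_le.2 ⟨by linarith, by linarith⟩) ?_
        rw [← hpt]
        have g' := h.gap (m + 1)
        have e1 := h.point (i := m) (a := t) (ρ := 0) ⟨n1, n2⟩ (by simp)
        have e2 := h.point (i := m + 1) (a := t) (ρ := 0) ⟨by linarith, by linarith⟩ (by simp)
        grind
    grind
  · -- an inner point of an arc
    have hl : lb i = lw m := (Prod.ext (p3 hz).1 (p3 hz).2).symm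
    have hi1 : i < i₁ := by
      rcases iu with k | k
      · exact k
      · exfalso
        rw [p1, ← hh] at hz
        rw [k] at hz
        simp [height] at hz
    have hA := ho.arc i.toNat (by omega) (by omega) (m - j₀).toNat (by omega)
    rw [show ((i.toNat : ℕ) : ℤ) = i by omega,
      show j₀ + (((m - j₀).toNat : ℕ) : ℤ) = m by omega] at hA
    rw [p1] at hz
    refine hA.contra h hP hwP hl hn t0 t1 rfl hz hq ?_
    rw [← p1]
    unfold Wave.level
    rw [he]

end off

/-! ### Images of curves under diffeomorphisms -/

section map
variable {T : SurfDiffeo} (hT : Set.MapsTo T.toFun SurfInt SurfInt)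
include hT

lemma IsSimpleClosed.map {γ : Curve} (h : IsSimpleClosed γ) : IsSimpleClosed (T.toFun ∘ γ) where
  continuous := T.smooth.continuousOn.comp_continuous h.continuous
    fun t => Wave.surfInt_subset (h.mem t)
  periodic t := congrArg T.toFun (h.periodic t)
  injOn := T.left_inv.injOn.comp h.injOn fun t _ => Wave.surfInt_subset (h.mem t)
  mem t := hT (h.mem t)

lemma Isotopic.map {γ δ : Curve} (h : Isotopic γ δ) : Isotopic (T.toFun ∘ γ) (T.toFun ∘ δ) := by
  obtain ⟨H, h1, h2, h3, h4⟩ := h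
  refine ⟨fun s => T.toFun ∘ H s, ?_, fun s hs => (h2 s hs).map hT, by simp only [h3], ?_⟩
  · exact T.smooth.continuousOn.comp h1 fun q hq =>
      Wave.surfInt_subset ((h2 q.1 hq.1).mem q.2)
  grind

lemma Iso.map {γ δ : Curve} (h : Iso γ δ) : Iso (T.toFun ∘ γ) (T.toFun ∘ δ) := by
  induction h with
  | single h => exact (h.map hT).iso
  | tail _ h ih => exact ih.trans (h.map hT).iso

lemma Rep.map {P : ℝ} {c : ℝ → ℂ × ℂ} {γ : Curve} (h : Rep P c γ) :
    Rep P (fun x => T.toFun (c x)) (T.toFun ∘ γ) := by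
  obtain ⟨h0, h1, σ, h2, h3, h4, h5⟩ := h
  exact ⟨h0, h1.map hT, σ, h2, h3, h4, fun x => congrArg T.toFun (h5 x)⟩

end map

namespace Wave
variable {W : Wave} {c : ℤ} {χ : ℝ → ℝ}

lemma twist_mapsTo (hχ : IsShear χ c) : Set.MapsTo (W.twist hχ).toFun SurfInt SurfInt :=
  W.mapsTo_twistMap χ subset_rfl

end Wave

/-! ### The effect of a twist on a word -/

/-- A curve crosses the annulus of a wave along its first two arcs; the word of its image. -/
structure TwistCheck (P hb hc n : ℕ) (lb lc : ℤ → Label) (a c : ℤ → ℤ)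
    (lw : ℤ → Label) (z : ℤ → ℤ) (τ ℓ j₀ : ℤ) (J : ℕ) : Prop where
  size : hc + 2 = hb + n ∧ 0 < n ∧ 2 ≤ hb ∧ 4 ≤ P
  strict_b : ∀ i < hb, a (i + 1 : ℕ) ≠ a (i : ℕ)
  strict_c : ∀ i < hc, c (i + 1 : ℕ) ≠ c (i : ℕ)
  start : c 0 = a 0
  tail : ∀ i < hb - 1, c (n + i : ℕ) = a (i + 2 : ℕ) - 320 * τ
  tail_lab : ∀ i < hb - 2, lc (n + i : ℕ) = lb (i + 2 : ℕ)
  cross : a 0 = z ℓ + 4 * (τ * sgz (lw ℓ).1) ∧ a 1 = z ℓ ∧ a 2 = z ℓ - 4 * (τ * sgz (lw ℓ).1)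
  lab_zero : lb 0 = lw ℓ ∨ lb 0 = lw (ℓ - 1)
  lab_one : lb 1 = lw ℓ ∨ lb 1 = lw (ℓ - 1)
  nodes : ∀ j < n + 1, n * (sgz (lw (ℓ - τ * (j : ℕ))).1 * (c (j : ℕ) - z (ℓ - τ * (j : ℕ)))) =
    τ * (4 * n - 8 * (j : ℕ))
  lab : ∀ j < n, lc (j : ℕ) = lw (if τ = 1 then ℓ - 1 - (j : ℕ) else ℓ + (j : ℕ))
  off : OffCheck P lb a lw z 2 hb j₀ J
  alt : ∀ i < hc, (lc (i + 1 : ℕ)).1 ≠ (lc (i : ℕ)).1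

instance (P hb hc n : ℕ) (lb lc : ℤ → Label) (a c : ℤ → ℤ)
    (lw : ℤ → Label) (z : ℤ → ℤ) (τ ℓ j₀ : ℤ) (J : ℕ) :
    Decidable (TwistCheck P hb hc n lb lc a c lw z τ ℓ j₀ J) :=
  decidable_of_iff ((hc + 2 = hb + n ∧ 0 < n ∧ 2 ≤ hb ∧ 4 ≤ P) ∧
    (∀ i < hb, a (i + 1 : ℕ) ≠ a (i : ℕ)) ∧ (∀ i < hc, c (i + 1 : ℕ) ≠ c (i : ℕ)) ∧ c 0 = a 0 ∧
    (∀ i < hb - 1, c (n + i : ℕ) = a (i + 2 : ℕ) - 320 * τ) ∧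
    (∀ i < hb - 2, lc (n + i : ℕ) = lb (i + 2 : ℕ)) ∧
    (a 0 = z ℓ + 4 * (τ * sgz (lw ℓ).1) ∧ a 1 = z ℓ ∧ a 2 = z ℓ - 4 * (τ * sgz (lw ℓ).1)) ∧
    (lb 0 = lw ℓ ∨ lb 0 = lw (ℓ - 1)) ∧ (lb 1 = lw ℓ ∨ lb 1 = lw (ℓ - 1)) ∧
    (∀ j < n + 1, n * (sgz (lw (ℓ - τ * (j : ℕ))).1 * (c (j : ℕ) - z (ℓ - τ * (j : ℕ)))) =
      τ * (4 * n - 8 * (j : ℕ))) ∧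
    (∀ j < n, lc (j : ℕ) = lw (if τ = 1 then ℓ - 1 - (j : ℕ) else ℓ + (j : ℕ))) ∧
    OffCheck P lb a lw z 2 hb j₀ J ∧ (∀ i < hc, (lc (i + 1 : ℕ)).1 ≠ (lc (i : ℕ)).1))
    ⟨fun ⟨h1, h2, h3, h4, h5, h6, h7, h8, h9, h10, h11, h12, h13⟩ =>
      ⟨h1, h2, h3, h4, h5, h6, h7, h8, h9, h10, h11, h12, h13⟩,
    fun ⟨h1, h2, h3, h4, h5, h6, h7, h8, h9, h10, h11, h12, h13⟩ =>
      ⟨h1, h2, h3, h4, h5, h6, h7, h8, h9, h10, h11, h12, h13⟩⟩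

lemma forall_mod {p : ℤ → Prop} {h : ℕ} (hh : 0 < h) (hp : ∀ i, p (i + h) ↔ p i)
    (hq : ∀ i < h, p (i : ℕ)) (i : ℤ) : p i := by
  have hh' : (0 : ℤ) < h := by grind
  have key : ∀ (q i : ℤ), p (i + q * h) ↔ p i := by
    intro q i
    induction q with
    | zero => simp
    | succ q ih => grind
    | pred q ih => grind
  have e : i = ((i % h).toNat : ℕ) + i / h * h := by
    rw [Int.toNat_of_nonneg (Int.emod_nonneg i hh'.ne')]
    have := Int.emod_add_mul_ediv i h
    linarith
  rw [e, key]
  have := Int.emod_lt_of_pos i hh'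
  grind

/-- The profile of the arcs that cross the annulus. -/
noncomputable def crossing (s₀ s₁ : ℝ) (x : ℝ) : ℝ :=
  if x ≤ 1 then s₀ * (x * (1 - x)) else s₁ * ((x - 1) * (2 - x))

lemma continuous_crossing (s₀ s₁ : ℝ) : Continuous (crossing s₀ s₁) := by
  unfold crossing
  refine Continuous.if_le (by fun_prop) (by fun_prop) continuous_id continuous_const ?_
  grind

lemma crossing_lipschitz {s₀ s₁ : ℝ} (h₀ : |s₀| = 1) (h₁ : |s₁| = 1) {x x' : ℝ} (h0 : 0 ≤ x)
    (hlt : x < x') (h2 : x' ≤ 2) : |crossing s₀ s₁ x' - crossing s₀ s₁ x| ≤ x' - x := by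
  have hd : 0 ≤ x' - x := by linarith
  unfold crossing
  split_ifs with k k' k'
  · rw [show s₀ * (x' * (1 - x')) - s₀ * (x * (1 - x)) = s₀ * ((x' - x) * (1 - x - x')) by ring,
      abs_mul, abs_mul, h₀, one_mul, abs_of_nonneg hd]
    refine mul_le_of_le_one_right hd (abs_le.2 ⟨by linarith, by linarith⟩)
  · linarith
  · refine (abs_sub _ _).trans ?_
    have e0 : 0 ≤ x * (1 - x) := mul_nonneg h0 (by linarith)
    have e1 : 0 ≤ (x' - 1) * (2 - x') := mul_nonneg (by linarith) (by linarith)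
    rw [abs_mul s₁, abs_mul s₀, h₀, h₁, one_mul, one_mul, abs_of_nonneg e0, abs_of_nonneg e1]
    nlinarith
  · rw [show s₁ * ((x' - 1) * (2 - x')) - s₁ * ((x - 1) * (2 - x)) =
      s₁ * ((x' - x) * (3 - x - x')) by ring, abs_mul, abs_mul, h₁, one_mul, abs_of_nonneg hd]
    refine mul_le_of_le_one_right hd (abs_le.2 ⟨by linarith, by linarith⟩)

lemma abs_sg (b : Bool) : |sg b| = 1 := by cases b <;> simp [sg]

section lobes
variable {W : Wave} {hw : ℕ} {lw : ℤ → Label} {z : ℤ → ℤ}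

/-- An arc of the annulus along a lobe. -/
lemma Lobes.band_arc (h : Lobes W hw lw z) {m : ℤ} {x x' t t' f : ℝ} (hf : f ∈ Set.Icc (0 : ℝ) 1)
    (hx : x - z m / 40 = sg (lw m).1 * t / 10) (hx' : z (m + 1) / 40 - x' = sg (lw m).1 * t' / 10)
    (ht : |t| ≤ 1) (ht' : |t'| ≤ 1) : ∃ r, 0 ≤ r ∧
    W.band (((1 - f) * x + f * x') / 8, (1 - f) * t + f * t') =
      pt (lw m).1 (lw m).2 r ((1 - f) * x + f * x') := by
  have b1 : |x - z m / 40| ≤ 1 / 10 := by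
    rw [hx, abs_div, abs_mul, abs_sg, one_mul, abs_of_pos (show (0 : ℝ) < 10 by norm_num)]
    linarith
  have b2 : |x' - z (m + 1) / 40| ≤ 1 / 10 := by
    rw [abs_sub_comm, hx', abs_div, abs_mul, abs_sg, one_mul,
      abs_of_pos (show (0 : ℝ) < 10 by norm_num)]
    linarith
  obtain ⟨⟨r0, r1⟩, hab⟩ := (h.lobe m).above hf (x := x) (x' := x') (by rwa [h.cast_z])
    (by rwa [h.cast_z])
  rw [h.cast_z, h.cast_z, hx, hx'] at hab
  set a := (1 - f) * x + f * x'
  have hs : 0 ≤ sg (lw m).1 * W.level (a / 8, (1 - f) * t + f * t') := by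
    unfold Wave.level
    simp only
    rw [mul_div_cancel₀ a (by norm_num : (8 : ℝ) ≠ 0),
      show sg (lw m).1 * (W.width * (W.core a - ((1 - f) * t + f * t') / 10)) =
      W.width * (sg (lw m).1 * W.core a - ((1 - f) * (sg (lw m).1 * t / 10) +
        f * (sg (lw m).1 * t' / 10))) by ring]
    exact mul_nonneg W.width_pos.le (by linarith)
  refine ⟨_, hs, ?_⟩
  rw [W.band_eq]
  simp only
  rw [mul_div_cancel₀ a (by norm_num : (8 : ℝ) ≠ 0)]
  exact (h.lobe m).point r0 r1 hs

variable {P hb hc n : ℕ} {lb lc : ℤ → Label} {a c : ℤ → ℤ} {τ ℓ j₀ : ℤ} {J : ℕ}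

lemma TwistCheck.node (hT : TwistCheck P hb hc n lb lc a c lw z τ ℓ j₀ J) {j : ℤ} (h0 : 0 ≤ j)
    (h1 : j ≤ n) : (c j : ℝ) / 40 - z (ℓ - τ * j) / 40 =
      sg (lw (ℓ - τ * j)).1 * (τ * (1 - 2 * j / n)) / 10 := by
  obtain ⟨k, rfl⟩ := Int.eq_ofNat_of_zero_le h0
  have hn : (0 : ℝ) < n := by exact_mod_cast hT.size.2.1
  have h := hT.nodes k (by omega)
  have h' : (n : ℝ) * (sgz (lw (ℓ - τ * k)).1 * (c k - z (ℓ - τ * k))) = τ * (4 * n - 8 * k) := by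
    exact_mod_cast h
  rw [← sg_eq_sgz] at h'
  have hs := sg_mul_self (lw (ℓ - τ * k)).1
  have e : (sg (lw (ℓ - τ * k)).1 * (c k - z (ℓ - τ * k)) : ℝ) = τ * (4 - 8 * k / n) := by
    field_simp
    linarith
  have e2 : ((c k : ℝ) - z (ℓ - τ * k)) = sg (lw (ℓ - τ * k)).1 * (τ * (4 - 8 * k / n)) := by grind
  push_cast
  grind

theorem TwistCheck.plan (h : Lobes W hw lw z) (hwP : W.width = P / 1000)
    (hτ : τ = 1 ∨ τ = -1)
    (ha : ∀ i, a (i + hb) = a i + 160 * τ) (hc' : ∀ i, c (i + hc) = c i + -160 * τ)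
    (hlb : ∀ i, lb (i + hb) = lb i) (hlc : ∀ i, lc (i + hc) = lc i)
    (hA : IsChain lb 0 (fun i => (a i : ℝ) / 40) (2 * hb) τ)
    (hC : IsChain lc 0 (fun i => (c i : ℝ) / 40) (2 * hc) (-τ))
    (hT : TwistCheck P hb hc n lb lc a c lw z τ ℓ j₀ J) :
    TwistPlan W hb hc n lb lc (fun i => (a i : ℝ) / 40) (fun i => (c i : ℝ) / 40) τ
      (fun x => τ * (1 - x) - crossing (sg (lb 0).1) (sg (lb 1).1) x / P) := by
  obtain ⟨hs1, hn, hb2, hP4⟩ := hT.size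
  have hn' : (0 : ℝ) < n := by exact_mod_cast hn
  have hP4' : (4 : ℝ) ≤ P := by exact_mod_cast hP4
  have hτ2 : (τ : ℝ) * τ = 1 := by rcases hτ with rfl | rfl <;> norm_num
  have hτabs : |(τ : ℝ)| = 1 := by rcases hτ with rfl | rfl <;> norm_num
  have hsb : ∀ i, a (i + 1) ≠ a i := by
    refine forall_mod (by omega : 0 < hb) (fun i => ?_) fun i hi => by
      exact_mod_cast hT.strict_b i hi
    rw [show i + (hb : ℤ) + 1 = i + 1 + hb by ring, ha, ha]
    constructor <;> intro k <;> omega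
  have hsc : ∀ i, c (i + 1) ≠ c i := by
    refine forall_mod (by omega : 0 < hc) (fun i => ?_) fun i hi => by
      exact_mod_cast hT.strict_c i hi
    rw [show i + (hc : ℤ) + 1 = i + 1 + hc by ring, hc', hc']
    constructor <;> intro k <;> omega
  have halt : ∀ i, (lc (i + 1)).1 ≠ (lc i).1 := by
    refine forall_mod (by omega : 0 < hc) (fun i => ?_) fun i hi => by exact_mod_cast hT.alt i hi
    rw [show i + (hc : ℤ) + 1 = i + 1 + hc by ring, hlc, hlc]
  have tmem : ∀ j : ℤ, 0 ≤ j → j ≤ n → |(τ : ℝ) * (1 - 2 * j / n)| ≤ 1 := by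
    intro j h0 h1
    have h0' : (0 : ℝ) ≤ j := by exact_mod_cast h0
    have h1' : (j : ℝ) ≤ n := by exact_mod_cast h1
    have : 2 * (j : ℝ) / n ≤ 2 := by rw [div_le_iff₀ hn']; linarith
    have : 0 ≤ 2 * (j : ℝ) / n := by positivity
    rw [abs_mul, hτabs, one_mul, abs_le]
    constructor <;> linarith
  obtain ⟨cr0, cr1, cr2⟩ := hT.cross
  set s := sg (lw ℓ).1 with hs
  have hss : s * s = 1 := sg_mul_self _
  have r0 : (a 0 : ℝ) = z ℓ + 4 * (τ * s) := by rw [hs, sg_eq_sgz]; exact_mod_cast cr0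
  have r1 : (a 1 : ℝ) = z ℓ := by exact_mod_cast cr1
  have r2 : (a 2 : ℝ) = z ℓ - 4 * (τ * s) := by rw [hs, sg_eq_sgz]; exact_mod_cast cr2
  refine
    { chain_b := hA
      chain_c := hC
      unit := hτ
      half_b := fun i => by simp only [ha]; push_cast; ring
      half_c := fun i => by simp only [hc']; grind
      half_lb := hlb
      half_lc := hlc
      strict_b := fun i k => hsb i (by
        have : (a (i + 1) : ℝ) = a i := by linarith
        exact_mod_cast this)
      strict_c := fun i k => hsc i (by
        have : (c (i + 1) : ℝ) = c i := by linarith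
        exact_mod_cast this)
      size := hs1
      n_pos := hn
      hb_ge := hb2
      start := by simp only [hT.start]
      tail := ?_
      tail_lab := ?_
      cont_t := by
        have := continuous_crossing (sg (lb 0).1) (sg (lb 1).1)
        fun_prop
      anti := ?_
      t_zero := by simp [crossing]
      t_two := by simp [crossing]; ring
      band_b := ?_
      out := fun x hx q hq => hT.off.off h (by omega) hwP hsb (by grind) hq
      band_c := ?_
      axis_c := ?_
      alt := halt }
  · intro i h0 h1
    have := hT.tail (i - n).toNat (by omega)
    rw [show ((n + (i - n).toNat : ℕ) : ℤ) = i by omega,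
      show (((i - n).toNat + 2 : ℕ) : ℤ) = i - n + 2 by omega] at this
    rw [this]
    grind
  · intro i h0 h1
    have := hT.tail_lab (i - n).toNat (by omega)
    grind
  · intro x hx x' hx' hlt
    have hl := abs_le.1 (crossing_lipschitz (abs_sg (lb 0).1) (abs_sg (lb 1).1) hx.1 hlt hx'.2)
    set w := crossing (sg (lb 0).1) (sg (lb 1).1)
    simp only
    have hd : 0 < x' - x := by linarith
    have h1 : |(τ : ℝ) * (w x' - w x) / P| ≤ (x' - x) / 4 := by
      rw [abs_div, abs_mul, hτabs, one_mul, abs_of_pos (show (0 : ℝ) < P by linarith)]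
      exact div_le_div₀ hd.le (abs_le.2 hl) (by norm_num) hP4'
    have h2 := (abs_le.1 h1).1
    have e : ∀ x, (τ : ℝ) * (τ * (1 - x) - w x / P) = (1 - x) - τ * w x / P := fun x => by grind
    rw [e, e]
    have : (τ : ℝ) * (w x' - w x) / P = τ * w x' / P - τ * w x / P := by ring
    linarith
  · intro x hx
    have hlin : lin (fun i => (a i : ℝ) / 40) x = z ℓ / 40 + τ * s * (1 - x) / 10 := by
      rcases le_total x 1 with k | k
      · rw [lin_on _ 0 (by grind) (by simpa using k)]
        grind
      · rw [lin_on _ 1 (by grind) (by grind)]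
        grind
    set t := lin (fun i => (a i : ℝ) / 40) x with ht
    have hnear : |t - z ℓ / 40| ≤ 1 / 10 := by
      rw [hlin, show (z ℓ : ℝ) / 40 + τ * s * (1 - x) / 10 - z ℓ / 40 = τ * s * (1 - x) / 10 by ring,
        abs_div, abs_mul, abs_mul, hτabs, hs, abs_sg, one_mul, one_mul,
        abs_of_pos (show (0 : ℝ) < 10 by norm_num)]
      grind
    have hcore : W.core t = τ * (1 - x) / 10 := by
      rw [h.core_zero hnear, hlin, ← hs]
      grind
    obtain ⟨n1, n2⟩ := abs_le.1 hnear
    have hpoint : ∀ (l : Label) (r : ℝ), 0 ≤ r → (l = lw ℓ ∨ l = lw (ℓ - 1)) →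
        W.point (sg l.1 * r) t = pt l.1 l.2 r t := by
      intro l r hr hl
      have e : sg l.1 * (sg l.1 * r) = r := by rw [← mul_assoc, sg_mul_self, one_mul]
      have g := h.gap ℓ
      have g' := h.gap (ℓ - 1)
      rw [sub_add_cancel] at g'
      rcases hl with rfl | rfl
      · have := h.point (i := ℓ) (a := t) (ρ := sg (lw ℓ).1 * r) ⟨by linarith, by linarith⟩
          (by grind)
        grind
      · have := h.point (i := ℓ - 1) (a := t) (ρ := sg (lw (ℓ - 1)).1 * r)
          ⟨by linarith, by grind⟩ (by grind)
        grind
    have hP0 : (P : ℝ) ≠ 0 := by linarith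
    have hsq : ((τ : ℝ) * s / 10) ^ 2 = 1 / 100 := by grind
    rw [W.band_eq]
    unfold Wave.level
    simp only
    rw [mul_div_cancel₀ t (by norm_num : (8 : ℝ) ≠ 0), hcore, hwP,
      show (P : ℝ) / 1000 * (τ * (1 - x) / 10 -
        (τ * (1 - x) - crossing (sg (lb 0).1) (sg (lb 1).1) x / P) / 10) =
        crossing (sg (lb 0).1) (sg (lb 1).1) x / 10000 by grind]
    rcases le_total x 1 with k | k
    · rw [chain_on hA.glue 0 (by exact_mod_cast hx.1) (by simpa using k)]
      have e1 : height 0 (fun i => (a i : ℝ) / 40) 0 (x - (0 : ℤ)) = x * (1 - x) / 10000 := by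
        unfold height curv
        simp only [Pi.zero_apply, zero_add, r0, r1]
        rw [show (z ℓ : ℝ) / 40 - (z ℓ + 4 * (τ * s)) / 40 = -(τ * s / 10) by ring, neg_sq, hsq]
        push_cast; ring
      have e2 : (a 0 : ℝ) / 40 + (x - (0 : ℤ)) * ((a (0 + 1) : ℝ) / 40 - a 0 / 40) = t := by
        rw [hlin]
        simp only [zero_add, r0, r1]
        push_cast; ring
      rw [e1, e2, crossing, if_pos k, mul_div_assoc (sg (lb 0).1), hpoint _ _ _ hT.lab_zero]
      exact div_nonneg (mul_nonneg hx.1 (by linarith)) (by norm_num)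
    · rw [chain_on hA.glue 1 (by grind) (by grind)]
      have e1 : height 0 (fun i => (a i : ℝ) / 40) 1 (x - (1 : ℤ)) =
          (x - 1) * (2 - x) / 10000 := by
        unfold height curv
        simp only [Pi.zero_apply, zero_add, show (1 : ℤ) + 1 = 2 by norm_num, r2, r1]
        rw [show ((z ℓ : ℝ) - 4 * (τ * s)) / 40 - z ℓ / 40 = -(τ * s / 10) by ring, neg_sq, hsq]
        push_cast; ring
      have e2 : (a 1 : ℝ) / 40 + (x - (1 : ℤ)) * ((a (1 + 1) : ℝ) / 40 - a 1 / 40) = t := by grind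
      have e3 : crossing (sg (lb 0).1) (sg (lb 1).1) x = sg (lb 1).1 * ((x - 1) * (2 - x)) := by
        unfold crossing
        split_ifs with k'
        · have : x = 1 := le_antisymm k' k
          rw [this]; ring
        · rfl
      rw [e1, e2, e3, mul_div_assoc (sg (lb 1).1), hpoint _ _ _ hT.lab_one]
      exact div_nonneg (mul_nonneg (by linarith) (by linarith [hx.2])) (by norm_num)
  · intro j h0 h1 y hy
    have hl := hT.lab j.toNat (by omega)
    rw [show ((j.toNat : ℕ) : ℤ) = j by omega] at hl
    have e0 := hT.node h0 h1.le
    have e1 := hT.node (j := j + 1) (by omega) (by omega)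
    have t0 := tmem j h0 h1.le
    have t1 := tmem (j + 1) (by omega) (by omega)
    rw [lin_on _ j hy.1 hy.2.le]
    have hf : y - j ∈ Set.Icc (0 : ℝ) 1 := ⟨by linarith [hy.1], by linarith [hy.2]⟩
    have hf' : 1 - (y - j) ∈ Set.Icc (0 : ℝ) 1 := ⟨by linarith [hf.2], by linarith [hf.1]⟩
    rcases hτ with ht | ht
    · rw [if_pos ht] at hl
      rw [ht, one_mul] at e0
      rw [ht, one_mul, show ℓ - (j + 1) = ℓ - 1 - j by ring] at e1
      have ea := h.sg_alt (ℓ - 1 - j)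
      rw [show ℓ - 1 - j + 1 = ℓ - j by ring] at ea
      rw [ea] at e0
      obtain ⟨r, hr, e⟩ := h.band_arc (m := ℓ - 1 - j) (f := 1 - (y - j)) hf'
        (x := (c (j + 1) : ℝ) / 40) (x' := (c j : ℝ) / 40)
        (t := (1 : ℤ) * (1 - 2 * (j + 1 : ℤ) / n)) (t' := (1 : ℤ) * (1 - 2 * j / n)) e1 (by
          rw [show ℓ - 1 - j + 1 = ℓ - j by ring]
          linarith) (by rwa [ht] at t1) (by rwa [ht] at t0)
      refine ⟨r, hr, ?_⟩
      rw [hl]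
      convert e using 2
      · rw [ht]; ext <;> simp only <;> push_cast <;> field_simp <;> ring
      · ring
    · rw [if_neg (by grind)] at hl
      rw [ht, show ℓ - -1 * j = ℓ + j by ring] at e0
      rw [ht, show ℓ - -1 * (j + 1) = ℓ + j + 1 by ring, h.sg_alt] at e1
      obtain ⟨r, hr, e⟩ := h.band_arc (m := ℓ + j) (f := y - j) hf
        (x := (c j : ℝ) / 40) (x' := (c (j + 1) : ℝ) / 40)
        (t := (-1 : ℤ) * (1 - 2 * j / n)) (t' := (-1 : ℤ) * (1 - 2 * (j + 1 : ℤ) / n)) e0 (by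
          linarith) (by rwa [ht] at t0) (by rwa [ht] at t1)
      refine ⟨r, hr, ?_⟩
      rw [hl]
      convert e using 2
      · rw [ht]; ext <;> simp only <;> push_cast <;> field_simp <;> ring
      · ring
  · intro j h0 h1
    have e0 := hT.node h0 h1
    have t0 := tmem j h0 h1
    have hnear : |(c j : ℝ) / 40 - z (ℓ - τ * j) / 40| ≤ 1 / 10 := by
      rw [e0, abs_div, abs_mul, abs_sg, one_mul, abs_of_pos (show (0 : ℝ) < 10 by norm_num)]
      linarith
    have := h.core_zero hnear
    unfold Wave.level
    simp only
    rw [mul_div_cancel₀ _ (by norm_num : (8 : ℝ) ≠ 0), this, e0]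
    linear_combination (W.width * (τ * (1 - 2 * j / n)) / 10) * sg_mul_self (lw (ℓ - τ * j)).1

end lobes

/-! ### Curves with a given word -/

section draws
variable {β β' : Curve} {h h' : ℕ} {D D' : ℤ} {lab lab' : List Label} {p p' : List ℤ}

lemma Draws.iso (hβ : Draws β h D lab p) (hβ' : Draws β' h D lab p) : Iso β β' := by
  obtain ⟨γ, h1, h2⟩ := hβ
  obtain ⟨γ', h1', h2'⟩ := hβ'
  exact h2.trans ((h1.isotopic h1').iso.trans h2'.symm)

lemma Draws.trans (hβ : Draws β h D lab p)
    (hl : LineIso (2 * h : ℤ) (2 * h' : ℤ) (word h D lab p) (word h' D' lab' p')) :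
    Draws β h' D' lab' p' := by
  obtain ⟨γ, h1, h2⟩ := hβ
  obtain ⟨δ, δ', k1, k2, k3⟩ := hl
  exact ⟨δ', k2, h2.trans ((h1.isotopic k1).iso.trans k3)⟩

lemma Draws.collapse {φ : List ℤ} (hβ : Draws β h D lab p) (hD : D = 160 ∨ D = -160)
    (hc : Collapse h h' D lab lab' p p' φ) : Draws β h' D lab' p' := by
  obtain ⟨γ, h1, h2⟩ := hβ
  exact ⟨γ, word_collapse hD hc h1, h2⟩

lemma Draws.expand {φ : List ℤ} (hβ : Draws β h' D lab' p') (hD : D = 160 ∨ D = -160)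
    (hm : LineIso (2 * h : ℤ) (2 * h : ℤ) (word h D lab p) (word h D lab p))
    (hc : Collapse h h' D lab lab' p p' φ) : Draws β h D lab p := by
  obtain ⟨γ, -, h1, -⟩ := hm
  obtain ⟨γ', h2, h3⟩ := hβ
  exact ⟨γ, h1, h3.trans (h2.isotopic (word_collapse hD hc h1)).iso⟩

end draws

lemma Motion.isChain_self {h K : ℕ} {D m M : ℤ} {lab : ℤ → Label} {a : ℤ → ℤ}
    (hm : Motion h K D m M lab a a) (hD : D = 160 ∨ D = -160) (h0 : ∀ i, a (i + h) = a i + D)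
    (hl : ∀ i, lab (i + h) = lab i) :
    IsChain lab 0 (fun i => (a i : ℝ) / 40) (2 * h) (D / 160) := by
  have := hm.isChain hD h0 h0 hl (s := 0) ⟨le_rfl, zero_le_one⟩
  rwa [interp_zero] at this

lemma IsAnnulus.isSimpleClosed {γ : Curve} {φ : ℝ × ℝ → ℂ × ℂ} (h : IsAnnulus γ φ) :
    IsSimpleClosed γ := by
  have e : γ = fun s => φ (s, 0) := funext fun s => (h.core s).symm
  have h0 : (0 : ℝ) ∈ Set.Icc (-1 : ℝ) 1 := ⟨by norm_num, by norm_num⟩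
  subst e
  refine ⟨h.smooth.continuousOn.comp_continuous (by fun_prop) fun s => ⟨trivial, h0⟩,
    fun s => h.periodic s 0, fun s hs s' hs' hss => ?_, fun s => h.mapsTo ⟨trivial, h0⟩⟩
  have := h.injOn (x₁ := (s, 0)) (x₂ := (s', 0)) ⟨hs, h0⟩ ⟨hs', h0⟩ hss
  grind

section twist
variable {W : Wave} {hw : ℕ} {lw : ℤ → Label} {z : ℤ → ℤ} {P : ℕ} {β : Curve} {hb hc : ℕ}
  {D : ℤ} {lb lc : List Label} {p q : List ℤ}

/-- The image of a curve that crosses the annulus once in each half-period. -/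
theorem Draws.twist (hβ : Draws β hb D lb p) (h : Lobes W hw lw z) (hwP : W.width = P / 1000)
    {n : ℕ} {D' τ ℓ j₀ : ℤ} {J Kb Kc : ℕ} {mb Mb mc Mc : ℤ}
    (hD : D = 160 * τ ∧ D' = -160 * τ ∧ (τ = 1 ∨ τ = -1))
    (hB : Motion hb Kb D mb Mb (extendLab hb lb) (extend hb D p) (extend hb D p))
    (hC : Motion hc Kc D' mc Mc (extendLab hc lc) (extend hc D' q) (extend hc D' q))
    (hT : TwistCheck P hb hc n (extendLab hb lb) (extendLab hc lc) (extend hb D p)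
      (extend hc D' q) lw z τ ℓ j₀ J) :
    Draws ((W.twist profile_isShear).toFun ∘ β) hc D' lc q := by
  obtain ⟨e1, e2, hτ⟩ := hD
  have hD1 : D = 160 ∨ D = -160 := by grind
  have hD2 : D' = 160 ∨ D' = -160 := by grind
  have cA := hB.isChain_self hD1 (extend_add hB.pos _ _) (extendLab_add _ _)
  have cC := hC.isChain_self hD2 (extend_add hC.pos _ _) (extendLab_add _ _)
  rw [show D / 160 = τ by omega] at cA
  rw [show D' / 160 = -τ by omega] at cC
  have plan := hT.plan h hwP hτ (fun i => by rw [extend_add hB.pos, e1])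
    (fun i => by rw [extend_add hC.pos, e2]) (extendLab_add _ _) (extendLab_add _ _) cA cC
  have hm := Wave.twist_mapsTo (W := W) profile_isShear
  obtain ⟨γ, r, i⟩ := hβ
  obtain ⟨δ, δ', k1, k2, k3⟩ := plan.lineIso r (r.2.1.map hm)
  exact ⟨δ', k2, (i.map hm).trans (((r.map hm).isotopic k1).iso.trans k3)⟩

/-- A curve that misses the annulus is fixed. -/
theorem Draws.twist_off (hβ : Draws β hb D lb p) (h : Lobes W hw lw z)
    (hwP : W.width = P / 1000) (hP : 0 < P) (hD : D = 160 ∨ D = -160) {j₀ : ℤ} {J : ℕ}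
    (hs : 0 < hb ∧ ∀ i < hb, extend hb D p (i + 1 : ℕ) ≠ extend hb D p (i : ℕ))
    (ho : OffCheck P (extendLab hb lb) (extend hb D p) lw z 0 hb j₀ J)
    {χ : ℝ → ℝ} {c : ℤ} (hχ : IsShear χ c) :
    Draws ((W.twist hχ).toFun ∘ β) hb D lb p := by
  obtain ⟨γ, r, i⟩ := hβ
  have hm := Wave.twist_mapsTo (W := W) hχ
  have e : (fun x => (W.twist hχ).toFun (word hb D lb p x)) = word hb D lb p := by
    funext x
    refine W.twistMap_outer hχ ?_
    rintro ⟨q, ⟨-, hq⟩, e⟩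
    have hb' : (0 : ℝ) < hb := by exact_mod_cast hs.1
    obtain ⟨w, hw⟩ : ∃ w : ℤ, D = 160 * w ∧ (w = 1 ∨ w = -1) := by grind
    have ht := chain_turn (extendLab_add hb lb) (a := fun i => (extend hb D p i : ℝ) / 40) (w := w)
      (fun i => by rw [extend_add hs.1, hw.1]; grind) hw.2 (x - ⌊x / hb⌋ * hb) ⌊x / hb⌋
    push_cast at ht
    rw [sub_add_cancel] at ht
    have hx := unroll_mem hb' x
    refine ho.off (q := (q.1 + (-⌊x / hb⌋ : ℤ) / 2, q.2)) h hP hwP ?_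
      (by exact_mod_cast Set.Ico_subset_Icc_self hx) ?_ ?_
    · refine forall_mod hs.1 (fun i => ?_) fun i hi => by grind
      rw [show i + (hb : ℤ) + 1 = i + 1 + hb by ring, extend_add hs.1, extend_add hs.1]
      constructor <;> intro k <;> omega
    · grind
    · rw [W.band_turn, e]
      unfold word
      rw [ht, turn_turn, neg_add_cancel, turn_zero]
      push_cast
      rfl
  have r' := r.map hm
  rw [e] at r'
  exact ⟨_, r', i.map hm⟩

/-- The core of the annulus has the word of the lobes. -/
theorem Lobes.draws {z : List ℤ} {lw : List Label}
    (h : Lobes W hw (extendLab hw lw) (extend hw 160 z)) :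
    Draws (fun s => W.band (s, 0)) hw 160 lw z := by
  set Z := extend hw 160 z with hZ
  set α := lin fun i => (Z i : ℝ) / 40 with hα
  have hpos : (0 : ℝ) < hw := by exact_mod_cast h.pos
  have gap : ∀ i, (Z i : ℝ) / 40 < Z (i + 1) / 40 := fun i => by linarith [h.gap i]
  have hmono : StrictMono α := lin_strictMono gap
  have hαi : ∀ i : ℤ, α i = Z i / 40 := fun i => lin_int _ i
  have hper : ∀ x, α (x + (2 * hw : ℤ)) = α x + 8 := fun x => by
    have := lin_add_mul (a := fun i => (Z i : ℝ) / 40) (N := hw) (c := 4)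
      (fun i => by rw [hZ, extend_add h.pos]; grind) x 2
    grind
  have hcore := W.isAnnulus.isSimpleClosed
  have hrep := (show Rep 1 _ _ by simpa using hcore.rep one_pos).comp (P' := (2 * hw : ℤ)) (ψ := fun x => α x / 8)
    (by push_cast; linarith) (by have := continuous_lin fun i => (Z i : ℝ) / 40; fun_prop)
    (fun x y hxy => by have := hmono.monotone hxy; grind) fun x => by grind
  set r : ℝ → ℝ := fun x => W.width * |W.core (α x)| with hr
  have hnear : ∀ (x : ℝ) (i : ℤ), (i : ℝ) ≤ x → x ≤ i + 1 →
      W.point (W.width * W.core (α x)) (α x) = pt (extendLab hw lw i).1 (extendLab hw lw i).2 (r x) (α x) ∧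
      near Z i (α x) := by
    intro x i h0 h1
    have a0 := hmono.monotone h0
    have a1 := hmono.monotone h1
    rw [hαi] at a0
    rw [show (i : ℝ) + 1 = ((i + 1 : ℤ) : ℝ) by grind, hαi] at a1
    have hn : near Z i (α x) := ⟨by linarith, by linarith⟩
    have hc := h.core hn
    have hc0 : 0 ≤ sg (extendLab hw lw i).1 * W.core (α x) :=
      le_trans (le_min (le_min (by linarith) (by linarith)) (by norm_num)) hc.1
    have e : r x = sg (extendLab hw lw i).1 * (W.width * W.core (α x)) := by
      have := abs_of_nonneg hc0
      rw [abs_mul, abs_sg, one_mul] at this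
      grind
    rw [e]
    exact ⟨h.point hn (by rw [← e]; exact mul_nonneg W.width_pos.le (abs_nonneg _)), hn⟩
  have hzero : ∀ i : ℤ, r i = 0 := fun i => by
    have := h.core_zero (i := i) (a := α i) (by grind)
    grind
  have e1 : (fun x => W.band (α x / 8, 0)) = graphMap (extendLab hw lw) r α := by
    funext x
    rw [graphMap, ← (hnear x ⌊x⌋ (Int.floor_le x) (Int.lt_floor_add_one x).le).1, Wave.band]
    grind
  have hg : IsGraph (extendLab hw lw) r α (2 * hw) 1 :=
    { pos := by have := h.pos; omega
      unit := rfl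
      period := fun x => by grind
      period_r := fun x => by
        have := W.core_add_mul (α x) 2
        grind
      period_lab := fun i => by
        rw [show i + 2 * (hw : ℤ) = i + hw + hw by ring, extendLab_add, extendLab_add]
      cont := continuous_lin _
      cont_r := continuous_const.mul (W.contDiff_core.continuous.comp (continuous_lin _)).abs
      injOn := fun i => hmono.injective.injOn
      zero := hzero
      nonneg := fun x => mul_nonneg W.width_pos.le (abs_nonneg _)
      lt_one := fun x => by
        have h1 := W.core_abs (α x)
        have h2 := W.width_le
        have h3 := W.width_pos
        have : r x ≤ 1 * (1 / 2) := mul_le_mul h2 h1 (abs_nonneg _) (by norm_num)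
        linarith
      short := fun i => by
        have h1 : α (i + 1) ≤ α (i + (2 * hw : ℤ)) := hmono.monotone (by
          have := h.pos
          have : (1 : ℝ) ≤ hw := by exact_mod_cast this
          push_cast; linarith)
        grind
      glue := fun i => by grind
      alt := fun i => by rw [h.alt]; grind
      inj := fun x x' hlt _ e => by
        have : x < x' := by
          by_contra! hle
          exact absurd (Int.floor_mono hle) (by omega)
        exact (hmono this).ne e }
  have e2 := hg.lineIso
  rw [← e1] at e2
  simp only [hαi] at e2
  obtain ⟨δ, δ', k1, k2, k3⟩ := e2
  refine ⟨δ', ?_, (hrep.isotopic ?_).iso.trans k3⟩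
  · exact k2
  grind

end twist

/-! ### Hurwitz equivalence -/

lemma hyp_hyp (p : ℂ × ℂ) : hyp (hyp p) = p := by simp [hyp]

lemma hyp_comp_hyp (γ : Curve) : hyp ∘ hyp ∘ γ = γ := funext fun _ => hyp_hyp _

lemma hyp_surf {p : ℂ × ℂ} (h : p ∈ Surf) : hyp p ∈ Surf :=
  ⟨by simpa [hyp] using h.1, h.2.1, h.2.2⟩

/-- The hyperelliptic involution as an orientation-preserving diffeomorphism. -/
noncomputable def hypDiffeo : SurfDiffeo where
  toFun := hyp
  invFun := hyp
  mapsTo _ h := hyp_surf h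
  mapsTo_inv _ h := hyp_surf h
  left_inv p _ := hyp_hyp p
  right_inv p _ := hyp_hyp p
  smooth := (contDiff_fst.prodMk contDiff_snd.neg).contDiffOn
  smooth_inv := (contDiff_fst.prodMk contDiff_snd.neg).contDiffOn
  orientation p _ := by
    refine ⟨(ContinuousLinearMap.fst ℝ ℂ ℂ).prod (-ContinuousLinearMap.snd ℝ ℂ ℂ),
      ((ContinuousLinearMap.fst ℝ ℂ ℂ).prod
        (-ContinuousLinearMap.snd ℝ ℂ ℂ)).hasFDerivAt.hasFDerivWithinAt, fun v _ hv => ?_⟩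
    have := areaForm_I_pos hv
    simpa [areaForm] using this
  marked _ h := ⟨hyp_surf h.1, h.2⟩

lemma Iso.hyp {γ δ : Curve} (h : Iso γ δ) : Iso (hyp ∘ γ) (hyp ∘ δ) :=
  h.map (T := hypDiffeo) fun _ k => ⟨by simpa [hypDiffeo, SmithPencil.hyp] using k.1, k.2⟩

lemma IsSimpleClosed.hyp {γ : Curve} (h : IsSimpleClosed γ) : IsSimpleClosed (hyp ∘ γ) :=
  h.iso_refl.hyp.simple_left

namespace HurwitzEquivalent

lemma iso_at {a b : Curve} {l r : List Curve} (hl : ∀ x ∈ l, IsSimpleClosed x)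
    (hr : ∀ x ∈ r, IsSimpleClosed x) (h : Iso a b) :
    HurwitzEquivalent (l ++ a :: r) (l ++ b :: r) := by
  have refl : ∀ l : List Curve, (∀ x ∈ l, IsSimpleClosed x) → List.Forall₂ Isotopic l l :=
    fun l hl => List.forall₂_same.2 fun x hx => (hl x hx).isotopic_refl
  have step : ∀ {a b}, Isotopic a b → HurwitzMove (l ++ a :: r) (l ++ b :: r) := fun h =>
    .isotopy _ _ (List.rel_append (refl l hl) (.cons h (refl r hr)))
  induction h with
  | single h => exact .single (step h)
  | tail _ h ih => exact ih.tail (step h)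

/-- An elementary transformation up to isotopy. -/
lemma elem {W : Wave} {a b c : Curve} {l r : List Curve} (hl : ∀ x ∈ l, IsSimpleClosed x)
    (hr : ∀ x ∈ r, IsSimpleClosed x) (hb : IsSimpleClosed b)
    (ha : Iso a fun s => W.band (s, 0)) (hc : Iso ((W.twist profile_isShear).toFun ∘ b) c) :
    HurwitzEquivalent (l ++ a :: b :: r) (l ++ c :: a :: r) := by
  refine (iso_at hl (List.forall_mem_cons.2 ⟨hb, hr⟩) ha).trans
    (.head (.elementary l r _ b _ W.twist_isDehnTwist)
      ((iso_at hl (List.forall_mem_cons.2 ⟨ha.simple_right, hr⟩) hc).trans ?_))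
  have := iso_at (l := l ++ [c]) (fun x hx => ?_) hr ha.symm
  · simp only [List.append_assoc, List.cons_append, List.nil_append] at this
    exact this
  · rcases List.mem_append.1 hx with hx | hx
    · exact hl x hx
    · rw [List.mem_singleton.1 hx]; exact hc.simple_right

/-- The first curve of a word can be moved to the end. -/
lemma rotate {W : Wave} {a : Curve} {l : List Curve} (hl : ∀ x ∈ l, IsSimpleClosed x)
    (ha : Iso a fun s => W.band (s, 0)) : HurwitzEquivalent (a :: l) (l ++ [a]) := by
  have hm := W.twist_mapsTo profile_isShear
  have hm' := W.twist_mapsTo profile_isShear.neg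
  obtain ⟨T, hT⟩ : ∃ T, T = W.twist profile_isShear := ⟨_, rfl⟩
  obtain ⟨T', hT'⟩ : ∃ T', T' = W.twist profile_isShear.neg := ⟨_, rfl⟩
  have eT : T.toFun = W.twistMap profile := by rw [hT]; rfl
  have eT' : T'.toFun = W.twistMap fun t => -profile t := by rw [hT']; rfl
  rw [← hT] at hm
  rw [← hT'] at hm'
  have pass : ∀ p : List Curve, (∀ x ∈ p, IsSimpleClosed x) →
      HurwitzEquivalent (p ++ a :: l) (p ++ l.map (fun x => T.toFun ∘ x) ++ [a]) := by
    induction l with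
    | nil => intro p _; rw [List.map_nil, List.append_nil]; exact .refl
    | cons b l ih =>
      obtain ⟨hb, hl⟩ := List.forall_mem_cons.1 hl
      intro p hp
      refine (elem hp hl hb ha (c := T.toFun ∘ b) (hT ▸ (hb.map hm).iso_refl)).trans ?_
      have := ih hl (p ++ [T.toFun ∘ b]) (by
        intro x hx
        rcases List.mem_append.1 hx with hx | hx
        · exact hp x hx
        · rw [List.mem_singleton.1 hx]; exact hb.map hm)
      simp only [List.append_assoc, List.cons_append, List.nil_append] at this
      simpa only [List.map_cons, List.append_assoc, List.cons_append, List.nil_append] using! this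
  have h1 := (pass [] (by simp)).tail (.conj _ T')
  have e : (([] ++ l.map (fun x => T.toFun ∘ x) ++ [a]).map fun x => T'.toFun ∘ x) =
      l ++ [T'.toFun ∘ a] := by
    simp only [List.nil_append, List.map_append, List.map_map, List.map_cons, List.map_nil]
    congr 1
    conv_rhs => rw [← List.map_id l]
    refine List.map_congr_left fun x hx => funext fun t => ?_
    simp only [Function.comp, eT, eT']
    exact W.twistMap_comp (χ := profile) (fun t => rfl) _
  rw [e] at h1
  have hcore := ha.simple_right
  have h2 : Iso (T'.toFun ∘ a) a := by
    refine (ha.map hm').trans (Iso.trans ?_ ha.symm)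
    have e2 : (T'.toFun ∘ fun s => W.band (s, 0)) = fun s => W.band (s + -profile 0, 0) :=
      funext fun s => by
        rw [Function.comp, eT', W.twistMap_band _ (q := (s, 0)) ⟨trivial, by norm_num, by norm_num⟩]
    have r1 := (hcore.map hm').rep one_pos
    rw [e2] at r1 ⊢
    simp only [div_one] at r1
    have r2 := (hcore.rep one_pos).comp (P' := 1) one_pos (ψ := fun s => s + -profile 0)
      (by fun_prop) (fun x y h => by simpa using h) (fun x => by ring)
    simp only [div_one] at r2
    exact (r1.isotopic r2).iso
  exact h1.trans (iso_at hl (by simp) h2)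

end HurwitzEquivalent

/-! ### The calculus of words -/

/-- The labels of arcs: the side of the unit circle, and the sheet. -/
abbrev pp : Label := (true, true)
abbrev pm : Label := (true, false)
abbrev mp : Label := (false, true)
abbrev mm : Label := (false, false)

section steps
variable {β : Curve} {h : ℕ} {D : ℤ} {lab : List Label} {p : List ℤ}

lemma Draws.move (hβ : Draws β h D lab p) (K : ℕ) (m M : ℤ) (p' : List ℤ)
    (hD : D = 160 ∨ D = -160 := by decide)
    (hm : Motion h K D m M (extendLab h lab) (extend h D p) (extend h D p') := by
      decide +kernel) : Draws β h D lab p' :=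
  hβ.trans (word_motion hD hm)

lemma Draws.insert (hβ : Draws β h D lab p) (h' : ℕ) (lab' : List Label) (p' φ : List ℤ)
    (hD : D = 160 ∨ D = -160 := by decide)
    (hc : Collapse h h' D lab lab' p p' φ := by decide +kernel) : Draws β h' D lab' p' :=
  hβ.collapse hD hc

lemma Draws.relabel (hβ : Draws β h D lab p) (lab' : List Label)
    (hD : D = 160 ∨ D = -160 := by decide)
    (hc : Collapse h h D lab lab' p p ((List.range h).map Int.ofNat) := by decide +kernel) :
    Draws β h D lab' p :=
  hβ.collapse hD hc

lemma Draws.delete (hβ : Draws β h D lab p) (h' K : ℕ) (m M : ℤ) (lab' : List Label)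
    (p' φ : List ℤ) (hD : D = 160 ∨ D = -160 := by decide)
    (hm : Motion h' K D m M (extendLab h' lab') (extend h' D p') (extend h' D p') := by
      decide +kernel)
    (hc : Collapse h' h D lab' lab p' p φ := by decide +kernel) : Draws β h' D lab' p' :=
  hβ.expand hD (word_motion hD hm) hc

lemma Draws.finger (hβ : Draws β h D lab p) (t K : ℕ) (m M : ℤ) (p' : List ℤ)
    (hD : D = 160 ∨ D = -160 := by decide)
    (h0 : Motion h K D m M (extendLab h lab) (extend h D p) (extend h D p) := by decide +kernel)
    (h1 : Motion h K D m M (extendLab h lab) (extend h D p') (extend h D p') := by decide +kernel)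
    (hF : Finger h K t m M (extendLab h lab) (extend h D p) (extend h D p') := by
      decide +kernel) : Draws β h D lab p' :=
  hβ.trans (word_finger hD h0 h1 hF)

lemma Draws.cross (hβ : Draws β h D lab p) {W : Wave} {P hw : ℕ} {lw : List Label}
    {z : List ℤ} (hW : Lobes W hw (extendLab hw lw) (extend hw 160 z) ∧ W.width = P / 1000)
    {n : ℕ} {τ ℓ j₀ : ℤ} {J : ℕ} (Kb : ℕ) (mb Mb : ℤ) (Kc : ℕ) (mc Mc : ℤ) (h' : ℕ) (D' : ℤ)
    (lab' : List Label) (p' : List ℤ)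
    (hD : D = 160 * τ ∧ D' = -160 * τ ∧ (τ = 1 ∨ τ = -1) := by decide)
    (hB : Motion h Kb D mb Mb (extendLab h lab) (extend h D p) (extend h D p) := by decide +kernel)
    (hC : Motion h' Kc D' mc Mc (extendLab h' lab') (extend h' D' p') (extend h' D' p') := by
      decide +kernel)
    (hT : TwistCheck P h h' n (extendLab h lab) (extendLab h' lab') (extend h D p)
      (extend h' D' p') (extendLab hw lw) (extend hw 160 z) τ ℓ j₀ J := by decide +kernel) :
    Draws ((W.twist profile_isShear).toFun ∘ β) h' D' lab' p' :=
  hβ.twist hW.1 hW.2 hD hB hC hT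

end steps

/-! ### The waves along which we twist -/

/-- The wave of the lift `V`. -/
noncomputable def waveV : Wave :=
  .ofLists [false, false, true, true] [true, false, false, false] 1000 (by decide) (by decide)

lemma lobesV : Lobes waveV 2 (extendLab 2 [pm, mp]) (extend 2 160 [60, 140]) ∧
    waveV.width = (1000 : ℕ) / 1000 :=
  ⟨LobesCheck.lobes (by unfold LobesCheck; decide +kernel), rfl⟩

/-- The wave of the lift `S`. -/
noncomputable def waveS : Wave :=
  .ofLists [false, true, false, true] [true, true, false, false] 4 (by decide) (by decide)

lemma lobesS : Lobes waveS 4 (extendLab 4 [pp, mm, pm, mp]) (extend 4 160 [20, 60, 100, 140]) ∧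
    waveS.width = (4 : ℕ) / 1000 :=
  ⟨LobesCheck.lobes (by unfold LobesCheck; decide +kernel), rfl⟩

/-- The wave of the lift `R`. -/
noncomputable def waveR : Wave :=
  .ofLists [false, true, true, false] [true, true, true, false] 1000 (by decide) (by decide)

lemma lobesR : Lobes waveR 2 (extendLab 2 [pp, mp]) (extend 2 160 [20, 100]) ∧
    waveR.width = (1000 : ℕ) / 1000 :=
  ⟨LobesCheck.lobes (by unfold LobesCheck; decide +kernel), rfl⟩

/-- The wave of the lift `T`. -/
noncomputable def waveT : Wave :=
  .ofLists [true, true, false, false] [true, true, false, true] 1000 (by decide) (by decide)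

lemma lobesT : Lobes waveT 2 (extendLab 2 [mm, pp]) (extend 2 160 [60, 140]) ∧
    waveT.width = (1000 : ℕ) / 1000 :=
  ⟨LobesCheck.lobes (by unfold LobesCheck; decide +kernel), rfl⟩

/-! ### The images of the curves -/

section images
variable {β : Curve}

theorem Draws.twistV_S (hβ : Draws β 4 160 [pp, mm, pm, mp] [20, 60, 100, 140]) :
    Draws ((waveV.twist profile_isShear).toFun ∘ β)
      4 (-160) [mp, pm, mm, pm] [220, 140, 30, 90] :=
  hβ
    |>.insert 8 [pm, mp, pm, mp, pp, mm, pm, mp]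
      [140, 140, 140, 140, 180, 220, 260, 300] [3, 3, 3, 3, 4, 5, 6, 7]
    |>.move 2 136 300 [136, 140, 144, 148, 180, 220, 260, 292]
    |>.cross lobesV (n := 4) (τ := 1) (ℓ := 1) (j₀ := 0) (J := 4)
      2 136 296 2 (-176) 136 10 (-160) [pm, mp, pm, mp, pm, mp, pp, mm, pm, mp]
      [136, 62, -20, -102, -176, -172, -140, -100, -60, -28]
    |>.move 2 (-176) 136 [120, 62, -20, -102, -160, -160, -140, -100, -60, -40]
    |>.relabel [pm, mp, pm, mp, pp, mp, pp, mm, pm, mm]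
    |>.move 2 (-160) 120 [100, 62, -20, -102, -140, -140, -140, -100, -60, -60]
    |>.move 2 (-140) 100 [100, 62, -20, -120, -120, -120, -120, -120, -60, -60]
    |>.relabel [pm, mp, pm, mm, pm, mm, pm, mm, pm, mm]
    |>.move 2 (-130) 100 [90, 60, -20, -130, -130, -130, -130, -130, -70, -70]
    |>.delete 4 2 30 220 [mp, pm, mm, pm] [220, 140, 30, 90]
      [3, 4, 5, 6, 6, 6, 6, 6, 7, 7]

theorem Draws.twistS_Q (hβ : Draws β 2 160 [mm, pm] [20, 100]) :
    Draws ((waveS.twist profile_isShear).toFun ∘ β)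
      6 (-160) [pp, mp, pm, mm, pp, mm] [57, 22, -21, -60, -99, -176] :=
  hβ
    |>.insert 6 [mm, pm, mm, pm, mm, pm]
      [100, 100, 100, 100, 180, 260] [1, 1, 1, 1, 2, 3]
    |>.move 2 88 272 [104, 100, 96, 88, 180, 272]
    |>.cross lobesS (n := 8) (τ := 1) (ℓ := 2) (j₀ := 1) (J := 6)
      2 88 272 3 (-232) 104 12 (-160) [mm, pp, mp, pm, mm, pp, mp, pm, mm, pm, mm, pm]
      [104, 57, 22, -21, -60, -99, -142, -177, -224, -232, -140, -48]
    |>.insert 12 [mm, pm, mm, pp, mp, pm, mm, pp, mp, pm, mm, pm]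
      [20, 112, 104, 57, 22, -21, -60, -99, -142, -177, -224, -232] [-2, -1, 0, 1, 2, 3, 4, 5, 6, 7, 8, 9]
    |>.move 3 (-232) 112 [20, 104, 104, 57, 22, -21, -60, -99, -142, -177, -224, -232]
    |>.relabel [mm, mm, mm, pp, mp, pm, mm, pp, mp, pm, mm, pm]
    |>.finger 0 3 (-232) 104 [20, 57, 57, 57, 22, -21, -60, -99, -142, -177, -224, -232]
    |>.delete 10 2 (-232) 57 [mm, pp, mp, pm, mm, pp, mp, pm, mm, pm] [20, 57, 22, -21, -60, -99, -142, -177, -224, -232]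
      [0, 1, 1, 1, 2, 3, 4, 5, 6, 7, 8, 9]
    |>.move 2 (-232) 57 [20, 57, 22, -21, -60, -99, -142, -177, -224, -224]
    |>.relabel [mm, pp, mp, pm, mm, pp, mp, pm, pm, pm]
    |>.finger 7 2 (-224) 57 [20, 57, 22, -21, -60, -99, -142, -177, -177, -177]
    |>.delete 8 2 (-177) 57 [mm, pp, mp, pm, mm, pp, mp, pm] [20, 57, 22, -21, -60, -99, -142, -177]
      [0, 1, 2, 3, 4, 5, 6, 7, 7, 7]
    |>.move 2 (-177) 57 [0, 57, 22, -21, -60, -99, -160, -160]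
    |>.relabel [mm, pp, mp, pm, mm, pp, mm, pp]
    |>.move 2 (-176) 57 [-16, 57, 22, -21, -60, -99, -176, -176]
    |>.delete 6 2 (-176) 57 [pp, mp, pm, mm, pp, mm] [57, 22, -21, -60, -99, -176]
      [-1, 0, 1, 2, 3, 4, 5, 5]

theorem Draws.twistV (hβ : Draws β 6 (-160) [pp, mp, pm, mm, pp, mm] [57, 22, -21, -60, -99, -176]) :
    Draws ((waveV.twist profile_isShear).toFun ∘ β)
      6 160 [pm, mm, pp, mp, pm, mp] [60, 90, 60, 20, -10, 140] :=
  hβ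
    |>.insert 10 [mp, pm, mp, pm, mm, pp, mm, pp, mp, pm]
      [-21, -21, -21, -21, -60, -99, -176, -103, -138, -181] [2, 2, 2, 2, 3, 4, 5, 6, 7, 8]
    |>.move 2 (-181) (-16) [-16, -20, -24, -28, -60, -99, -176, -103, -138, -172]
    |>.cross lobesV (n := 4) (τ := -1) (ℓ := -1) (j₀ := -4) (J := 4)
      2 (-176) (-16) 2 (-16) 296 12 160 [mp, pm, mp, pm, mp, pm, mm, pp, mm, pp, mp, pm]
      [-16, 58, 140, 222, 296, 292, 260, 221, 144, 217, 182, 148]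
    |>.insert 12 [pp, mp, pm, mp, pm, mp, pm, mp, pm, mm, pp, mm]
      [57, 22, -12, -16, 58, 140, 222, 296, 292, 260, 221, 144] [-3, -2, -1, 0, 1, 2, 3, 4, 5, 6, 7, 8]
    |>.move 2 (-16) 296 [57, 22, 0, 0, 58, 140, 222, 280, 280, 260, 221, 144]
    |>.relabel [pp, mp, pp, mp, pm, mp, pm, mm, pm, mm, pp, mm]
    |>.move 2 0 280 [57, 22, 22, 22, 58, 140, 222, 260, 260, 260, 221, 144]
    |>.move 2 22 260 [40, 40, 40, 40, 40, 140, 222, 260, 260, 260, 221, 144]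
    |>.relabel [pm, mm, pm, mm, pm, mp, pm, mm, pm, mm, pp, mm]
    |>.move 2 0 260 [0, 0, 0, 0, 0, 140, 222, 260, 260, 260, 221, 160]
    |>.relabel [pm, mp, pm, mp, pm, mp, pm, mm, pm, mm, pp, mp]
    |>.move 2 (-10) 260 [-10, -10, -10, -10, -10, 140, 220, 250, 250, 250, 220, 180]
    |>.delete 6 2 (-10) 220 [pm, mm, pp, mp, pm, mp] [60, 90, 60, 20, -10, 140]
      [4, 4, 4, 4, 4, 5, 6, 7, 7, 7, 8, 9]

end images

/-! ### The lifts and their words -/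

theorem exists_liftV : ∃ γ : Curve, IsLift (wave (-1 / 2) (-1 / 2) (1 / 2) (1 / 2), 1) γ ∧
    Draws γ 2 160 [pm, mp] [60, 140] :=
  exists_lift (n := 9) (K := 2) (m := 20) (M := 340) (b := true)
    (lab := [mp, mp, mp, pm, pm, pm, pm, mp, mp, mp, mp, pm, pm, pm, pm, mp, mp, mp])
    (R := [20, 20, 20, 0, 20, 20, 20, 0, 20, 20, 20, 0, 20, 20, 20, 0, 20, 20])
    (A := [20, 30, 40, 60, 80, 100, 120, 140, 160, 180, 200, 220, 240, 260, 280, 300, 320, 330])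
    (ν := [3, 7, 11, 15])
    (V := [(-20, 20), (-20, 40), (20, 80), (20, 120), (-20, 160), (-20, 200), (20, 240), (20,
      280), (-20, 320), (-20, 340)])
    (by decide +kernel) (by decide) (by norm_num [wave, sg])

theorem exists_liftT : ∃ γ : Curve, IsLift (wave (1 / 2) (1 / 2) (-1 / 2) (-1 / 2), 1) γ ∧
    Draws γ 2 160 [mm, pp] [60, 140] :=
  exists_lift (n := 9) (K := 2) (m := 20) (M := 340) (b := true)
    (lab := [pp, pp, pp, mm, mm, mm, mm, pp, pp, pp, pp, mm, mm, mm, mm, pp, pp, pp])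
    (R := [20, 20, 20, 0, 20, 20, 20, 0, 20, 20, 20, 0, 20, 20, 20, 0, 20, 20])
    (A := [20, 30, 40, 60, 80, 100, 120, 140, 160, 180, 200, 220, 240, 260, 280, 300, 320, 330])
    (ν := [3, 7, 11, 15])
    (V := [(20, 20), (20, 40), (-20, 80), (-20, 120), (20, 160), (20, 200), (-20, 240), (-20,
      280), (20, 320), (20, 340)])
    (by decide +kernel) (by decide) (by norm_num [wave, sg])

theorem exists_liftS : ∃ γ : Curve, IsLift (wave (-1 / 2) (1 / 2) (-1 / 2) (1 / 2), 1) γ ∧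
    Draws γ 4 160 [pp, mm, pm, mp] [20, 60, 100, 140] :=
  exists_lift (n := 9) (K := 2) (m := 20) (M := 340) (b := true)
    (lab := [pp, pp, pp, mm, mm, pm, pm, mp, mp, pp, pp, mm, mm, pm, pm, mp, mp, mp])
    (R := [0, 10, 20, 0, 20, 0, 20, 0, 20, 0, 20, 0, 20, 0, 20, 0, 20, 10])
    (A := [20, 30, 40, 60, 80, 100, 120, 140, 160, 180, 200, 220, 240, 260, 280, 300, 320, 330])
    (ν := [0, 3, 5, 7, 9, 11, 13, 15])
    (V := [(0, 20), (20, 40), (-20, 80), (20, 120), (-20, 160), (20, 200), (-20, 240), (20, 280),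
      (-20, 320), (0, 340)])
    (by decide +kernel) (by decide) (by norm_num [wave, sg])

theorem exists_liftR : ∃ γ : Curve, IsLift (wave (-1 / 2) (1 / 2) (1 / 2) (-1 / 2), 1) γ ∧
    Draws γ 2 160 [pp, mp] [20, 100] :=
  exists_lift (n := 9) (K := 2) (m := 20) (M := 340) (b := true)
    (lab := [pp, pp, pp, pp, pp, mp, mp, mp, mp, pp, pp, pp, pp, mp, mp, mp, mp, mp])
    (R := [0, 10, 20, 20, 20, 0, 20, 20, 20, 0, 20, 20, 20, 0, 20, 20, 20, 10])
    (A := [20, 30, 40, 60, 80, 100, 120, 140, 160, 180, 200, 220, 240, 260, 280, 300, 320, 330])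
    (ν := [0, 5, 9, 13])
    (V := [(0, 20), (20, 40), (20, 80), (-20, 120), (-20, 160), (20, 200), (20, 240), (-20, 280),
      (-20, 320), (0, 340)])
    (by decide +kernel) (by decide) (by norm_num [wave, sg])

theorem exists_liftQ : ∃ γ : Curve, IsLift (wave (1 / 2) (-1 / 2) (-1 / 2) (1 / 2), -1) γ ∧
    Draws γ 2 160 [mm, pm] [20, 100] :=
  exists_lift (n := 9) (K := 2) (m := 20) (M := 340) (b := false)
    (lab := [mm, mm, mm, mm, mm, pm, pm, pm, pm, mm, mm, mm, mm, pm, pm, pm, pm, pm])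
    (R := [0, 10, 20, 20, 20, 0, 20, 20, 20, 0, 20, 20, 20, 0, 20, 20, 20, 10])
    (A := [20, 30, 40, 60, 80, 100, 120, 140, 160, 180, 200, 220, 240, 260, 280, 300, 320, 330])
    (ν := [0, 5, 9, 13])
    (V := [(0, 20), (-20, 40), (-20, 80), (20, 120), (20, 160), (-20, 200), (-20, 240), (20, 280),
      (20, 320), (0, 340)])
    (by decide +kernel) (by decide) (by norm_num [wave, sg])

theorem exists_liftP : ∃ γ : Curve, IsLift (wave (1 / 2) (-1 / 2) (1 / 2) (-1 / 2), -1) γ ∧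
    Draws γ 4 160 [mm, pp, mp, pm] [20, 60, 100, 140] :=
  exists_lift (n := 9) (K := 2) (m := 20) (M := 340) (b := false)
    (lab := [mm, mm, mm, pp, pp, mp, mp, pm, pm, mm, mm, pp, pp, mp, mp, pm, pm, pm])
    (R := [0, 10, 20, 0, 20, 0, 20, 0, 20, 0, 20, 0, 20, 0, 20, 0, 20, 10])
    (A := [20, 30, 40, 60, 80, 100, 120, 140, 160, 180, 200, 220, 240, 260, 280, 300, 320, 330])
    (ν := [0, 3, 5, 7, 9, 11, 13, 15])
    (V := [(0, 20), (-20, 40), (20, 80), (-20, 120), (20, 160), (-20, 200), (20, 240), (-20, 280),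
      (20, 320), (0, 340)])
    (by decide +kernel) (by decide) (by norm_num [wave, sg])

theorem exists_liftPathOne : ∃ γ : Curve, IsLift (pathOne, 1) γ ∧
    Draws γ 6 160 [pm, mm, pp, mp, pm, mp] [60, 90, 60, 20, -10, 140] :=
  exists_lift (n := 32) (K := 2) (m := -10) (M := 380) (b := true)
    (lab := [pm, pm, pm, pm, mm, mm, mm, mm, pp, pp, pp, pp, mp, mp, mp, mp, pm, pm, pm, pm, pm,
      pm, pm, pm, pm, pm, pm, mp, mp, mp, mp, mp, pm, pm, pm, pm, mm, mm, mm, mm, pp, pp, pp, pp,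
      mp, mp, mp, mp, pm, pm, pm, pm, pm, pm, pm, pm, pm, pm, pm, mp, mp, mp, mp, mp])
    (R := [0, 5, 10, 5, 0, 5, 10, 5, 0, 5, 10, 5, 0, 5, 10, 5, 0, 5, 10, 5, 0, 5, 10, 15, 20, 20,
      20, 0, 20, 20, 20, 10, 0, 5, 10, 5, 0, 5, 10, 5, 0, 5, 10, 5, 0, 5, 10, 5, 0, 5, 10, 5, 0, 5,
      10, 15, 20, 20, 20, 0, 20, 20, 20, 10])
    (A := [60, 70, 80, 85, 90, 85, 80, 70, 60, 50, 40, 30, 20, 10, 0, -5, -10, -5, 0, 10, 20, 30,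
      40, 60, 80, 100, 120, 140, 160, 180, 200, 210, 220, 230, 240, 245, 250, 245, 240, 230, 220,
      210, 200, 190, 180, 170, 160, 155, 150, 155, 160, 170, 180, 190, 200, 220, 240, 260, 280, 300,
      320, 340, 360, 370])
    (ν := [0, 4, 8, 12, 16, 27, 32, 36, 40, 44, 48, 59])
    (V := [(0, 60), (10, 80), (0, 90), (-10, 80), (0, 60), (10, 40), (0, 20), (-10, 0), (0, -10),
      (10, 0), (0, 20), (10, 40), (20, 80), (20, 120), (-20, 160), (-20, 200), (0, 220), (10, 240),
      (0, 250), (-10, 240), (0, 220), (10, 200), (0, 180), (-10, 160), (0, 150), (10, 160), (0,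
      180), (10, 200), (20, 240), (20, 280), (-20, 320), (-20, 360), (0, 380)])
    (by decide +kernel) (by decide) (by norm_num [pathOne, sg])

theorem exists_liftPathTwo : ∃ γ : Curve, IsLift (pathTwo, 1) γ ∧
    Draws γ 4 (-160) [mp, pm, mm, pm] [220, 140, 30, 90] :=
  exists_lift (n := 24) (K := 2) (m := -130) (M := 220) (b := true)
    (lab := [mp, mp, mp, mp, mp, pm, pm, pm, pm, pm, pm, pm, mm, mm, mm, mm, mm, mm, mm, mm, pm,
      pm, pm, pm, mp, mp, mp, mp, mp, pm, pm, pm, pm, pm, pm, pm, mm, mm, mm, mm, mm, mm, mm, mm,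
      pm, pm, pm, pm])
    (R := [0, 10, 20, 20, 20, 0, 20, 20, 20, 15, 10, 5, 0, 5, 10, 5, 0, 5, 10, 5, 0, 5, 10, 5, 0,
      10, 20, 20, 20, 0, 20, 20, 20, 15, 10, 5, 0, 5, 10, 5, 0, 5, 10, 5, 0, 5, 10, 5])
    (A := [220, 210, 200, 180, 160, 140, 120, 100, 80, 60, 40, 35, 30, 35, 40, 50, 60, 70, 80, 85,
      90, 85, 80, 70, 60, 50, 40, 20, 0, -20, -40, -60, -80, -100, -120, -125, -130, -125, -120,
      -110, -100, -90, -80, -75, -70, -75, -80, -90])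
    (ν := [0, 5, 12, 20, 24, 29, 36, 44])
    (V := [(0, 220), (-20, 200), (-20, 160), (20, 120), (20, 80), (10, 40), (0, 30), (-10, 40),
      (0, 60), (-10, 80), (0, 90), (10, 80), (0, 60), (-20, 40), (-20, 0), (20, -40), (20, -80),
      (10, -120), (0, -130), (-10, -120), (0, -100), (-10, -80), (0, -70), (10, -80), (0, -100)])
    (by decide +kernel) (by decide) (by norm_num [pathTwo, sg])

/-! ### The two factorizations -/

lemma Draws.simple {β : Curve} {h : ℕ} {D : ℤ} {lab : List Label} {p : List ℤ}
    (hβ : Draws β h D lab p) : IsSimpleClosed β := by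
  obtain ⟨γ, -, h⟩ := hβ
  exact h.simple_left

/-- The Hurwitz equivalence between the halves of the two words. -/
lemma half_equivalent {V T S R Q P d₁ d₂ : Curve} (hV : Draws V 2 160 [pm, mp] [60, 140])
    (hT : Draws T 2 160 [mm, pp] [60, 140])
    (hS : Draws S 4 160 [pp, mm, pm, mp] [20, 60, 100, 140])
    (hR : Draws R 2 160 [pp, mp] [20, 100]) (hQ : Draws Q 2 160 [mm, pm] [20, 100])
    (hP : IsSimpleClosed P)
    (h₁ : Draws d₁ 6 160 [pm, mm, pp, mp, pm, mp] [60, 90, 60, 20, -10, 140])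
    (h₂ : Draws d₂ 4 (-160) [mp, pm, mm, pm] [220, 140, 30, 90])
    {l r : List Curve} (hl : ∀ x ∈ l, IsSimpleClosed x) (hr : ∀ x ∈ r, IsSimpleClosed x) :
    HurwitzEquivalent (l ++ [V, T, S, R, Q, P] ++ r) (l ++ [T, d₁, d₂, V, R, P] ++ r) := by
  have cV := hV.iso lobesV.1.draws
  have cS := hS.iso lobesS.1.draws
  have cR := hR.iso lobesR.1.draws
  have sV := hV.simple
  have sT := hT.simple
  have sS := hS.simple
  have sR := hR.simple
  have sQ := hQ.simple
  have s₁ := h₁.simple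
  have s₂ := h₂.simple
  have fix₁ := (hT.twist_off lobesV.1 lobesV.2 (by decide) (by decide) (j₀ := -1) (J := 4)
    (by decide +kernel) (by decide +kernel) profile_isShear).iso hT
  have fix₂ := (hQ.twist_off lobesR.1 lobesR.2 (by decide) (by decide) (j₀ := -1) (J := 4)
    (by decide +kernel) (by decide +kernel) profile_isShear).iso hQ
  have he := hQ.twistS_Q
  obtain ⟨e, heq⟩ : ∃ e, e = (waveS.twist profile_isShear).toFun ∘ Q := ⟨_, rfl⟩
  rw [← heq] at he
  have se := he.simple
  have i₁ := he.twistV.iso h₁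
  have i₂ := hS.twistV_S.iso h₂
  have app : ∀ {p q : List Curve}, (∀ x ∈ p, IsSimpleClosed x) → (∀ x ∈ q, IsSimpleClosed x) →
      ∀ x ∈ p ++ q, IsSimpleClosed x := fun hp hq => List.forall_mem_append.2 ⟨hp, hq⟩
  have m1 := HurwitzEquivalent.elem (l := l) (r := [S, R, Q, P] ++ r) hl
    (app (by simp [*]) hr) sT cV fix₁
  have m2 := HurwitzEquivalent.elem (l := l ++ [T, V, S]) (r := [P] ++ r)
    (app hl (by simp [*])) (app (by simp [*]) hr) sQ cR fix₂
  have m3 := HurwitzEquivalent.elem (l := l ++ [T, V]) (r := [R, P] ++ r) (c := e)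
    (app hl (by simp [sT, sV])) (app (by simp [sR, hP]) hr) sQ cS (heq ▸ se.iso_refl)
  have m4 := HurwitzEquivalent.elem (l := l ++ [T]) (r := [S, R, P] ++ r)
    (app hl (by simp [*])) (app (by simp [*]) hr) se cV i₁
  have m5 := HurwitzEquivalent.elem (l := l ++ [T, d₁]) (r := [R, P] ++ r)
    (app hl (by simp [*])) (app (by simp [*]) hr) sS cV i₂
  simp only [List.append_assoc, List.cons_append, List.nil_append] at m1 m2 m3 m4 m5 ⊢
  exact m1.trans (m2.trans (m3.trans (m4.trans m5)))

/-- The factorization of Smith's pencil is Hurwitz equivalent to the combinatorial one. -/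
theorem exists_factorizations :
    ∃ c d : Fin 12 → Curve,
      (∀ i, IsLift (smithData i) (c i)) ∧
      (∀ i, IsLift (combData i) (d i)) ∧
      HurwitzEquivalent (List.ofFn c).reverse (List.ofFn d) := by
  obtain ⟨V, lV, hV⟩ := exists_liftV
  obtain ⟨T, lT, hT⟩ := exists_liftT
  obtain ⟨S, lS, hS⟩ := exists_liftS
  obtain ⟨R, lR, hR⟩ := exists_liftR
  obtain ⟨Q, lQ, hQ⟩ := exists_liftQ
  obtain ⟨P, lP, hP⟩ := exists_liftP
  obtain ⟨d₁, l₁, h₁⟩ := exists_liftPathOne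
  obtain ⟨d₂, l₂, h₂⟩ := exists_liftPathTwo
  have kP := lP.hyp
  have kQ := lQ.hyp
  rw [neg_neg] at kP kQ
  refine ⟨![hyp ∘ P, hyp ∘ Q, hyp ∘ R, hyp ∘ S, hyp ∘ T, hyp ∘ V, P, Q, R, S, T, V],
    ![d₁, d₂, V, R, P, hyp ∘ T, hyp ∘ d₁, hyp ∘ d₂, hyp ∘ V, hyp ∘ R, hyp ∘ P, T], ?_, ?_, ?_⟩
  · intro i
    fin_cases i
    exacts [kP, kQ, lR.hyp, lS.hyp, lT.hyp, lV.hyp, lP, lQ, lR, lS, lT, lV]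
  · intro i
    fin_cases i
    exacts [l₁, l₂, lV, lR, lP, lT.hyp, l₁.hyp, l₂.hyp, lV.hyp, lR.hyp, kP, lT]
  have sV := hV.simple
  have sT := hT.simple
  have sS := hS.simple
  have sR := hR.simple
  have sQ := hQ.simple
  have sP := hP.simple
  have s₁ := h₁.simple
  have s₂ := h₂.simple
  have half := @half_equivalent V T S R Q P d₁ d₂ hV hT hS hR hQ sP h₁ h₂
  have e : HurwitzEquivalent
      ([V, T, S, R, Q, P] ++ [V, T, S, R, Q, P].map (hyp ∘ ·))
      ([T, d₁, d₂, V, R, P] ++ [T, d₁, d₂, V, R, P].map (hyp ∘ ·)) := by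
    have m1 := @half [] ([V, T, S, R, Q, P].map (hyp ∘ ·)) (by simp)
      (by simp [sV.hyp, sT.hyp, sS.hyp, sR.hyp, sQ.hyp, sP.hyp])
    have m2 := @half ([T, d₁, d₂, V, R, P].map (hyp ∘ ·)) []
      (by simp [sV.hyp, sT.hyp, s₁.hyp, s₂.hyp, sR.hyp, sP.hyp]) (by simp)
    have k1 := m1.tail (.conj _ hypDiffeo)
    have k2 := m2.tail (.conj _ hypDiffeo)
    simp only [List.nil_append, List.append_nil, List.map_append, List.map_cons, List.map_nil,
      show hypDiffeo.toFun = hyp from rfl, hyp_comp_hyp] at k1 k2 ⊢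
    exact k1.trans k2
  have rot := HurwitzEquivalent.rotate (W := waveT) (a := T)
    (l := [d₁, d₂, V, R, P] ++ [T, d₁, d₂, V, R, P].map (hyp ∘ ·))
    (by simp [sV, s₁, s₂, sR, sP, sV.hyp, sT.hyp, s₁.hyp, s₂.hyp, sR.hyp, sP.hyp])
    (hT.iso lobesT.1.draws)
  exact e.trans rot

end SmithPencil

theorem lemma4 :
    ∃ c d : Fin 12 → SmithPencil.Curve,
      (∀ i, SmithPencil.IsLift (SmithPencil.smithData i) (c i)) ∧
      (∀ i, SmithPencil.IsLift (SmithPencil.combData i) (d i)) ∧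
      SmithPencil.HurwitzEquivalent (List.ofFn c).reverse (List.ofFn d) :=
  SmithPencil.exists_factorizations
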